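/- **The functions $M_n$, $L_n$.** For $n\ge 1$ and $(z_1,\dots,z_n)\in(\mathbb C^*)^n$ set $s_i=z_1+\cdots+z_i$. Let $M_1(z_1)=2\pi i$ and, for $n\ge 2$, $$M_n(z_1,\dots,z_n)=2\pi i\int_C\frac{dt}{s_1-t}\circ\cdots\circ\frac{dt}{s_{n-1}-t},$$ where $C$ is the line segment from $0$ to $s_n$, perturbed to avoid every $s_i$ in its interior by a small clockwise half circle, and $\int_C\omega_1\circ\cdots\circ\omega_k$ is the iterated integral of the pulled back forms over $0\le t_1\le\cdots\le t_k\le 1$. Let $$L_n(z_1,\dots,z_n)=\sum_{k=1}^n\ \sum_{\substack{0=i_0<\cdots<i_k=n\\ s_{i_j}-s_{i_{j-1}}\in\mathbb R_{>0}\, s_n}}\frac{(-1)^{k-1}}{k}\prod_{j=0}^{k-1}M_{i_{j+1}-i_j}(z_{i_j+1},\dots,z_{i_{j+1}}).$$ **Stokes data.** Let $G$ be an affine algebraic group over $\mathbb C$ (a Zariski closed subgroup of some $GL_N(\mathbb C)$) with Lie algebra $\mathfrak g$, let $H\subset G$ be a torus with Lie algebra $\mathfrak h$, and let $Z\in\mathfrak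 h$. For $\alpha\in\mathfrak h^*$ put $Z(\alpha)=\alpha(Z)$ and $\mathfrak g_\alpha=\{x\in\mathfrak g:[h,x]=\alpha(h)x\ \forall h\in\mathfrak h\}$, and let $\Phi^Z$ be the finite set of the $\alpha\neq 0$ with $\mathfrak g_\alpha\ne 0$ and $Z(\alpha)\neq0$. Let $f=\sum_{\alpha\in\Phi^Z}f_\alpha$ with $f_\alpha\in\mathfrak g_\alpha$, and consider $\nabla=d-\left(\frac{Z}{t^2}+\frac ft\right)dt$. The Stokes rays of $\nabla$ are the rays $\mathbb R_{>0}\zeta$, $\zeta$ a nonzero eigenvalue of $\operatorname{ad}(Z)$ on $\mathfrak g$. For a ray $r$ that is not a Stokes ray let $\mathbb H_r=\{uv:u\in r,\ \operatorname{Re}v>0\}$ and let $Y_r:\mathbb H_r\to G$ be the unique holomorphic function with $Y_r'=\left(\frac{Z}{t^2}+\frac ft\right)Y_r$ and $Y_re^{Z/t}\to1$ as $t\to0$ in $\mathbb H_r$. The Stokes factor of a Stokes ray $\ell$ is the $S_\ell\in G$ with $Y_{r_+}=Y_{r_-}S_\ell$ on $\mathbb H_{r_+}\cap\mathbb H_{r_-}$,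 where $r_+$ and $r_-$ are small clockwise and anticlockwise perturbations of $\ell$, such that the closed convex sector between them contains no Stokes ray but $\ell$. The value $\epsilon=\mathcal S(f)$ of the Stokes map is the unique family $(\epsilon_\alpha)_{\alpha\in\Phi^Z}$, $\epsilon_\alpha\in\mathfrak g_\alpha$, with $S_\ell=\exp\big(\sum_{Z(\alpha)\in\ell}\epsilon_\alpha\big)$ for all Stokes rays $\ell$. **Theorem.** (i) For all $m\ge1$, all $(z_1,\dots,z_m)\in(\mathbb C^*)^m$ and all elements $x_1,\dots,x_m$ of a complex Lie algebra $\mathfrak L$, the element $$\sum_{\sigma\in \mathrm{Sym}_m}L_m(z_{\sigma(1)},\dots,z_{\sigma(m)})\,x_{\sigma(1)}\cdots x_{\sigma(m)}\in U\mathfrak L$$ is a Lie polynomial in $x_1,\dots,x_m$ (the image of an element of the free Lie algebra on $m$ generators that depends only on $z_1,\dots,z_m$); in particular it lies in $\mathfrak L$. (ii) The element $\epsilon=\mathcal S(f)$ exists, is unique, and is given by the Lie series $$\epsilon_\alpha=\sum_{n\ge1}\ \sum_{\substack{\alpha_1,\dots,\alpha_n\in\Phi^Z\\ \alpha_1+\cdots+\alpha_n=\alpha}}L_n(Z(\alpha_1),\dots,Z(\alpha_n))\,f_{\alpha_1}\cdots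 f_{\alpha_n}\qquad(\alpha\in\Phi^Z):$$ for each $n$ the inner sum, an element of $U\mathfrak g$, lies in the Lie subalgebra of $\mathfrak g$ generated by the $f_\beta$, $\beta\in\Phi^Z$, and the sum over $n$ converges absolutely to $\epsilon_\alpha$, in $\mathfrak g$ and in every finite-dimensional representation of $\mathfrak g$ (in particular in every finite-dimensional representation of $G$). -/

import Mathlib

open scoped Topology

-- the commutator bracket on matrices and on enveloping algebras
attribute [local instance] LieRing.ofAssociativeRing

noncomputable section

namespace Stokes

/-! ### Iterated integrals and the functions `M_n`, `L_n` -/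

/-- Iterated integral over `0 ≤ t₁ ≤ ⋯ ≤ t_k ≤ x` of `ω 0 (t₁) ⋯ ω (k-1) (t_k)`. -/
def iteratedIntegral (ω : ℕ → ℝ → ℂ) : ℕ → ℝ → ℂ
  | 0, _ => 1
  | k + 1, x => ∫ u in (0 : ℝ)..x, iteratedIntegral ω k u * ω k u

/-- `s_k = z_1 + ⋯ + z_k`. -/
def partialSum {n : ℕ} (z : Fin n → ℂ) (k : ℕ) : ℂ :=
  ∑ i : Fin n, if (i : ℕ) < k then z i else 0

open Classical in
/-- The parameters `p ∈ (0,1)` such that `p * s_n` is one of the points `s_1, …, s_{n-1}`. -/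
def indentParams {n : ℕ} (z : Fin n → ℂ) : Finset ℝ :=
  (((Finset.Ioo 0 n).image fun k => partialSum z k / partialSum z n).filter
    fun w => w.im = 0 ∧ 0 < w.re ∧ w.re < 1).image Complex.re

/-- The segment from `0` to `s_n`, in which the pieces at distance at most `δ * |s_n|` from the
points `s_i` of the open segment are replaced by half circles centred at these points. The half
circles lie on the left of the segment, i.e. they are run through clockwise.
(`Real.sqrt` vanishes on negative numbers.) -/
def indentedPath {n : ℕ} (z : Fin n → ℂ) (δ : ℝ) (x : ℝ) : ℂ :=
  partialSum z n *
    ((x : ℂ) + Complex.I * ((∑ p ∈ indentParams z, Real.sqrt (δ ^ 2 - (x - p) ^ 2) : ℝ) : ℂ))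

/-- `M_n(z_1,…,z_n) = 2πi ∫_C dt/(s_1 - t) ∘ ⋯ ∘ dt/(s_{n-1} - t)`, where `C` is the indented
segment for a small radius: the integral does not depend on the radius once it is small. For
`n = 1` this is `2πi`. -/
def M (n : ℕ) (z : Fin n → ℂ) : ℂ :=
  2 * Real.pi * Complex.I *
    Filter.limUnder (𝓝[>] (0 : ℝ)) fun δ =>
      iteratedIntegral
        (fun k u => deriv (indentedPath z δ) u / (partialSum z (k + 1) - indentedPath z δ u))
        (n - 1) 1

open Classical in
/-- `L_n`: a sum over the ways of cutting `(z_1,…,z_n)` into `k` consecutive nonempty blocks,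
each with sum in `ℝ_{>0} · s_n`, of `(-1)^(k-1)/k` times the product of the values of `M` on the
blocks. -/
def L (n : ℕ) (z : Fin n → ℂ) : ℂ :=
  ∑ c : Composition n,
    if ∀ j : Fin c.length, ∃ ρ : ℝ, 0 < ρ ∧ ∑ i, z (c.embedding j i) = ρ * ∑ i, z i then
      (-1) ^ (c.length - 1) / (c.length : ℂ) *
        ∏ j : Fin c.length, M (c.blocksFun j) (z ∘ c.embedding j)
    else 0

/-! ### Linear algebraic groups over `ℂ` -/

variable {N : ℕ}

/-- The value of a polynomial in the matrix entries at `g`. -/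
def evalAt (g : GL (Fin N) ℂ) (p : MvPolynomial (Fin N × Fin N) ℂ) : ℂ :=
  MvPolynomial.eval (fun ij => (g : Matrix (Fin N) (Fin N) ℂ) ij.1 ij.2) p

/-- `G` is Zariski closed in `GL_N(ℂ)`. -/
def IsZariskiClosed (G : Subgroup (GL (Fin N) ℂ)) : Prop :=
  ∃ S : Set (MvPolynomial (Fin N × Fin N) ℂ), ∀ g, g ∈ G ↔ ∀ p ∈ S, evalAt g p = 0

/-- The left invariant derivation `p ↦ (g ↦ d/ds p(g (1 + s X)) at s = 0)`. -/
def leftInvDer (X : Matrix (Fin N) (Fin N) ℂ) :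
    Derivation ℂ (MvPolynomial (Fin N × Fin N) ℂ) (MvPolynomial (Fin N × Fin N) ℂ) :=
  MvPolynomial.mkDerivation ℂ fun ij =>
    ∑ k, MvPolynomial.C (X k ij.2) * MvPolynomial.X (ij.1, k)

theorem leftInvDer_X (X : Matrix (Fin N) (Fin N) ℂ) (i j : Fin N) :
    leftInvDer X (MvPolynomial.X (i, j)) =
      ∑ k, MvPolynomial.C (X k j) * MvPolynomial.X (i, k) := by
  simp [leftInvDer, MvPolynomial.mkDerivation_X]

theorem leftInvDer_add (X Y : Matrix (Fin N) (Fin N) ℂ) :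
    leftInvDer (X + Y) = leftInvDer X + leftInvDer Y := by
  refine MvPolynomial.derivation_ext fun ⟨i, j⟩ => ?_
  simp [leftInvDer_X, add_mul, Finset.sum_add_distrib]

theorem leftInvDer_smul (c : ℂ) (X : Matrix (Fin N) (Fin N) ℂ) :
    leftInvDer (c • X) = c • leftInvDer X := by
  refine MvPolynomial.derivation_ext fun ⟨i, j⟩ => ?_
  simp [leftInvDer_X, Finset.smul_sum, MvPolynomial.smul_eq_C_mul, mul_assoc]

theorem leftInvDer_lie (X Y : Matrix (Fin N) (Fin N) ℂ) :
    leftInvDer ⁅X, Y⁆ = ⁅leftInvDer X, leftInvDer Y⁆ := by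
  have key : ∀ (A B : Matrix (Fin N) (Fin N) ℂ) (i j : Fin N),
      leftInvDer A (leftInvDer B (MvPolynomial.X (i, j))) =
        ∑ k, MvPolynomial.C ((A * B) k j) * MvPolynomial.X (i, k) := by
    intro A B i j
    simp only [leftInvDer_X, map_sum, Derivation.leibniz, MvPolynomial.derivation_C, mul_zero,
      add_zero, smul_eq_mul, Finset.mul_sum, Matrix.mul_apply, Finset.sum_mul, map_mul]
    rw [Finset.sum_comm]
    exact Finset.sum_congr rfl fun _ _ => Finset.sum_congr rfl fun _ _ => by ring
  refine MvPolynomial.derivation_ext fun ⟨i, j⟩ => ?_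
  rw [Derivation.commutator_apply, key, key, leftInvDer_X, ← Finset.sum_sub_distrib]
  simp [Ring.lie_def, sub_mul]

/-- The Lie algebra of `G`: the matrices whose left invariant derivation preserves the ideal of
the polynomials that vanish on `G`. -/
def lieAlg (G : Subgroup (GL (Fin N) ℂ)) : LieSubalgebra ℂ (Matrix (Fin N) (Fin N) ℂ) where
  carrier := {X | ∀ p, (∀ g ∈ G, evalAt g p = 0) → ∀ g ∈ G, evalAt g (leftInvDer X p) = 0}
  add_mem' {X Y} hX hY p hp g hg := by
    have h1 := hX p hp g hg
    have h2 := hY p hp g hg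
    simp only [evalAt] at h1 h2 ⊢
    rw [leftInvDer_add, Derivation.add_apply, map_add, h1, h2, add_zero]
  zero_mem' p _ g _ := by
    have : leftInvDer (0 : Matrix (Fin N) (Fin N) ℂ) = 0 := by
      simpa using leftInvDer_smul 0 (0 : Matrix (Fin N) (Fin N) ℂ)
    simp [evalAt, this]
  smul_mem' c X hX p hp g hg := by
    have h1 := hX p hp g hg
    simp only [evalAt] at h1 ⊢
    rw [leftInvDer_smul, Derivation.smul_apply, MvPolynomial.smul_eval, h1, mul_zero]
  lie_mem' {X Y} hX hY p hp g hg := by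
    have h1 := hX _ (hY p hp) g hg
    have h2 := hY _ (hX p hp) g hg
    simp only [evalAt] at h1 h2 ⊢
    rw [leftInvDer_lie, Derivation.commutator_apply, map_sub, h1, h2, sub_zero]

/-- `H` is a torus: a closed subgroup of `GL_N(ℂ)` that is diagonalizable and connected (it has no
proper closed subgroup of finite index). -/
def IsTorus (H : Subgroup (GL (Fin N) ℂ)) : Prop :=
  IsZariskiClosed H ∧
  (∃ P : GL (Fin N) ℂ, ∀ h ∈ H, ((P * h * P⁻¹ : GL (Fin N) ℂ) : Matrix (Fin N) (Fin N) ℂ).IsDiag) ∧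
  ∀ K : Subgroup (GL (Fin N) ℂ), K ≤ H → IsZariskiClosed K → K.relIndex H ≠ 0 → K = H

/-! ### Roots -/

/-- `𝔤_α = {x ∈ 𝔤 | [h, x] = α(h) x for all h ∈ 𝔥}`. -/
def rootSpace (G H : Subgroup (GL (Fin N) ℂ)) (α : Module.Dual ℂ (lieAlg H)) :
    Submodule ℂ (lieAlg G) where
  carrier := {x | ∀ h : lieAlg H, ⁅(h : Matrix (Fin N) (Fin N) ℂ), (x : Matrix (Fin N) (Fin N) ℂ)⁆ =
    α h • (x : Matrix (Fin N) (Fin N) ℂ)}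
  add_mem' {x y} hx hy h := by
    simp [lie_add, hx h, hy h]
  zero_mem' h := by simp
  smul_mem' c x hx h := by
    simp [lie_smul, hx h, smul_comm c]

/-- The roots `α` of `G` relative to `H` with `Z(α) = α(Z) ≠ 0`. -/
def rootsZ (G H : Subgroup (GL (Fin N) ℂ)) (Z : lieAlg H) : Set (Module.Dual ℂ (lieAlg H)) :=
  {α | α ≠ 0 ∧ rootSpace G H α ≠ ⊥ ∧ α Z ≠ 0}

theorem rootsZ_finite (G H : Subgroup (GL (Fin N) ℂ)) (Z : lieAlg H) : (rootsZ G H Z).Finite := by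
  by_contra hinf
  obtain ⟨t, ht, hcard⟩ := Set.Infinite.exists_subset_card_eq hinf
    (Module.finrank ℂ (Matrix (Fin N) (Fin N) ℂ) + 1)
  have hx : ∀ α : t, ∃ x : lieAlg G, x ∈ rootSpace G H α ∧ x ≠ 0 := fun α =>
    Submodule.exists_mem_ne_zero_of_ne_bot (ht α.2).2.1
  choose x hx hx0 using hx
  obtain ⟨h, hh⟩ := Module.Dual.exists_forall_ne_zero_of_forall_exists
    (fun q : {q : t × t // q.1 ≠ q.2} =>
      (q.1.1 : Module.Dual ℂ (lieAlg H)) - (q.1.2 : Module.Dual ℂ (lieAlg H)))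
    (fun q => by
      by_contra hc
      push Not at hc
      exact q.2 (Subtype.ext (sub_eq_zero.1 (LinearMap.ext fun v => hc v))))
  have hli := Module.End.eigenvectors_linearIndependent'
    (LieModule.toEnd ℂ (Matrix (Fin N) (Fin N) ℂ) (Matrix (Fin N) (Fin N) ℂ)
      (h : Matrix (Fin N) (Fin N) ℂ))
    (fun α : t => (α : Module.Dual ℂ (lieAlg H)) h)
    (fun α β hαβ => by
      by_contra hne
      exact hh ⟨(α, β), hne⟩ (by simpa [sub_eq_zero] using hαβ))
    (fun α => (x α : Matrix (Fin N) (Fin N) ℂ))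
    (fun α => ⟨Module.End.mem_eigenspace_iff.2 (by simpa using hx α h), by simpa using hx0 α⟩)
  have := hli.fintype_card_le_finrank
  simp only [Fintype.card_coe] at this
  omega

instance rootsZFintype (G H : Subgroup (GL (Fin N) ℂ)) (Z : lieAlg H) : Fintype (rootsZ G H Z) :=
  (rootsZ_finite G H Z).fintype

/-- `⊕_α 𝔤_α`, the sum over the finite set of the roots with `Z(α) ≠ 0`. This is `[Z, 𝔤]`. -/
abbrev OffDiag (G H : Subgroup (GL (Fin N) ℂ)) (Z : lieAlg H) : Type :=
  ∀ α : rootsZ G H Z, rootSpace G H (α : Module.Dual ℂ (lieAlg H))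

/-- The component `f_α`, as an element of `𝔤`. -/
def OffDiag.component {G H : Subgroup (GL (Fin N) ℂ)} {Z : lieAlg H} (f : OffDiag G H Z)
    (α : rootsZ G H Z) : lieAlg G :=
  (f α : lieAlg G)

/-- The matrix `f = ∑ f_α`. -/
def OffDiag.toMatrix {G H : Subgroup (GL (Fin N) ℂ)} {Z : lieAlg H} (f : OffDiag G H Z) :
    Matrix (Fin N) (Fin N) ℂ :=
  ∑ α, (f.component α : Matrix (Fin N) (Fin N) ℂ)

/-! ### The connection `d - (Z/t² + f/t) dt` and its Stokes data -/

/-- The ray `ℝ_{>0} exp(iθ)`. -/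
def ray (θ : ℝ) : Set ℂ :=
  {u | ∃ ρ : ℝ, 0 < ρ ∧ u = ρ * Complex.exp (θ * Complex.I)}

/-- The half plane `{u v | u ∈ r, Re v > 0}` of the ray `r` of angle `θ`. -/
def halfPlane (θ : ℝ) : Set ℂ :=
  {t | ∃ u ∈ ray θ, ∃ v : ℂ, 0 < v.re ∧ t = u * v}

/-- The ray of angle `θ` contains a nonzero eigenvalue of `ad Z` on the Lie algebra of `G`. -/
def IsStokesRay (G : Subgroup (GL (Fin N) ℂ)) (Z : Matrix (Fin N) (Fin N) ℂ) (θ : ℝ) : Prop :=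
  ∃ ζ ∈ ray θ, ∃ x ∈ lieAlg G, x ≠ 0 ∧ ⁅Z, x⁆ = ζ • x

/-- `Y` is a holomorphic function from the half plane of the ray of angle `θ` to `G` with
`Y' = (Z/t² + f/t) Y` and `Y e^{Z/t} → 1` as `t → 0` in the half plane. The values of `Y` outside
the half plane are irrelevant. -/
structure IsCanonicalSolution (G : Subgroup (GL (Fin N) ℂ)) (Z f : Matrix (Fin N) (Fin N) ℂ)
    (θ : ℝ) (Y : ℂ → GL (Fin N) ℂ) : Prop where
  mem : ∀ t ∈ halfPlane θ, Y t ∈ G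
  hasDerivAt : ∀ t ∈ halfPlane θ,
    HasDerivAt (fun t => (Y t : Matrix (Fin N) (Fin N) ℂ))
      (((t ^ 2)⁻¹ • Z + t⁻¹ • f) * (Y t : Matrix (Fin N) (Fin N) ℂ)) t
  tendsto : Filter.Tendsto
    (fun t => (Y t : Matrix (Fin N) (Fin N) ℂ) * NormedSpace.exp (t⁻¹ • Z))
    (𝓝[halfPlane θ] 0) (𝓝 1)

/-- `S` is the Stokes factor of the Stokes ray of angle `θ`: `Y₊ = Y₋ S`, where `Y₊` and `Y₋` are
the canonical solutions for a clockwise and an anticlockwise perturbation of the ray such that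
the closed convex sector between them contains no other Stokes ray. -/
def IsStokesFactor (G : Subgroup (GL (Fin N) ℂ)) (Z f : Matrix (Fin N) (Fin N) ℂ)
    (θ : ℝ) (S : GL (Fin N) ℂ) : Prop :=
  S ∈ G ∧ ∃ (θp θm : ℝ) (Yp Ym : ℂ → GL (Fin N) ℂ),
    θp < θ ∧ θ < θm ∧ θm - θp < Real.pi ∧
    (∀ φ ∈ Set.Icc θp θm, IsStokesRay G Z φ → φ = θ) ∧
    IsCanonicalSolution G Z f θp Yp ∧ IsCanonicalSolution G Z f θm Ym ∧
    ∀ t ∈ halfPlane θp ∩ halfPlane θm, Yp t = Ym t * S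

open Classical in
/-- `ε` is the value of the Stokes map at `f`: the Stokes factor of every Stokes ray `ℓ` is
`exp (∑ ε_α)`, the sum over the roots `α` with `Z(α) ∈ ℓ`. -/
def IsStokesMapValue {G H : Subgroup (GL (Fin N) ℂ)} {Z : lieAlg H} (f ε : OffDiag G H Z) : Prop :=
  ∀ θ : ℝ, IsStokesRay G (Z : Matrix (Fin N) (Fin N) ℂ) θ →
    ∃ S : GL (Fin N) ℂ, IsStokesFactor G (Z : Matrix (Fin N) (Fin N) ℂ) f.toMatrix θ S ∧
      (S : Matrix (Fin N) (Fin N) ℂ) =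
        NormedSpace.exp (∑ α : rootsZ G H Z with α.1 Z ∈ ray θ,
          (ε.component α : Matrix (Fin N) (Fin N) ℂ))

open Classical in
/-- `∑ L_n(Z(α_1),…,Z(α_n)) φ(f_{α_1}) ⋯ φ(f_{α_n})` over the `α_i` with `∑ α_i = α` and
`Z(α_i) ≠ 0`, for a linear map `φ` from `𝔤` to an associative algebra. -/
def seriesTerm {G H : Subgroup (GL (Fin N) ℂ)} {Z : lieAlg H} {A : Type*} [Ring A] [Algebra ℂ A]
    (φ : lieAlg G →ₗ[ℂ] A) (f : OffDiag G H Z) (α : rootsZ G H Z) (n : ℕ) : A :=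
  ∑ a : Fin n → rootsZ G H Z with ∑ i, (a i).1 = α.1,
    L n (fun i => (a i).1 Z) • (List.ofFn fun i => φ (f.component (a i))).prod

end Stokes

end

/-! Fix a ray through `ζ` and put `W = Z/ζ`, `τ = ζ/t`. The solution normalised at `t = 0` is a
series over words in the `f_α`. Up to inversion, its coefficients solve the triangular system
`q_{b::l}' = -s q_{b::l} + q_l/τ`, where `s` is the sum of the values `Z(α)/ζ` of the letters of `b
:: l`. This system is solved by Laplace transforms `q_l(τ) = ωτ ∫ exp(-xωτ) F_l(xω) dx` of
multilogarithms, `(s - p) F_{b::l}'(p) = F_l(p)` (`mlog_spec`, `hasDerivAt_qser`). Integration rays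
slightly above (`e = 1`) or below (`e = -1`) the positive real axis give the canonical solutions on
the two sides of the given ray.

The Stokes factor compares these two solutions. When the integration rays are moved to the real
axis, the multilogarithms from above and from below differ by shifted multilogarithms that start at
the positive real sums `s`; the coefficient is `2πi` times a boundary value from above
(`tendsto_bdry_jump`, `bdry_connection`). A Laplace transform turns the shift by `s` into
`exp(-sτ)`, whence `q⁺ = q⁻ * (c exp(-sτ))` (`qser_connection`), and the factors `exp(-sτ)` are
conjugation by `exp(τW)`. A boundary value from above is an iterated integral along the segment
indented by clockwise half circles, so `c` is given by the numbers `M` (`Mw_reverse`,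
`connCoeff_eq`). Hence the Stokes factor is a sum of words with coefficients `M`, and the sum over
cuttings that defines `L` is the coefficient of its logarithm (`L_eq_log`).

The logarithm consists of Lie elements. The `q_l` satisfy the shuffle relations, because both sides
solve the same equation and tend to zero along a ray on which `exp(-sτ)` does not decay (`sh_qser`).
So `c`, a quotient of two characters of the shuffle algebra, is a character
(`isChar_stokesSeriesRev`); its logarithm vanishes on shuffles (`IsChar.sh_log`), and the
Dynkin–Specht–Wever theorem writes it by brackets (`natCast_mul_lsum_rprod`). The words without
repeated letters give part (i), the words of a given weight the terms of part (ii).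

Convergence rests on finiteness of weights: a nonzero product of the `f_α` is an eigenvector of `ad
W`, so only finitely many sums `s` occur in words of any length. For a finite set of singular points
the multilogarithm of a word of length `n` is at most `b^n ((1 + x)^κ - 1)` on a ray, with `b` as
small as desired and `κ` independent of `n` (`exists_mlog_bound`). The words in a Stokes factor have
weights on one ray, so its logarithm involves finitely many powers of a nilpotent element
(`exists_hasSum_wpart_log`).

The solutions lie in `G`: scaling the words of length `n` by `s^n` gives a curve from `1` with
logarithmic derivative in the Lie algebra (`evalM_solInv`). Uniqueness of `ε` follows since
canonical solutions agree across sectors without Stokes rays, `exp` is injective on nilpotent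
matrices, and projections to weight spaces separate the roots on one ray. -/

open scoped Topology

attribute [local instance] LieRing.ofAssociativeRing

noncomputable section

namespace Stokes

/-! ### Noncommutative formal power series -/

section Series

variable {Φ R : Type*}

/-- Noncommutative formal power series, given by their coefficients. -/
@[ext] structure NCS (Φ R : Type*) where
  /-- The coefficients. -/
  coeff : List Φ → R

namespace NCS

instance : CoeFun (NCS Φ R) fun _ => List Φ → R := ⟨coeff⟩

theorem coeff_injective : Function.Injective (coeff : NCS Φ R → List Φ → R) :=
  fun _ _ h => NCS.ext h

theorem ext' {a b : NCS Φ R} (h : ∀ l, a l = b l) : a = b := NCS.ext (funext h)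

/-- The series obtained by stripping the initial letter `x`. -/
def strip (x : Φ) (a : NCS Φ R) : NCS Φ R := ⟨fun u => a (x :: u)⟩

@[simp] theorem strip_apply (a : NCS Φ R) (x : Φ) (l : List Φ) : strip x a l = a (x :: l) := rfl

variable [Ring R]

instance : Zero (NCS Φ R) := ⟨⟨fun _ => 0⟩⟩
instance : Add (NCS Φ R) := ⟨fun a b => ⟨fun l => a l + b l⟩⟩
instance : Neg (NCS Φ R) := ⟨fun a => ⟨fun l => -a l⟩⟩
instance : Sub (NCS Φ R) := ⟨fun a b => ⟨fun l => a l - b l⟩⟩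
instance : SMul ℕ (NCS Φ R) := ⟨fun n a => ⟨fun l => n • a l⟩⟩
instance : SMul ℤ (NCS Φ R) := ⟨fun n a => ⟨fun l => n • a l⟩⟩

instance : AddCommGroup (NCS Φ R) :=
  coeff_injective.addCommGroup coeff rfl (fun _ _ => rfl) (fun _ => rfl) (fun _ _ => rfl)
    (fun _ _ => rfl) (fun _ _ => rfl)

/-- The convolution product: the sum of `a u * b v` over the decompositions `l = u ++ v`. -/
def conv : NCS Φ R → NCS Φ R → List Φ → R
  | a, b, [] => a [] * b []
  | a, b, x :: l => a [] * b (x :: l) + conv (strip x a) b l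

instance : Mul (NCS Φ R) := ⟨fun a b => ⟨conv a b⟩⟩
instance : One (NCS Φ R) := ⟨⟨fun l => match l with
  | [] => 1
  | _ :: _ => 0⟩⟩

theorem mul_nil (a b : NCS Φ R) : (a * b) [] = a [] * b [] := rfl
theorem mul_cons (a b : NCS Φ R) (x : Φ) (l : List Φ) :
    (a * b) (x :: l) = a [] * b (x :: l) + (strip x a * b) l := rfl
theorem one_nil : (1 : NCS Φ R) [] = 1 := rfl
theorem one_cons (x : Φ) (l : List Φ) : (1 : NCS Φ R) (x :: l) = 0 := rfl
@[simp] theorem add_apply (a b : NCS Φ R) (l : List Φ) : (a + b) l = a l + b l := rfl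
@[simp] theorem sub_apply (a b : NCS Φ R) (l : List Φ) : (a - b) l = a l - b l := rfl
@[simp] theorem zero_apply (l : List Φ) : (0 : NCS Φ R) l = 0 := rfl
theorem zero_mul' (b : NCS Φ R) (l : List Φ) : ((0 : NCS Φ R) * b) l = 0 := by
  induction l with
  | nil => simp [mul_nil]
  | cons x l ih =>
    have : strip x (0 : NCS Φ R) = 0 := rfl
    rw [mul_cons, this, ih]
    simp

theorem mul_zero' (a : NCS Φ R) (l : List Φ) : (a * (0 : NCS Φ R)) l = 0 := by
  induction l generalizing a with
  | nil => simp [mul_nil]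
  | cons x l ih => rw [mul_cons, ih]; simp

theorem add_mul' (a b c : NCS Φ R) (l : List Φ) : ((a + b) * c) l = (a * c) l + (b * c) l := by
  induction l generalizing a b with
  | nil => simp [mul_nil, add_mul]
  | cons x l ih =>
    have : strip x (a + b) = strip x a + strip x b := rfl
    rw [mul_cons, mul_cons, mul_cons, this, ih, add_apply, add_mul]; abel

theorem mul_add' (a b c : NCS Φ R) (l : List Φ) : (a * (b + c)) l = (a * b) l + (a * c) l := by
  induction l generalizing a with
  | nil => simp [mul_nil, mul_add]
  | cons x l ih => rw [mul_cons, mul_cons, mul_cons, ih, add_apply, mul_add]; abel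

theorem one_mul' (a : NCS Φ R) (l : List Φ) : (1 * a) l = a l := by
  cases l with
  | nil => simp [mul_nil, one_nil]
  | cons x l =>
    rw [mul_cons, one_nil, one_mul]
    have : strip x (1 : NCS Φ R) = 0 := rfl
    rw [this, zero_mul', add_zero]

theorem mul_one' (a : NCS Φ R) (l : List Φ) : (a * 1) l = a l := by
  induction l generalizing a with
  | nil => simp [mul_nil, one_nil]
  | cons x l ih => rw [mul_cons, ih, one_cons, mul_zero, zero_add]; rfl

/-- Multiplication of the coefficients by `r` from the left. -/
def lsmul (r : R) (a : NCS Φ R) : NCS Φ R := ⟨fun l => r * a l⟩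

theorem lsmul_mul (r : R) (a b : NCS Φ R) (l : List Φ) : (lsmul r a * b) l = r * (a * b) l := by
  induction l generalizing a with
  | nil => simp [mul_nil, lsmul, mul_assoc]
  | cons x l ih =>
    have : strip x (lsmul r a) = lsmul r (strip x a) := rfl
    rw [mul_cons, mul_cons, this, ih]; simp [lsmul, mul_assoc, mul_add]

theorem strip_mul (x : Φ) (a b : NCS Φ R) :
    strip x (a * b) = lsmul (a []) (strip x b) + strip x a * b := rfl

theorem mul_assoc' (a b c : NCS Φ R) (l : List Φ) : (a * b * c) l = (a * (b * c)) l := by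
  induction l generalizing a with
  | nil => simp [mul_nil, mul_assoc]
  | cons x l ih =>
    rw [mul_cons, mul_cons, strip_mul, add_mul', ih, lsmul_mul, mul_nil, mul_cons, mul_add]
    simp [mul_assoc, add_assoc]

instance : Ring (NCS Φ R) :=
  { (inferInstance : AddCommGroup (NCS Φ R)) with
    mul := (· * ·)
    one := 1
    zero_mul := fun a => ext' (zero_mul' a)
    mul_zero := fun a => ext' (mul_zero' a)
    left_distrib := fun a b c => ext' (mul_add' a b c)
    right_distrib := fun a b c => ext' (add_mul' a b c)
    one_mul := fun a => ext' (one_mul' a)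
    mul_one := fun a => ext' (mul_one' a)
    mul_assoc := fun a b c => ext' (mul_assoc' a b c) }

/-- A product depends only on the values at the factors of the word. -/
theorem mul_congr {a a' b b' : NCS Φ R} {l : List Φ}
    (h : ∀ u v, u ++ v = l → a u * b v = a' u * b' v) : (a * b) l = (a' * b') l := by
  induction l generalizing a a' with
  | nil => rw [mul_nil, mul_nil]; exact h [] [] rfl
  | cons x l ih =>
    rw [mul_cons, mul_cons, h [] (x :: l) rfl]
    congr 1
    exact ih fun u v huv => h (x :: u) v (by simp [huv])

theorem sum_apply {ι : Type*} (s : Finset ι) (a : ι → NCS Φ R) (l : List Φ) :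
    (∑ i ∈ s, a i) l = ∑ i ∈ s, a i l := by
  induction s using Finset.cons_induction with
  | empty => simp
  | cons i s hi ih => rw [Finset.sum_cons, Finset.sum_cons, add_apply, ih]

theorem natCast_mul_apply (k : ℕ) (a : NCS Φ R) (l : List Φ) : ((k : NCS Φ R) * a) l = k * a l := by
  rw [← nsmul_eq_mul, ← nsmul_eq_mul]
  induction k with
  | zero => simp
  | succ k ih => rw [succ_nsmul, succ_nsmul, add_apply, ih]

/-- A series without constant term to the power `k` starts in degree `k`. -/
theorem pow_apply_eq_zero {a : NCS Φ R} (ha : a [] = 0) {k : ℕ} {l : List Φ} (h : l.length < k) :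
    (a ^ k) l = 0 := by
  induction k generalizing l with
  | zero => simp at h
  | succ k ih =>
    rw [pow_succ', mul_congr (a' := 0) (b' := a ^ k)]
    · rw [zero_mul]; rfl
    · intro u v huv
      rcases u with _ | ⟨x, u⟩
      · simp [ha]
      · rw [ih (l := v), mul_zero, mul_zero]
        have := congrArg List.length huv
        simp at this
        omega

end NCS

/-! ### Shuffles -/

/-- The sum of `c` over the shuffles of two words. -/
def sh : (List Φ → ℂ) → List Φ → List Φ → ℂ
  | c, [], [] => c []
  | c, a :: u, [] => sh (fun l => c (a :: l)) u []
  | c, [], b :: v => sh (fun l => c (b :: l)) [] v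
  | c, a :: u, b :: v => sh (fun l => c (a :: l)) u (b :: v) + sh (fun l => c (b :: l)) (a :: u) v
termination_by _ u v => u.length + v.length

theorem sh_nil_nil (c : List Φ → ℂ) : sh c [] [] = c [] := by simp [sh]
theorem sh_cons_cons (c : List Φ → ℂ) (a b : Φ) (u v : List Φ) : sh c (a :: u) (b :: v) =
    sh (fun l => c (a :: l)) u (b :: v) + sh (fun l => c (b :: l)) (a :: u) v := by
  rw [sh]
theorem sh_cons_nil (c : List Φ → ℂ) (a : Φ) (u : List Φ) :
    sh c (a :: u) [] = sh (fun l => c (a :: l)) u [] := by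
  rw [sh]
theorem sh_nil_cons (c : List Φ → ℂ) (b : Φ) (v : List Φ) :
    sh c [] (b :: v) = sh (fun l => c (b :: l)) [] v := by
  rw [sh]

@[simp] theorem sh_nil_left (c : List Φ → ℂ) (v : List Φ) : sh c [] v = c v := by
  induction v generalizing c with
  | nil => exact sh_nil_nil c
  | cons b v ih => rw [sh_nil_cons, ih]

@[simp] theorem sh_nil_right (c : List Φ → ℂ) (u : List Φ) : sh c u [] = c u := by
  induction u generalizing c with
  | nil => exact sh_nil_nil c
  | cons b v ih => rw [sh_cons_nil, ih]

/-- Induction on pairs of words along the recursion of `sh`. -/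
theorem pair_induction {p : List Φ → List Φ → Prop} (h0 : p [] [])
    (h1 : ∀ a u, p u [] → p (a :: u) []) (h2 : ∀ b v, p [] v → p [] (b :: v))
    (h3 : ∀ a u b v, p u (b :: v) → p (a :: u) v → p (a :: u) (b :: v)) (u v : List Φ) : p u v := by
  induction u generalizing v with
  | nil =>
    induction v with
    | nil => exact h0
    | cons b v ih => exact h2 b v ih
  | cons a u ih =>
    induction v with
    | nil => exact h1 a u (ih [])
    | cons b v ih' => exact h3 a u b v (ih _) ih'

theorem sh_congr {c c' : List Φ → ℂ} {u v : List Φ} (h : ∀ l, l.Perm (u ++ v) → c l = c' l) :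
    sh c u v = sh c' u v := by
  induction u, v using pair_induction generalizing c c' with
  | h0 => simpa using h [] (by simp)
  | h1 a u ih => simpa using h (a :: u) (by simp)
  | h2 b v ih => simpa using h (b :: v) (by simp)
  | h3 a u b v ih1 ih2 =>
    rw [sh_cons_cons, sh_cons_cons]
    congr 1
    · exact ih1 fun l hl => h _ (by simpa using hl)
    · refine ih2 fun l hl => h _ ?_
      exact (hl.cons b).trans (List.perm_middle (l₁ := a :: u)).symm

theorem sh_add (c d : List Φ → ℂ) (u v : List Φ) :
    sh (fun l => c l + d l) u v = sh c u v + sh d u v := by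
  induction u, v using pair_induction generalizing c d with
  | h0 => simp
  | h1 a u ih => simp
  | h2 b v ih => simp
  | h3 a u b v ih1 ih2 => simp only [sh_cons_cons, ih1, ih2]; ring

theorem sh_const_mul (r : ℂ) (c : List Φ → ℂ) (u v : List Φ) :
    sh (fun l => r * c l) u v = r * sh c u v := by
  induction u, v using pair_induction generalizing c with
  | h0 => simp
  | h1 a u ih => simp
  | h2 b v ih => simp
  | h3 a u b v ih1 ih2 => simp only [sh_cons_cons, ih1, ih2]; ring

theorem sh_zero (u v : List Φ) : sh (fun _ : List Φ => (0 : ℂ)) u v = 0 := by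
  simpa using sh_const_mul 0 (fun _ : List Φ => (0 : ℂ)) u v

theorem sh_sum {ι : Type*} (s : Finset ι) (c : ι → List Φ → ℂ) (u v : List Φ) :
    sh (fun l => ∑ i ∈ s, c i l) u v = ∑ i ∈ s, sh (c i) u v := by
  induction s using Finset.cons_induction with
  | empty => simpa using sh_zero u v
  | cons i s hi ih => simp only [Finset.sum_cons, sh_add, ih]

/-- `sh` as a map to series with coefficients in the ring of series. -/
def shS (c : NCS Φ ℂ) : NCS Φ (NCS Φ ℂ) := ⟨fun u => ⟨sh c.coeff u⟩⟩

theorem shS_apply (c : NCS Φ ℂ) (u v : List Φ) : shS c u v = sh c.coeff u v := rfl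

/-- Deconcatenation is compatible with shuffling: to cut a shuffle of `u` and `v` in two is to cut
`u` and `v` and to shuffle the left parts and the right parts. The induction on the total length
removes the first letter of the shuffle. -/
theorem shS_mul (a b : NCS Φ ℂ) (u v : List Φ) :
    sh (a * b).coeff u v = (shS a * shS b) u v := by
  have key : ∀ (n : ℕ) (a b : NCS Φ ℂ) (u v : List Φ), u.length + v.length = n →
      sh (a * b).coeff u v = (shS a * shS b) u v := by
    intro n
    induction n with
    | zero =>
      intro a b u v h
      have hu : u = [] := List.length_eq_zero_iff.1 (by omega)
      have hv : v = [] := List.length_eq_zero_iff.1 (by omega)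
      subst hu hv
      simp [NCS.mul_nil, shS]
    | succ n ih =>
      have hst : ∀ (x : Φ) (a b : NCS Φ ℂ) (u v : List Φ), u.length + v.length = n →
          sh (fun l => (a * b) (x :: l)) u v =
            a [] * sh (NCS.strip x b).coeff u v + (shS (NCS.strip x a) * shS b) u v := by
        intro x a b u v h
        rw [← ih _ _ _ _ h, ← sh_const_mul, ← sh_add]
        rfl
      have e2 : ∀ (y : Φ) (a : NCS Φ ℂ), NCS.strip y (shS a []) = shS (NCS.strip y a) [] := by
        intro y a
        refine NCS.ext' fun w => ?_
        simp [shS]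
      intro a b u v h
      rcases u with _ | ⟨x, u⟩
      · rcases v with _ | ⟨y, v⟩
        · simp at h
        · rw [sh_nil_cons, hst y a b [] v (by simpa using h), NCS.mul_nil, NCS.mul_nil,
            NCS.mul_cons, e2]
          simp only [shS_apply, sh_nil_left, NCS.strip_apply]
      · rcases v with _ | ⟨y, v⟩
        · rw [sh_cons_nil, hst x a b u [] (by simpa using h), NCS.mul_cons, NCS.add_apply,
            NCS.mul_nil]
          simp only [shS_apply, sh_nil_right, NCS.strip_apply]
          congr 1
          have h0 : ∀ (c d : NCS Φ (NCS Φ ℂ)), (∀ w, c w [] = d w []) →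
              ∀ e u, (c * e) u [] = (d * e) u [] := by
            intro c d hcd e u
            induction u generalizing c d with
            | nil => rw [NCS.mul_nil, NCS.mul_nil, NCS.mul_nil, NCS.mul_nil, hcd]
            | cons x u ih =>
              rw [NCS.mul_cons, NCS.mul_cons, NCS.add_apply, NCS.add_apply, NCS.mul_nil,
                NCS.mul_nil, hcd, ih (NCS.strip x c) (NCS.strip x d) fun w => hcd (x :: w)]
          refine h0 _ _ (fun w => ?_) _ _
          simp [shS_apply]
        · rw [sh_cons_cons, hst x a b u (y :: v) (by simp at h ⊢; omega),
            hst y a b (x :: u) v (by simp at h ⊢; omega), NCS.mul_cons (shS a), NCS.add_apply,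
            NCS.mul_cons (shS a []), NCS.mul_cons (shS (NCS.strip y a)), NCS.add_apply]
          -- The shuffles whose first letter comes from the second word form a series of their own.
          -- It vanishes when its second word is empty, so the letter `y` has to lie in the left
          -- factor of the cut.
          have e1 : ∀ (c : NCS Φ (NCS Φ ℂ)) (u : List Φ),
              (NCS.strip x (shS a) * c) u (y :: v) = (shS (NCS.strip x a) * c) u (y :: v) +
                (NCS.strip x (shS (NCS.strip y a)) * c) u v := by
            intro c u
            have : NCS.strip x (shS a) = shS (NCS.strip x a) + (⟨fun u' => ⟨fun v' => match v' with
                | [] => 0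
                | y :: v' => sh (NCS.strip y a).coeff (x :: u') v'⟩⟩ : NCS Φ (NCS Φ ℂ)) := by
              refine NCS.ext' fun u' => NCS.ext' fun v' => ?_
              cases v' with
              | nil => simp [shS_apply]
              | cons y v' =>
                simp only [NCS.strip_apply, shS_apply, sh_cons_cons, NCS.add_apply]
                rfl
            rw [this, add_mul, NCS.add_apply, NCS.add_apply]
            congr 1
            have h1 : ∀ (p q : NCS Φ (NCS Φ ℂ)), (∀ w, p w [] = 0) →
                (∀ w, NCS.strip y (p w) = q w) → ∀ u, (p * c) u (y :: v) = (q * c) u v := by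
              intro p q hp hq u
              induction u generalizing p q with
              | nil => rw [NCS.mul_nil, NCS.mul_nil, NCS.mul_cons, hp, zero_mul, zero_add, hq]
              | cons x u ih =>
                rw [NCS.mul_cons, NCS.mul_cons, NCS.add_apply, NCS.add_apply, NCS.mul_cons, hp,
                  zero_mul, zero_add, hq, ih (NCS.strip x p) (NCS.strip x q) (fun w => hp _)
                    (fun w => hq _)]
            exact h1 _ _ (fun w => rfl) (fun w => rfl) u
          rw [e1, e2, shS_apply b, sh_cons_cons]
          simp only [shS_apply, sh_nil_nil]
          change _ = a [] * (sh (NCS.strip x b).coeff u (y :: v) +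
            sh (NCS.strip y b).coeff (x :: u) v) + _ + _
          ring
  exact key _ a b u v rfl

end Series

/-! ### Characters and primitive elements -/

section Characters

variable {Φ : Type*}

theorem NCS.mul_congr₂ {A A' B B' : NCS Φ (NCS Φ ℂ)} {u v : List Φ}
    (h : ∀ u₁ u₂ v₁ v₂, u₁ ++ u₂ = u → v₁ ++ v₂ = v →
      A u₁ v₁ * B u₂ v₂ = A' u₁ v₁ * B' u₂ v₂) : (A * B) u v = (A' * B') u v := by
  induction u generalizing A A' with
  | nil =>
    rw [NCS.mul_nil, NCS.mul_nil]
    exact NCS.mul_congr fun v₁ v₂ hv => h [] [] v₁ v₂ rfl hv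
  | cons x u ih =>
    rw [NCS.mul_cons, NCS.mul_cons, NCS.add_apply, NCS.add_apply]
    congr 1
    · exact NCS.mul_congr fun v₁ v₂ hv => h [] (x :: u) v₁ v₂ rfl hv
    · exact ih fun u₁ u₂ v₁ v₂ hu hv => h (x :: u₁) u₂ v₁ v₂ (by simp [hu]) hv

/-- The series `a ⊗ a` in two sets of letters. -/
def tens (a : NCS Φ ℂ) : NCS Φ (NCS Φ ℂ) := ⟨fun u => ⟨fun v => a u * a v⟩⟩

theorem tens_apply (a : NCS Φ ℂ) (u v : List Φ) : tens a u v = a u * a v := rfl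

theorem lsmul_mul_lsmul (r r' : ℂ) (a b : NCS Φ ℂ) (l : List Φ) :
    (NCS.lsmul r a * NCS.lsmul r' b) l = r * r' * (a * b) l := by
  rw [NCS.lsmul_mul]
  have : (a * NCS.lsmul r' b) l = (NCS.lsmul r' a * b) l :=
    NCS.mul_congr fun u v _ => by simp only [NCS.lsmul]; ring
  rw [this, NCS.lsmul_mul]
  ring

/-- Stripping letters from `tens a` leaves a family of multiples of the fixed series `a`; the
induction runs over all such families. -/
theorem tens_mul (a b : NCS Φ ℂ) (u v : List Φ) :
    (tens a * tens b) u v = (a * b) u * (a * b) v := by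
  have key : ∀ (a' : NCS Φ ℂ) (A : NCS Φ (NCS Φ ℂ)) (hA : ∀ u, A u = NCS.lsmul (a' u) a),
      (A * tens b) u v = (a' * b) u * (a * b) v := by
    induction u with
    | nil =>
      intro a' A hA
      rw [NCS.mul_nil, NCS.mul_nil, hA]
      exact lsmul_mul_lsmul _ _ _ _ _
    | cons x u ih =>
      intro a' A hA
      rw [NCS.mul_cons, NCS.mul_cons, NCS.add_apply, ih (NCS.strip x a') (NCS.strip x A)
        (fun u => hA _), hA, add_mul]
      congr 1
      exact lsmul_mul_lsmul _ _ _ _ _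
  exact key a (tens a) fun u => rfl

/-- The shuffle relations hold for words of total length at most `m`. -/
def IsChar (m : ℕ) (c : NCS Φ ℂ) : Prop :=
  ∀ u v : List Φ, u.length + v.length ≤ m → sh c.coeff u v = c u * c v

/-- A character is a group-like series, `shS a = tens a`, and both `shS` and `tens` are
multiplicative. Only factors of `u` and `v` enter, so the truncation at total length `m` does no
harm. -/
theorem IsChar.mul {m : ℕ} {a b : NCS Φ ℂ} (ha : IsChar m a) (hb : IsChar m b) :
    IsChar m (a * b) := by
  intro u v huv
  rw [shS_mul, ← tens_mul]
  refine NCS.mul_congr₂ fun u₁ u₂ v₁ v₂ hu hv => ?_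
  subst hu hv
  simp only [List.length_append] at huv
  rw [shS_apply, shS_apply, tens_apply, tens_apply, ha _ _ (by omega), hb _ _ (by omega)]

theorem IsChar.one (m : ℕ) : IsChar m (1 : NCS Φ ℂ) := by
  intro u v _
  induction u, v using pair_induction with
  | h0 => simp [NCS.one_nil]
  | h1 a u ih => simp [NCS.one_nil]
  | h2 b v ih => simp [NCS.one_nil]
  | h3 a u b v ih1 ih2 => simp [sh_cons_cons, NCS.one_cons, sh_zero]

theorem IsChar.pow {m : ℕ} {a : NCS Φ ℂ} (ha : IsChar m a) (k : ℕ) : IsChar m (a ^ k) := by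
  induction k with
  | zero => simpa using IsChar.one m
  | succ k ih => rw [pow_succ]; exact ih.mul ha

/-- If `X` vanishes at smaller pairs, then only one term of a product is left. -/
theorem NCS.mul_apply_of_forall {A X : NCS Φ (NCS Φ ℂ)} {u v : List Φ}
    (h : ∀ u₁ u₂ v₁ v₂, u₁ ++ u₂ = u → v₁ ++ v₂ = v → u₁ ≠ [] ∨ v₁ ≠ [] → X u₂ v₂ = 0) :
    (A * X) u v = A [] [] * X u v := by
  have h1 : (A [] * X u) v = A [] [] * X u v := by
    cases v with
    | nil => rfl
    | cons y v =>
      rw [NCS.mul_cons]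
      have : (NCS.strip y (A []) * X u) v = (0 * X u) v := NCS.mul_congr fun v₁ v₂ hv => by
        rw [h [] u (y :: v₁) v₂ rfl (by simp [hv]) (by simp)]; simp
      rw [this, zero_mul]; simp
  cases u with
  | nil => rw [NCS.mul_nil, h1]
  | cons x u =>
    rw [NCS.mul_cons, NCS.add_apply, h1]
    have : (NCS.strip x A * X) u v = ((0 : NCS Φ (NCS Φ ℂ)) * X) u v :=
      NCS.mul_congr₂ fun u₁ u₂ v₁ v₂ hu hv => by
        rw [h (x :: u₁) u₂ v₁ v₂ (by simp [hu]) hv (by simp)]; simp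
    rw [this, zero_mul]; simp

/-- A quotient of group-like series is group-like. The product `tens a * (shS b - tens b)` vanishes
at `(u, v)`, and by induction on the total length the only term left in it is `shS b - tens b` at
`(u, v)` itself. -/
theorem IsChar.of_mul {m : ℕ} {a b c : NCS Φ ℂ} (ha : IsChar m a) (hc : IsChar m c)
    (h1 : a [] = 1) (h : ∀ l : List Φ, l.length ≤ m → c l = (a * b) l) : IsChar m b := by
  have key : ∀ (n : ℕ) (u v : List Φ), u.length + v.length = n → n ≤ m →
      sh b.coeff u v = b u * b v := by
    intro n
    induction n using Nat.strong_induction_on with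
    | _ n ih =>
      intro u v huv hn
      have e1 : (shS a * shS b) u v = (tens a * tens b) u v := by
        rw [← shS_mul, tens_mul, ← h u (by omega), ← h v (by omega), ← hc u v (by omega)]
        refine sh_congr fun l hl => (h l ?_).symm
        rw [hl.length_eq, List.length_append]
        omega
      have e2 : (shS a * shS b) u v = (tens a * shS b) u v := NCS.mul_congr₂ fun u₁ u₂ v₁ v₂ hu hv => by
        subst hu hv
        simp only [List.length_append] at huv
        rw [shS_apply, tens_apply, ha _ _ (by omega)]
      have e3 : (tens a * (shS b - tens b)) u v = 0 := by
        rw [mul_sub, NCS.sub_apply, NCS.sub_apply, ← e2, e1, sub_self]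
      rw [NCS.mul_apply_of_forall] at e3
      · simpa [tens_apply, h1, shS_apply, sub_eq_zero] using e3
      · intro u₁ u₂ v₁ v₂ hu hv hne
        subst hu hv
        simp only [List.length_append] at huv
        rw [NCS.sub_apply, NCS.sub_apply, shS_apply, tens_apply, sub_eq_zero]
        refine ih _ ?_ u₂ v₂ rfl ?_
        · have : 0 < u₁.length ∨ 0 < v₁.length := by simpa [List.length_pos_iff] using hne
          omega
        · omega
  exact fun u v huv => key _ u v rfl huv

/-- The antipode of a character. -/
def antipode (q : NCS Φ ℂ) : NCS Φ ℂ := ⟨fun l => (-1) ^ l.length * q l.reverse⟩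

/-- The alternating sum over the cuts telescopes. The product of the values at a reversed left part
`y :: r` and a right part `x :: v` is the sum over the shuffles that begin with `y` and those that
begin with `x`; the latter cancel against the cuts further to the right. -/
theorem antipode_mul {q : NCS Φ ℂ} (h1 : q [] = 1) {l : List Φ}
    (h : ∀ u v, u ++ v = l → sh q.coeff u.reverse v = q u.reverse * q v) :
    (antipode q * q) l = (1 : NCS Φ ℂ) l := by
  have key : ∀ (v : List Φ) (y : Φ) (r : List Φ) (A : NCS Φ ℂ),
      (∀ w, A w = (-1) ^ w.length * q (w.reverse ++ (y :: r))) →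
      (∀ w v', w ++ v' = v → sh q.coeff (w.reverse ++ (y :: r)) v' =
        q (w.reverse ++ (y :: r)) * q v') →
      (A * q) v = sh (fun l => q (y :: l)) r v := by
    intro v
    induction v with
    | nil =>
      intro y r A hA hq
      rw [NCS.mul_nil, hA]
      simp [h1]
    | cons x v ih =>
      intro y r A hA hq
      have hs : NCS.strip x A = -NCS.strip x (-A) := by
        rw [show NCS.strip x (-A) = -NCS.strip x A from rfl, neg_neg]
      rw [NCS.mul_cons, hs, neg_mul]
      change _ + -(NCS.strip x (-A) * q).coeff v = _
      rw [ih x (y :: r) (NCS.strip x (-A))]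
      · have := hq [] (x :: v) rfl
        rw [hA]
        simp only [List.reverse_nil, List.nil_append, sh_cons_cons, List.length_nil, pow_zero,
          one_mul] at this ⊢
        rw [← this]
        ring
      · intro w
        change -(A.coeff (x :: w)) = _
        rw [hA]
        simp [pow_succ]
      · intro w v' hw
        have := hq (x :: w) v' (by simp [hw])
        simpa using this
  cases l with
  | nil => rw [NCS.mul_nil]; simp [antipode, h1, NCS.one_nil]
  | cons x l =>
    have hs : NCS.strip x (antipode q) = -NCS.strip x (-antipode q) := by
      rw [show NCS.strip x (-antipode q) = -NCS.strip x (antipode q) from rfl, neg_neg]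
    rw [NCS.mul_cons, NCS.one_cons, hs, neg_mul]
    change _ + -(NCS.strip x (-antipode q) * q).coeff l = _
    rw [key l x [] (NCS.strip x (-antipode q))]
    · simp [antipode, h1]
    · intro w
      change -((antipode q).coeff (x :: w)) = _
      simp [antipode, pow_succ]
    · intro w v' hw
      have := h (x :: w) v' (by simp [hw])
      simpa using this

/-! ### Logarithms -/

open Polynomial in
/-- The binomial coefficient `X choose j` as a polynomial. -/
def binomPoly (j : ℕ) : ℂ[X] := C ((j.factorial : ℂ)⁻¹) * descPochhammer ℂ j

theorem binomPoly_eval (j k : ℕ) : (binomPoly j).eval (k : ℂ) = (k.choose j : ℂ) := by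
  rw [binomPoly, Polynomial.eval_mul, Polynomial.eval_C, descPochhammer_eval_eq_descFactorial,
    Nat.descFactorial_eq_factorial_mul_choose, Nat.cast_mul, inv_mul_cancel_left₀]
  exact_mod_cast j.factorial_ne_zero

theorem descPochhammer_eval_neg_one (j : ℕ) :
    (descPochhammer ℂ j).eval (-1) = (-1) ^ j * (j.factorial : ℂ) := by
  induction j with
  | zero => simp
  | succ j ih =>
    rw [descPochhammer_succ_right, Polynomial.eval_mul, ih, Nat.factorial_succ]
    simp
    ring

/-- The coefficients of the logarithm. -/
def logCoeff (j : ℕ) : ℂ := (-1) ^ (j - 1) / j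

/-- This identifies the logarithm of `S` as the linear term in `k` of the powers `S ^ k`. For `j =
0` the convention `x / 0 = 0` gives the right value. -/
theorem binomPoly_coeff_one (j : ℕ) : (binomPoly j).coeff 1 = logCoeff j := by
  rw [binomPoly, Polynomial.coeff_C_mul, logCoeff]
  cases j with
  | zero => simp [Polynomial.coeff_one]
  | succ j =>
    rw [descPochhammer_succ_left, Polynomial.coeff_X_mul, Polynomial.coeff_zero_eq_eval_zero,
      Polynomial.eval_comp]
    simp only [Polynomial.eval_sub, Polynomial.eval_X, Polynomial.eval_one, zero_sub,
      descPochhammer_eval_neg_one, Nat.factorial_succ, Nat.add_sub_cancel]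
    have : (j.factorial : ℂ) ≠ 0 := by exact_mod_cast j.factorial_ne_zero
    have h2 : ((j : ℂ) + 1) ≠ 0 := by exact_mod_cast j.succ_ne_zero
    push_cast
    field_simp

theorem binomPoly_coeff_zero (j : ℕ) : (binomPoly j).coeff 0 = if j = 0 then 1 else 0 := by
  have := binomPoly_eval j 0
  rw [Nat.cast_zero, ← Polynomial.coeff_zero_eq_eval_zero] at this
  rw [this]
  cases j <;> simp

/-- The logarithm of a series with constant term `1`. -/
def NCS.log (S : NCS Φ ℂ) : NCS Φ ℂ :=
  ⟨fun l => ∑ j ∈ Finset.range (l.length + 1), logCoeff j * ((S - 1) ^ j) l⟩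

theorem sub_one_nil {S : NCS Φ ℂ} (h1 : S [] = 1) : (S - 1) [] = 0 := by
  rw [NCS.sub_apply, h1, NCS.one_nil, sub_self]

theorem NCS.log_eq {S : NCS Φ ℂ} (h1 : S [] = 1) {l : List Φ} {n : ℕ} (hn : l.length ≤ n) :
    NCS.log S l = ∑ j ∈ Finset.range (n + 1), logCoeff j * ((S - 1) ^ j) l := by
  refine Finset.sum_subset (Finset.range_mono (Nat.succ_le_succ hn)) fun j _ hj => ?_
  rw [NCS.pow_apply_eq_zero (sub_one_nil h1) (by simpa using hj), mul_zero]

theorem NCS.pow_eq {S : NCS Φ ℂ} (h1 : S [] = 1) {l : List Φ} {n : ℕ} (hn : l.length ≤ n) (k : ℕ) :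
    (S ^ k) l = ∑ j ∈ Finset.range (n + 1), (k.choose j : ℂ) * ((S - 1) ^ j) l := by
  have e : S ^ k = ∑ j ∈ Finset.range (k + 1), ((k.choose j : ℕ) : NCS Φ ℂ) * (S - 1) ^ j := by
    conv_lhs => rw [← sub_add_cancel S 1]
    rw [(Commute.one_right (S - 1)).add_pow]
    refine Finset.sum_congr rfl fun j _ => ?_
    rw [one_pow, mul_one]
    exact (Nat.cast_commute _ _).eq.symm
  rw [e, NCS.sum_apply]
  simp only [NCS.natCast_mul_apply]
  -- Both cut-offs give the same sum: beyond `k` the binomial coefficients vanish, and beyond the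
  -- length of the word the powers of `S - 1` do.
  have h2 : ∀ a b : ℕ, (∀ j, b < j → (k.choose j : ℂ) * ((S - 1) ^ j) l = 0) →
      ∑ j ∈ Finset.range (a + b + 1), (k.choose j : ℂ) * ((S - 1) ^ j) l =
        ∑ j ∈ Finset.range (b + 1), (k.choose j : ℂ) * ((S - 1) ^ j) l := by
    intro a b hb
    refine (Finset.sum_subset (by simp) fun j _ hj => ?_).symm
    exact hb j (by simpa using hj)
  rw [← h2 n k fun j hj => by simp [Nat.choose_eq_zero_of_lt hj], add_comm n k,
    h2 k n fun j hj => by rw [NCS.pow_apply_eq_zero (sub_one_nil h1) (by omega), mul_zero]]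

open Polynomial in
/-- The logarithm of a character vanishes on shuffles of nonempty words. -/
theorem IsChar.sh_log {m : ℕ} {S : NCS Φ ℂ} (hS : IsChar m S) (h1 : S [] = 1) {u v : List Φ}
    (hu : u ≠ []) (hv : v ≠ []) (huv : u.length + v.length ≤ m) :
    sh (NCS.log S).coeff u v = 0 := by
  set P : (ℕ → ℂ) → ℂ[X] := fun c => ∑ j ∈ Finset.range (m + 1), C (c j) * binomPoly j with hP
  have hev : ∀ (c : ℕ → ℂ) (k : ℕ),
      (P c).eval (k : ℂ) = ∑ j ∈ Finset.range (m + 1), (k.choose j : ℂ) * c j := by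
    intro c k
    rw [hP, eval_finsetSum]
    exact Finset.sum_congr rfl fun j _ => by rw [eval_mul, eval_C, binomPoly_eval, mul_comm]
  have hc1 : ∀ c : ℕ → ℂ, (P c).coeff 1 = ∑ j ∈ Finset.range (m + 1), logCoeff j * c j := by
    intro c
    rw [hP, finsetSum_coeff]
    exact Finset.sum_congr rfl fun j _ => by rw [coeff_C_mul, binomPoly_coeff_one, mul_comm]
  have hc0 : ∀ l : List Φ, l ≠ [] → (P fun j => ((S - 1) ^ j) l).coeff 0 = 0 := by
    intro l hl
    rw [hP, finsetSum_coeff]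
    refine Finset.sum_eq_zero fun j _ => ?_
    rw [coeff_C_mul, binomPoly_coeff_zero]
    obtain ⟨x, l, rfl⟩ := List.exists_cons_of_ne_nil hl
    split_ifs with hj
    · simp [hj, NCS.one_cons]
    · simp
  -- Every power `S ^ k` is a character, and its coefficients are polynomials in `k`. So the shuffle
  -- relation is an identity of polynomials, as it holds at all natural numbers.
  have main : P (fun j => sh ((S - 1) ^ j).coeff u v) =
      (P fun j => ((S - 1) ^ j) u) * (P fun j => ((S - 1) ^ j) v) := by
    refine eq_of_infinite_eval_eq _ _ ?_
    refine (Set.infinite_range_of_injective (Nat.cast_injective (R := ℂ))).mono ?_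
    rintro _ ⟨k, rfl⟩
    change _ = _
    rw [eval_mul, hev, hev, hev, ← NCS.pow_eq h1 (by omega), ← NCS.pow_eq h1 (by omega),
      ← hS.pow k u v huv]
    have : sh (S ^ k).coeff u v = sh (fun l => ∑ j ∈ Finset.range (m + 1),
        (k.choose j : ℂ) * ((S - 1) ^ j) l) u v := sh_congr fun l hl => NCS.pow_eq h1
          (by rw [hl.length_eq, List.length_append]; exact huv) k
    rw [this, sh_sum]
    simp only [sh_const_mul]
  -- On the right both factors lack a constant term, since `u` and `v` are nonempty, so the product
  -- has no linear term. On the left the linear term is the logarithm.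
  have h2 := congrArg (fun p => coeff p 1) main
  simp only [hc1] at h2
  rw [mul_coeff_one, hc0 u hu, hc0 v hv] at h2
  simp only [zero_mul, mul_zero, add_zero] at h2
  rw [← h2]
  have : sh (NCS.log S).coeff u v = sh (fun l => ∑ j ∈ Finset.range (m + 1),
        logCoeff j * ((S - 1) ^ j) l) u v := sh_congr fun l hl => NCS.log_eq h1
          (by rw [hl.length_eq, List.length_append]; exact huv)
  rw [this, sh_sum]
  simp only [sh_const_mul]

end Characters

/-! ### Sums over words -/

section Words

variable {Φ : Type*} [Fintype Φ]

/-- The sum of `F` over the words of length `n`. -/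
def lsum {A : Type*} [AddCommMonoid A] : ℕ → (List Φ → A) → A
  | 0, F => F []
  | n + 1, F => ∑ b, lsum n fun l => F (b :: l)

theorem lsum_eq_sum_ofFn {A : Type*} [AddCommMonoid A] (n : ℕ) (F : List Φ → A) :
    lsum n F = ∑ a : Fin n → Φ, F (List.ofFn a) := by
  induction n generalizing F with
  | zero => simp [lsum]
  | succ n ih =>
    rw [lsum, ← (Fin.consEquiv fun _ : Fin (n + 1) => Φ).sum_comp, Fintype.sum_prod_type]
    refine Finset.sum_congr rfl fun b _ => ?_
    rw [ih]
    exact Finset.sum_congr rfl fun a _ => by simp [Fin.consEquiv, List.ofFn_succ]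

theorem lsum_congr {A : Type*} [AddCommMonoid A] {n : ℕ} {F G : List Φ → A}
    (h : ∀ l, l.length = n → F l = G l) : lsum n F = lsum n G := by
  rw [lsum_eq_sum_ofFn, lsum_eq_sum_ofFn]
  exact Finset.sum_congr rfl fun a _ => h _ (by simp)

theorem lsum_add {A : Type*} [AddCommMonoid A] (n : ℕ) (F G : List Φ → A) :
    lsum n (fun l => F l + G l) = lsum n F + lsum n G := by
  simp only [lsum_eq_sum_ofFn, Finset.sum_add_distrib]

theorem lsum_mul {A : Type*} [NonUnitalNonAssocSemiring A] (n : ℕ) (F : List Φ → A) (a : A) :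
    lsum n (fun l => F l * a) = lsum n F * a := by
  simp only [lsum_eq_sum_ofFn, Finset.sum_mul]

theorem mul_lsum {A : Type*} [NonUnitalNonAssocSemiring A] (n : ℕ) (F : List Φ → A) (a : A) :
    lsum n (fun l => a * F l) = a * lsum n F := by
  simp only [lsum_eq_sum_ofFn, Finset.mul_sum]

theorem lsum_zero {A : Type*} [AddCommMonoid A] (n : ℕ) :
    lsum n (fun _ : List Φ => (0 : A)) = 0 := by
  simp [lsum_eq_sum_ofFn]

end Words

section LieElements

variable {Φ : Type*}

/-! ### Lie elements -/

/-- The product of the `x b`, in the reversed order. -/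
def rprod {A : Type*} [Monoid A] (x : Φ → A) : List Φ → A
  | [] => 1
  | b :: l => rprod x l * x b

/-- The iterated bracket `[…[[x_n, x_{n-1}], x_{n-2}], …, x_1]`. -/
def brk {𝔏 : Type*} [LieRing 𝔏] (x : Φ → 𝔏) : List Φ → 𝔏
  | [] => 0
  | [b] => x b
  | b :: c :: l => ⁅brk x (c :: l), x b⁆

theorem brk_cons {𝔏 : Type*} [LieRing 𝔏] (x : Φ → 𝔏) (b : Φ) {l : List Φ} (hl : l ≠ []) :
    brk x (b :: l) = ⁅brk x l, x b⁆ := by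
  obtain ⟨c, l, rfl⟩ := List.exists_cons_of_ne_nil hl
  rfl

/-- The sum of `F u v` over the pairs of complementary subwords of a word. -/
def unsh {A : Type*} [Add A] : (List Φ → List Φ → A) → List Φ → A
  | F, [] => F [] []
  | F, b :: l => unsh (fun u v => F (b :: u) v) l + unsh (fun u v => F u (b :: v)) l

theorem unsh_add {A : Type*} [AddCommMonoid A] (F G : List Φ → List Φ → A) (l : List Φ) :
    unsh (fun u v => F u v + G u v) l = unsh F l + unsh G l := by
  induction l generalizing F G with
  | nil => rfl
  | cons b l ih => simp only [unsh, ih]; abel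

theorem unsh_mul {A : Type*} [Ring A] (F : List Φ → List Φ → A) (a : A) (l : List Φ) :
    unsh (fun u v => F u v * a) l = unsh F l * a := by
  induction l generalizing F with
  | nil => rfl
  | cons b l ih => simp only [unsh, ih, add_mul]

theorem unsh_zero {A : Type*} [AddCommMonoid A] (l : List Φ) :
    unsh (fun _ _ : List Φ => (0 : A)) l = 0 := by
  induction l with
  | nil => rfl
  | cons b l ih => simp only [unsh, ih, add_zero]

theorem unsh_ite {A : Type*} [AddCommMonoid A] (G : List Φ → A) (l : List Φ) :
    unsh (fun u v => if u.isEmpty then G v else 0) l = G l := by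
  induction l generalizing G with
  | nil => rfl
  | cons b l ih =>
    simp only [unsh, List.isEmpty_cons, Bool.false_eq_true, if_false, unsh_zero, zero_add]
    exact ih fun v => G (b :: v)

/-- The heart of Dynkin's theorem. A new letter `b` goes either to the bracket or to the product,
and `rprod v * ⁅brk u, x b⁆ + rprod v * x b * brk u = rprod v * brk u * x b`. The pair with empty
`u`, where the letter starts a bracket, raises the factor from the length of `l` by one. -/
theorem unsh_rprod_brk {A : Type*} [Ring A] (x : Φ → A) (l : List Φ) :
    unsh (fun u v => rprod x v * brk x u) l = l.length * rprod x l := by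
  induction l with
  | nil => simp [unsh, brk]
  | cons b l ih =>
    have e : unsh (fun u v => rprod x v * brk x u) (b :: l) =
        unsh (fun u v => (rprod x v * brk x u + if u.isEmpty then rprod x v else 0) * x b) l := by
      rw [unsh, ← unsh_add]
      congr 1
      funext u v
      cases u with
      | nil => simp [brk]
      | cons c u =>
        rw [brk_cons x b (by simp), Ring.lie_def]
        simp only [rprod, List.isEmpty_cons, Bool.false_eq_true, if_false]
        noncomm_ring
    rw [e, unsh_mul, unsh_add, unsh_ite, ih, rprod]
    simp [add_mul, mul_assoc]

variable [Fintype Φ]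

/-- The recursion of `sh` in the lengths of the two words, summed over all pairs of lengths with a
given total; on the edges of the range only one branch exists. -/
theorem sum_antidiagonal_succ_of {M : Type*} [AddCommMonoid M] {G A B : ℕ → ℕ → M}
    (h1 : ∀ i j, G (i + 1) (j + 1) = A i (j + 1) + B (i + 1) j) (h2 : ∀ i, G (i + 1) 0 = A i 0)
    (h3 : ∀ j, G 0 (j + 1) = B 0 j) (n : ℕ) :
    ∑ ij ∈ Finset.HasAntidiagonal.antidiagonal (n + 1), G ij.1 ij.2 =
      ∑ ij ∈ Finset.HasAntidiagonal.antidiagonal n, A ij.1 ij.2 +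
      ∑ ij ∈ Finset.HasAntidiagonal.antidiagonal n, B ij.1 ij.2 := by
  set A' : ℕ × ℕ → M := fun ij => match ij.1 with
    | 0 => 0
    | i + 1 => A i ij.2 with hA
  set B' : ℕ × ℕ → M := fun ij => match ij.2 with
    | 0 => 0
    | j + 1 => B ij.1 j with hB
  have e : ∀ ij ∈ Finset.HasAntidiagonal.antidiagonal (n + 1), G ij.1 ij.2 = A' ij + B' ij := by
    rintro ⟨i, j⟩ hij
    rw [Finset.HasAntidiagonal.mem_antidiagonal] at hij
    rcases i with _ | i <;> rcases j with _ | j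
    · simp at hij
    · simp [hA, hB, h3]
    · simp [hA, hB, h2]
    · simp [hA, hB, h1]
  rw [Finset.sum_congr rfl e, Finset.sum_add_distrib, Finset.Nat.sum_antidiagonal_succ,
    Finset.Nat.sum_antidiagonal_succ' (f := B')]
  simp [hA, hB]

theorem lsum_sum {A ι : Type*} [AddCommMonoid A] (s : Finset ι) (n : ℕ) (F : ι → List Φ → A) :
    lsum n (fun l => ∑ b ∈ s, F b l) = ∑ b ∈ s, lsum n (F b) := by
  simp only [lsum_eq_sum_ofFn]
  exact Finset.sum_comm

/-- Shuffling is dual to splitting a word into complementary subwords: each pair of a word and such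
a splitting is counted once on either side. -/
theorem lsum_smul_unsh {A : Type*} [AddCommGroup A] [Module ℂ A] (n : ℕ) (c : List Φ → ℂ)
    (F : List Φ → List Φ → A) :
    lsum n (fun l => c l • unsh F l) = ∑ ij ∈ Finset.HasAntidiagonal.antidiagonal n,
      lsum ij.1 fun u => lsum ij.2 fun v => sh c u v • F u v := by
  induction n generalizing c F with
  | zero => simp [lsum, unsh]
  | succ n ih =>
    rw [sum_antidiagonal_succ_of
      (G := fun i j => lsum i fun u => lsum j fun v => sh c u v • F u v)
      (A := fun i j => ∑ a, lsum i fun u => lsum j fun v =>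
        sh (fun l => c (a :: l)) u v • F (a :: u) v)
      (B := fun i j => ∑ b, lsum i fun u => lsum j fun v =>
        sh (fun l => c (b :: l)) u v • F u (b :: v))]
    · have e : ∀ X : ℕ × ℕ → Φ → A, ∑ ij ∈ Finset.HasAntidiagonal.antidiagonal n, ∑ b, X ij b =
          ∑ b, ∑ ij ∈ Finset.HasAntidiagonal.antidiagonal n, X ij b := fun X => Finset.sum_comm
      rw [e, e, ← Finset.sum_add_distrib, lsum]
      refine Finset.sum_congr rfl fun b _ => ?_
      simp only [unsh, smul_add, lsum_add]
      rw [ih (fun l => c (b :: l)), ih (fun l => c (b :: l))]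
    · intro i j
      simp only [lsum, sh_cons_cons, add_smul, lsum_add, Finset.sum_add_distrib, lsum_sum]
      congr 1
      exact Finset.sum_comm
    · intro i
      simp only [lsum, sh_cons_nil]
    · intro j
      simp only [lsum, sh_nil_cons]

/-- The Dynkin–Specht–Wever theorem: a sum of words whose coefficients vanish on shuffles of
nonempty words is a sum of brackets. -/
theorem natCast_mul_lsum_rprod {A : Type*} [Ring A] [Algebra ℂ A] (x : Φ → A) (n : ℕ)
    (c : List Φ → ℂ)
    (hc : ∀ u v : List Φ, u ≠ [] → v ≠ [] → u.length + v.length = n → sh c u v = 0) :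
    (n : ℂ) • lsum n (fun l => c l • rprod x l) = lsum n fun l => c l • brk x l := by
  have h1 : (n : ℂ) • lsum n (fun l => c l • rprod x l) =
      lsum n fun l => c l • unsh (fun u v => rprod x v * brk x u) l := by
    have : (n : ℂ) • lsum n (fun l => c l • rprod x l) = (n : A) * lsum n (fun l => c l • rprod x l) := by
      rw [Algebra.smul_def, map_natCast]
    rw [this, ← mul_lsum]
    refine lsum_congr fun l hl => ?_
    rw [unsh_rprod_brk, hl, mul_smul_comm]
  -- Only the pairs with an empty second word survive: `brk` vanishes at an empty first word, and
  -- `sh c` at two nonempty words.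
  rw [h1, lsum_smul_unsh, Finset.sum_eq_single (n, 0)]
  · simp [lsum, rprod]
  · rintro ⟨i, j⟩ hij hne
    rw [Finset.HasAntidiagonal.mem_antidiagonal] at hij
    simp only at hij ⊢
    rw [lsum_congr (G := fun _ => 0), lsum_zero]
    intro u hu
    rw [lsum_congr (G := fun _ => 0), lsum_zero]
    intro v hv
    by_cases hu0 : u = []
    · simp [hu0, brk]
    · rw [hc u v hu0 ?_ (by omega), zero_smul]
      rintro rfl
      simp only [List.length_nil] at hv
      exact hne (by ext <;> simp <;> omega)
  · simp

/-- The coefficients of a character satisfy a differential equation in the degree. -/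
theorem natCast_mul_lsum_rprod_of_char {A : Type*} [Ring A] [Algebra ℂ A] (x : Φ → A) (n : ℕ)
    (c : List Φ → ℂ)
    (hc : ∀ u v : List Φ, rprod x v * brk x u = 0 ∨ sh c u v = c u * c v) :
    (n : ℂ) • lsum n (fun l => c l • rprod x l) = ∑ ij ∈ Finset.HasAntidiagonal.antidiagonal n,
      lsum ij.2 (fun l => c l • rprod x l) * lsum ij.1 fun l => c l • brk x l := by
  have h1 : (n : ℂ) • lsum n (fun l => c l • rprod x l) =
      lsum n fun l => c l • unsh (fun u v => rprod x v * brk x u) l := by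
    have : (n : ℂ) • lsum n (fun l => c l • rprod x l) = (n : A) * lsum n (fun l => c l • rprod x l) := by
      rw [Algebra.smul_def, map_natCast]
    rw [this, ← mul_lsum]
    refine lsum_congr fun l hl => ?_
    rw [unsh_rprod_brk, hl, mul_smul_comm]
  rw [h1, lsum_smul_unsh]
  refine Finset.sum_congr rfl fun ij _ => ?_
  rw [← mul_lsum]
  refine lsum_congr fun u _ => ?_
  rw [← lsum_mul]
  refine lsum_congr fun v _ => ?_
  rw [smul_mul_smul_comm]
  rcases hc u v with h | h
  · rw [h, smul_zero, smul_zero]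
  · rw [h, mul_comm]

/-- The sum of words over a product of series is a Cauchy product. -/
theorem lsum_mul_rprod {A : Type*} [Ring A] [Algebra ℂ A] (x : Φ → A) (n : ℕ) (a b : NCS Φ ℂ) :
    lsum n (fun l => (a * b) l • rprod x l) = ∑ ij ∈ Finset.HasAntidiagonal.antidiagonal n,
      lsum ij.2 (fun l => b l • rprod x l) * lsum ij.1 fun l => a l • rprod x l := by
  induction n generalizing a with
  | zero =>
    simp only [lsum, NCS.mul_nil, rprod, Finset.Nat.antidiagonal_zero, Finset.sum_singleton]
    rw [smul_mul_smul_comm, mul_one, mul_comm]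
  | succ n ih =>
    rw [Finset.Nat.sum_antidiagonal_succ]
    simp only [lsum, NCS.mul_cons, add_smul, lsum_add, Finset.sum_add_distrib, rprod]
    congr 1
    · rw [Finset.sum_mul]
      refine Finset.sum_congr rfl fun y _ => ?_
      rw [← lsum_mul]
      refine lsum_congr fun l _ => ?_
      rw [smul_mul_smul_comm, mul_one, mul_comm]
    · simp only [Finset.mul_sum]
      rw [Finset.sum_comm]
      refine Finset.sum_congr rfl fun y _ => ?_
      have e : ∀ (m : ℕ) (f : List Φ → ℂ), lsum m (fun l => f l • (rprod x l * x y)) =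
          lsum m (fun l => f l • rprod x l) * x y := by
        intro m f
        rw [← lsum_mul]
        exact lsum_congr fun l _ => by rw [smul_mul_assoc]
      rw [e, ih (NCS.strip y a), Finset.sum_mul]
      refine Finset.sum_congr rfl fun ij _ => ?_
      rw [e, mul_assoc]
      rfl

end LieElements

/-! ### Sums over compositions -/

section Compositions

variable {Φ : Type*}

theorem NCS.mul_eq_sum {R : Type*} [Ring R] (a b : NCS Φ R) (l : List Φ) :
    (a * b) l = ∑ i ∈ Finset.range (l.length + 1), a (l.take i) * b (l.drop i) := by
  induction l generalizing a with
  | nil => simp [NCS.mul_nil]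
  | cons x l ih =>
    rw [NCS.mul_cons, ih, List.length_cons, Finset.sum_range_succ' _ (l.length + 1), add_comm]
    simp

/-- The blocks of the compositions of `n`. -/
def blockLists (n : ℕ) : Finset (List ℕ) :=
  (Finset.univ : Finset (Composition n)).image Composition.blocks

theorem mem_blockLists {n : ℕ} {bs : List ℕ} :
    bs ∈ blockLists n ↔ (∀ i ∈ bs, 0 < i) ∧ bs.sum = n := by
  simp only [blockLists, Finset.mem_image, Finset.mem_univ, true_and]
  exact ⟨fun ⟨c, hc⟩ => hc ▸ ⟨fun i hi => c.blocks_pos hi, c.blocks_sum⟩,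
    fun ⟨h1, h2⟩ => ⟨⟨bs, fun hi => h1 _ hi, h2⟩, rfl⟩⟩

theorem sum_composition {M : Type*} [AddCommMonoid M] (n : ℕ) (F : List ℕ → M) :
    ∑ c : Composition n, F c.blocks = ∑ bs ∈ blockLists n, F bs := by
  rw [blockLists, Finset.sum_image]
  intro c _ c' _ h
  exact Composition.ext h

theorem sum_blockLists_succ {M : Type*} [AddCommMonoid M] (n : ℕ) (F : List ℕ → M) :
    ∑ bs ∈ blockLists (n + 1), F bs =
      ∑ i ∈ Finset.range (n + 1), ∑ bs ∈ blockLists (n - i), F ((i + 1) :: bs) := by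
  rw [Finset.sum_sigma']
  refine Finset.sum_bij' (fun bs _ => ⟨bs.headI - 1, bs.tail⟩) (fun ib _ => (ib.1 + 1) :: ib.2)
    ?_ ?_ ?_ ?_ ?_
  · intro bs hbs
    rw [mem_blockLists] at hbs
    rcases bs with _ | ⟨i, bs⟩
    · simp at hbs
    · have := hbs.1 i (by simp)
      have h2 := hbs.2
      rw [List.sum_cons] at h2
      simp only [List.headI_cons, List.tail_cons, Finset.mem_sigma, Finset.mem_range,
        mem_blockLists]
      exact ⟨by omega, fun j hj => hbs.1 j (by simp [hj]), by omega⟩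
  · rintro ⟨i, bs⟩ h
    simp only [Finset.mem_sigma, Finset.mem_range, mem_blockLists] at h
    rw [mem_blockLists]
    refine ⟨?_, by have := h.2.2; have := h.1; simp only [List.sum_cons]; omega⟩
    intro j hj
    rcases List.mem_cons.1 hj with rfl | hj
    · omega
    · exact h.2.1 j hj
  · intro bs hbs
    rw [mem_blockLists] at hbs
    rcases bs with _ | ⟨i, bs⟩
    · simp at hbs
    · have := hbs.1 i (by simp)
      simp
      omega
  · rintro ⟨i, bs⟩ h
    simp
  · intro bs hbs
    rw [mem_blockLists] at hbs
    rcases bs with _ | ⟨i, bs⟩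
    · simp at hbs
    · have := hbs.1 i (by simp)
      simp [show i - 1 + 1 = i by omega]

/-- The `k`-th convolution power sums over the cuttings into `k` pieces, and a series without
constant term ignores empty pieces. The induction peels off the first block and shifts the weights
`W`, which is why these are arbitrary. -/
theorem sum_composition_eq {g : NCS Φ ℂ} (hg : g [] = 0) (W : ℕ → ℂ) (l : List Φ) :
    ∑ bs ∈ blockLists l.length, W bs.length * ((l.splitWrtCompositionAux bs).map g.coeff).prod =
      ∑ k ∈ Finset.range (l.length + 1), W k * (g ^ k) l := by
  have key : ∀ (n : ℕ) (W : ℕ → ℂ) (l : List Φ), l.length = n →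
      ∑ bs ∈ blockLists n, W bs.length * ((l.splitWrtCompositionAux bs).map g.coeff).prod =
      ∑ k ∈ Finset.range (n + 1), W k * (g ^ k) l := by
    intro n
    induction n using Nat.strong_induction_on with
    | _ n ih =>
      intro W l hl
      rcases n with _ | n
      · have h0 : blockLists 0 = {[]} := by
          ext bs
          rw [mem_blockLists, Finset.mem_singleton]
          constructor
          · rintro ⟨h1, h2⟩
            rcases bs with _ | ⟨i, bs⟩
            · rfl
            · have := h1 i (by simp)
              rw [List.sum_cons] at h2
              omega
          · rintro rfl
            simp
        have : l = [] := List.length_eq_zero_iff.1 hl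
        subst this
        rw [h0]
        simp [NCS.one_nil, List.splitWrtCompositionAux]
      · rw [sum_blockLists_succ]
        have e1 : ∀ i ∈ Finset.range (n + 1), ∑ bs ∈ blockLists (n - i),
            W ((i + 1) :: bs).length *
              ((l.splitWrtCompositionAux ((i + 1) :: bs)).map g.coeff).prod =
            ∑ k ∈ Finset.range (n + 1), W (k + 1) *
              (g (l.take (i + 1)) * (g ^ k) (l.drop (i + 1))) := by
          intro i hi
          rw [Finset.mem_range] at hi
          have := ih (n - i) (by omega) (fun k => W (k + 1)) (l.drop (i + 1)) (by simp; omega)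
          have h2 : ∑ k ∈ Finset.range (n - i + 1), W (k + 1) * (g ^ k) (l.drop (i + 1)) =
              ∑ k ∈ Finset.range (n + 1), W (k + 1) * (g ^ k) (l.drop (i + 1)) := by
            refine Finset.sum_subset (Finset.range_mono (by omega)) fun k _ hk => ?_
            rw [NCS.pow_apply_eq_zero hg, mul_zero]
            simp at hk ⊢
            omega
          rw [h2] at this
          calc _ = g (l.take (i + 1)) * ∑ bs ∈ blockLists (n - i), W (bs.length + 1) *
                (((l.drop (i + 1)).splitWrtCompositionAux bs).map g.coeff).prod := by
                rw [Finset.mul_sum]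
                refine Finset.sum_congr rfl fun bs _ => ?_
                rw [List.splitWrtCompositionAux_cons, List.map_cons, List.prod_cons,
                  List.length_cons]
                ring
            _ = _ := by
                rw [this, Finset.mul_sum]
                exact Finset.sum_congr rfl fun k _ => by ring
        rw [Finset.sum_congr rfl e1, Finset.sum_comm, Finset.sum_range_succ' _ (n + 1)]
        have e2 : (g ^ 0) l = 0 := by
          obtain ⟨x, l', rfl⟩ := List.exists_cons_of_ne_nil (l := l) (by rintro rfl; simp at hl)
          rw [pow_zero, NCS.one_cons]
        rw [e2, mul_zero, add_zero]
        refine Finset.sum_congr rfl fun k _ => ?_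
        rw [pow_succ', NCS.mul_eq_sum, hl, Finset.sum_range_succ' _ (n + 1)]
        simp [hg, Finset.mul_sum]
  exact key _ W l rfl

theorem NCS.pow_reverse (g h : NCS Φ ℂ) (hgh : ∀ l, h l = g l.reverse) (k : ℕ) (l : List Φ) :
    (h ^ k) l = (g ^ k) l.reverse := by
  induction k generalizing l with
  | zero =>
    rcases l with _ | ⟨x, l⟩
    · simp
    · obtain ⟨y, l', hl⟩ := List.exists_cons_of_ne_nil (l := (x :: l).reverse) (by simp)
      rw [hl, pow_zero, pow_zero, NCS.one_cons, NCS.one_cons]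
  | succ k ih =>
    rw [pow_succ', pow_succ, NCS.mul_eq_sum, NCS.mul_eq_sum, ← Finset.sum_range_reflect,
      List.length_reverse]
    refine Finset.sum_congr rfl fun i hi => ?_
    rw [Finset.mem_range] at hi
    rw [hgh, ih, List.take_reverse, List.drop_reverse, mul_comm]
    congr 4

/-! ### `L` as a logarithm -/

/-- `M` as a function of a list. -/
def Mw (l : List ℂ) : ℂ := M l.length l.get

theorem M_eq_Mw {n : ℕ} (z : Fin n → ℂ) : M n z = Mw (List.ofFn z) := by
  have key : ∀ (m : ℕ) (z' : Fin m → ℂ) (h : m = n), (∀ i, z' i = z (Fin.cast h i)) →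
      M n z = M m z' := by
    rintro m z' rfl h
    congr 1
    funext i
    exact (h i).symm
  refine key _ _ (by simp) fun i => ?_
  simp only [List.get_eq_getElem, List.getElem_ofFn]
  rfl

open Classical in
/-- The series `1 + ∑ M(w) w` over the words `w` with sum in `ℝ_{>0} ζ`. -/
def stokesSeries (z : Φ → ℂ) (ζ : ℂ) : NCS Φ ℂ :=
  ⟨fun w => if w = [] then 1 else
    if ∃ ρ : ℝ, 0 < ρ ∧ (w.map z).sum = ρ * ζ then Mw (w.map z) else 0⟩

theorem stokesSeries_nil (z : Φ → ℂ) (ζ : ℂ) : stokesSeries z ζ [] = 1 := by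
  simp [stokesSeries]

theorem splitWrtComposition_ofFn {α : Type*} {n : ℕ} (a : Fin n → α) (c : Composition n) :
    (List.ofFn a).splitWrtComposition c =
      List.ofFn fun j : Fin c.length => List.ofFn (a ∘ c.embedding j) := by
  refine List.ext_getElem (by simp) fun j h1 h2 => ?_
  rw [List.getElem_splitWrtComposition, List.getElem_ofFn]
  have hj : j < c.length := by simpa using h2
  have hs : c.sizeUpTo (j + 1) ≤ n := c.sizeUpTo_le _
  have hs2 := c.sizeUpTo_succ hj
  have hb : c.blocksFun ⟨j, hj⟩ = c.blocks[j] := rfl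
  refine List.ext_getElem ?_ fun i h3 h4 => ?_
  · simp only [List.length_drop, List.length_take, List.length_ofFn]
    omega
  · simp only [List.getElem_drop, List.getElem_take, List.getElem_ofFn, Function.comp_apply]
    rfl

-- The condition on the blocks in the definition of `L` can be moved into the factors, because a
-- single bad block makes the product vanish. It refers to positive multiples of the total sum,
-- which are the same as positive multiples of `ζ`.
open Classical in
theorem L_eq_log {n : ℕ} (z : Φ → ℂ) (a : Fin n → Φ) {ζ : ℂ} {ρ : ℝ} (hρ : 0 < ρ)
    (hs : ∑ i, z (a i) = ρ * ζ) :
    L n (fun i => z (a i)) = NCS.log (stokesSeries z ζ) (List.ofFn a) := by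
  have h := sum_composition_eq (sub_one_nil (stokesSeries_nil z ζ)) logCoeff (List.ofFn a)
  rw [show NCS.log (stokesSeries z ζ) (List.ofFn a) = _ from h.symm, List.length_ofFn,
    ← sum_composition n fun bs => logCoeff bs.length *
    (((List.ofFn a).splitWrtCompositionAux bs).map (stokesSeries z ζ - 1).coeff).prod, L]
  refine Finset.sum_congr rfl fun c _ => ?_
  have h2 := splitWrtComposition_ofFn a c
  rw [List.splitWrtComposition] at h2
  rw [h2, List.map_ofFn, List.prod_ofFn, Composition.blocks_length]
  have hcond : ∀ x : ℂ, (∃ ρ' : ℝ, 0 < ρ' ∧ x = ρ' * ∑ i, z (a i)) ↔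
      ∃ ρ' : ℝ, 0 < ρ' ∧ x = ρ' * ζ := by
    intro x
    rw [hs]
    constructor
    · rintro ⟨r, hr, h⟩
      exact ⟨r * ρ, by positivity, by rw [h]; push_cast; ring⟩
    · rintro ⟨r, hr, h⟩
      refine ⟨r / ρ, by positivity, ?_⟩
      have : (ρ : ℂ) ≠ 0 := by exact_mod_cast hρ.ne'
      rw [h]
      push_cast
      field_simp
  have hterm : ∀ j : Fin c.length,
      ((stokesSeries z ζ - 1).coeff ∘ fun j => List.ofFn (a ∘ c.embedding j)) j =
      if ∃ ρ' : ℝ, 0 < ρ' ∧ ∑ i, z (a (c.embedding j i)) = ρ' * ∑ i, z (a i) then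
        M (c.blocksFun j) ((fun i => z (a i)) ∘ c.embedding j) else 0 := by
    intro j
    have hne : List.ofFn (a ∘ c.embedding j) ≠ [] := by
      have := c.one_le_blocksFun j
      intro h
      have := congrArg List.length h
      simp at this
      omega
    rw [Function.comp_apply, NCS.sub_apply]
    have h1 : (1 : NCS Φ ℂ) (List.ofFn (a ∘ c.embedding j)) = 0 := by
      obtain ⟨x, l, h⟩ := List.exists_cons_of_ne_nil hne
      rw [h, NCS.one_cons]
    rw [h1, sub_zero, M_eq_Mw]
    simp only [stokesSeries, hne, if_false, List.map_ofFn, List.sum_ofFn, hcond]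
    rfl
  simp only [hterm]
  by_cases hall : ∀ j : Fin c.length, ∃ ρ' : ℝ, 0 < ρ' ∧
      ∑ i, z (a (c.embedding j i)) = ρ' * ∑ i, z (a i)
  · rw [if_pos hall]
    rw [Finset.prod_congr rfl fun j _ => if_pos (hall j)]
    rfl
  · rw [if_neg hall]
    push Not at hall
    obtain ⟨j, hj⟩ := hall
    rw [Finset.prod_eq_zero (Finset.mem_univ j), mul_zero]
    rw [if_neg]
    push Not
    exact hj

/-- The series `stokesSeries`, read from the right to the left. -/
def stokesSeriesRev (z : Φ → ℂ) (ζ : ℂ) : NCS Φ ℂ := ⟨fun l => stokesSeries z ζ l.reverse⟩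

theorem stokesSeriesRev_nil (z : Φ → ℂ) (ζ : ℂ) : stokesSeriesRev z ζ [] = 1 :=
  stokesSeries_nil z ζ

theorem log_stokesSeriesRev (z : Φ → ℂ) (ζ : ℂ) (l : List Φ) :
    NCS.log (stokesSeriesRev z ζ) l = NCS.log (stokesSeries z ζ) l.reverse := by
  simp only [NCS.log, List.length_reverse]
  refine Finset.sum_congr rfl fun j _ => ?_
  rw [NCS.pow_reverse (stokesSeries z ζ - 1)]
  intro l
  rw [NCS.sub_apply, NCS.sub_apply]
  congr 1
  rcases l with _ | ⟨x, l⟩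
  · simp
  · obtain ⟨y, l', hl⟩ := List.exists_cons_of_ne_nil (l := (x :: l).reverse) (by simp)
    rw [hl, NCS.one_cons, NCS.one_cons]

end Compositions

/-! ### Multilogarithms on a star-shaped domain -/

section Multilog

/-- The point `1 + i e μ`; the rays in the sector are spanned by such points. -/
def slope (e μ : ℝ) : ℂ := 1 + e * μ * Complex.I

@[simp] theorem slope_re (e μ : ℝ) : (slope e μ).re = 1 := by simp [slope]
@[simp] theorem slope_im (e μ : ℝ) : (slope e μ).im = e * μ := by simp [slope]
@[simp] theorem slope_zero (e : ℝ) : slope e 0 = 1 := by simp [slope]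

theorem slope_ne_zero (e μ : ℝ) : slope e μ ≠ 0 := fun h => by
  simpa using congrArg Complex.re h

/-- Apart from `0` and positive real numbers, the points of the finite set `E` lie outside the
closed sector `|Im| ≤ μ₀ Re`. The sign `e` is that of the half of the sector to be used. -/
structure IsSector (E : Finset ℂ) (μ₀ e : ℝ) : Prop where
  pos : 0 < μ₀
  sign : e = 1 ∨ e = -1
  out : ∀ s ∈ E, s ≠ 0 → s.im = 0 ∧ 0 < s.re ∨ μ₀ * s.re < |s.im|

/-- The points that can be joined to a base point in the half sector by a segment that avoids the
nonzero points of `E`. -/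
def dom (E : Finset ℂ) (μ₀ e : ℝ) : Set ℂ :=
  {p | ∀ s ∈ E, s ≠ 0 → s ∉ segment ℝ (slope e (μ₀ / 2)) p}

variable {E : Finset ℂ} {μ₀ e : ℝ}

/-- The complement for a single `s` is the image of a closed subset of `[0,1] × ℂ` under the
projection along the compact factor, hence closed. -/
theorem isOpen_dom : IsOpen (dom E μ₀ e) := by
  have h : dom E μ₀ e = ⋂ s ∈ E, {p | s ≠ 0 → s ∉ segment ℝ (slope e (μ₀ / 2)) p} := by
    ext p; simp [dom]
  rw [h]
  refine isOpen_biInter_finset fun s _ => ?_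
  by_cases hs : s = 0
  · simp [hs]
  · simp only [ne_eq, hs, not_false_eq_true, forall_const]
    rw [← isClosed_compl_iff]
    have hcl : IsClosed {q : unitInterval × ℂ |
        slope e (μ₀ / 2) + ((q.1 : ℝ) : ℂ) * (q.2 - slope e (μ₀ / 2)) = s} :=
      isClosed_eq (by fun_prop) continuous_const
    have := isClosedMap_snd_of_compactSpace _ hcl
    convert this using 1
    ext p
    simp only [Set.mem_compl_iff, Set.mem_ofPred_eq, not_not, Set.mem_image, Prod.exists,
      exists_eq_right, segment_eq_image', Subtype.exists, exists_prop]
    constructor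
    · rintro ⟨t, ht, h⟩
      exact ⟨t, ht, by simpa using h⟩
    · rintro ⟨t, ht, h⟩
      exact ⟨t, ht, by simpa using h⟩

theorem segment_subset_dom {p : ℂ} (hp : p ∈ dom E μ₀ e) :
    segment ℝ (slope e (μ₀ / 2)) p ⊆ dom E μ₀ e := by
  intro q hq s hs hs0 hsq
  exact hp s hs hs0 ((convex_segment _ _).segment_subset (left_mem_segment ℝ _ _) hq hsq)

theorem notMem_dom {s : ℂ} (hs : s ∈ E) (h0 : s ≠ 0) : s ∉ dom E μ₀ e := fun h =>
  h s hs h0 (right_mem_segment ℝ _ _)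

/-- All points of the segment from the base point stay in the half sector, so the points of `E`
outside the closed sector are avoided. A real point on the segment can only be its endpoint, since
the base point is off the axis. -/
theorem IsSector.mul_slope_mem (h : IsSector E μ₀ e) {x μ : ℝ} (hx : 0 ≤ x) (hμ : 0 ≤ μ)
    (hμ' : μ < μ₀) (hE : x = 0 ∨ 0 < μ ∨ (x : ℂ) ∉ E) : (x : ℂ) * slope e μ ∈ dom E μ₀ e := by
  intro s hs hs0 hseg
  obtain ⟨a, b, ha, hb, hab, rfl⟩ := hseg
  have hpos := h.pos
  have hre : (a • slope e (μ₀ / 2) + b • ((x : ℂ) * slope e μ)).re = a + b * x := by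
    simp
  have him : (a • slope e (μ₀ / 2) + b • ((x : ℂ) * slope e μ)).im =
      e * (a * (μ₀ / 2) + b * (x * μ)) := by
    simp; ring
  have habs : |(a • slope e (μ₀ / 2) + b • ((x : ℂ) * slope e μ)).im| =
      a * (μ₀ / 2) + b * (x * μ) := by
    have : 0 ≤ a * (μ₀ / 2) + b * (x * μ) := by positivity
    rw [him]
    rcases h.sign with rfl | rfl
    · rw [one_mul, abs_of_nonneg this]
    · rw [neg_one_mul, abs_neg, abs_of_nonneg this]
  rcases h.out _ hs hs0 with ⟨h1, _⟩ | h1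
  · rw [h1, abs_zero] at habs
    have ha0 : a = 0 := by
      by_contra hne
      have : 0 < a := lt_of_le_of_ne ha (Ne.symm hne)
      have : 0 < a * (μ₀ / 2) + b * (x * μ) := by positivity
      linarith
    have hb1 : b = 1 := by linarith
    subst ha0 hb1
    have hxμ : x * μ = 0 := by linarith
    rcases hE with h2 | h2 | h2
    · simp [h2] at hs0
    · have : x = 0 := by
        rcases mul_eq_zero.1 hxμ with h | h
        · exact h
        · exact absurd h h2.ne'
      simp [this] at hs0
    · rcases mul_eq_zero.1 hxμ with h | h
      · simp [h] at hs0
      · subst h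
        simp at hs
        exact h2 hs
  · rw [habs, hre] at h1
    have h2 : b * (x * μ) ≤ b * (x * μ₀) := by gcongr
    nlinarith [mul_nonneg ha hpos.le]

theorem IsSector.zero_mem (h : IsSector E μ₀ e) : (0 : ℂ) ∈ dom E μ₀ e := by
  simpa using h.mul_slope_mem (x := 0) (μ := 0) le_rfl le_rfl h.pos (Or.inl rfl)

theorem IsSector.ofReal_mem (h : IsSector E μ₀ e) {x : ℝ} (hx : 0 ≤ x) (hE : (x : ℂ) ∉ E) :
    (x : ℂ) ∈ dom E μ₀ e := by
  simpa using h.mul_slope_mem (x := x) (μ := 0) hx le_rfl h.pos (Or.inr (Or.inr hE))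

/-- The integral along the segment from the base point. A segment has a convex open neighbourhood
inside the domain; there a primitive `g` exists and the integral equals `g q - g P`. -/
theorem exists_primitive {f : ℂ → ℂ} (hf : DifferentiableOn ℂ f (dom E μ₀ e)) :
    ∃ G : ℂ → ℂ, ∀ p ∈ dom E μ₀ e, HasDerivAt G (f p) p := by
  set P := slope e (μ₀ / 2) with hP
  refine ⟨fun p => ∫ t in (0 : ℝ)..1, f (P + t * (p - P)) * (p - P), fun p hp => ?_⟩
  have hcomp : IsCompact (segment ℝ P p) := by
    rw [segment_eq_image']
    exact isCompact_Icc.image (by fun_prop)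
  obtain ⟨δ, hδ, hsub⟩ := hcomp.exists_thickening_subset_open isOpen_dom (segment_subset_dom hp)
  set U := Metric.thickening δ (segment ℝ P p) with hU
  have hUc : Convex ℝ U := (convex_segment _ _).thickening δ
  have hUo : IsOpen U := Metric.isOpen_thickening
  have hseg : segment ℝ P p ⊆ U := Metric.self_subset_thickening hδ _
  obtain ⟨g, hg⟩ := hUc.exists_forall_hasDerivWithinAt (hf.mono hsub)
  have hg' : ∀ q ∈ U, HasDerivAt g (f q) q := fun q hq => (hg q hq).hasDerivAt (hUo.mem_nhds hq)
  have hPU : P ∈ U := hseg (left_mem_segment ℝ _ _)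
  have hpU : p ∈ U := hseg (right_mem_segment ℝ _ _)
  have key : ∀ q ∈ U, ∫ t in (0 : ℝ)..1, f (P + t * (q - P)) * (q - P) = g q - g P := by
    intro q hq
    have hmem : ∀ t ∈ Set.uIcc (0 : ℝ) 1, P + t * (q - P) ∈ U := by
      intro t ht
      rw [Set.uIcc_of_le zero_le_one] at ht
      refine hUc.segment_subset hPU hq ?_
      rw [segment_eq_image']
      exact ⟨t, ht, by simp⟩
    have hd : ∀ t ∈ Set.uIcc (0 : ℝ) 1, HasDerivAt (fun t : ℝ => g (P + t * (q - P)))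
        (f (P + t * (q - P)) * (q - P)) t := by
      intro t ht
      have h1 : HasDerivAt (fun t : ℝ => P + t * (q - P)) (q - P) t := by
        simpa using ((Complex.ofRealCLM.hasDerivAt (x := t)).mul_const (q - P)).const_add P
      exact (hg' _ (hmem t ht)).comp_of_eq t h1 rfl
    rw [intervalIntegral.integral_eq_sub_of_hasDerivAt hd]
    · simp
    · apply ContinuousOn.intervalIntegrable
      refine ContinuousOn.mul ?_ continuousOn_const
      exact (hf.continuousOn.mono hsub).comp (by fun_prop) hmem
  have : (fun q => ∫ t in (0 : ℝ)..1, f (P + t * (q - P)) * (q - P)) =ᶠ[𝓝 p]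
      fun q => g q - g P := by
    filter_upwards [hUo.mem_nhds hpU] with q hq using key q hq
  exact ((hg' p hpU).sub_const (g P)).congr_of_eventuallyEq this

variable {Φ : Type*}

/-- The sum of the values of the letters of a word. -/
def wsum (z : Φ → ℂ) (l : List Φ) : ℂ := (l.map z).sum

@[simp] theorem wsum_nil (z : Φ → ℂ) : wsum z [] = 0 := by simp [wsum]
@[simp] theorem wsum_cons (z : Φ → ℂ) (b : Φ) (l : List Φ) : wsum z (b :: l) = z b + wsum z l := by
  simp [wsum]
@[simp] theorem wsum_append (z : Φ → ℂ) (u v : List Φ) :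
    wsum z (u ++ v) = wsum z u + wsum z v := by
  simp [wsum]

/-- The sums of all nonempty final parts of the word lie in `E`. -/
def Adm (E : Finset ℂ) (z : Φ → ℂ) : List Φ → Prop
  | [] => True
  | b :: l => wsum z (b :: l) ∈ E ∧ Adm E z l

/-- The multilogarithms: `F_[] = 1`, `(s - p) F_{b::l}'(p) = F_l(p)` with `s` the sum of `b :: l`,
and `F_{b::l}(0) = 0`. -/
def mlog (E : Finset ℂ) (μ₀ e : ℝ) (z : Φ → ℂ) : List Φ → ℂ → ℂ
  | [] => fun _ => 1
  | b :: l => Classical.epsilon fun G => G 0 = 0 ∧ ∀ p ∈ dom E μ₀ e,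
      ∃ d, HasDerivAt G d p ∧ (wsum z (b :: l) - p) * d = mlog E μ₀ e z l p

variable {z : Φ → ℂ}

/-- The equation is kept in the form without division because the sum of a word may be zero while
the origin belongs to the domain. -/
theorem mlog_spec (h : IsSector E μ₀ e) (hz : ∀ b, z b ≠ 0) {l : List Φ} (hl : Adm E z l) :
    DifferentiableOn ℂ (mlog E μ₀ e z l) (dom E μ₀ e) ∧ ∀ b l', l = b :: l' →
      mlog E μ₀ e z l 0 = 0 ∧ ∀ p ∈ dom E μ₀ e,
      ∃ d, HasDerivAt (mlog E μ₀ e z l) d p ∧ (wsum z l - p) * d = mlog E μ₀ e z l' p := by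
  induction l with
  | nil => exact ⟨differentiableOn_const _, by simp⟩
  | cons b l ih =>
    obtain ⟨ihd, ih0⟩ := ih hl.2
    have hex : ∃ G : ℂ → ℂ, G 0 = 0 ∧ ∀ p ∈ dom E μ₀ e,
        ∃ d, HasDerivAt G d p ∧ (wsum z (b :: l) - p) * d = mlog E μ₀ e z l p := by
      -- A word with sum zero has at least two letters, so the multilogarithm of its tail vanishes
      -- at the origin and the quotient by `p` has a removable singularity there.
      by_cases hs : wsum z (b :: l) = 0
      · obtain ⟨c, l', rfl⟩ : ∃ c l', l = c :: l' := by
          refine List.exists_cons_of_ne_nil ?_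
          rintro rfl
          exact hz b (by simpa using hs)
        have h0 := (ih0 c l' rfl).1
        obtain ⟨G, hG⟩ := exists_primitive
          ((Complex.differentiableOn_dslope (isOpen_dom.mem_nhds h.zero_mem)).2 ihd).neg
        refine ⟨fun p => G p - G 0, by simp, fun p hp => ⟨_, (hG p hp).sub_const _, ?_⟩⟩
        have := sub_smul_dslope (mlog E μ₀ e z (c :: l')) 0 p
        rw [h0, sub_zero, sub_zero, smul_eq_mul] at this
        rw [hs, ← this]
        simp
      · have hne : ∀ p ∈ dom E μ₀ e, wsum z (b :: l) - p ≠ 0 := fun p hp h =>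
          notMem_dom hl.1 hs (sub_eq_zero.1 h ▸ hp)
        obtain ⟨G, hG⟩ := exists_primitive (f := fun p => mlog E μ₀ e z l p / (wsum z (b :: l) - p))
          (ihd.div (by fun_prop) hne)
        refine ⟨fun p => G p - G 0, by simp, fun p hp => ⟨_, (hG p hp).sub_const _, ?_⟩⟩
        exact mul_div_cancel₀ _ (hne p hp)
    have hspec := Classical.epsilon_spec hex
    have e1 : mlog E μ₀ e z (b :: l) = Classical.epsilon fun G : ℂ → ℂ => G 0 = 0 ∧
        ∀ p ∈ dom E μ₀ e, ∃ d, HasDerivAt G d p ∧ (wsum z (b :: l) - p) * d = mlog E μ₀ e z l p := by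
      rw [mlog]
    rw [← e1] at hspec
    refine ⟨fun p hp => ?_, ?_⟩
    · obtain ⟨d, hd, -⟩ := hspec.2 p hp
      exact hd.differentiableAt.differentiableWithinAt
    · rintro b' l' ⟨⟩
      exact hspec

/-- The primitive of `mlog` that vanishes at `0`. -/
def mlogInt (E : Finset ℂ) (μ₀ e : ℝ) (z : Φ → ℂ) (l : List Φ) : ℂ → ℂ :=
  Classical.epsilon fun G => G 0 = 0 ∧ ∀ p ∈ dom E μ₀ e, HasDerivAt G (mlog E μ₀ e z l p) p

theorem mlogInt_spec (h : IsSector E μ₀ e) (hz : ∀ b, z b ≠ 0) {l : List Φ} (hl : Adm E z l) :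
    mlogInt E μ₀ e z l 0 = 0 ∧
      ∀ p ∈ dom E μ₀ e, HasDerivAt (mlogInt E μ₀ e z l) (mlog E μ₀ e z l p) p := by
  obtain ⟨G, hG⟩ := exists_primitive (mlog_spec h hz hl).1
  exact Classical.epsilon_spec (p := fun G : ℂ → ℂ => G 0 = 0 ∧
    ∀ p ∈ dom E μ₀ e, HasDerivAt G (mlog E μ₀ e z l p) p)
    ⟨fun p => G p - G 0, by simp, fun p hp => (hG p hp).sub_const _⟩

end Multilog

/-! ### Growth of multilogarithms along rays -/

section Bounds

variable {E : Finset ℂ} {μ₀ e : ℝ} {Φ : Type*} {z : Φ → ℂ}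

theorem isPreconnected_dom (h : IsSector E μ₀ e) : IsPreconnected (dom E μ₀ e) := by
  have : StarConvex ℝ (slope e (μ₀ / 2)) (dom E μ₀ e) := by
    rw [starConvex_iff_segment_subset]
    exact fun p hp => segment_subset_dom hp
  exact (this.isPathConnected (segment_subset_dom h.zero_mem (left_mem_segment ℝ _ _))).isConnected.isPreconnected

/-- Both sides have the same derivative and vanish at the origin. The formula recovers
multilogarithms from their primitives, which, unlike the multilogarithms, extend continuously to all
points of the positive real axis. -/
theorem mlog_mul_add_mlogInt (h : IsSector E μ₀ e) (hz : ∀ b, z b ≠ 0) {b : Φ} {l : List Φ}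
    (hl : Adm E z (b :: l)) {p : ℂ} (hp : p ∈ dom E μ₀ e) :
    (wsum z (b :: l) - p) * mlog E μ₀ e z (b :: l) p + mlogInt E μ₀ e z (b :: l) p =
      mlogInt E μ₀ e z l p := by
  set g : ℂ → ℂ := fun p => (wsum z (b :: l) - p) * mlog E μ₀ e z (b :: l) p +
    mlogInt E μ₀ e z (b :: l) p - mlogInt E μ₀ e z l p with hg
  have hd : ∀ p ∈ dom E μ₀ e, HasDerivAt g 0 p := by
    intro p hp
    obtain ⟨d, hd, hd2⟩ := ((mlog_spec h hz hl).2 b l rfl).2 p hp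
    have h1 := (((hasDerivAt_id p).const_sub (wsum z (b :: l))).mul hd).add
      ((mlogInt_spec h hz hl).2 p hp) |>.sub ((mlogInt_spec h hz hl.2).2 p hp)
    refine h1.congr_deriv ?_
    simp only [id_eq]
    rw [hd2]
    ring
  have h0 : g p = g 0 := isOpen_dom.is_const_of_deriv_eq_zero (isPreconnected_dom h)
    (fun p hp => (hd p hp).differentiableAt.differentiableWithinAt)
    (fun p hp => (hd p hp).deriv) hp h.zero_mem
  have h2 : g 0 = 0 := by
    simp only [hg]
    rw [((mlog_spec h hz hl).2 b l rfl).1, (mlogInt_spec h hz hl).1, (mlogInt_spec h hz hl.2).1]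
    simp
  rw [h2] at h0
  exact sub_eq_zero.1 h0

theorem norm_slope_ge (e μ : ℝ) : 1 ≤ ‖slope e μ‖ := by
  simpa using Complex.abs_re_le_norm (slope e μ)

theorem IsSector.abs_sign (h : IsSector E μ₀ e) : |e| = 1 := by
  rcases h.sign with rfl | rfl <;> simp

/-- A real point of `E` is seen from the ray under the angle of the ray, which accounts for the
factor `μ`. A point outside the sector has a positive distance from it. For large `x` the distance
is of the order of `x`. -/
theorem IsSector.norm_sub_ge (h : IsSector E μ₀ e) {μ₁ : ℝ} (h1 : 0 < μ₁) (h1' : μ₁ < μ₀) :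
    ∃ c > 0, ∀ s ∈ E, s ≠ 0 → ∀ μ, 0 < μ → μ ≤ μ₁ → ∀ x : ℝ, 0 ≤ x →
      c * μ * (1 + x) ≤ ‖s - x * slope e μ‖ := by
  have key : ∀ s ∈ E, s ≠ 0 → ∃ c > 0, ∀ μ, 0 < μ → μ ≤ μ₁ → ∀ x : ℝ, 0 ≤ x →
      c * μ * (1 + x) ≤ ‖s - x * slope e μ‖ := by
    intro s hs hs0
    rcases h.out s hs hs0 with ⟨him, hre⟩ | hout
    · set k := (s.re / 2) / (1 + s.re / 2) with hk
      have hkpos : 0 < k := by positivity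
      refine ⟨min k (k / μ₁), by positivity, fun μ hμ hμ1 x hx => ?_⟩
      rcases le_or_gt (s.re / 2) x with hxs | hxs
      · have h2 : x * μ ≤ ‖s - x * slope e μ‖ := by
          have h3 := Complex.abs_im_le_norm (s - x * slope e μ)
          have h4 : |(s - x * slope e μ).im| = x * μ := by
            simp only [Complex.sub_im, him, Complex.mul_im, Complex.ofReal_re, slope_im,
              Complex.ofReal_im, slope_re, mul_one, add_zero, zero_sub, abs_neg, abs_mul,
              h.abs_sign, one_mul, abs_of_nonneg hx, abs_of_pos hμ]
          linarith
        have h5 : k * (1 + x) ≤ x := by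
          rw [hk, div_mul_eq_mul_div, div_le_iff₀ (by positivity)]
          nlinarith
        calc min k (k / μ₁) * μ * (1 + x) ≤ k * μ * (1 + x) := by
              gcongr
              exact min_le_left _ _
          _ = k * (1 + x) * μ := by ring
          _ ≤ x * μ := by gcongr
          _ ≤ _ := h2
      · have h2 : s.re / 2 ≤ ‖s - x * slope e μ‖ := by
          have h3 := Complex.re_le_norm (s - x * slope e μ)
          have h4 : (s - x * slope e μ).re = s.re - x := by simp
          linarith
        calc min k (k / μ₁) * μ * (1 + x) ≤ k / μ₁ * μ * (1 + s.re / 2) := by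
              gcongr
              exact min_le_right _ _
          _ ≤ k / μ₁ * μ₁ * (1 + s.re / 2) := by gcongr
          _ = s.re / 2 := by rw [hk]; field_simp
          _ ≤ _ := h2
    · set d := (|s.im| - μ₀ * s.re) / (1 + μ₀) with hd
      have hμ₀ := h.pos
      have hdpos : 0 < d := by
        have : 0 < |s.im| - μ₀ * s.re := by linarith
        positivity
      set c := min (d / (2 * ‖s‖ + 2)) (1 / 2) with hc
      have hcpos : 0 < c := by positivity
      refine ⟨c / μ₁, by positivity, fun μ hμ hμ1 x hx => ?_⟩
      have e1 : c / μ₁ * μ * (1 + x) ≤ c * (1 + x) := by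
        have : c / μ₁ * μ ≤ c := by
          rw [div_mul_eq_mul_div, div_le_iff₀ h1]
          gcongr
        gcongr
      refine e1.trans ?_
      rcases le_or_gt x (2 * ‖s‖ + 1) with hxs | hxs
      · have h2 : d ≤ ‖s - x * slope e μ‖ := by
          rw [hd, div_le_iff₀ (by positivity)]
          have h3 := Complex.abs_im_le_norm (s - x * slope e μ)
          have h4 := (neg_le_abs _).trans (Complex.abs_re_le_norm (s - x * slope e μ))
          have h5 : |s.im| - x * μ ≤ |(s - x * slope e μ).im| := by
            have h6 : (s - x * slope e μ).im = s.im - e * (x * μ) := by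
              simp; ring
            have h7 := abs_sub_abs_le_abs_sub s.im (e * (x * μ))
            have h10 : |e * (x * μ)| = x * μ := by
              rw [abs_mul, h.abs_sign, one_mul, abs_of_nonneg (mul_nonneg hx hμ.le)]
            rw [h10] at h7
            rw [h6]
            exact h7
          have h8 : -(s - x * slope e μ).re = x - s.re := by simp
          have h9 : x * μ ≤ μ₀ * x := by nlinarith
          nlinarith
        calc c * (1 + x) ≤ d / (2 * ‖s‖ + 2) * (2 * ‖s‖ + 2) := by
              refine mul_le_mul (min_le_left _ _) (by linarith) (by positivity) (by positivity)
          _ = d := by field_simp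
          _ ≤ _ := h2
      · have h2 : x - ‖s‖ ≤ ‖s - x * slope e μ‖ := by
          have h3 := norm_sub_norm_le (x * slope e μ) s
          rw [norm_sub_rev, norm_mul, Complex.norm_real, Real.norm_of_nonneg hx] at h3
          nlinarith [norm_slope_ge e μ]
        have : c * (1 + x) ≤ 1 / 2 * (1 + x) := by
          gcongr
          exact min_le_right _ _
        linarith
  have ev : ∀ᶠ c in 𝓝[>] (0 : ℝ), ∀ s ∈ E, s ≠ 0 → ∀ μ, 0 < μ → μ ≤ μ₁ → ∀ x : ℝ, 0 ≤ x →
      c * μ * (1 + x) ≤ ‖s - x * slope e μ‖ := by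
    rw [Finset.eventually_all]
    intro s hs
    by_cases hs0 : s = 0
    · simp [hs0]
    · obtain ⟨c, hc, hcs⟩ := key s hs hs0
      filter_upwards [Ioo_mem_nhdsGT hc] with c' hc' _ μ hμ hμ1 x hx
      refine le_trans ?_ (hcs μ hμ hμ1 x hx)
      gcongr
      exact hc'.2.le
  obtain ⟨c, hc, hc'⟩ := (ev.and self_mem_nhdsWithin).exists
  exact ⟨c, hc', hc⟩

theorem hasDerivAt_ray {g : ℂ → ℂ} {d ω : ℂ} {x : ℝ} (h : HasDerivAt g d (x * ω)) :
    HasDerivAt (fun x : ℝ => g (x * ω)) (d * ω) x := by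
  have h1 : HasDerivAt (fun x : ℝ => (x : ℂ) * ω) ω x := by
    simpa using (Complex.ofRealCLM.hasDerivAt (x := x)).mul_const ω
  exact HasDerivAt.comp_of_eq x h h1 rfl

open Classical in
/-- The growth of multilogarithms along a ray: the constant in front decreases exponentially in
the length of the word. -/
theorem exists_mlog_bound (h : IsSector E μ₀ e) (hz : ∀ b, z b ≠ 0) {μ : ℝ} (hμ : 0 < μ)
    (hμ' : μ < μ₀) {b : ℝ} (hb : 0 < b) (hb1 : b ≤ 1) :
    ∃ κ : ℕ, 0 < κ ∧ ∀ l, Adm E z l → l ≠ [] → ∀ x : ℝ, 0 ≤ x →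
      ‖mlog E μ₀ e z l (x * slope e μ)‖ ≤
        b ^ (l.length + if wsum z l = 0 then 0 else 1) * ((1 + x) ^ κ - 1) := by
  obtain ⟨c, hc, hcE⟩ := h.norm_sub_ge hμ hμ'
  set C := ‖slope e μ‖ / (c * μ) with hC
  have hCpos : 0 < C := by
    have := norm_slope_ge e μ
    positivity
  -- Integration of `(1 + x) ^ (κ - 1)` gains `1 / κ`; with this `κ` a letter that leads to a
  -- nonzero sum gains `b ^ 2`. A letter that leads to sum zero gains nothing, but then the sum
  -- before it was nonzero, and the spare factor `b` kept in the exponent pays for it.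
  obtain ⟨κ, hκ⟩ := exists_nat_gt (C / b ^ 2)
  have hκpos : 0 < (κ : ℝ) := lt_trans (by positivity) hκ
  have hκ2 : C ≤ b ^ 2 * κ := by
    rw [div_lt_iff₀ (by positivity)] at hκ
    linarith
  have hκn : 0 < κ := by exact_mod_cast hκpos
  refine ⟨κ, hκn, ?_⟩
  -- the bound follows from a bound on the derivative
  have grow : ∀ (l : List Φ) (B : ℝ), 0 ≤ B → Adm E z l → l ≠ [] →
      (∀ x : ℝ, 0 < x → ∀ d, HasDerivAt (mlog E μ₀ e z l) d (x * slope e μ) →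
        ‖d * slope e μ‖ ≤ B * (κ * (1 + x) ^ (κ - 1))) →
      ∀ x : ℝ, 0 ≤ x → ‖mlog E μ₀ e z l (x * slope e μ)‖ ≤ B * ((1 + x) ^ κ - 1) := by
    intro l B hB hl hne hd x hx
    obtain ⟨a, l', rfl⟩ := List.exists_cons_of_ne_nil hne
    obtain ⟨h0, hder⟩ := (mlog_spec h hz hl).2 a l' rfl
    have hdom : ∀ x : ℝ, 0 ≤ x → (x : ℂ) * slope e μ ∈ dom E μ₀ e := fun x hx =>
      h.mul_slope_mem hx hμ.le hμ' (Or.inr (Or.inl hμ))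
    set g : ℝ → ℂ := fun x => mlog E μ₀ e z (a :: l') (x * slope e μ) with hg
    have hgd : ∀ y : ℝ, 0 ≤ y → ∃ d, HasDerivAt (mlog E μ₀ e z (a :: l')) d (y * slope e μ) ∧
        HasDerivAt g (d * slope e μ) y := fun y hy => by
      obtain ⟨d, hd, -⟩ := hder _ (hdom y hy)
      exact ⟨d, hd, hasDerivAt_ray hd⟩
    choose! d hd1 hd2 using hgd
    have hBd : ∀ y : ℝ, HasDerivAt (fun y : ℝ => B * ((1 + y) ^ κ - 1))
        (B * (κ * (1 + y) ^ (κ - 1))) y := by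
      intro y
      have := ((((hasDerivAt_id y).const_add 1).pow κ).sub_const 1).const_mul B
      simpa using this
    -- at the origin the bound on the derivative holds by continuity
    have hcont : ∀ y : ℝ, 0 ≤ y → ContinuousAt g y := fun y hy => (hd2 y hy).continuousAt
    rcases hx.eq_or_lt with rfl | hxpos
    · simp [h0]
    refine le_of_forall_pos_le_add fun ε hε => ?_
    have hev : ∀ᶠ y in 𝓝[>] (0 : ℝ), ‖g y‖ ≤ ε ∧ y < x := by
      have h1 : Filter.Tendsto g (𝓝[>] 0) (𝓝 (g 0)) := (hcont 0 le_rfl).tendsto.mono_left nhdsWithin_le_nhds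
      have h2 : g 0 = 0 := by simp [hg, h0]
      rw [h2] at h1
      have h3 := (h1.norm.eventually (gt_mem_nhds (by simpa using hε)))
      filter_upwards [h3, Ioo_mem_nhdsGT hxpos] with y hy hy2 using ⟨hy.le, hy2.2⟩
    obtain ⟨y, ⟨hy1, hy2⟩, hy0⟩ := (hev.and self_mem_nhdsWithin).exists
    have hy0 : 0 < y := hy0
    have := image_norm_le_of_norm_deriv_right_le_deriv_boundary (f := g)
      (f' := fun y => d y * slope e μ) (a := y) (b := x)
      (B := fun y => B * ((1 + y) ^ κ - 1) + ε) (B' := fun y => B * (κ * (1 + y) ^ (κ - 1)))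
      (fun w hw => (hcont w (hy0.le.trans hw.1)).continuousWithinAt)
      (fun w hw => (hd2 w (hy0.le.trans hw.1)).hasDerivWithinAt)
      (by
        have : 0 ≤ B * ((1 + y) ^ κ - 1) := by
          have : 1 ≤ (1 + y) ^ κ := one_le_pow₀ (by linarith)
          exact mul_nonneg hB (by linarith)
        linarith)
      (fun w => (hBd w).add_const ε)
      (fun w hw => hd w (hy0.trans_le hw.1) _ (hd1 w (hy0.le.trans hw.1)))
      ⟨hy2.le, le_rfl⟩
    exact this
  intro l
  induction l with
  | nil => simp
  | cons a l ih =>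
    intro hl _
    have hder := ((mlog_spec h hz hl).2 a l rfl).2
    have hdom : ∀ x : ℝ, 0 ≤ x → (x : ℂ) * slope e μ ∈ dom E μ₀ e := fun x hx =>
      h.mul_slope_mem hx hμ.le hμ' (Or.inr (Or.inl hμ))
    have hd' : ∀ x : ℝ, 0 < x → ∀ d, HasDerivAt (mlog E μ₀ e z (a :: l)) d (x * slope e μ) →
        (wsum z (a :: l) - x * slope e μ) * d = mlog E μ₀ e z l (x * slope e μ) := by
      intro x hx d hd
      obtain ⟨d', hd', h2⟩ := hder _ (hdom x hx.le)
      rw [hd.unique hd', h2]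
    refine grow (a :: l) _ (by positivity) hl (by simp) fun x hx d hd => ?_
    have hrel := hd' x hx d hd
    by_cases hs : wsum z (a :: l) = 0
    · have hne : l ≠ [] := by
        rintro rfl
        exact hz a (by simpa using hs)
      have hsl : wsum z l ≠ 0 := by
        intro h0
        rw [wsum_cons, h0, add_zero] at hs
        exact hz a hs
      have hb1 := ih hl.2 hne x hx.le
      rw [if_neg hsl] at hb1
      rw [if_pos hs, add_zero, List.length_cons]
      have hn : ‖d * slope e μ‖ * x = ‖mlog E μ₀ e z l (x * slope e μ)‖ := by
        rw [← hrel, hs, zero_sub, neg_mul, norm_neg, norm_mul, norm_mul, norm_mul,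
          Complex.norm_real, Real.norm_of_nonneg hx.le]
        ring
      have hmean : (1 + x) ^ κ - 1 ≤ κ * (1 + x) ^ (κ - 1) * x := by
        have : ∀ n : ℕ, (1 + x) ^ (n + 1) - 1 ≤ (n + 1) * (1 + x) ^ n * x := by
          intro n
          induction n with
          | zero => simp
          | succ n ihn =>
            have h1 : (1 : ℝ) ≤ (1 + x) ^ (n + 1) := one_le_pow₀ (by linarith)
            have h2 : (1 + x) ^ (n + 2) - 1 = (1 + x) * ((1 + x) ^ (n + 1) - 1) + x := by ring
            rw [h2]
            push_cast
            calc (1 + x) * ((1 + x) ^ (n + 1) - 1) + x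
                ≤ (1 + x) * ((n + 1) * (1 + x) ^ n * x) + (1 + x) ^ (n + 1) * x := by
                  gcongr
                  nlinarith
              _ = _ := by ring
        obtain ⟨n, rfl⟩ : ∃ n, κ = n + 1 := ⟨κ - 1, by omega⟩
        simpa using this n
      have h3 : ‖d * slope e μ‖ * x ≤ b ^ (l.length + 1) * (κ * (1 + x) ^ (κ - 1)) * x := by
        rw [hn]
        refine hb1.trans ?_
        rw [mul_assoc]
        gcongr
      exact le_of_mul_le_mul_right h3 hx
    · rw [if_neg hs, List.length_cons]
      have hlow := hcE _ hl.1 hs μ hμ le_rfl x hx.le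
      have hF : ‖mlog E μ₀ e z l (x * slope e μ)‖ ≤ b ^ l.length * (1 + x) ^ κ := by
        rcases l with _ | ⟨a', l'⟩
        · simp only [mlog, norm_one, List.length_nil, pow_zero, one_mul]
          exact one_le_pow₀ (by linarith)
        · have h1 := ih hl.2 (by simp) x hx.le
          have hX : 1 ≤ (1 + x) ^ κ := one_le_pow₀ (by linarith)
          split_ifs at h1 with h0
          · refine h1.trans ?_
            rw [add_zero]
            gcongr
            linarith
          · refine h1.trans ?_
            refine mul_le_mul ?_ (by linarith) (by linarith) (by positivity)
            exact pow_le_pow_of_le_one hb.le hb1 (by omega)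
      have hx1 : 0 < c * μ * (1 + x) := by positivity
      have h4 : ‖d‖ * (c * μ * (1 + x)) ≤ b ^ l.length * (1 + x) ^ κ := by
        calc ‖d‖ * (c * μ * (1 + x)) ≤ ‖d‖ * ‖wsum z (a :: l) - x * slope e μ‖ := by gcongr
          _ = ‖mlog E μ₀ e z l (x * slope e μ)‖ := by rw [← hrel, norm_mul, mul_comm]
          _ ≤ _ := hF
      obtain ⟨n, rfl⟩ : ∃ n, κ = n + 1 := ⟨κ - 1, by omega⟩
      have h5 : ‖d‖ * (c * μ) ≤ b ^ l.length * (1 + x) ^ n := by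
        refine le_of_mul_le_mul_right ?_ (show 0 < 1 + x by linarith)
        calc ‖d‖ * (c * μ) * (1 + x) = ‖d‖ * (c * μ * (1 + x)) := by ring
          _ ≤ _ := h4
          _ = _ := by ring
      have h6 : ‖d * slope e μ‖ ≤ b ^ l.length * (1 + x) ^ n * C := by
        rw [norm_mul, hC, mul_div_assoc', le_div_iff₀ (by positivity)]
        calc ‖d‖ * ‖slope e μ‖ * (c * μ) = ‖d‖ * (c * μ) * ‖slope e μ‖ := by ring
          _ ≤ _ := by gcongr
      refine h6.trans ?_
      calc b ^ l.length * (1 + x) ^ n * C ≤ b ^ l.length * (1 + x) ^ n * (b ^ 2 * (n + 1 : ℕ)) := by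
            gcongr
        _ = _ := by rw [Nat.add_sub_cancel]; ring

end Bounds

/-! ### Laplace transforms -/

section Laplace

open MeasureTheory

/-- The function is continuous and grows at most polynomially on `[0, ∞)`. -/
def PolyGrowth (g : ℝ → ℂ) : Prop :=
  ContinuousOn g (Set.Ici 0) ∧ ∃ (C : ℝ) (κ : ℕ), 0 ≤ C ∧ ∀ x : ℝ, 0 ≤ x → ‖g x‖ ≤ C * (1 + x) ^ κ

theorem exists_pow_le_exp (κ : ℕ) {a : ℝ} (ha : 0 < a) :
    ∃ C : ℝ, 0 < C ∧ ∀ x : ℝ, 0 ≤ x → (1 + x) ^ κ ≤ C * Real.exp (a * x) := by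
  refine ⟨κ.factorial / a ^ κ * Real.exp a, by positivity, fun x hx => ?_⟩
  have h := Real.pow_div_factorial_le_exp (x := a * (1 + x)) (by positivity) κ
  rw [div_le_iff₀ (by positivity), mul_pow] at h
  rw [div_mul_eq_mul_div, div_mul_eq_mul_div, le_div_iff₀ (by positivity)]
  rw [mul_add, mul_one, Real.exp_add] at h
  linarith

theorem PolyGrowth.const (c : ℂ) : PolyGrowth fun _ => c :=
  ⟨continuousOn_const, ‖c‖, 0, norm_nonneg _, fun x _ => by simp⟩

theorem PolyGrowth.ofReal : PolyGrowth fun x => (x : ℂ) :=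
  ⟨by fun_prop, 1, 1, zero_le_one, fun x hx => by
    rw [Complex.norm_real, Real.norm_of_nonneg hx]; linarith⟩

theorem PolyGrowth.mul {g h : ℝ → ℂ} (hg : PolyGrowth g) (hh : PolyGrowth h) :
    PolyGrowth fun x => g x * h x := by
  obtain ⟨hg, C, κ, hC, hgC⟩ := hg
  obtain ⟨hh, D, m, hD, hhD⟩ := hh
  refine ⟨hg.mul hh, C * D, κ + m, by positivity, fun x hx => ?_⟩
  rw [norm_mul]
  calc ‖g x‖ * ‖h x‖ ≤ (C * (1 + x) ^ κ) * (D * (1 + x) ^ m) :=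
        mul_le_mul (hgC x hx) (hhD x hx) (norm_nonneg _) (by positivity)
    _ = _ := by ring

theorem PolyGrowth.add {g h : ℝ → ℂ} (hg : PolyGrowth g) (hh : PolyGrowth h) :
    PolyGrowth fun x => g x + h x := by
  obtain ⟨hg, C, κ, hC, hgC⟩ := hg
  obtain ⟨hh, D, m, hD, hhD⟩ := hh
  refine ⟨hg.add hh, C + D, κ + m, by positivity, fun x hx => ?_⟩
  have h1 : (1 + x) ^ κ ≤ (1 + x) ^ (κ + m) := pow_le_pow_right₀ (by linarith) (by omega)
  have h2 : (1 + x) ^ m ≤ (1 + x) ^ (κ + m) := pow_le_pow_right₀ (by linarith) (by omega)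
  calc ‖g x + h x‖ ≤ C * (1 + x) ^ κ + D * (1 + x) ^ m :=
        (norm_add_le _ _).trans (add_le_add (hgC x hx) (hhD x hx))
    _ ≤ C * (1 + x) ^ (κ + m) + D * (1 + x) ^ (κ + m) := by gcongr
    _ = _ := by ring

theorem PolyGrowth.const_mul (c : ℂ) {g : ℝ → ℂ} (hg : PolyGrowth g) :
    PolyGrowth fun x => c * g x := (PolyGrowth.const c).mul hg

theorem PolyGrowth.sub {g h : ℝ → ℂ} (hg : PolyGrowth g) (hh : PolyGrowth h) :
    PolyGrowth fun x => g x - h x := by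
  simpa [sub_eq_add_neg] using hg.add (hh.const_mul (-1))

/-- The Laplace transform on `[0, ∞)`. -/
def lap (g : ℝ → ℂ) (σ : ℂ) : ℂ := ∫ x in Set.Ioi (0 : ℝ), Complex.exp (-(x * σ)) * g x

theorem norm_exp_neg_mul (x : ℝ) (σ : ℂ) :
    ‖Complex.exp (-(x * σ))‖ = Real.exp (-(x * σ.re)) := by
  simp [Complex.norm_exp]

theorem PolyGrowth.exists_bound {g : ℝ → ℂ} (hg : PolyGrowth g) {r : ℝ} (hr : 0 < r) :
    ∃ C : ℝ, 0 ≤ C ∧ ∀ x : ℝ, 0 ≤ x → ∀ σ : ℂ, r ≤ σ.re →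
      ‖Complex.exp (-(x * σ)) * g x‖ ≤ C * Real.exp (-(r / 2) * x) := by
  obtain ⟨_, C, κ, hC, hgC⟩ := hg
  obtain ⟨D, hD, hDx⟩ := exists_pow_le_exp κ (half_pos hr)
  refine ⟨C * D, by positivity, fun x hx σ hσ => ?_⟩
  rw [norm_mul, norm_exp_neg_mul]
  calc Real.exp (-(x * σ.re)) * ‖g x‖ ≤ Real.exp (-(x * r)) * (C * (D * Real.exp (r / 2 * x))) := by
        refine mul_le_mul (Real.exp_le_exp.2 (by nlinarith)) ((hgC x hx).trans ?_)
          (norm_nonneg _) (Real.exp_pos _).le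
        gcongr
        exact hDx x hx
    _ = C * D * (Real.exp (-(x * r)) * Real.exp (r / 2 * x)) := by ring
    _ = _ := by rw [← Real.exp_add]; ring_nf

theorem PolyGrowth.aestronglyMeasurable {g : ℝ → ℂ} (hg : PolyGrowth g) (σ : ℂ) :
    AEStronglyMeasurable (fun x : ℝ => Complex.exp (-(x * σ)) * g x)
      (volume.restrict (Set.Ioi 0)) := by
  refine ContinuousOn.aestronglyMeasurable ?_ measurableSet_Ioi
  exact ContinuousOn.mul (by fun_prop) (hg.1.mono Set.Ioi_subset_Ici_self)

theorem PolyGrowth.integrableOn {g : ℝ → ℂ} (hg : PolyGrowth g) {σ : ℂ} (hσ : 0 < σ.re) :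
    IntegrableOn (fun x : ℝ => Complex.exp (-(x * σ)) * g x) (Set.Ioi 0) := by
  obtain ⟨C, hC, hb⟩ := hg.exists_bound hσ
  refine Integrable.mono' ((exp_neg_integrableOn_Ioi 0 (half_pos hσ)).const_mul C)
    (hg.aestronglyMeasurable σ) ?_
  filter_upwards [ae_restrict_mem measurableSet_Ioi] with x hx using hb x (le_of_lt hx) σ le_rfl

theorem PolyGrowth.tendsto_exp_mul {g : ℝ → ℂ} (hg : PolyGrowth g) {σ : ℂ} (hσ : 0 < σ.re) :
    Filter.Tendsto (fun x : ℝ => Complex.exp (-(x * σ)) * g x) Filter.atTop (𝓝 0) := by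
  obtain ⟨C, hC, hb⟩ := hg.exists_bound hσ
  refine squeeze_zero_norm' (a := fun x => C * Real.exp (-(σ.re / 2) * x)) ?_ ?_
  · filter_upwards [Filter.eventually_ge_atTop 0] with x hx using hb x hx σ le_rfl
  · have h1 : Filter.Tendsto (fun x : ℝ => -(σ.re / 2) * x) Filter.atTop Filter.atBot :=
      Filter.tendsto_id.const_mul_atTop_of_neg (by linarith)
    simpa using (Real.tendsto_exp_atBot.comp h1).const_mul C

theorem PolyGrowth.hasDerivAt_lap {g : ℝ → ℂ} (hg : PolyGrowth g) {σ : ℂ} (hσ : 0 < σ.re) :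
    HasDerivAt (lap g) (-lap (fun x => x * g x) σ) σ := by
  have hxg := PolyGrowth.ofReal.mul hg
  obtain ⟨C, hC, hb⟩ := hxg.exists_bound (half_pos hσ)
  have hs : {σ' : ℂ | σ.re / 2 < σ'.re} ∈ 𝓝 σ :=
    (isOpen_lt continuous_const Complex.continuous_re).mem_nhds (by simp; linarith)
  have := (hasDerivAt_integral_of_dominated_loc_of_deriv_le (μ := volume.restrict (Set.Ioi (0 : ℝ)))
    (F := fun σ x => Complex.exp (-(x * σ)) * g x)
    (F' := fun σ x => -(Complex.exp (-(x * σ)) * (x * g x)))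
    (bound := fun x => C * Real.exp (-(σ.re / 2 / 2) * x)) hs
    (Filter.Eventually.of_forall fun σ' => hg.aestronglyMeasurable σ')
    (hg.integrableOn hσ) (hxg.aestronglyMeasurable σ).neg ?_ ?_ ?_).2
  · rw [integral_neg] at this
    exact this
  · filter_upwards [ae_restrict_mem measurableSet_Ioi] with x hx σ' hσ'
    rw [norm_neg]
    exact hb x (le_of_lt hx) σ' (le_of_lt hσ')
  · exact (exp_neg_integrableOn_Ioi 0 (half_pos (half_pos hσ))).const_mul C
  · refine Filter.Eventually.of_forall fun x σ' _ => ?_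
    have h1 : HasDerivAt (fun σ : ℂ => -((x : ℂ) * σ)) (-(x : ℂ)) σ' := by
      simpa using ((hasDerivAt_id σ').const_mul (x : ℂ)).fun_neg
    refine (h1.cexp.mul_const (g x)).congr_deriv ?_
    ring

theorem lap_const_mul (c : ℂ) (g : ℝ → ℂ) (σ : ℂ) :
    lap (fun x => c * g x) σ = c * lap g σ := by
  rw [lap, lap, ← integral_const_mul]
  congr 1; ext x; ring

theorem lap_sub {g h : ℝ → ℂ} (hg : PolyGrowth g) (hh : PolyGrowth h) {σ : ℂ} (hσ : 0 < σ.re) :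
    lap (fun x => g x - h x) σ = lap g σ - lap h σ := by
  rw [lap, lap, lap, ← integral_sub (hg.integrableOn hσ) (hh.integrableOn hσ)]
  simp only [mul_sub]

theorem lap_congr {g h : ℝ → ℂ} (hgh : ∀ x, 0 < x → g x = h x) (σ : ℂ) : lap g σ = lap h σ :=
  setIntegral_congr_fun measurableSet_Ioi fun x hx => by simp only [hgh x hx]

theorem lap_deriv {g g' : ℝ → ℂ} (hg : PolyGrowth g) (hg' : PolyGrowth g')
    (hd : ∀ x, 0 < x → HasDerivAt g (g' x) x) {σ : ℂ} (hσ : 0 < σ.re) :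
    lap g' σ = σ * lap g σ - g 0 := by
  have h1 := integral_Ioi_of_hasDerivAt_of_tendsto (a := (0 : ℝ))
    (f := fun x : ℝ => Complex.exp (-(x * σ)) * g x)
    (f' := fun x : ℝ => Complex.exp (-(x * σ)) * g' x - σ * (Complex.exp (-(x * σ)) * g x)) (m := 0)
    ?_ ?_ ?_ (hg.tendsto_exp_mul hσ)
  · rw [integral_sub (hg'.integrableOn hσ) ((hg.integrableOn hσ).const_mul σ),
      integral_const_mul] at h1
    simp only [Complex.ofReal_zero, zero_mul, neg_zero, Complex.exp_zero, one_mul, zero_sub] at h1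
    rw [lap, lap]
    linear_combination h1
  · exact (ContinuousOn.mul (by fun_prop) hg.1) 0 Set.self_mem_Ici
  · intro x hx
    have h1 : HasDerivAt (fun x : ℝ => -((x : ℂ) * σ)) (-σ) x := by
      simpa using ((Complex.ofRealCLM.hasDerivAt (x := x)).mul_const σ).fun_neg
    refine (h1.cexp.mul (hd x hx)).congr_deriv ?_
    ring
  · exact (hg'.integrableOn hσ).sub ((hg.integrableOn hσ).const_mul σ)

theorem lap_one {σ : ℂ} (hσ : 0 < σ.re) : lap (fun _ => 1) σ = σ⁻¹ := by
  have h := lap_deriv (PolyGrowth.const 1) (PolyGrowth.const 0)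
    (fun x _ => hasDerivAt_const x 1) hσ
  have h0 : lap (fun _ => 0) σ = 0 := by simp [lap]
  rw [h0] at h
  exact eq_inv_of_mul_eq_one_right (by linear_combination -h)

/-- A function that vanishes to first order at the origin has a Laplace transform of order `σ⁻²`.
The constant depends on `κ` and `r` alone, so that the small factor `B` of a long word is preserved.
-/
theorem exists_lap_bound (κ : ℕ) {r : ℝ} (hr : 0 < r) :
    ∃ K : ℝ, 0 < K ∧ ∀ (g : ℝ → ℂ) (B : ℝ), 0 ≤ B →
      (∀ x : ℝ, 0 ≤ x → ‖g x‖ ≤ B * ((1 + x) ^ κ - 1)) →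
      ∀ σ : ℂ, r ≤ σ.re → ‖lap g σ‖ ≤ B * K / σ.re ^ 2 := by
  obtain ⟨C, hC, hCx⟩ := exists_pow_le_exp κ (half_pos hr)
  -- Absorbing the factor `x` into `exp(σ.re x / 4)` costs `4 / σ.re`, and the integral of the
  -- remaining exponential is `4 / σ.re`. The summand `1` keeps the constant positive for `κ = 0`.
  refine ⟨κ * C * 16 + 1, by positivity, fun g B hB hgB σ hσ => ?_⟩
  have hpos : 0 < σ.re := hr.trans_le hσ
  have hstep : ∀ x : ℝ, 0 ≤ x → (1 + x) ^ κ - 1 ≤ κ * x * (1 + x) ^ κ := by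
    intro x hx
    have key : ∀ n : ℕ, (1 + x) ^ n - 1 ≤ n * x * (1 + x) ^ n := by
      intro n
      induction n with
      | zero => simp
      | succ n ih =>
        have h1 : (1 : ℝ) ≤ (1 + x) ^ n := one_le_pow₀ (by linarith)
        push_cast
        have h2 : (1 + x) ^ (n + 1) - 1 = (1 + x) * ((1 + x) ^ n - 1) + x := by ring
        rw [h2]
        calc (1 + x) * ((1 + x) ^ n - 1) + x
            ≤ (1 + x) * (n * x * (1 + x) ^ n) + x * (1 + x) ^ (n + 1) := by
              gcongr
              exact le_mul_of_one_le_right hx (one_le_pow₀ (by linarith))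
          _ = _ := by ring
    exact key κ
  have hbound : ∀ x : ℝ, 0 < x → ‖Complex.exp (-(x * σ)) * g x‖ ≤
      B * (κ * C) * (4 / σ.re) * Real.exp (-(σ.re / 4) * x) := by
    intro x hx
    rw [norm_mul, norm_exp_neg_mul]
    have h1 : ‖g x‖ ≤ B * (κ * x * (C * Real.exp (σ.re / 2 * x))) := by
      refine (hgB x hx.le).trans ?_
      gcongr
      refine (hstep x hx.le).trans ?_
      gcongr
      refine (hCx x hx.le).trans ?_
      gcongr
    have h2 : x ≤ 4 / σ.re * Real.exp (σ.re / 4 * x) := by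
      rw [div_mul_eq_mul_div, le_div_iff₀ hpos]
      have := Real.add_one_le_exp (σ.re / 4 * x)
      linarith
    calc Real.exp (-(x * σ.re)) * ‖g x‖
        ≤ Real.exp (-(x * σ.re)) * (B * (κ * (4 / σ.re * Real.exp (σ.re / 4 * x)) *
            (C * Real.exp (σ.re / 2 * x)))) := by
          gcongr
          refine h1.trans ?_
          gcongr
      _ = B * (κ * C) * (4 / σ.re) * (Real.exp (-(x * σ.re)) * Real.exp (σ.re / 4 * x) *
            Real.exp (σ.re / 2 * x)) := by ring
      _ = _ := by rw [← Real.exp_add, ← Real.exp_add]; ring_nf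
  have hexpint : ∫ x in Set.Ioi (0 : ℝ), Real.exp (-(σ.re / 4) * x) = 4 / σ.re := by
    rw [integral_exp_mul_Ioi (by linarith)]
    simp
  calc ‖lap g σ‖ ≤ ∫ x in Set.Ioi (0 : ℝ),
        B * (κ * C) * (4 / σ.re) * Real.exp (-(σ.re / 4) * x) := by
        refine norm_integral_le_of_norm_le
          ((exp_neg_integrableOn_Ioi 0 (by linarith : 0 < σ.re / 4)).const_mul _) ?_
        filter_upwards [ae_restrict_mem measurableSet_Ioi] with x hx using hbound x hx
    _ = B * (κ * C * 16) / σ.re ^ 2 := by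
        rw [integral_const_mul, hexpint]
        field_simp
        ring
    _ ≤ _ := by
        gcongr
        linarith

end Laplace

/-! ### Shuffles as a relation between words, and admissible pairs -/

section Shuffles

variable {Φ : Type*}

/-- The third word is a shuffle of the first two. -/
inductive Shuf : List Φ → List Φ → List Φ → Prop
  | nil : Shuf [] [] []
  | left (a : Φ) {u v w : List Φ} : Shuf u v w → Shuf (a :: u) v (a :: w)
  | right (b : Φ) {u v w : List Φ} : Shuf u v w → Shuf u (b :: v) (b :: w)

theorem Shuf.nil_right (u : List Φ) : Shuf u [] u := by
  induction u with
  | nil => exact .nil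
  | cons a u ih => exact .left a ih

theorem Shuf.nil_left (v : List Φ) : Shuf [] v v := by
  induction v with
  | nil => exact .nil
  | cons a u ih => exact .right a ih

theorem Shuf.wsum_eq (z : Φ → ℂ) {u v w : List Φ} (h : Shuf u v w) :
    wsum z w = wsum z u + wsum z v := by
  induction h with
  | nil => simp
  | left a _ ih => simp [ih, add_assoc]
  | right b _ ih => simp [ih]; ring

theorem Shuf.eq_nil {u v : List Φ} (h : Shuf u v []) : u = [] ∧ v = [] := by
  cases h; simp

theorem sh_congr_shuf {c c' : List Φ → ℂ} {u v : List Φ} (h : ∀ w, Shuf u v w → c w = c' w) :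
    sh c u v = sh c' u v := by
  induction u, v using pair_induction generalizing c c' with
  | h0 => simpa using h [] .nil
  | h1 a u ih => simpa using h (a :: u) (.nil_right _)
  | h2 b v ih => simpa using h (b :: v) (.nil_left _)
  | h3 a u b v ih1 ih2 =>
    rw [sh_cons_cons, sh_cons_cons, ih1 fun w hw => h _ (.left a hw),
      ih2 fun w hw => h _ (.right b hw)]

/-- Used for the submonoid of functions that tend to zero. -/
theorem sh_mem {T : Type*} (S : AddSubmonoid (T → ℂ)) {c : List Φ → T → ℂ} {u v : List Φ}
    (h : ∀ w, Shuf u v w → c w ∈ S) : (fun t => sh (fun w => c w t) u v) ∈ S := by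
  induction u, v using pair_induction generalizing c with
  | h0 => simpa using h [] .nil
  | h1 a u ih => simpa using h (a :: u) (.nil_right _)
  | h2 b v ih => simpa using h (b :: v) (.nil_left _)
  | h3 a u b v ih1 ih2 =>
    simp only [sh_cons_cons]
    exact S.add_mem (ih1 (c := fun w => c (a :: w)) fun w hw => h _ (.left a hw))
      (ih2 (c := fun w => c (b :: w)) fun w hw => h _ (.right b hw))

theorem hasDerivAt_sh {c : List Φ → ℂ → ℂ} {c' : List Φ → ℂ} {τ : ℂ} {u v : List Φ}
    (h : ∀ w, Shuf u v w → HasDerivAt (c w) (c' w) τ) :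
    HasDerivAt (fun τ => sh (fun w => c w τ) u v) (sh c' u v) τ := by
  induction u, v using pair_induction generalizing c c' with
  | h0 => simpa using h [] .nil
  | h1 a u ih => simpa using h (a :: u) (.nil_right _)
  | h2 b v ih => simpa using h (b :: v) (.nil_left _)
  | h3 a u b v ih1 ih2 =>
    simp only [sh_cons_cons]
    exact (ih1 (c := fun w => c (a :: w)) (c' := fun w => c' (a :: w))
      fun w hw => h _ (.left a hw)).fun_add
      (ih2 (c := fun w => c (b :: w)) (c' := fun w => c' (b :: w)) fun w hw => h _ (.right b hw))

/-- All sums of a final part of `u` and a final part of `v` lie in `E`. -/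
def AdmPair (E : Finset ℂ) (z : Φ → ℂ) (u v : List Φ) : Prop :=
  ∀ u' v', u' <:+ u → v' <:+ v → wsum z u' + wsum z v' ∈ E

theorem adm_iff {E : Finset ℂ} {z : Φ → ℂ} {l : List Φ} :
    Adm E z l ↔ ∀ l', l' <:+ l → l' ≠ [] → wsum z l' ∈ E := by
  induction l with
  | nil => simp [Adm]
  | cons b l ih =>
    rw [Adm, ih]
    constructor
    · rintro ⟨h1, h2⟩ l' hl' hne
      rcases List.suffix_cons_iff.1 hl' with rfl | h
      · exact h1
      · exact h2 l' h hne
    · intro h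
      exact ⟨h _ List.suffix_rfl (by simp), fun l' hl' hne => h l' (hl'.trans (List.suffix_cons _ _)) hne⟩

theorem AdmPair.mono {E : Finset ℂ} {z : Φ → ℂ} {u v u' v' : List Φ} (h : AdmPair E z u v)
    (hu : u' <:+ u) (hv : v' <:+ v) : AdmPair E z u' v' :=
  fun _ _ hu' hv' => h _ _ (hu'.trans hu) (hv'.trans hv)

/-- A final part of a shuffle is a shuffle of final parts, so its sum is one of the sums controlled
by `AdmPair`. -/
theorem AdmPair.adm_shuf {E : Finset ℂ} {z : Φ → ℂ} {u v w : List Φ} (h : AdmPair E z u v)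
    (hw : Shuf u v w) : Adm E z w := by
  induction hw with
  | nil => trivial
  | left a hw ih =>
    refine ⟨?_, ih (h.mono (List.suffix_cons _ _) List.suffix_rfl)⟩
    rw [(hw.left a).wsum_eq]
    exact h _ _ List.suffix_rfl List.suffix_rfl
  | right b hw ih =>
    refine ⟨?_, ih (h.mono List.suffix_rfl (List.suffix_cons _ _))⟩
    rw [(hw.right b).wsum_eq]
    exact h _ _ List.suffix_rfl List.suffix_rfl

theorem AdmPair.adm_left {E : Finset ℂ} {z : Φ → ℂ} {u v : List Φ} (h : AdmPair E z u v) :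
    Adm E z u := (h.mono List.suffix_rfl (List.nil_suffix)).adm_shuf (.nil_right u)

theorem AdmPair.adm_right {E : Finset ℂ} {z : Φ → ℂ} {u v : List Φ} (h : AdmPair E z u v) :
    Adm E z v := (h.mono (List.nil_suffix) List.suffix_rfl).adm_shuf (.nil_left v)

end Shuffles

/-! ### The flat sections as Laplace transforms of multilogarithms -/

section Solutions

variable {E : Finset ℂ} {μ₀ e : ℝ} {Φ : Type*} {z : Φ → ℂ}

/-- `q_l(τ) = ωτ ∫ exp(-xωτ) F_l(xω) dx` where `ω = 1 + i e μ`. -/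
def qser (E : Finset ℂ) (μ₀ e : ℝ) (z : Φ → ℂ) (μ : ℝ) (l : List Φ) (τ : ℂ) : ℂ :=
  slope e μ * τ * lap (fun x => mlog E μ₀ e z l (x * slope e μ)) (slope e μ * τ)

theorem qser_nil {μ : ℝ} {τ : ℂ} (hτ : 0 < (slope e μ * τ).re) : qser E μ₀ e z μ [] τ = 1 := by
  simp only [qser, mlog]
  rw [lap_one hτ]
  exact mul_inv_cancel₀ fun h => by simp [h] at hτ

theorem polyGrowth_mlog (h : IsSector E μ₀ e) (hz : ∀ b, z b ≠ 0) {μ : ℝ} (hμ : 0 < μ)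
    (hμ' : μ < μ₀) {l : List Φ} (hl : Adm E z l) :
    PolyGrowth fun x => mlog E μ₀ e z l (x * slope e μ) := by
  refine ⟨?_, ?_⟩
  · refine (mlog_spec h hz hl).1.continuousOn.comp (by fun_prop) fun x hx => ?_
    exact h.mul_slope_mem hx hμ.le hμ' (Or.inr (Or.inl hμ))
  · obtain ⟨κ, _, hκ⟩ := exists_mlog_bound h hz hμ hμ' one_pos le_rfl
    by_cases hne : l = []
    · exact ⟨1, 0, zero_le_one, fun x _ => by simp [hne, mlog]⟩
    · refine ⟨1, κ, zero_le_one, fun x hx => ?_⟩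
      have := hκ l hl hne x hx
      rw [one_pow, one_mul] at this
      linarith

/-- The Laplace transform exchanges multiplication by `x` and differentiation, so it turns the
equation of the multilogarithms into an equation in `τ` that involves only the word and its tail. -/
theorem hasDerivAt_qser (h : IsSector E μ₀ e) (hz : ∀ b, z b ≠ 0) {μ : ℝ} (hμ : 0 < μ)
    (hμ' : μ < μ₀) {b : Φ} {l : List Φ} (hl : Adm E z (b :: l)) {τ : ℂ}
    (hτ : 0 < (slope e μ * τ).re) :
    HasDerivAt (qser E μ₀ e z μ (b :: l))
      (-wsum z (b :: l) * qser E μ₀ e z μ (b :: l) τ + qser E μ₀ e z μ l τ / τ) τ := by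
  set ω := slope e μ with hω
  set s := wsum z (b :: l) with hs
  set g : ℝ → ℂ := fun x => mlog E μ₀ e z (b :: l) (x * ω) with hg
  set gl : ℝ → ℂ := fun x => mlog E μ₀ e z l (x * ω) with hgl
  have hgP : PolyGrowth g := polyGrowth_mlog h hz hμ hμ' hl
  have hglP : PolyGrowth gl := polyGrowth_mlog h hz hμ hμ' hl.2
  have hτ0 : τ ≠ 0 := fun h0 => by simp [h0] at hτ
  have hω0 : ω ≠ 0 := slope_ne_zero _ _
  obtain ⟨h0, hder⟩ := (mlog_spec h hz hl).2 b l rfl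
  have hxgP : PolyGrowth fun x => x * g x := PolyGrowth.ofReal.mul hgP
  have hGP : PolyGrowth fun x => s * g x - ω * (x * g x) :=
    (hgP.const_mul s).sub (hxgP.const_mul ω)
  -- Integration by parts is applied to `(s - xω) F`, whose derivative is `ω (F_l - F)` by the
  -- equation of `F`. There is no boundary term because `F` vanishes at the origin.
  have hibp := lap_deriv (g := fun x => s * g x - ω * (x * g x)) (g' := fun x => ω * (gl x - g x))
    hGP ((hglP.sub hgP).const_mul ω) (fun x hx => by
      obtain ⟨d, hd, hd2⟩ := hder _ (h.mul_slope_mem hx.le hμ.le hμ' (Or.inr (Or.inl hμ)))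
      have h1 := hasDerivAt_ray hd
      have h2 := (h1.const_mul s).sub
        (((Complex.ofRealCLM.hasDerivAt (x := x)).mul h1).const_mul ω)
      refine h2.congr_deriv ?_
      simp only [Complex.ofRealCLM_apply, Complex.ofReal_one, hgl, hg]
      rw [← hd2]
      ring) hτ
  have hg0 : g 0 = 0 := by simp [hg, h0]
  rw [lap_const_mul, lap_sub hglP hgP hτ, lap_sub (hgP.const_mul s) (hxgP.const_mul ω) hτ,
    lap_const_mul, lap_const_mul] at hibp
  simp only [hg0, mul_zero, sub_zero] at hibp
  have hm : HasDerivAt (fun τ : ℂ => ω * τ) ω τ := by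
    simpa using (hasDerivAt_id τ).const_mul ω
  have hQ : HasDerivAt (fun τ : ℂ => lap g (ω * τ)) (-lap (fun x => x * g x) (ω * τ) * ω) τ :=
    HasDerivAt.comp_of_eq τ (hgP.hasDerivAt_lap hτ) hm rfl
  refine (hm.mul hQ).congr_deriv ?_
  simp only [qser]
  rw [← hω]
  have e2 : ω * τ * lap gl (ω * τ) / τ = ω * lap gl (ω * τ) := by field_simp
  rw [show (fun x : ℝ => mlog E μ₀ e z l (x * ω)) = gl from rfl, e2]
  linear_combination -hibp

theorem exists_qser_bound (h : IsSector E μ₀ e) (hz : ∀ b, z b ≠ 0) {μ : ℝ} (hμ : 0 < μ)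
    (hμ' : μ < μ₀) {b : ℝ} (hb : 0 < b) (hb1 : b ≤ 1) {r : ℝ} (hr : 0 < r) :
    ∃ K : ℝ, 0 < K ∧ ∀ l, Adm E z l → l ≠ [] → ∀ τ : ℂ, r ≤ (slope e μ * τ).re →
      ‖qser E μ₀ e z μ l τ‖ ≤ b ^ l.length * (K * ‖slope e μ * τ‖ / (slope e μ * τ).re ^ 2) := by
  obtain ⟨κ, _, hκ⟩ := exists_mlog_bound h hz hμ hμ' hb hb1
  obtain ⟨K, hK, hKb⟩ := exists_lap_bound κ hr
  refine ⟨K, hK, fun l hl hne τ hτ => ?_⟩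
  have h1 := hKb (fun x => mlog E μ₀ e z l (x * slope e μ)) (b ^ l.length) (by positivity)
    (fun x hx => by
      refine (hκ l hl hne x hx).trans ?_
      have hX : 1 ≤ (1 + x) ^ κ := one_le_pow₀ (by linarith)
      refine mul_le_mul_of_nonneg_right ?_ (by linarith)
      exact pow_le_pow_of_le_one hb.le hb1 (by omega)) _ hτ
  rw [qser, norm_mul]
  calc ‖slope e μ * τ‖ * _ ≤ ‖slope e μ * τ‖ * (b ^ l.length * K / (slope e μ * τ).re ^ 2) := by
        gcongr
    _ = _ := by ring

theorem tendsto_qser_ray (h : IsSector E μ₀ e) (hz : ∀ b, z b ≠ 0) {μ : ℝ} (hμ : 0 < μ)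
    (hμ' : μ < μ₀) {l : List Φ} (hl : Adm E z l) (hne : l ≠ []) {ω' : ℂ}
    (hω' : 0 < (slope e μ * ω').re) :
    Filter.Tendsto (fun x : ℝ => qser E μ₀ e z μ l (x * ω')) Filter.atTop (𝓝 0) := by
  obtain ⟨K, hK, hKb⟩ := exists_qser_bound h hz hμ hμ' one_pos le_rfl hω'
  set r := (slope e μ * ω').re with hr
  refine squeeze_zero_norm' (a := fun x => K * ‖slope e μ * ω'‖ / r ^ 2 * x⁻¹) ?_ ?_
  · filter_upwards [Filter.eventually_ge_atTop 1] with x hx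
    have e1 : slope e μ * (x * ω') = x * (slope e μ * ω') := by ring
    have e2 : (slope e μ * (x * ω')).re = x * r := by rw [e1, Complex.re_ofReal_mul]
    have := hKb l hl hne (x * ω') (by rw [e2]; nlinarith)
    refine this.trans (le_of_eq ?_)
    rw [e2, e1, norm_mul, Complex.norm_real, Real.norm_of_nonneg (by linarith), one_pow, one_mul]
    field_simp
  · simpa using tendsto_inv_atTop_zero.const_mul (K * ‖slope e μ * ω'‖ / r ^ 2)

/-- A ray on which `exp(-sτ)` does not decay and along which all the `q_l` tend to zero. -/
theorem IsSector.exists_test_ray (h : IsSector E μ₀ e) {s : ℂ} (hs : s ∈ E) :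
    ∃ ω' : ℂ, (s * ω').re ≤ 0 ∧ ∀ μ, 0 < μ → μ < μ₀ → 0 < (slope e μ * ω').re := by
  have hμ₀ := h.pos
  have he : e * e = 1 := by rcases h.sign with rfl | rfl <;> norm_num
  have main : s.im = 0 ∧ 0 ≤ s.re ∨ μ₀ * s.re < |s.im| := by
    by_cases h0 : s = 0
    · simp [h0]
    · rcases h.out s hs h0 with ⟨h1, h2⟩ | h1
      · exact Or.inl ⟨h1, h2.le⟩
      · exact Or.inr h1
  rcases main with ⟨h1, h2⟩ | h1
  · refine ⟨-(e * Complex.I), by simp [h1], fun μ hμ _ => ?_⟩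
    have : (slope e μ * -(e * Complex.I)).re = e * e * μ := by simp; ring
    rw [this, he, one_mul]
    exact hμ
  · rcases le_total 0 s.im with h3 | h3
    · rw [abs_of_nonneg h3] at h1
      -- The direction is chosen such that `Re (p ω')` vanishes on the boundary ray of the sector
      -- that faces `s`.
      refine ⟨1 + (μ₀⁻¹ : ℝ) * Complex.I, ?_, fun μ hμ hμ' => ?_⟩
      · have : (s * (1 + (μ₀⁻¹ : ℝ) * Complex.I)).re = (μ₀ * s.re - s.im) / μ₀ := by
          simp; field_simp
        rw [this]
        exact div_nonpos_of_nonpos_of_nonneg (by linarith) hμ₀.le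
      · have : (slope e μ * (1 + (μ₀⁻¹ : ℝ) * Complex.I)).re = (μ₀ - e * μ) / μ₀ := by
          simp; field_simp
        rw [this]
        apply div_pos _ hμ₀
        rcases h.sign with rfl | rfl <;> linarith
    · rw [abs_of_nonpos h3] at h1
      refine ⟨1 - (μ₀⁻¹ : ℝ) * Complex.I, ?_, fun μ hμ hμ' => ?_⟩
      · have : (s * (1 - (μ₀⁻¹ : ℝ) * Complex.I)).re = (μ₀ * s.re + s.im) / μ₀ := by
          simp; field_simp
        rw [this]
        exact div_nonpos_of_nonpos_of_nonneg (by linarith) hμ₀.le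
      · have : (slope e μ * (1 - (μ₀⁻¹ : ℝ) * Complex.I)).re = (μ₀ + e * μ) / μ₀ := by
          simp; field_simp
        rw [this]
        apply div_pos _ hμ₀
        rcases h.sign with rfl | rfl <;> linarith

/-- The solutions are the multiples of `exp(-sτ)`, which does not decay in the direction `ω'`. This
is the uniqueness principle behind `qser_indep` and `sh_qser`. -/
theorem eq_zero_of_hasDerivAt_of_tendsto {U : Set ℂ} (hU : Convex ℝ U) {y : ℂ → ℂ} {s : ℂ}
    (hy : ∀ τ ∈ U, HasDerivAt y (-s * y τ) τ) {ω' : ℂ} (hs : (s * ω').re ≤ 0)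
    (hω' : ∀ x : ℝ, 0 < x → x * ω' ∈ U)
    (hlim : Filter.Tendsto (fun x : ℝ => y (x * ω')) Filter.atTop (𝓝 0)) {τ : ℂ} (hτ : τ ∈ U) :
    y τ = 0 := by
  have hd : ∀ τ ∈ U, HasDerivAt (fun τ => Complex.exp (s * τ) * y τ) 0 τ := by
    intro τ hτ
    have h1 : HasDerivAt (fun τ : ℂ => s * τ) s τ := by simpa using (hasDerivAt_id τ).const_mul s
    refine (h1.cexp.mul (hy τ hτ)).congr_deriv ?_
    ring
  have hconst : ∀ σ ∈ U, Complex.exp (s * σ) * y σ = Complex.exp (s * τ) * y τ := fun σ hσ =>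
    by
      have := hU.norm_image_sub_le_of_norm_hasDerivWithin_le (C := 0)
        (fun p hp => (hd p hp).hasDerivWithinAt) (by simp) hτ hσ
      rw [zero_mul] at this
      exact sub_eq_zero.1 (norm_le_zero_iff.1 this)
  have h0 : Filter.Tendsto (fun x : ℝ => Complex.exp (s * (x * ω')) * y (x * ω')) Filter.atTop
      (𝓝 0) := by
    refine squeeze_zero_norm' ?_ (tendsto_zero_iff_norm_tendsto_zero.1 hlim)
    filter_upwards [Filter.eventually_gt_atTop 0] with x hx
    rw [norm_mul, Complex.norm_exp]
    have : (s * (x * ω')).re ≤ 0 := by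
      rw [show s * (x * ω') = x * (s * ω') by ring, Complex.re_ofReal_mul]
      exact mul_nonpos_of_nonneg_of_nonpos hx.le hs
    exact mul_le_of_le_one_left (norm_nonneg _) (Real.exp_le_one_iff.2 this)
  have h1 : Filter.Tendsto (fun x : ℝ => Complex.exp (s * (x * ω')) * y (x * ω')) Filter.atTop
      (𝓝 (Complex.exp (s * τ) * y τ)) := by
    refine tendsto_const_nhds.congr' ?_
    filter_upwards [Filter.eventually_gt_atTop 0] with x hx
    exact (hconst _ (hω' x hx)).symm
  have := tendsto_nhds_unique h1 h0
  simpa using this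

theorem convex_re_pos (ω : ℂ) : Convex ℝ {τ : ℂ | 0 < (ω * τ).re} := by
  intro a ha b hb s t hs ht hst
  simp only [Set.mem_ofPred_eq] at *
  have : (ω * (s • a + t • b)).re = s * (ω * a).re + t * (ω * b).re := by
    simp; ring
  rw [this]
  rcases hs.eq_or_lt with rfl | hs
  · rw [show t = 1 by linarith]; simpa using hb
  · have := mul_nonneg ht hb.le
    have := mul_pos hs ha
    linarith

/-- By induction both functions solve the same inhomogeneous equation. Their difference solves the
homogeneous one and tends to zero along the test ray, which serves all `μ` at once. -/
theorem qser_indep (h : IsSector E μ₀ e) (hz : ∀ b, z b ≠ 0) {μ μ' : ℝ} (hμ : 0 < μ)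
    (hμ₀ : μ < μ₀) (hμ' : 0 < μ') (hμ₀' : μ' < μ₀) {l : List Φ} (hl : Adm E z l) {τ : ℂ}
    (hτ : 0 < (slope e μ * τ).re) (hτ' : 0 < (slope e μ' * τ).re) :
    qser E μ₀ e z μ l τ = qser E μ₀ e z μ' l τ := by
  induction l generalizing τ with
  | nil => rw [qser_nil hτ, qser_nil hτ']
  | cons b l ih =>
    obtain ⟨ω', hω1, hω2⟩ := h.exists_test_ray hl.1
    refine sub_eq_zero.1 (eq_zero_of_hasDerivAt_of_tendsto
      (U := {τ : ℂ | 0 < (slope e μ * τ).re} ∩ {τ : ℂ | 0 < (slope e μ' * τ).re})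
      (y := fun τ => qser E μ₀ e z μ (b :: l) τ - qser E μ₀ e z μ' (b :: l) τ)
      (s := wsum z (b :: l)) (ω' := ω') ((convex_re_pos _).inter (convex_re_pos _)) ?_ hω1 ?_ ?_
      ⟨hτ, hτ'⟩)
    · rintro τ ⟨hτ, hτ'⟩
      refine ((hasDerivAt_qser h hz hμ hμ₀ hl hτ).sub
        (hasDerivAt_qser h hz hμ' hμ₀' hl hτ')).congr_deriv ?_
      rw [ih hl.2 hτ hτ']
      ring
    · intro x hx
      refine ⟨?_, ?_⟩ <;> simp only [Set.mem_ofPred_eq] <;>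
      rw [mul_left_comm, Complex.re_ofReal_mul]
      · exact mul_pos hx (hω2 μ hμ hμ₀)
      · exact mul_pos hx (hω2 μ' hμ' hμ₀')
    · simpa using (tendsto_qser_ray h hz hμ hμ₀ hl (by simp) (hω2 μ hμ hμ₀)).sub
        (tendsto_qser_ray h hz hμ' hμ₀' hl (by simp) (hω2 μ' hμ' hμ₀'))

/-- All shuffles have the same sum `s`, so both sides satisfy an equation with the term `-s y`. The
inhomogeneous terms remove the first letter of a shuffle on the left and of `u` or `v` on the right,
and agree by induction. -/
theorem sh_qser (h : IsSector E μ₀ e) (hz : ∀ b, z b ≠ 0) {μ : ℝ} (hμ : 0 < μ)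
    (hμ₀ : μ < μ₀) {u v : List Φ} (huv : AdmPair E z u v) {τ : ℂ}
    (hτ : 0 < (slope e μ * τ).re) :
    sh (fun w => qser E μ₀ e z μ w τ) u v = qser E μ₀ e z μ u τ * qser E μ₀ e z μ v τ := by
  induction u, v using pair_induction generalizing τ with
  | h0 => simp [qser_nil hτ]
  | h1 a u ih => simp [qser_nil hτ]
  | h2 b v ih => simp [qser_nil hτ]
  | h3 a u b v ih1 ih2 =>
    set s := wsum z (a :: u) + wsum z (b :: v) with hs
    have hsE : s ∈ E := huv _ _ List.suffix_rfl List.suffix_rfl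
    obtain ⟨ω', hω1, hω2⟩ := h.exists_test_ray hsE
    have hw : ∀ w, Shuf (a :: u) (b :: v) w → w ≠ [] ∧ Adm E z w := fun w hw =>
      ⟨by rintro rfl; simpa using hw.eq_nil, huv.adm_shuf hw⟩
    have huv1 := huv.mono (List.suffix_cons a u) List.suffix_rfl
    have huv2 := huv.mono List.suffix_rfl (List.suffix_cons b v)
    refine sub_eq_zero.1 (eq_zero_of_hasDerivAt_of_tendsto (U := {τ : ℂ | 0 < (slope e μ * τ).re})
      (y := fun τ => sh (fun w => qser E μ₀ e z μ w τ) (a :: u) (b :: v) -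
        qser E μ₀ e z μ (a :: u) τ * qser E μ₀ e z μ (b :: v) τ)
      (s := s) (ω' := ω') (convex_re_pos _) ?_ hω1 ?_ ?_ hτ)
    · intro τ hτ
      have hd := hasDerivAt_sh (c := fun w τ => qser E μ₀ e z μ w τ)
        (c' := fun w => -s * qser E μ₀ e z μ w τ + τ⁻¹ * qser E μ₀ e z μ w.tail τ)
        (τ := τ) (u := a :: u) (v := b :: v) (fun w hw' => by
          obtain ⟨hne, hadm⟩ := hw w hw'
          obtain ⟨c, w, rfl⟩ := List.exists_cons_of_ne_nil hne
          refine (hasDerivAt_qser h hz hμ hμ₀ hadm hτ).congr_deriv ?_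
          rw [hw'.wsum_eq z, List.tail_cons]
          ring)
      rw [sh_add, sh_const_mul, sh_const_mul, sh_cons_cons (fun w => qser E μ₀ e z μ w.tail τ)] at hd
      simp only [List.tail_cons] at hd
      rw [ih1 huv1 hτ, ih2 huv2 hτ] at hd
      refine (hd.sub ((hasDerivAt_qser h hz hμ hμ₀ huv.adm_left hτ).mul
        (hasDerivAt_qser h hz hμ hμ₀ huv.adm_right hτ))).congr_deriv ?_
      ring
    · intro x hx
      simp only [Set.mem_ofPred_eq]
      rw [mul_left_comm, Complex.re_ofReal_mul]
      exact mul_pos hx (hω2 μ hμ hμ₀)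
    · have h1 := sh_mem (T := ℝ)
        { carrier := {f : ℝ → ℂ | Filter.Tendsto f Filter.atTop (𝓝 0)}
          add_mem' := fun {f g} hf hg => by
            have : Filter.Tendsto (f + g) Filter.atTop (𝓝 (0 + 0)) := Filter.Tendsto.add hf hg
            rwa [add_zero] at this
          zero_mem' := tendsto_const_nhds }
        (c := fun w x => qser E μ₀ e z μ w (x * ω')) (u := a :: u) (v := b :: v)
        (fun w hw' => tendsto_qser_ray h hz hμ hμ₀ (hw w hw').2 (hw w hw').1 (hω2 μ hμ hμ₀))
      have h1 : Filter.Tendsto (fun x : ℝ => sh (fun w => qser E μ₀ e z μ w (x * ω')) (a :: u) (b :: v))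
        Filter.atTop (𝓝 0) := h1
      simpa using h1.sub ((tendsto_qser_ray h hz hμ hμ₀ huv.adm_left (by simp) (hω2 μ hμ hμ₀)).mul
        (tendsto_qser_ray h hz hμ hμ₀ huv.adm_right (by simp) (hω2 μ hμ hμ₀)))

end Solutions

/-! ### Boundary values on the positive real axis -/

section Boundary

variable {E : Finset ℂ} {μ₀ e : ℝ} {Φ : Type*} {z : Φ → ℂ}

/-- The substitution `μ = t ^ 2` makes the derivative bounded by `2 * K`. -/
theorem norm_sub_le_sqrt_of_deriv {f f' : ℝ → ℂ} {K m : ℝ}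
    (hd : ∀ μ, 0 < μ → μ ≤ m → HasDerivAt f (f' μ) μ)
    (hb : ∀ μ, 0 < μ → μ ≤ m → ‖f' μ‖ ≤ K / √μ) {μ μ' : ℝ} (hμ : 0 < μ) (hμm : μ ≤ m)
    (hμ' : 0 < μ') (hμm' : μ' ≤ m) : ‖f μ - f μ'‖ ≤ 2 * K * |√μ - √μ'| := by
  have hmem : ∀ t ∈ Set.Ioc 0 (√m), 0 < t ^ 2 ∧ t ^ 2 ≤ m := by
    intro t ht
    have hm : 0 ≤ m := by linarith
    exact ⟨by have := ht.1; positivity, (Real.le_sqrt ht.1.le hm).1 ht.2⟩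
  have key := (convex_Ioc (0 : ℝ) (√m)).norm_image_sub_le_of_norm_hasDerivWithin_le
    (f := fun t : ℝ => f (t ^ 2)) (f' := fun t => (2 * t : ℝ) • f' (t ^ 2)) (C := 2 * K)
    (fun t ht => by
      have h1 := hd _ (hmem t ht).1 (hmem t ht).2
      have h2 : HasDerivAt (fun t : ℝ => t ^ 2) (2 * t) t := by simpa using hasDerivAt_pow 2 t
      exact (HasDerivAt.scomp (h := fun t : ℝ => t ^ 2) t h1 h2).hasDerivWithinAt)
    (fun t ht => by
      have h1 := hb _ (hmem t ht).1 (hmem t ht).2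
      have ht0 := ht.1
      rw [Real.sqrt_sq ht0.le] at h1
      rw [norm_smul, Real.norm_of_nonneg (by linarith)]
      rw [le_div_iff₀ ht0] at h1
      linarith)
    (x := √μ') (y := √μ) ⟨Real.sqrt_pos.2 hμ', Real.sqrt_le_sqrt hμm'⟩
    ⟨Real.sqrt_pos.2 hμ, Real.sqrt_le_sqrt hμm⟩
  simpa [Real.sq_sqrt hμ.le, Real.sq_sqrt hμ'.le] using key

/-- The substitution `μ = 1 / t ^ 2` makes the derivative bounded by `2 * K`. -/
theorem norm_le_of_deriv_rpow {f f' : ℝ → ℂ} {K m : ℝ} (hm : 0 < m) (hK : 0 ≤ K)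
    (hd : ∀ μ, 0 < μ → μ ≤ m → HasDerivAt f (f' μ) μ)
    (hb : ∀ μ, 0 < μ → μ ≤ m → ‖f' μ‖ ≤ K / (μ * √μ)) {μ : ℝ} (hμ : 0 < μ) (hμm : μ ≤ m) :
    ‖f μ‖ ≤ ‖f m‖ + 2 * K / √μ := by
  have hmem : ∀ t ∈ Set.Ici (√m)⁻¹, 0 < t ∧ 0 < (t ^ 2)⁻¹ ∧ (t ^ 2)⁻¹ ≤ m := by
    intro t ht
    have h0 : 0 < (√m)⁻¹ := inv_pos.2 (Real.sqrt_pos.2 hm)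
    have ht0 : 0 < t := h0.trans_le ht
    refine ⟨ht0, by positivity, inv_le_of_inv_le₀ hm ?_⟩
    have := pow_le_pow_left₀ h0.le (Set.mem_Ici.1 ht) 2
    rwa [inv_pow, Real.sq_sqrt hm.le] at this
  have key := (convex_Ici (𝕜 := ℝ) (√m)⁻¹).norm_image_sub_le_of_norm_hasDerivWithin_le
    (f := fun t : ℝ => f (t ^ 2)⁻¹)
    (f' := fun t => (-(2 * t) / (t ^ 2) ^ 2 : ℝ) • f' (t ^ 2)⁻¹) (C := 2 * K)
    (fun t ht => by
      obtain ⟨ht0, h1, h2⟩ := hmem t ht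
      have h3 : HasDerivAt (fun t : ℝ => (t ^ 2)⁻¹) (-(2 * t) / (t ^ 2) ^ 2) t := by
        have : HasDerivAt (fun t : ℝ => t ^ 2) (2 * t) t := by simpa using hasDerivAt_pow 2 t
        exact this.fun_inv (by positivity)
      exact ((hd _ h1 h2).scomp t h3).hasDerivWithinAt)
    (fun t ht => by
      obtain ⟨ht0, h1, h2⟩ := hmem t ht
      have h3 := hb _ h1 h2
      rw [Real.sqrt_inv, Real.sqrt_sq ht0.le] at h3
      rw [norm_smul, neg_div, norm_neg, Real.norm_of_nonneg (by positivity)]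
      calc 2 * t / (t ^ 2) ^ 2 * ‖f' (t ^ 2)⁻¹‖ ≤ 2 * t / (t ^ 2) ^ 2 * (K / ((t ^ 2)⁻¹ * t⁻¹)) := by
            gcongr
        _ = 2 * K := by field_simp)
    (x := (√m)⁻¹) (y := (√μ)⁻¹) Set.self_mem_Ici
    (inv_anti₀ (Real.sqrt_pos.2 hμ) (Real.sqrt_le_sqrt hμm))
  simp only [inv_pow, Real.sq_sqrt hμ.le, Real.sq_sqrt hm.le, inv_inv] at key
  have h1 : ‖(√μ)⁻¹ - (√m)⁻¹‖ ≤ (√μ)⁻¹ := by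
    have h2 : (√m)⁻¹ ≤ (√μ)⁻¹ := inv_anti₀ (Real.sqrt_pos.2 hμ) (Real.sqrt_le_sqrt hμm)
    have h3 : 0 ≤ (√m)⁻¹ := by positivity
    rw [Real.norm_of_nonneg (by linarith)]
    linarith
  have h2 : ‖f μ‖ ≤ ‖f m‖ + ‖f μ - f m‖ := by
    simpa using norm_add_le (f m) (f μ - f m)
  refine h2.trans ?_
  gcongr
  refine key.trans ?_
  rw [div_eq_mul_inv]
  gcongr

theorem hasDerivAt_slope {g : ℂ → ℂ} {d : ℂ} {x μ : ℝ} (h : HasDerivAt g d (x * slope e μ)) :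
    HasDerivAt (fun μ : ℝ => g (x * slope e μ)) (d * (x * (e * Complex.I))) μ := by
  have h1 : HasDerivAt (fun μ : ℝ => (x : ℂ) * slope e μ) (x * (e * Complex.I)) μ := by
    have := ((((Complex.ofRealCLM.hasDerivAt (x := μ)).const_mul (e : ℂ)).mul_const
      Complex.I).const_add 1).const_mul (x : ℂ)
    simpa [slope] using this
  exact HasDerivAt.comp_of_eq μ h h1 rfl

/-- The cruder bound `1 / √μ` suffices near the axis because it is integrable, and it reproduces
itself: the distance to the singular points costs a factor `1 / μ` in the derivative with respect to
`μ`, and integration restores `1 / √μ`. -/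
theorem exists_mlog_bound_slope (h : IsSector E μ₀ e) (hz : ∀ b, z b ≠ 0) {m : ℝ} (hm : 0 < m)
    (hm' : m < μ₀) {l : List Φ} (hl : Adm E z l) :
    ∃ (A : ℝ) (k : ℕ), 0 ≤ A ∧ ∀ μ, 0 < μ → μ ≤ m → ∀ x : ℝ, 0 ≤ x →
      ‖mlog E μ₀ e z l (x * slope e μ)‖ ≤ A * (1 + x) ^ k / √μ := by
  induction l with
  | nil =>
    refine ⟨√m, 0, by positivity, fun μ hμ hμm x _ => ?_⟩
    simp only [mlog, norm_one, pow_zero, mul_one]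
    rw [one_le_div (Real.sqrt_pos.2 hμ)]
    exact Real.sqrt_le_sqrt hμm
  | cons b l ih =>
    obtain ⟨A, k, hA, hAk⟩ := ih hl.2
    obtain ⟨c, hc, hcE⟩ := h.norm_sub_ge hm hm'
    obtain ⟨κ, _, hκ⟩ := exists_mlog_bound h hz hm hm' one_pos le_rfl
    set C := max (1 / c) m with hC
    have hCpos : 0 < C := lt_max_of_lt_right hm
    have hder := ((mlog_spec h hz hl).2 b l rfl).2
    refine ⟨√m + 2 * (C * A), κ + k, by positivity, fun μ hμ hμm x hx => ?_⟩
    have hdom : ∀ μ, 0 < μ → μ ≤ m → (x : ℂ) * slope e μ ∈ dom E μ₀ e := fun μ hμ hμm =>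
      h.mul_slope_mem hx hμ.le (hμm.trans_lt hm') (Or.inr (Or.inl hμ))
    have hex : ∀ μ, 0 < μ ∧ μ ≤ m → ∃ d, HasDerivAt (mlog E μ₀ e z (b :: l)) d (x * slope e μ) ∧
        (wsum z (b :: l) - x * slope e μ) * d = mlog E μ₀ e z l (x * slope e μ) :=
      fun μ hμ => hder _ (hdom μ hμ.1 hμ.2)
    choose! d hd1 hd2 using hex
    have hbd : ∀ μ, 0 < μ → μ ≤ m → ‖d μ * (x * (e * Complex.I))‖ ≤
        C * A * (1 + x) ^ k / (μ * √μ) := by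
      intro μ hμ hμm
      have e1 : ‖d μ * (x * (e * Complex.I))‖ = ‖d μ‖ * x := by
        rw [norm_mul, norm_mul, norm_mul, Complex.norm_real, Complex.norm_real, Complex.norm_I,
          Real.norm_of_nonneg hx, Real.norm_eq_abs, h.abs_sign]
        ring
      have e2 : ‖d μ‖ * x ≤ C / μ * ‖mlog E μ₀ e z l (x * slope e μ)‖ := by
        rw [← hd2 μ ⟨hμ, hμm⟩, norm_mul]
        by_cases hs : wsum z (b :: l) = 0
        · rw [hs, zero_sub, norm_neg, norm_mul, Complex.norm_real, Real.norm_of_nonneg hx]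
          have h1 : 1 ≤ C / μ := by
            rw [one_le_div hμ]
            exact hμm.trans (le_max_right _ _)
          have h2 := norm_slope_ge e μ
          calc ‖d μ‖ * x = 1 * (x * 1 * ‖d μ‖) := by ring
            _ ≤ _ := by gcongr
        · have h1 := hcE _ hl.1 hs μ hμ hμm x hx
          calc ‖d μ‖ * x ≤ ‖d μ‖ * (1 + x) := by gcongr; linarith
            _ = (1 / c) / μ * (c * μ * (1 + x) * ‖d μ‖) := by field_simp
            _ ≤ _ := by
              gcongr
              exact le_max_left _ _
      rw [e1]
      refine e2.trans ?_
      calc C / μ * _ ≤ C / μ * (A * (1 + x) ^ k / √μ) := by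
            gcongr
            exact hAk μ hμ hμm x hx
        _ = _ := by rw [div_mul_div_comm]; ring
    have h1 := norm_le_of_deriv_rpow hm (by positivity)
      (fun μ hμ hμm => hasDerivAt_slope (hd1 μ ⟨hμ, hμm⟩)) hbd hμ hμm
    have h2 := hκ (b :: l) hl (by simp) x hx
    rw [one_pow, one_mul] at h2
    have h3 : 1 ≤ √m / √μ := by
      rw [one_le_div (Real.sqrt_pos.2 hμ)]
      exact Real.sqrt_le_sqrt hμm
    have h4 : (1 + x) ^ κ ≤ (1 + x) ^ (κ + k) := pow_le_pow_right₀ (by linarith) (by omega)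
    have h5 : (1 + x) ^ k ≤ (1 + x) ^ (κ + k) := pow_le_pow_right₀ (by linarith) (by omega)
    calc _ ≤ _ := h1
      _ ≤ √m / √μ * (1 + x) ^ (κ + k) + 2 * (C * A * (1 + x) ^ (κ + k)) / √μ := by
        gcongr
        calc _ ≤ (1 + x) ^ κ - 1 := h2
          _ ≤ (1 + x) ^ (κ + k) := by linarith
          _ ≤ _ := le_mul_of_one_le_left (by positivity) h3
      _ = _ := by ring

/-- Integrating the bound `1 / √μ` gives Hölder continuity of exponent `1/2` up to the axis, hence
boundary values. -/
theorem exists_mlogInt_holder (h : IsSector E μ₀ e) (hz : ∀ b, z b ≠ 0) {m : ℝ} (hm : 0 < m)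
    (hm' : m < μ₀) {l : List Φ} (hl : Adm E z l) :
    ∃ (A : ℝ) (k : ℕ), 0 ≤ A ∧ ∀ μ μ', 0 < μ → μ ≤ m → 0 < μ' → μ' ≤ m → ∀ x : ℝ, 0 ≤ x →
      ‖mlogInt E μ₀ e z l (x * slope e μ) - mlogInt E μ₀ e z l (x * slope e μ')‖ ≤
        A * (1 + x) ^ k * |√μ - √μ'| := by
  obtain ⟨A, k, hA, hAk⟩ := exists_mlog_bound_slope h hz hm hm' hl
  refine ⟨2 * A, k + 1, by positivity, fun μ μ' hμ hμm hμ' hμm' x hx => ?_⟩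
  have := norm_sub_le_sqrt_of_deriv (K := A * (1 + x) ^ (k + 1))
    (fun μ hμ hμm => hasDerivAt_slope ((mlogInt_spec h hz hl).2 _
      (h.mul_slope_mem hx hμ.le (hμm.trans_lt hm') (Or.inr (Or.inl hμ)))))
    (fun μ hμ hμm => by
      have e1 : ‖mlog E μ₀ e z l (x * slope e μ) * (x * (e * Complex.I))‖ =
          ‖mlog E μ₀ e z l (x * slope e μ)‖ * x := by
        rw [norm_mul, norm_mul, norm_mul, Complex.norm_real, Complex.norm_real, Complex.norm_I,
          Real.norm_of_nonneg hx, Real.norm_eq_abs, h.abs_sign]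
        ring
      rw [e1]
      calc _ ≤ A * (1 + x) ^ k / √μ * (1 + x) :=
            mul_le_mul (hAk μ hμ hμm x hx) (by linarith) hx (by positivity)
        _ = _ := by ring) hμ hμm hμ' hμm'
  calc _ ≤ _ := this
    _ = _ := by ring

/-- The boundary values on the real axis of the primitives of multilogarithms. -/
def bdry (E : Finset ℂ) (μ₀ e : ℝ) (z : Φ → ℂ) (l : List Φ) (x : ℝ) : ℂ :=
  Filter.limUnder (𝓝[>] (0 : ℝ)) fun μ => mlogInt E μ₀ e z l (x * slope e μ)

theorem tendsto_bdry (h : IsSector E μ₀ e) (hz : ∀ b, z b ≠ 0) {l : List Φ} (hl : Adm E z l)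
    {x : ℝ} (hx : 0 ≤ x) :
    Filter.Tendsto (fun μ : ℝ => mlogInt E μ₀ e z l (x * slope e μ)) (𝓝[>] 0)
      (𝓝 (bdry E μ₀ e z l x)) := by
  apply tendsto_nhds_limUnder
  have hm : 0 < μ₀ / 2 := half_pos h.pos
  obtain ⟨A, k, hA, hAk⟩ := exists_mlogInt_holder h hz hm (half_lt_self h.pos) hl
  refine cauchy_map_iff_exists_tendsto.1 ?_
  rw [Metric.cauchy_iff]
  refine ⟨inferInstance, fun ε hε => ?_⟩
  set K := A * (1 + x) ^ k + 1 with hK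
  have hKpos : 0 < K := by positivity
  set δ := min (μ₀ / 2) ((ε / (2 * K)) ^ 2) with hδ
  have hδpos : 0 < δ := lt_min hm (by positivity)
  refine ⟨_, Filter.image_mem_map (Ioo_mem_nhdsGT hδpos), ?_⟩
  rintro _ ⟨μ, hμ, rfl⟩ _ ⟨μ', hμ', rfl⟩
  have hs : ∀ μ ∈ Set.Ioo 0 δ, 0 ≤ √μ ∧ √μ < ε / (2 * K) := fun μ hμ => by
    refine ⟨Real.sqrt_nonneg _, ?_⟩
    rw [Real.sqrt_lt' (by positivity)]
    exact hμ.2.trans_le (min_le_right _ _)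
  rw [dist_eq_norm]
  have h1 := hAk μ μ' hμ.1 (hμ.2.le.trans (min_le_left _ _)) hμ'.1
    (hμ'.2.le.trans (min_le_left _ _)) x hx
  have h2 : |√μ - √μ'| < ε / (2 * K) := by
    rw [abs_lt]
    constructor <;> linarith [(hs μ hμ).1, (hs μ hμ).2, (hs μ' hμ').1, (hs μ' hμ').2]
  calc _ ≤ _ := h1
    _ ≤ K * (ε / (2 * K)) := by
      gcongr
      linarith
    _ < ε := by field_simp; linarith

theorem exists_bdry_bound (h : IsSector E μ₀ e) (hz : ∀ b, z b ≠ 0) {m : ℝ} (hm : 0 < m)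
    (hm' : m < μ₀) {l : List Φ} (hl : Adm E z l) :
    ∃ (A : ℝ) (k : ℕ), 0 ≤ A ∧ ∀ μ, 0 < μ → μ ≤ m → ∀ x : ℝ, 0 ≤ x →
      ‖mlogInt E μ₀ e z l (x * slope e μ) - bdry E μ₀ e z l x‖ ≤ A * (1 + x) ^ k * √μ := by
  obtain ⟨A, k, hA, hAk⟩ := exists_mlogInt_holder h hz hm hm' hl
  refine ⟨A, k, hA, fun μ hμ hμm x hx => ?_⟩
  refine le_of_tendsto (tendsto_const_nhds.sub (tendsto_bdry h hz hl hx)).norm ?_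
  filter_upwards [Ioo_mem_nhdsGT hμ] with μ' hμ'
  refine (hAk μ μ' hμ hμm hμ'.1 (hμ'.2.le.trans hμm) x hx).trans ?_
  have : √μ' ≤ √μ := Real.sqrt_le_sqrt hμ'.2.le
  have : |√μ - √μ'| ≤ √μ := by
    rw [abs_of_nonneg (by linarith)]
    linarith [Real.sqrt_nonneg μ']
  gcongr

theorem bdry_eq (h : IsSector E μ₀ e) (hz : ∀ b, z b ≠ 0) {l : List Φ} (hl : Adm E z l)
    {x : ℝ} (hx : 0 ≤ x) (hxd : (x : ℂ) ∈ dom E μ₀ e) :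
    bdry E μ₀ e z l x = mlogInt E μ₀ e z l x := by
  refine tendsto_nhds_unique (tendsto_bdry h hz hl hx) ?_
  have h1 : ContinuousAt (mlogInt E μ₀ e z l) (x : ℂ) :=
    ((mlogInt_spec h hz hl).2 _ hxd).continuousAt
  have h2 : Filter.Tendsto (fun μ : ℝ => (x : ℂ) * slope e μ) (𝓝[>] 0) (𝓝 (x : ℂ)) := by
    have : Continuous fun μ : ℝ => (x : ℂ) * slope e μ := by unfold slope; fun_prop
    simpa using (this.tendsto 0).mono_left nhdsWithin_le_nhds
  exact h1.tendsto.comp h2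

theorem bdry_zero (h : IsSector E μ₀ e) (hz : ∀ b, z b ≠ 0) {l : List Φ} (hl : Adm E z l) :
    bdry E μ₀ e z l 0 = 0 := by
  rw [bdry_eq h hz hl le_rfl (by simpa using h.zero_mem)]
  simpa using (mlogInt_spec h hz hl).1

theorem polyGrowth_mlogInt (h : IsSector E μ₀ e) (hz : ∀ b, z b ≠ 0) {μ : ℝ} (hμ : 0 < μ)
    (hμ' : μ < μ₀) {l : List Φ} (hl : Adm E z l) :
    PolyGrowth fun x => mlogInt E μ₀ e z l (x * slope e μ) := by
  have hd : ∀ x : ℝ, 0 ≤ x → HasDerivAt (fun x : ℝ => mlogInt E μ₀ e z l (x * slope e μ))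
      (mlog E μ₀ e z l (x * slope e μ) * slope e μ) x := fun x hx =>
    hasDerivAt_ray ((mlogInt_spec h hz hl).2 _
      (h.mul_slope_mem hx hμ.le hμ' (Or.inr (Or.inl hμ))))
  refine ⟨fun x hx => (hd x hx).continuousAt.continuousWithinAt, ?_⟩
  obtain ⟨-, C, κ, hC, hCκ⟩ := polyGrowth_mlog h hz hμ hμ' hl
  refine ⟨C * ‖slope e μ‖, κ + 1, by positivity, fun x hx => ?_⟩
  have := (convex_Icc (0 : ℝ) x).norm_image_sub_le_of_norm_hasDerivWithin_le
    (C := C * (1 + x) ^ κ * ‖slope e μ‖)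
    (fun y hy => (hd y hy.1).hasDerivWithinAt) (fun y hy => by
      rw [norm_mul]
      gcongr
      refine (hCκ y hy.1).trans ?_
      have := hy.1
      gcongr
      exact hy.2) (Set.left_mem_Icc.2 hx) (Set.right_mem_Icc.2 hx)
  have h0 := (mlogInt_spec h hz hl).1
  simp only [Complex.ofReal_zero, zero_mul, h0, sub_zero] at this
  rw [Real.norm_of_nonneg hx] at this
  refine this.trans ?_
  have hx1 : x ≤ 1 + x := by linarith
  calc _ ≤ C * (1 + x) ^ κ * ‖slope e μ‖ * (1 + x) := by gcongr
    _ = _ := by ring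

theorem exists_mlogInt_bound (h : IsSector E μ₀ e) (hz : ∀ b, z b ≠ 0) {m : ℝ} (hm : 0 < m)
    (hm' : m < μ₀) {l : List Φ} (hl : Adm E z l) :
    ∃ (A : ℝ) (k : ℕ), 0 ≤ A ∧ ∀ μ, 0 < μ → μ ≤ m → ∀ x : ℝ, 0 ≤ x →
      ‖mlogInt E μ₀ e z l (x * slope e μ)‖ ≤ A * (1 + x) ^ k := by
  obtain ⟨A, k, hA, hAk⟩ := exists_mlogInt_holder h hz hm hm' hl
  obtain ⟨-, C, κ, hC, hCκ⟩ := polyGrowth_mlogInt h hz hm hm' hl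
  refine ⟨C + A * √m, κ + k, by positivity, fun μ hμ hμm x hx => ?_⟩
  have h1 := hAk μ m hμ hμm hm le_rfl x hx
  have h2 := hCκ x hx
  have h3 : |√μ - √m| ≤ √m := by
    have := Real.sqrt_le_sqrt hμm
    rw [abs_of_nonpos (by linarith)]
    linarith [Real.sqrt_nonneg μ]
  have h4 : (1 + x) ^ κ ≤ (1 + x) ^ (κ + k) := pow_le_pow_right₀ (by linarith) (by omega)
  have h5 : (1 + x) ^ k ≤ (1 + x) ^ (κ + k) := pow_le_pow_right₀ (by linarith) (by omega)
  calc ‖mlogInt E μ₀ e z l (x * slope e μ)‖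
      ≤ ‖mlogInt E μ₀ e z l (x * slope e m)‖ +
        ‖mlogInt E μ₀ e z l (x * slope e μ) - mlogInt E μ₀ e z l (x * slope e m)‖ := by
        simpa using norm_add_le (mlogInt E μ₀ e z l (x * slope e m))
          (mlogInt E μ₀ e z l (x * slope e μ) - mlogInt E μ₀ e z l (x * slope e m))
    _ ≤ C * (1 + x) ^ (κ + k) + A * (1 + x) ^ (κ + k) * √m := by
        refine add_le_add (h2.trans (by gcongr)) (h1.trans (by gcongr))
    _ = _ := by ring

theorem polyGrowth_bdry (h : IsSector E μ₀ e) (hz : ∀ b, z b ≠ 0) {l : List Φ}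
    (hl : Adm E z l) : PolyGrowth (bdry E μ₀ e z l) := by
  have hm : 0 < μ₀ / 2 := half_pos h.pos
  have hm' : μ₀ / 2 < μ₀ := half_lt_self h.pos
  refine ⟨?_, ?_⟩
  · obtain ⟨A, k, hA, hAk⟩ := exists_bdry_bound h hz hm hm' hl
    have hR : ∀ R : ℝ, 0 ≤ R → ContinuousOn (bdry E μ₀ e z l) (Set.Icc 0 R) := by
      intro R hR
      have hu : TendstoUniformlyOn (fun (μ : ℝ) (x : ℝ) => mlogInt E μ₀ e z l (x * slope e μ))
          (bdry E μ₀ e z l) (𝓝[>] 0) (Set.Icc 0 R) := by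
        rw [Metric.tendstoUniformlyOn_iff]
        intro ε hε
        have h1 : Filter.Tendsto (fun μ : ℝ => A * (1 + R) ^ k * √μ) (𝓝[>] 0) (𝓝 0) := by
          have : Continuous fun μ : ℝ => A * (1 + R) ^ k * √μ := by fun_prop
          simpa using (this.tendsto 0).mono_left nhdsWithin_le_nhds
        filter_upwards [h1.eventually (gt_mem_nhds hε), Ioo_mem_nhdsGT hm] with μ hμ1 hμ2 x hx
        rw [dist_comm, dist_eq_norm]
        refine (hAk μ hμ2.1 hμ2.2.le x hx.1).trans_lt (lt_of_le_of_lt ?_ hμ1)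
        have := hx.1
        gcongr
        exact hx.2
      refine hu.continuousOn (Filter.Eventually.frequently ?_)
      filter_upwards [Ioo_mem_nhdsGT hm] with μ hμ
      exact (polyGrowth_mlogInt h hz hμ.1 (hμ.2.trans hm') hl).1.mono Set.Icc_subset_Ici_self
    intro x hx
    have hx' : 0 ≤ x := hx
    have := hR (x + 1) (by linarith) x ⟨hx, by linarith⟩
    refine this.mono_of_mem_nhdsWithin ?_
    rw [mem_nhdsWithin]
    exact ⟨Set.Iio (x + 1), isOpen_Iio, by simp, fun y hy => ⟨hy.2, le_of_lt hy.1⟩⟩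
  · obtain ⟨A, k, hA, hAk⟩ := exists_mlogInt_bound h hz hm hm' hl
    refine ⟨A, k, hA, fun x hx => le_of_tendsto (tendsto_bdry h hz hl hx).norm ?_⟩
    filter_upwards [Ioo_mem_nhdsGT hm] with μ hμ using hAk μ hμ.1 hμ.2.le x hx

theorem qser_eq_lap_mlogInt (h : IsSector E μ₀ e) (hz : ∀ b, z b ≠ 0) {μ : ℝ} (hμ : 0 < μ)
    (hμ' : μ < μ₀) {l : List Φ} (hl : Adm E z l) {τ : ℂ} (hτ : 0 < (slope e μ * τ).re) :
    qser E μ₀ e z μ l τ = slope e μ * τ ^ 2 *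
      lap (fun x => mlogInt E μ₀ e z l (x * slope e μ)) (slope e μ * τ) := by
  have h1 := lap_deriv (polyGrowth_mlogInt h hz hμ hμ' hl)
    ((polyGrowth_mlog h hz hμ hμ' hl).const_mul (slope e μ))
    (fun x hx => by
      rw [mul_comm]
      exact hasDerivAt_ray ((mlogInt_spec h hz hl).2 _
        (h.mul_slope_mem hx.le hμ.le hμ' (Or.inr (Or.inl hμ))))) hτ
  have h0 := (mlogInt_spec h hz hl).1
  rw [lap_const_mul] at h1
  simp only [Complex.ofReal_zero, zero_mul, h0, sub_zero] at h1
  rw [qser]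
  linear_combination τ * h1

/-- The left side does not depend on `μ`, so the ray of integration may be turned to the real axis.
The limit is taken under the integral after one integration by parts, since only the primitives have
boundary values at every point. -/
theorem qser_eq_lap_bdry (h : IsSector E μ₀ e) (hz : ∀ b, z b ≠ 0) {μ : ℝ} (hμ : 0 < μ)
    (hμ' : μ < μ₀) {l : List Φ} (hl : Adm E z l) {τ : ℂ} (hτ : 0 < (slope e μ * τ).re)
    (hτ0 : 0 < τ.re) : qser E μ₀ e z μ l τ = τ ^ 2 * lap (bdry E μ₀ e z l) τ := by
  have hm : 0 < μ₀ / 2 := half_pos h.pos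
  have hm' : μ₀ / 2 < μ₀ := half_lt_self h.pos
  obtain ⟨A, k, hA, hAk⟩ := exists_mlogInt_bound h hz hm hm' hl
  have hcs : Continuous fun μ : ℝ => slope e μ * τ := by unfold slope; fun_prop
  have hre : Filter.Tendsto (fun μ : ℝ => (slope e μ * τ).re) (𝓝[>] 0) (𝓝 τ.re) := by
    have := ((Complex.continuous_re.comp hcs).tendsto 0).mono_left
      (nhdsWithin_le_nhds (s := Set.Ioi 0))
    simpa only [Function.comp_def, slope_zero, one_mul] using this
  have hev : ∀ᶠ μ' in 𝓝[>] (0 : ℝ), 0 < μ' ∧ μ' ≤ μ₀ / 2 ∧ τ.re / 2 < (slope e μ' * τ).re := by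
    filter_upwards [hre.eventually (lt_mem_nhds (half_lt_self hτ0)), Ioo_mem_nhdsGT hm] with μ' h1 h2
      using ⟨h2.1, h2.2.le, h1⟩
  have hPG : PolyGrowth fun x => (A * (1 + x) ^ k : ℂ) := by
    refine ⟨by fun_prop, A, k, hA, fun x hx => ?_⟩
    have : (A * (1 + x) ^ k : ℂ) = ((A * (1 + x) ^ k : ℝ) : ℂ) := by push_cast; rfl
    simp only [this]
    rw [Complex.norm_real, Real.norm_of_nonneg (by positivity)]
  obtain ⟨C, hC, hCb⟩ := hPG.exists_bound (half_pos hτ0)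
  have hlim : Filter.Tendsto (fun μ' : ℝ => slope e μ' * τ ^ 2 *
      lap (fun x => mlogInt E μ₀ e z l (x * slope e μ')) (slope e μ' * τ)) (𝓝[>] 0)
      (𝓝 (1 * τ ^ 2 * lap (bdry E μ₀ e z l) τ)) := by
    refine Filter.Tendsto.mul ?_ ?_
    · have : Continuous fun μ : ℝ => slope e μ * τ ^ 2 := by unfold slope; fun_prop
      have := (this.tendsto 0).mono_left (nhdsWithin_le_nhds (s := Set.Ioi 0))
      simpa using this
    · refine MeasureTheory.tendsto_integral_filter_of_dominated_convergence
        (fun x => C * Real.exp (-(τ.re / 2 / 2) * x)) ?_ ?_ ?_ ?_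
      · filter_upwards [hev] with μ' hμ2
        exact (polyGrowth_mlogInt h hz hμ2.1 (hμ2.2.1.trans_lt hm') hl).aestronglyMeasurable _
      · filter_upwards [hev] with μ' hμ2
        filter_upwards [MeasureTheory.ae_restrict_mem measurableSet_Ioi] with x hx
        have hx : 0 < x := hx
        refine le_trans ?_ (hCb x hx.le (slope e μ' * τ) hμ2.2.2.le)
        rw [norm_mul, norm_mul]
        gcongr
        refine (hAk μ' hμ2.1 hμ2.2.1 x hx.le).trans (le_of_eq ?_)
        have : (A * (1 + x) ^ k : ℂ) = ((A * (1 + x) ^ k : ℝ) : ℂ) := by push_cast; rfl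
        rw [this, Complex.norm_real, Real.norm_of_nonneg (by positivity)]
      · exact (exp_neg_integrableOn_Ioi 0 (half_pos (half_pos hτ0))).const_mul C
      · filter_upwards [MeasureTheory.ae_restrict_mem measurableSet_Ioi] with x hx
        refine Filter.Tendsto.mul ?_ (tendsto_bdry h hz hl (le_of_lt hx))
        have : Continuous fun μ : ℝ => Complex.exp (-(x * (slope e μ * τ))) := by
          unfold slope; fun_prop
        have := (this.tendsto 0).mono_left (nhdsWithin_le_nhds (s := Set.Ioi 0))
        simpa using this
  rw [one_mul] at hlim
  refine tendsto_nhds_unique (tendsto_const_nhds.congr' ?_) hlim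
  filter_upwards [hev] with μ' hμ2
  have hpos : 0 < (slope e μ' * τ).re := (half_pos hτ0).trans hμ2.2.2
  rw [qser_indep h hz hμ hμ' hμ2.1 (hμ2.2.1.trans_lt hm') hl hτ hpos,
    qser_eq_lap_mlogInt h hz hμ2.1 (hμ2.2.1.trans_lt hm') hl hpos]

end Boundary

/-! ### Boundary values near a singular point and the jump across the axis -/

section Jump

variable {E : Finset ℂ} {μ₀ e : ℝ} {Φ : Type*} {z : Φ → ℂ}

/-- The boundary values on the positive real axis of the multilogarithms (away from the point of
logarithmic growth). -/
def bval (E : Finset ℂ) (μ₀ e : ℝ) (z : Φ → ℂ) : List Φ → ℝ → ℂ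
  | [], _ => 1
  | b :: l, x => (bdry E μ₀ e z l x - bdry E μ₀ e z (b :: l) x) / (wsum z (b :: l) - x)

/-- The part of the domain on one side of the real axis, including real points. -/
def halfDom (E : Finset ℂ) (μ₀ e : ℝ) : Set ℂ := {p | p ∈ dom E μ₀ e ∧ 0 ≤ e * p.im}

theorem IsSector.eq_mul_slope (h : IsSector E μ₀ e) {p : ℂ} (hp : 0 < p.re) :
    p = (p.re : ℂ) * slope e (e * p.im / p.re) := by
  have he : e * e = 1 := by rcases h.sign with rfl | rfl <;> norm_num
  apply Complex.ext
  · simp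
  · simp only [Complex.mul_im, Complex.ofReal_re, slope_im, Complex.ofReal_im, slope_re]
    field_simp
    linear_combination (-p.im) * he

theorem tendsto_slope (e : ℝ) {s : ℝ} (hs : 0 < s) :
    Filter.Tendsto (fun p : ℂ => e * p.im / p.re) (𝓝 (s : ℂ)) (𝓝 0) := by
  have : ContinuousAt (fun p : ℂ => e * p.im / p.re) (s : ℂ) :=
    ContinuousAt.div (by fun_prop) (by fun_prop) (by simpa using hs.ne')
  simpa [ContinuousAt] using this

theorem IsSector.eventually_mem_dom (h : IsSector E μ₀ e) {s : ℝ} (hs : 0 < s) :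
    ∀ᶠ p in 𝓝[≠] (s : ℂ), 0 ≤ e * p.im → p ∈ dom E μ₀ e := by
  have h1 : ∀ᶠ p in 𝓝[≠] (s : ℂ), p ∉ E := by
    have : ((E : Set ℂ) \ {(s : ℂ)})ᶜ ∈ 𝓝 (s : ℂ) :=
      ((E.finite_toSet.subset Set.sdiff_subset).isClosed.isOpen_compl).mem_nhds (by simp)
    filter_upwards [mem_nhdsWithin_of_mem_nhds this, self_mem_nhdsWithin] with p hp hp2 hpE
    exact hp ⟨hpE, hp2⟩
  have h2 : ∀ᶠ p in 𝓝[≠] (s : ℂ), 0 < p.re :=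
    mem_nhdsWithin_of_mem_nhds (Complex.continuous_re.continuousAt.eventually (lt_mem_nhds (by simpa using hs)))
  have h3 : ∀ᶠ p in 𝓝[≠] (s : ℂ), e * p.im / p.re < μ₀ :=
    mem_nhdsWithin_of_mem_nhds ((tendsto_slope e hs).eventually (gt_mem_nhds h.pos))
  filter_upwards [h1, h2, h3] with p hp1 hp2 hp3 hp
  rw [h.eq_mul_slope hp2]
  have h4 : 0 ≤ e * p.im / p.re := by positivity
  refine h.mul_slope_mem hp2.le h4 hp3 ?_
  rcases h4.eq_or_lt with h5 | h5
  · right; right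
    intro h6
    apply hp1
    rw [h.eq_mul_slope hp2, ← h5]
    simpa using h6
  · exact Or.inr (Or.inl h5)

theorem tendsto_mlogInt_bdry (h : IsSector E μ₀ e) (hz : ∀ b, z b ≠ 0) {l : List Φ}
    (hl : Adm E z l) {s : ℝ} (hs : 0 < s) :
    Filter.Tendsto (mlogInt E μ₀ e z l) (𝓝[halfDom E μ₀ e] (s : ℂ)) (𝓝 (bdry E μ₀ e z l s)) := by
  have hm : 0 < μ₀ / 2 := half_pos h.pos
  have hm' : μ₀ / 2 < μ₀ := half_lt_self h.pos
  obtain ⟨A, k, hA, hAk⟩ := exists_bdry_bound h hz hm hm' hl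
  have h1 : Filter.Tendsto (fun p : ℂ => bdry E μ₀ e z l p.re) (𝓝[halfDom E μ₀ e] (s : ℂ))
      (𝓝 (bdry E μ₀ e z l s)) := by
    have hc : ContinuousAt (bdry E μ₀ e z l) s :=
      (polyGrowth_bdry h hz hl).1.continuousAt (Ici_mem_nhds hs)
    have hre : Filter.Tendsto Complex.re (𝓝[halfDom E μ₀ e] (s : ℂ)) (𝓝 s) := by
      simpa using (Complex.continuous_re.tendsto (s : ℂ)).mono_left nhdsWithin_le_nhds
    exact hc.tendsto.comp hre
  have h2 : Filter.Tendsto (fun p : ℂ => A * (1 + p.re) ^ k * √(e * p.im / p.re)) (𝓝 (s : ℂ))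
      (𝓝 0) := by
    have h3 : Filter.Tendsto (fun p : ℂ => A * (1 + p.re) ^ k) (𝓝 (s : ℂ)) (𝓝 (A * (1 + s) ^ k)) := by
      have : Continuous fun p : ℂ => A * (1 + p.re) ^ k := by fun_prop
      simpa using this.tendsto (s : ℂ)
    have h4 : Filter.Tendsto (fun p : ℂ => √(e * p.im / p.re)) (𝓝 (s : ℂ)) (𝓝 0) := by
      simpa using (tendsto_slope e hs).sqrt
    simpa using h3.mul h4
  have h5 : Filter.Tendsto (fun p : ℂ => mlogInt E μ₀ e z l p - bdry E μ₀ e z l p.re)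
      (𝓝[halfDom E μ₀ e] (s : ℂ)) (𝓝 0) := by
    refine squeeze_zero_norm' ?_ (h2.mono_left nhdsWithin_le_nhds)
    have e2 : ∀ᶠ p in 𝓝[halfDom E μ₀ e] (s : ℂ), 0 < p.re :=
      mem_nhdsWithin_of_mem_nhds
        (Complex.continuous_re.continuousAt.eventually (lt_mem_nhds (by simpa using hs)))
    have e3 : ∀ᶠ p in 𝓝[halfDom E μ₀ e] (s : ℂ), e * p.im / p.re < μ₀ / 2 :=
      mem_nhdsWithin_of_mem_nhds ((tendsto_slope e hs).eventually (gt_mem_nhds hm))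
    filter_upwards [e2, e3, self_mem_nhdsWithin] with p hp2 hp3 hp
    have h4 : 0 ≤ e * p.im / p.re := div_nonneg hp.2 hp2.le
    have hp' := h.eq_mul_slope hp2
    rcases h4.eq_or_lt with h5 | h5
    · rw [← h5] at hp' ⊢
      rw [slope_zero, mul_one] at hp'
      have := bdry_eq h hz hl hp2.le (hp' ▸ hp.1)
      rw [this, ← hp']
      simp
    · have := hAk _ h5 hp3.le p.re hp2.le
      rwa [← hp'] at this
  simpa using h5.add h1

/-- `mlog_mul_add_mlogInt` is divided by the difference of the sum of the word and `p`, which has a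
nonzero limit. The limit exists even if a proper final part of the word has sum `s`. -/
theorem tendsto_mlog_bval (h : IsSector E μ₀ e) (hz : ∀ b, z b ≠ 0) {l : List Φ}
    (hl : Adm E z l) {s : ℝ} (hs : 0 < s) (hls : wsum z l ≠ s) :
    Filter.Tendsto (mlog E μ₀ e z l) (𝓝[halfDom E μ₀ e] (s : ℂ)) (𝓝 (bval E μ₀ e z l s)) := by
  rcases l with _ | ⟨b, l⟩
  · simp only [mlog, bval]
    exact tendsto_const_nhds
  · have h1 : Filter.Tendsto (fun p : ℂ => (mlogInt E μ₀ e z l p - mlogInt E μ₀ e z (b :: l) p) /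
        (wsum z (b :: l) - p)) (𝓝[halfDom E μ₀ e] (s : ℂ)) (𝓝 (bval E μ₀ e z (b :: l) s)) := by
      refine ((tendsto_mlogInt_bdry h hz hl.2 hs).sub (tendsto_mlogInt_bdry h hz hl hs)).div
        ?_ (sub_ne_zero.2 hls)
      exact (tendsto_const_nhds.sub Filter.tendsto_id).mono_left nhdsWithin_le_nhds
    refine h1.congr' ?_
    have h2 : ∀ᶠ p in 𝓝[halfDom E μ₀ e] (s : ℂ), p ≠ wsum z (b :: l) :=
      mem_nhdsWithin_of_mem_nhds (isOpen_ne.mem_nhds (Ne.symm hls))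
    filter_upwards [h2, self_mem_nhdsWithin] with p hp hp2
    rw [← mlog_mul_add_mlogInt h hz hl hp2.1, add_sub_cancel_right,
      mul_div_cancel_left₀ _ (sub_ne_zero.2 (Ne.symm hp))]

/-- A first order expansion at `s` within one side of the axis, where `s` itself may be singular:
the derivative of the primitive tends to `bval`, and the mean value inequality is applied on the
segment from `s` to `p`. -/
theorem norm_mlogInt_sub_le (h : IsSector E μ₀ e) (hz : ∀ b, z b ≠ 0) {l : List Φ}
    (hl : Adm E z l) {s : ℝ} (hs : 0 < s) (hls : wsum z l ≠ s) {ε : ℝ} (hε : 0 < ε) :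
    ∃ δ > 0, ∀ p : ℂ, p ≠ s → ‖p - s‖ < δ → 0 ≤ e * p.im → p ∈ dom E μ₀ e ∧
      ‖mlogInt E μ₀ e z l p - bdry E μ₀ e z l s - (p - s) * bval E μ₀ e z l s‖ ≤ ε * ‖p - s‖ := by
  have h1 := (tendsto_mlog_bval h hz hl hs hls).eventually (Metric.closedBall_mem_nhds _ hε)
  have h2 := h.eventually_mem_dom hs
  rw [eventually_nhdsWithin_iff] at h1 h2
  obtain ⟨δ, hδ, hδp⟩ := Metric.eventually_nhds_iff.1 (h1.and h2)
  refine ⟨δ, hδ, fun p hps hpδ hpe => ?_⟩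
  have hdisc : ∀ p : ℂ, p ≠ s → ‖p - s‖ < δ → 0 ≤ e * p.im → p ∈ dom E μ₀ e ∧
      ‖mlog E μ₀ e z l p - bval E μ₀ e z l s‖ ≤ ε := by
    intro p hps hpδ hpe
    obtain ⟨h3, h4⟩ := hδp (y := p) (by rwa [dist_eq_norm])
    have h5 := h4 hps hpe
    refine ⟨h5, ?_⟩
    have h6 := h3 ⟨h5, hpe⟩
    rwa [dist_eq_norm] at h6
  refine ⟨(hdisc p hps hpδ hpe).1, ?_⟩
  set c := bval E μ₀ e z l s with hc
  have hpt : ∀ t ∈ Set.Ioc (0 : ℝ) 1, (s : ℂ) + t * (p - s) ≠ s ∧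
      ‖(s : ℂ) + t * (p - s) - s‖ < δ ∧ 0 ≤ e * ((s : ℂ) + t * (p - s)).im := by
    intro t ht
    have ht0 := ht.1
    refine ⟨?_, ?_, ?_⟩
    · simp [sub_eq_zero, hps, ht0.ne']
    · rw [add_sub_cancel_left, norm_mul, Complex.norm_real, Real.norm_of_nonneg ht0.le]
      exact lt_of_le_of_lt (mul_le_of_le_one_left (norm_nonneg _) ht.2) hpδ
    · have : e * ((s : ℂ) + t * (p - s)).im = t * (e * p.im) := by simp; ring
      rw [this]
      positivity
  have hd : ∀ t ∈ Set.Ioc (0 : ℝ) 1, HasDerivWithinAt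
      (fun t : ℝ => mlogInt E μ₀ e z l (s + t * (p - s)) - (t * (p - s)) * c)
      ((mlog E μ₀ e z l (s + t * (p - s)) - c) * (p - s)) (Set.Ioc 0 1) t := by
    intro t ht
    obtain ⟨a1, a2, a3⟩ := hpt t ht
    have b1 := (mlogInt_spec h hz hl).2 _ (hdisc _ a1 a2 a3).1
    have b2 : HasDerivAt (fun t : ℝ => (s : ℂ) + t * (p - s)) (p - s) t := by
      simpa using ((Complex.ofRealCLM.hasDerivAt (x := t)).mul_const (p - s)).const_add (s : ℂ)
    have b3 : HasDerivAt (fun t : ℝ => (t : ℂ) * (p - s)) (p - s) t := by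
      simpa using (Complex.ofRealCLM.hasDerivAt (x := t)).mul_const (p - s)
    have b4 : HasDerivAt (fun t : ℝ => mlogInt E μ₀ e z l (s + t * (p - s)))
        (mlog E μ₀ e z l (s + t * (p - s)) * (p - s)) t := HasDerivAt.comp_of_eq t b1 b2 rfl
    refine ((b4.sub (b3.mul_const c)).congr_deriv ?_).hasDerivWithinAt
    ring
  have hb : ∀ t ∈ Set.Ioc (0 : ℝ) 1,
      ‖(mlog E μ₀ e z l (s + t * (p - s)) - c) * (p - s)‖ ≤ ε * ‖p - s‖ := by
    intro t ht
    obtain ⟨a1, a2, a3⟩ := hpt t ht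
    rw [norm_mul]
    gcongr
    exact (hdisc _ a1 a2 a3).2
  have hlim : Filter.Tendsto (fun t : ℝ => mlogInt E μ₀ e z l (s + t * (p - s)) - (t * (p - s)) * c)
      (𝓝[>] 0) (𝓝 (bdry E μ₀ e z l s - 0)) := by
    refine Filter.Tendsto.sub ?_ ?_
    · refine (tendsto_mlogInt_bdry h hz hl hs).comp (tendsto_nhdsWithin_iff.2 ⟨?_, ?_⟩)
      · have : Continuous fun t : ℝ => (s : ℂ) + t * (p - s) := by fun_prop
        simpa using (this.tendsto 0).mono_left nhdsWithin_le_nhds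
      · filter_upwards [Ioc_mem_nhdsGT one_pos] with t ht
        obtain ⟨a1, a2, a3⟩ := hpt t ht
        exact ⟨(hdisc _ a1 a2 a3).1, a3⟩
    · have : Continuous fun t : ℝ => (t : ℂ) * (p - s) * c := by fun_prop
      simpa using (this.tendsto 0).mono_left nhdsWithin_le_nhds
  have hfin : ‖(mlogInt E μ₀ e z l (s + ((1 : ℝ) : ℂ) * (p - s)) - (((1 : ℝ) : ℂ) * (p - s)) * c) -
      (bdry E μ₀ e z l s - 0)‖ ≤ ε * ‖p - s‖ := by
    refine le_of_tendsto (tendsto_const_nhds.sub hlim).norm ?_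
    filter_upwards [Ioc_mem_nhdsGT one_pos] with t ht
    refine ((convex_Ioc (0 : ℝ) 1).norm_image_sub_le_of_norm_hasDerivWithin_le hd hb ht
      (Set.right_mem_Ioc.2 one_pos)).trans ?_
    refine mul_le_of_le_one_right (by positivity) ?_
    rw [Real.norm_of_nonneg (by linarith [ht.2])]
    linarith [ht.1]
  simp only [Complex.ofReal_one, one_mul, add_sub_cancel, sub_zero] at hfin
  rw [show mlogInt E μ₀ e z l p - bdry E μ₀ e z l s - (p - s) * c =
    mlogInt E μ₀ e z l p - (p - s) * c - bdry E μ₀ e z l s by ring]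
  exact hfin

/-- For the primitives `H` of `b :: l` and `H_l` of `l` one has `((H - H_l(s)) / (s - p))' = (H_l -
H_l(s)) / (s - p)²`. Integrated over a half circle of radius `ρ` about `s`, the right side tends to
`e i π` times the derivative of `H_l` at `s`, and the left side gives the symmetric difference
quotient. -/
theorem tendsto_bdry_jump (h : IsSector E μ₀ e) (hz : ∀ b, z b ≠ 0) {b : Φ} {l : List Φ}
    (hl : Adm E z (b :: l)) {s : ℝ} (hs : 0 < s) (hls : wsum z (b :: l) = s) :
    Filter.Tendsto (fun ρ : ℝ => (bdry E μ₀ e z (b :: l) (s + ρ) + bdry E μ₀ e z (b :: l) (s - ρ) -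
      2 * bdry E μ₀ e z l s) / ρ) (𝓝[>] 0)
      (𝓝 (e * Complex.I * Real.pi * bval E μ₀ e z l s)) := by
  have hls' : wsum z l ≠ s := by
    intro h1
    rw [wsum_cons, h1] at hls
    exact hz b (by simpa using hls)
  rw [Metric.tendsto_nhds]
  intro ε hε
  obtain ⟨δ, hδ, hδp⟩ := norm_mlogInt_sub_le h hz hl.2 hs hls'
    (show 0 < ε / (2 * Real.pi) by have := Real.pi_pos; positivity)
  filter_upwards [Ioo_mem_nhdsGT (lt_min hδ hs)] with ρ hρ
  have hρ0 := hρ.1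
  have hρδ : ρ < δ := hρ.2.trans_le (min_le_left _ _)
  have hρs : ρ < s := hρ.2.trans_le (min_le_right _ _)
  have hρC : (ρ : ℂ) ≠ 0 := by exact_mod_cast hρ0.ne'
  have he : e * e = 1 := by rcases h.sign with rfl | rfl <;> norm_num
  set c := bval E μ₀ e z l s with hc
  set H := bdry E μ₀ e z l s with hH
  set w : ℝ → ℂ := fun φ => ρ * Complex.exp (e * φ * Complex.I) with hw
  have hwn : ∀ φ, ‖w φ‖ = ρ := fun φ => by
    simp only [hw]
    rw [norm_mul, Complex.norm_real, Real.norm_of_nonneg hρ0.le,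
      show (e * φ * Complex.I : ℂ) = ((e * φ : ℝ) : ℂ) * Complex.I by push_cast; ring,
      Complex.norm_exp_ofReal_mul_I, mul_one]
  have hw0 : ∀ φ, w φ ≠ 0 := fun φ h0 => by
    have := hwn φ
    rw [h0, norm_zero] at this
    exact hρ0.ne this
  have hpt : ∀ φ ∈ Set.Icc (0 : ℝ) Real.pi, (s : ℂ) + w φ ≠ s ∧ ‖(s : ℂ) + w φ - s‖ < δ ∧
      0 ≤ e * ((s : ℂ) + w φ).im := by
    intro φ hφ
    refine ⟨by simpa using hw0 φ, by rw [add_sub_cancel_left, hwn]; exact hρδ, ?_⟩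
    have e1 : ((s : ℂ) + w φ).im = ρ * Real.sin (e * φ) := by
      simp only [hw, Complex.add_im, Complex.ofReal_im, zero_add, Complex.im_ofReal_mul]
      rw [show (e * φ * Complex.I : ℂ) = ((e * φ : ℝ) : ℂ) * Complex.I by push_cast; ring,
        Complex.exp_ofReal_mul_I_im]
    have e2 : e * Real.sin (e * φ) = Real.sin φ := by
      rcases h.sign with rfl | rfl <;> simp
    rw [e1, mul_left_comm, e2]
    exact mul_nonneg hρ0.le (Real.sin_nonneg_of_nonneg_of_le_pi hφ.1 hφ.2)
  -- The limit `e i c φ` is subtracted in advance, so that the remaining derivative is small.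
  have hd : ∀ φ ∈ Set.Icc (0 : ℝ) Real.pi, HasDerivWithinAt
      (fun φ : ℝ => (mlogInt E μ₀ e z (b :: l) (s + w φ) - H) * (-(w φ)⁻¹) - e * Complex.I * c * φ)
      (e * Complex.I * ((mlogInt E μ₀ e z l (s + w φ) - H) * (w φ)⁻¹ - c))
      (Set.Icc 0 Real.pi) φ := by
    intro φ hφ
    obtain ⟨a1, a2, a3⟩ := hpt φ hφ
    have hmem := (hδp _ a1 a2 a3).1
    have b1 := (mlogInt_spec h hz hl).2 _ hmem
    have b2 : HasDerivAt w (w φ * (e * Complex.I)) φ := by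
      have b3 : HasDerivAt (fun φ : ℝ => (e * φ * Complex.I : ℂ)) (e * Complex.I) φ := by
        simpa using ((Complex.ofRealCLM.hasDerivAt (x := φ)).const_mul (e : ℂ)).mul_const Complex.I
      refine (b3.cexp.const_mul (ρ : ℂ)).congr_deriv ?_
      simp only [hw]
      ring
    have b4 : HasDerivAt (fun φ : ℝ => mlogInt E μ₀ e z (b :: l) (s + w φ))
        (mlog E μ₀ e z (b :: l) (s + w φ) * (w φ * (e * Complex.I))) φ :=
      HasDerivAt.comp_of_eq φ b1 (b2.const_add (s : ℂ)) rfl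
    have b5 := ((b4.sub_const H).mul (b2.fun_inv (hw0 φ)).fun_neg).sub
      ((Complex.ofRealCLM.hasDerivAt (x := φ)).const_mul (e * Complex.I * c : ℂ))
    refine (b5.congr_deriv ?_).hasDerivWithinAt
    have b6 := mlog_mul_add_mlogInt h hz hl hmem
    rw [hls] at b6
    have b7 := hw0 φ
    simp only [Complex.ofRealCLM_apply, Complex.ofReal_one, mul_one]
    rw [← b6]
    field_simp
    ring
  have hb : ∀ φ ∈ Set.Icc (0 : ℝ) Real.pi,
      ‖e * Complex.I * ((mlogInt E μ₀ e z l (s + w φ) - H) * (w φ)⁻¹ - c)‖ ≤ ε / (2 * Real.pi) := by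
    intro φ hφ
    obtain ⟨a1, a2, a3⟩ := hpt φ hφ
    have h1 := (hδp _ a1 a2 a3).2
    rw [add_sub_cancel_left, hwn] at h1
    have b7 := hw0 φ
    have e1 : (mlogInt E μ₀ e z l (s + w φ) - H) * (w φ)⁻¹ - c =
        (mlogInt E μ₀ e z l (s + w φ) - H - w φ * c) / w φ := by field_simp
    rw [e1, norm_mul, norm_mul, Complex.norm_real, Complex.norm_I, Real.norm_eq_abs, h.abs_sign,
      one_mul, one_mul, norm_div, hwn, div_le_iff₀ hρ0]
    exact h1
  have hfin := (convex_Icc (0 : ℝ) Real.pi).norm_image_sub_le_of_norm_hasDerivWithin_le hd hb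
    (Set.left_mem_Icc.2 Real.pi_pos.le) (Set.right_mem_Icc.2 Real.pi_pos.le)
  have hw1 : w 0 = ρ := by simp [hw]
  have hw2 : w Real.pi = -ρ := by
    simp only [hw]
    rcases h.sign with he | he
    · rw [he]; simp [Complex.exp_pi_mul_I]
    · rw [he]; simp [Complex.exp_neg, Complex.exp_pi_mul_I]
  have hm1 : ((s + ρ : ℝ) : ℂ) ∈ dom E μ₀ e := by
    obtain ⟨a1, a2, a3⟩ := hpt 0 (Set.left_mem_Icc.2 Real.pi_pos.le)
    have := (hδp _ a1 a2 a3).1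
    rw [hw1] at this
    exact_mod_cast this
  have hm2 : ((s - ρ : ℝ) : ℂ) ∈ dom E μ₀ e := by
    obtain ⟨a1, a2, a3⟩ := hpt Real.pi (Set.right_mem_Icc.2 Real.pi_pos.le)
    have := (hδp _ a1 a2 a3).1
    rw [hw2, ← sub_eq_add_neg] at this
    exact_mod_cast this
  rw [dist_eq_norm, bdry_eq h hz hl (by linarith) hm1, bdry_eq h hz hl (by linarith) hm2]
  rw [hw1, hw2, sub_zero, Real.norm_of_nonneg Real.pi_pos.le] at hfin
  push_cast
  have e3 : (mlogInt E μ₀ e z (b :: l) (s + ρ) + mlogInt E μ₀ e z (b :: l) (s - ρ) - 2 * H) / ρ -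
      e * Complex.I * Real.pi * c =
      (mlogInt E μ₀ e z (b :: l) (s + -ρ) - H) * (-(-(ρ : ℂ))⁻¹) - e * Complex.I * c * Real.pi -
      ((mlogInt E μ₀ e z (b :: l) (s + ρ) - H) * (-(ρ : ℂ)⁻¹) -
        e * Complex.I * c * ((0 : ℝ) : ℂ)) := by
    rw [← sub_eq_add_neg, inv_neg, neg_neg, Complex.ofReal_zero]
    field_simp
    ring
  rw [e3]
  refine hfin.trans_lt ?_
  have := Real.pi_pos
  field_simp
  linarith

end Jump

/-! ### The connection formula -/

section Connection

variable {E : Finset ℂ} {μ₀ e : ℝ} {Φ : Type*} {z : Φ → ℂ}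

/-- The sums of all nonempty factors of the word lie in `E`. -/
def AdmInf (E : Finset ℂ) (z : Φ → ℂ) (l : List Φ) : Prop :=
  ∀ l', l' <:+: l → l' ≠ [] → wsum z l' ∈ E

theorem AdmInf.adm {l l' : List Φ} (h : AdmInf E z l) (hl : l' <:+: l) : Adm E z l' :=
  adm_iff.2 fun _ h1 h2 => h _ (h1.isInfix.trans hl) h2

theorem AdmInf.mono {l l' : List Φ} (h : AdmInf E z l) (hl : l' <:+: l) : AdmInf E z l' :=
  fun _ h1 h2 => h _ (h1.trans hl) h2

open Classical in
/-- The coefficients that connect the multilogarithms on the two sides of the real axis. -/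
def connCoeff (E : Finset ℂ) (μ₀ : ℝ) (z : Φ → ℂ) : List Φ → ℂ
  | [] => 1
  | b :: l => if (wsum z (b :: l)).im = 0 ∧ 0 < (wsum z (b :: l)).re then
      2 * Real.pi * Complex.I * bval E μ₀ 1 z l (wsum z (b :: l)).re else 0

theorem connCoeff_ne_zero {l : List Φ} (h : connCoeff E μ₀ z l ≠ 0) :
    wsum z l = ((wsum z l).re : ℂ) ∧ 0 ≤ (wsum z l).re := by
  rcases l with _ | ⟨b, l⟩
  · simp
  · rw [connCoeff] at h
    split_ifs at h with h1
    · exact ⟨Complex.ext (by simp) (by simpa using h1.1), h1.2.le⟩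
    · exact absurd rfl h

theorem mlogInt_nil (h : IsSector E μ₀ e) {p : ℂ} (hp : p ∈ dom E μ₀ e) (hz : ∀ b, z b ≠ 0) :
    mlogInt E μ₀ e z [] p = p := by
  have hs := mlogInt_spec h hz (l := []) trivial
  have := isOpen_dom.is_const_of_deriv_eq_zero (f := fun p => mlogInt E μ₀ e z [] p - p)
    (isPreconnected_dom h)
    (fun p hp => ((hs.2 p hp).differentiableAt.sub differentiableAt_id).differentiableWithinAt)
    (fun p hp => by
      have := (hs.2 p hp).sub (hasDerivAt_id p)
      simp only [mlog, sub_self] at this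
      exact this.deriv) hp h.zero_mem
  simp only [hs.1, sub_zero] at this
  exact sub_eq_zero.1 this

theorem bdry_nil (h : IsSector E μ₀ e) (hz : ∀ b, z b ≠ 0) {x : ℝ} (hx : 0 ≤ x) :
    bdry E μ₀ e z [] x = x := by
  refine tendsto_nhds_unique (tendsto_bdry h hz (l := []) trivial hx) ?_
  have h2 : Filter.Tendsto (fun μ : ℝ => (x : ℂ) * slope e μ) (𝓝[>] 0) (𝓝 (x : ℂ)) := by
    have : Continuous fun μ : ℝ => (x : ℂ) * slope e μ := by unfold slope; fun_prop
    simpa using (this.tendsto 0).mono_left nhdsWithin_le_nhds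
  refine h2.congr' ?_
  filter_upwards [Ioo_mem_nhdsGT h.pos] with μ hμ
  rw [mlogInt_nil h (h.mul_slope_mem hx hμ.1.le hμ.2 (Or.inr (Or.inl hμ.1))) hz]

/-- The multilogarithm of a nonempty word vanishes at the origin, so its primitive has slope zero
there. -/
theorem tendsto_bdry_div (h : IsSector E μ₀ e) (hz : ∀ b, z b ≠ 0) {l : List Φ}
    (hl : Adm E z l) (hne : l ≠ []) :
    Filter.Tendsto (fun ρ : ℝ => bdry E μ₀ e z l ρ / ρ) (𝓝[>] 0) (𝓝 0) := by
  obtain ⟨b, l, rfl⟩ := List.exists_cons_of_ne_nil hne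
  have h1 := (mlogInt_spec h hz hl).2 0 h.zero_mem
  rw [((mlog_spec h hz hl).2 b l rfl).1] at h1
  have h2 : HasDerivAt (fun x : ℝ => mlogInt E μ₀ e z (b :: l) x) 0 0 := by
    have := HasDerivAt.comp_ofReal (z := (0 : ℝ)) (by simpa using h1)
    simpa using this
  have h3 := h2.tendsto_slope_zero_right
  simp only [zero_add, Complex.ofReal_zero, (mlogInt_spec h hz hl).1, sub_zero] at h3
  refine h3.congr' ?_
  have h4 : ∀ᶠ x : ℝ in 𝓝[>] 0, (x : ℂ) ∈ dom E μ₀ e := by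
    have : Filter.Tendsto (fun x : ℝ => (x : ℂ)) (𝓝[>] 0) (𝓝 0) := by
      simpa using (Complex.continuous_ofReal.tendsto 0).mono_left nhdsWithin_le_nhds
    exact this.eventually (isOpen_dom.mem_nhds h.zero_mem)
  filter_upwards [h4, self_mem_nhdsWithin] with x hx hx0
  rw [bdry_eq h hz hl (le_of_lt hx0) hx, div_eq_inv_mul, Complex.real_smul]
  simp

/-- `max (x - c) 0` encodes the shift to the right by `c`, extended by zero. The equation of the
primitives survives the shift with the singular point moved by `c`. -/
theorem hasDerivAt_bdry_shift (h : IsSector E μ₀ e) (hz : ∀ b, z b ≠ 0) {b : Φ} {l : List Φ}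
    (hl : Adm E z (b :: l)) {c x : ℝ} (hxc : x ≠ c) (hxE : ((x - c : ℝ) : ℂ) ∉ E) :
    ∃ d, HasDerivAt (fun x : ℝ => bdry E μ₀ e z (b :: l) (max (x - c) 0)) d x ∧
      (wsum z (b :: l) + c - x) * d + bdry E μ₀ e z (b :: l) (max (x - c) 0) =
        bdry E μ₀ e z l (max (x - c) 0) := by
  rcases lt_or_gt_of_ne hxc with hlt | hgt
  · refine ⟨0, ?_, ?_⟩
    · refine (hasDerivAt_const x (bdry E μ₀ e z (b :: l) 0)).congr_of_eventuallyEq ?_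
      filter_upwards [gt_mem_nhds hlt] with y hy
      rw [max_eq_right (by linarith)]
    · rw [max_eq_right (by linarith), bdry_zero h hz hl, bdry_zero h hz hl.2]
      simp
  · have hpos : 0 < x - c := by linarith
    have hdom := h.ofReal_mem hpos.le hxE
    rw [max_eq_left hpos.le, bdry_eq h hz hl hpos.le hdom, bdry_eq h hz hl.2 hpos.le hdom]
    refine ⟨mlog E μ₀ e z (b :: l) ((x - c : ℝ) : ℂ), ?_, ?_⟩
    · have h1 := (mlogInt_spec h hz hl).2 _ hdom
      have h2 : HasDerivAt (fun x : ℝ => ((x - c : ℝ) : ℂ)) 1 x := by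
        simpa using (Complex.ofRealCLM.hasDerivAt (x := x)).sub_const (c : ℂ)
      have h3 : HasDerivAt (fun x : ℝ => mlogInt E μ₀ e z (b :: l) ((x - c : ℝ) : ℂ))
          (mlog E μ₀ e z (b :: l) ((x - c : ℝ) : ℂ) * 1) x := HasDerivAt.comp_of_eq x h1 h2 rfl
      rw [mul_one] at h3
      refine h3.congr_of_eventuallyEq ?_
      have h4 : ∀ᶠ y : ℝ in 𝓝 x, ((y - c : ℝ) : ℂ) ∈ dom E μ₀ e :=
        h2.continuousAt.eventually (isOpen_dom.mem_nhds hdom)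
      filter_upwards [h4, lt_mem_nhds hgt] with y hy hyc
      rw [max_eq_left (by linarith), bdry_eq h hz hl (by linarith) hy]
    · rw [← mlog_mul_add_mlogInt h hz hl hdom]
      push_cast
      ring

theorem continuous_bdry_shift (h : IsSector E μ₀ e) (hz : ∀ b, z b ≠ 0) {l : List Φ}
    (hl : Adm E z l) (c : ℝ) : Continuous fun x : ℝ => bdry E μ₀ e z l (max (x - c) 0) := by
  rw [← continuousOn_univ]
  exact (polyGrowth_bdry h hz hl).1.comp (by fun_prop) fun x _ => Set.mem_Ici.2 (le_max_right _ _)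

/-- The right hand side of the connection formula. -/
def connSum (E : Finset ℂ) (μ₀ : ℝ) (z : Φ → ℂ) (l : List Φ) (x : ℝ) : ℂ :=
  ∑ i ∈ Finset.range (l.length + 1), connCoeff E μ₀ z (l.drop i) *
    bdry E μ₀ (-1) z (l.take i) (max (x - (wsum z (l.drop i)).re) 0)

-- The connection formulas of a word and of its tail are subtracted and divided by the sum of the
-- word minus `x`. That sum is the sum over the initial part plus the shift, so each summand becomes
-- a shifted boundary value.
open Classical in
theorem bval_connection (h2 : IsSector E μ₀ (-1)) (hz : ∀ b, z b ≠ 0)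
    {l : List Φ} (hl : AdmInf E z l)
    (hc : ∀ l', l' <:+ l → ∀ x, 0 ≤ x → bdry E μ₀ 1 z l' x = connSum E μ₀ z l' x) {x : ℝ}
    (hx : 0 < x) (hxl : wsum z l ≠ x) :
    bval E μ₀ 1 z l x = ∑ i ∈ Finset.range (l.length + 1), connCoeff E μ₀ z (l.drop i) *
      if (wsum z (l.drop i)).re < x then bval E μ₀ (-1) z (l.take i) (x - (wsum z (l.drop i)).re)
      else 0 := by
  rcases l with _ | ⟨b, l⟩
  · simp [bval, connCoeff, hx]
  · rw [bval, hc _ (List.suffix_cons b l) x hx.le, hc _ List.suffix_rfl x hx.le, connSum, connSum,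
      List.length_cons, Finset.sum_range_succ' _ (l.length + 1), Finset.sum_range_succ' _ (l.length + 1)]
    simp only [List.drop_succ_cons, List.take_succ_cons, List.drop_zero, List.take_zero]
    have hne : wsum z (b :: l) - x ≠ 0 := sub_ne_zero.2 hxl
    rw [bdry_nil h2 hz (le_max_right _ _), ← sub_sub, ← Finset.sum_sub_distrib, sub_div,
      Finset.sum_div, sub_eq_add_neg]
    congr 1
    · refine Finset.sum_congr rfl fun i _ => ?_
      by_cases hσ : connCoeff E μ₀ z (l.drop i) = 0
      · simp [hσ]
      · obtain ⟨hr, hr0⟩ := connCoeff_ne_zero hσ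
        set v := l.drop i with hv
        set u := l.take i with hu
        have hsum : wsum z (b :: l) = wsum z (b :: u) + wsum z v := by
          conv_lhs => rw [← List.take_append_drop i l]
          rw [← List.cons_append, wsum_append]
        have hadm : Adm E z (b :: u) := hl.adm
          (List.IsPrefix.isInfix (by simpa using List.take_prefix (i + 1) (b :: l)))
        rw [← mul_sub, mul_div_assoc]
        congr 1
        split_ifs with hlt
        · rw [max_eq_left (by linarith), bval, hsum]
          congr 1
          push_cast
          linear_combination hr
        · rw [max_eq_right (by linarith), bdry_zero h2 hz hadm, bdry_zero h2 hz hadm.2]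
          simp
    · by_cases hσ : connCoeff E μ₀ z (b :: l) = 0
      · simp [hσ]
      · obtain ⟨hr, hr0⟩ := connCoeff_ne_zero hσ
        have hne' : (wsum z (b :: l)).re ≠ x := fun h3 => hxl (by rw [hr, h3])
        rw [mul_div_assoc, ← mul_neg]
        congr 1
        split_ifs with hlt
        · rw [max_eq_left (by linarith)]
          rw [hr] at hne ⊢
          simp only [bval]
          push_cast
          rw [Complex.ofReal_re]
          field_simp
          ring
        · rw [max_eq_right (by linarith [lt_of_le_of_ne (not_lt.1 hlt) (Ne.symm hne')])]
          simp

theorem eq_of_hasDerivAt_zero_off_finite {f : ℝ → ℂ} {B : Set ℝ} (hB : B.Finite) {a b : ℝ}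
    (hab : a ≤ b) (hc : ContinuousOn f (Set.Icc a b))
    (hd : ∀ x ∈ Set.Ioo a b, x ∉ B → HasDerivAt f 0 x) : f b = f a := by
  have := MeasureTheory.integral_eq_of_hasDerivAt_off_countable_of_le f (fun _ => 0) hab
    hB.countable hc (fun x hx => hd x hx.1 hx.2) (by simp)
  simpa [sub_eq_zero, eq_comm] using this

/-- The connection formula: continuation of multilogarithms across the real axis. -/
theorem bdry_connection (h1 : IsSector E μ₀ 1) (h2 : IsSector E μ₀ (-1)) (hz : ∀ b, z b ≠ 0)
    {l : List Φ} (hl : AdmInf E z l) {x : ℝ} (hx : 0 ≤ x) :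
    bdry E μ₀ 1 z l x = connSum E μ₀ z l x := by
  classical
  suffices H : ∀ l, AdmInf E z l → ∀ l', l' <:+ l → ∀ x, 0 ≤ x →
      bdry E μ₀ 1 z l' x = connSum E μ₀ z l' x from H l hl l List.suffix_rfl x hx
  clear hl hx x l
  intro l
  induction l with
  | nil =>
    intro _ l' hl' x hx
    rw [List.suffix_nil] at hl'
    subst hl'
    rw [bdry_nil h1 hz hx]
    simp [connSum, connCoeff, bdry_nil h2 hz hx, hx]
  | cons b l ih =>
    intro hl l' hl'
    have hlt : AdmInf E z l := hl.mono (List.suffix_cons b l).isInfix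
    have ih := ih hlt
    rcases List.suffix_cons_iff.1 hl' with rfl | hl'
    swap
    · exact ih l' hl'
    set s := wsum z (b :: l) with hs
    have hA : Adm E z (b :: l) := hl.adm List.infix_rfl
    have hU : ∀ i, Adm E z (b :: l.take i) := fun i => hl.adm
      (List.IsPrefix.isInfix (by simpa using List.take_prefix (i + 1) (b :: l)))
    have hsum : ∀ i, s = wsum z (b :: l.take i) + wsum z (l.drop i) := fun i => by
      rw [hs]
      conv_lhs => rw [← List.take_append_drop i l]
      rw [← List.cons_append, wsum_append]
    set r : ℕ → ℝ := fun i => (wsum z (l.drop i)).re with hr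
    set σ : ℕ → ℂ := fun i => connCoeff E μ₀ z (l.drop i) with hσ
    have hσr : ∀ i, σ i ≠ 0 → wsum z (l.drop i) = (r i : ℂ) ∧ 0 ≤ r i := fun i hi =>
      connCoeff_ne_zero hi
    -- `Ψ` is the difference of the two sides without the one summand in which the whole word is
    -- connected. The shift by `0` gives all terms the same form.
    set Ψ : ℝ → ℂ := fun x => bdry E μ₀ 1 z (b :: l) (max (x - 0) 0) -
      ∑ i ∈ Finset.range (l.length + 1), σ i * bdry E μ₀ (-1) z (b :: l.take i) (max (x - r i) 0)
      with hΨ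
    -- it remains to compute `Ψ`
    suffices key : ∀ x, 0 ≤ x → Ψ x = connCoeff E μ₀ z (b :: l) * ((max (x - s.re) 0 : ℝ) : ℂ) by
      intro x hx
      have h3 := key x hx
      rw [connSum, List.length_cons, Finset.sum_range_succ']
      simp only [List.drop_succ_cons, List.take_succ_cons, List.drop_zero, List.take_zero]
      rw [bdry_nil h2 hz (le_max_right _ _), ← h3, hΨ]
      simp only [sub_zero, max_eq_left hx]
      ring
    have hΨc : Continuous Ψ := by
      refine (continuous_bdry_shift h1 hz hA 0).sub (continuous_finsetSum _ fun i _ => ?_)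
      exact (continuous_bdry_shift h2 hz (hU i) (r i)).const_mul _
    have hΨ0 : Ψ 0 = 0 := by
      simp only [hΨ, sub_self, max_self, bdry_zero h1 hz hA, zero_sub]
      rw [neg_eq_zero]
      refine Finset.sum_eq_zero fun i _ => ?_
      by_cases h0 : σ i = 0
      · simp [h0]
      · rw [max_eq_right (by linarith [(hσr i h0).2]), bdry_zero h2 hz (hU i), mul_zero]
    -- the finite set of points where the functions need not be differentiable
    set B : Set ℝ := (⋃ i ∈ Finset.range (l.length + 1), {x | x = r i ∨ ((x - r i : ℝ) : ℂ) ∈ E}) ∪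
      {x : ℝ | x = 0 ∨ ((x - 0 : ℝ) : ℂ) ∈ E} with hBdef
    have hBfin : B.Finite := by
      have h3 : ∀ c : ℝ, {x : ℝ | x = c ∨ ((x - c : ℝ) : ℂ) ∈ E}.Finite := by
        intro c
        refine (Set.finite_singleton c).union (Set.Finite.preimage (Function.Injective.injOn ?_)
          E.finite_toSet)
        intro x y hxy
        have : x - c = y - c := Complex.ofReal_injective hxy
        linarith
      exact (Set.Finite.biUnion (Finset.finite_toSet _) fun i _ => h3 _).union (h3 0)
    -- All terms satisfy an equation with the same singular point `s`, and their right sides cancel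
    -- by the induction hypothesis for `l`. Hence `Ψ / (s - x)` is constant on intervals that avoid
    -- `s`.
    have hder : ∀ x, 0 < x → x ∉ B → ∃ d, HasDerivAt Ψ d x ∧ (s - x) * d + Ψ x = 0 := by
      intro x hx hxB
      simp only [hBdef, Set.mem_union, Set.mem_iUnion, Finset.mem_range, Set.mem_ofPred_eq,
        not_or, not_exists] at hxB
      obtain ⟨hxB1, hxB2⟩ := hxB
      obtain ⟨d₀, hd₀, hd₀'⟩ := hasDerivAt_bdry_shift h1 hz hA hxB2.1 hxB2.2
      have hi : ∀ i, i < l.length + 1 → ∃ d, HasDerivAt (fun x : ℝ =>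
          bdry E μ₀ (-1) z (b :: l.take i) (max (x - r i) 0)) d x ∧
          (wsum z (b :: l.take i) + r i - x) * d +
            bdry E μ₀ (-1) z (b :: l.take i) (max (x - r i) 0) =
            bdry E μ₀ (-1) z (l.take i) (max (x - r i) 0) := fun i hi =>
        hasDerivAt_bdry_shift h2 hz (hU i) (hxB1 i hi).1 (hxB1 i hi).2
      choose! d hd hd' using hi
      refine ⟨d₀ - ∑ i ∈ Finset.range (l.length + 1), σ i * d i, ?_, ?_⟩
      · refine hd₀.sub (HasDerivAt.fun_sum fun i hi => ?_)
        exact (hd i (Finset.mem_range.1 hi)).const_mul _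
      · have e1 := ih l List.suffix_rfl x hx.le
        rw [connSum] at e1
        simp only [hΨ]
        rw [Complex.ofReal_zero, add_zero, sub_zero, max_eq_left hx.le, e1] at hd₀'
        rw [sub_zero, max_eq_left hx.le, mul_sub, Finset.mul_sum]
        have e2 : ∀ i ∈ Finset.range (l.length + 1), (s - x) * (σ i * d i) +
            σ i * bdry E μ₀ (-1) z (b :: l.take i) (max (x - r i) 0) =
            σ i * bdry E μ₀ (-1) z (l.take i) (max (x - r i) 0) := by
          intro i hi
          by_cases h0 : σ i = 0
          · simp [h0]
          · rw [← hd' i (Finset.mem_range.1 hi), hsum i, (hσr i h0).1]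
            ring
        have e3 := Finset.sum_congr rfl e2
        rw [Finset.sum_add_distrib] at e3
        linear_combination hd₀' - e3
    have hquot : ∀ a c : ℝ, 0 ≤ a → a ≤ c → (∀ x ∈ Set.Icc a c, s - (x : ℂ) ≠ 0) →
        Ψ c / (s - c) = Ψ a / (s - a) := by
      intro a c ha hac hne
      refine eq_of_hasDerivAt_zero_off_finite (f := fun x : ℝ => Ψ x / (s - x)) hBfin hac
        (hΨc.continuousOn.div (by fun_prop) hne) fun x hx hxB => ?_
      obtain ⟨d, hd, hd'⟩ := hder x (ha.trans_lt hx.1) hxB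
      have hden : HasDerivAt (fun x : ℝ => s - (x : ℂ)) (-1) x := by
        simpa using (Complex.ofRealCLM.hasDerivAt (x := x)).const_sub s
      refine (hd.div hden (hne x (Set.Ioo_subset_Icc_self hx))).congr_deriv ?_
      rw [show d * (s - x) - Ψ x * -1 = (s - x) * d + Ψ x by ring, hd', zero_div]
    intro x hx
    by_cases hreal : s.im = 0 ∧ 0 ≤ s.re
    swap
    · have hne : ∀ y ∈ Set.Icc 0 x, s - (y : ℂ) ≠ 0 := by
        intro y hy h0
        rw [sub_eq_zero] at h0
        exact hreal ⟨by simp [h0], by simpa [h0] using hy.1⟩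
      have h3 := hquot 0 x le_rfl hx hne
      rw [hΨ0, zero_div, div_eq_zero_iff] at h3
      rw [h3.resolve_right (hne x ⟨hx, le_rfl⟩), connCoeff,
        if_neg (fun h4 => hreal ⟨h4.1, h4.2.le⟩), zero_mul]
    obtain ⟨him, hre⟩ := hreal
    have hsr : s = (s.re : ℂ) := Complex.ext (by simp) (by simpa using him)
    have hbelow : ∀ x, 0 ≤ x → x < s.re → Ψ x = 0 := by
      intro x hx hxs
      have hne : ∀ y ∈ Set.Icc 0 x, s - (y : ℂ) ≠ 0 := by
        intro y hy h0
        rw [hsr, sub_eq_zero] at h0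
        have : s.re = y := by exact_mod_cast h0
        linarith [hy.2]
      have h3 := hquot 0 x le_rfl hx hne
      rw [hΨ0, zero_div, div_eq_zero_iff] at h3
      exact h3.resolve_right (hne x ⟨hx, le_rfl⟩)
    have hat : Ψ s.re = 0 := by
      rcases hre.eq_or_lt with h0 | h0
      · rw [← h0]; exact hΨ0
      · refine tendsto_nhds_unique (hΨc.tendsto s.re |>.mono_left
          (nhdsWithin_le_nhds (s := Set.Iio s.re))) (tendsto_const_nhds.congr' ?_)
        filter_upwards [Ioo_mem_nhdsLT h0] with y hy
        exact (hbelow y hy.1.le hy.2).symm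
    rcases le_or_gt x s.re with hxs | hxs
    · rw [max_eq_right (by linarith), Complex.ofReal_zero, mul_zero]
      rcases hxs.eq_or_lt with rfl | h0
      · exact hat
      · exact hbelow x hx h0
    rw [max_eq_left (by linarith)]
    -- `Ψ` is linear to the right of `s`
    have habove : ∀ ρ : ℝ, 0 < ρ → Ψ (s.re + ρ) / ρ = Ψ x / (x - s.re) := by
      have h3 : ∀ a c : ℝ, s.re < a → a ≤ c → Ψ c / (c - s.re) = Ψ a / (a - s.re) := by
        intro a c ha hac
        have h4 := hquot a c (by linarith) hac (by
          intro y hy h0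
          rw [hsr, sub_eq_zero] at h0
          have : s.re = y := by exact_mod_cast h0
          linarith [hy.1])
        rw [hsr] at h4
        rw [← neg_sub (s.re : ℂ), ← neg_sub (s.re : ℂ) (a : ℂ), div_neg, div_neg]
        simpa using h4
      intro ρ hρ
      have e1 : (ρ : ℂ) = ((s.re + ρ : ℝ) : ℂ) - s.re := by push_cast; ring
      rw [e1]
      rcases le_total (s.re + ρ) x with h4 | h4
      · exact (h3 _ _ (by linarith) h4).symm
      · exact h3 _ _ hxs h4
    -- `Ψ` vanishes up to `s` and is linear beyond, so only its slope to the right of `s` has to be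
    -- found.
    suffices hlim : Filter.Tendsto (fun ρ : ℝ => Ψ (s.re + ρ) / ρ) (𝓝[>] 0)
        (𝓝 (connCoeff E μ₀ z (b :: l))) by
      have h3 : Ψ x / (x - s.re) = connCoeff E μ₀ z (b :: l) := by
        refine tendsto_nhds_unique (tendsto_const_nhds.congr' ?_) hlim
        filter_upwards [self_mem_nhdsWithin] with ρ hρ
        exact (habove ρ hρ).symm
      have h4 : (x : ℂ) - s.re ≠ 0 := by
        rw [sub_ne_zero]
        exact_mod_cast hxs.ne'
      rw [← h3]
      push_cast
      field_simp
    rcases hre.eq_or_lt with h0 | h0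
    · -- the sum of the word vanishes
      rw [connCoeff, if_neg (fun h4 => by rw [← hs, ← h0] at h4; exact lt_irrefl _ h4.2), ← h0]
      have h3 : Filter.Tendsto (fun ρ : ℝ => bdry E μ₀ 1 z (b :: l) ρ / ρ -
          ∑ i ∈ Finset.range (l.length + 1),
            σ i * (bdry E μ₀ (-1) z (b :: l.take i) (max (ρ - r i) 0) / ρ)) (𝓝[>] 0)
          (𝓝 (0 - ∑ i ∈ Finset.range (l.length + 1), σ i * 0)) := by
        refine (tendsto_bdry_div h1 hz hA (by simp)).sub (tendsto_finsetSum _ fun i _ => ?_)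
        by_cases h4 : σ i = 0
        · simp [h4]
        · refine Filter.Tendsto.const_mul _ ?_
          rcases (hσr i h4).2.eq_or_lt with h5 | h5
          · rw [← h5]
            refine (tendsto_bdry_div h2 hz (hU i) (by simp)).congr' ?_
            filter_upwards [self_mem_nhdsWithin] with ρ hρ
            rw [sub_zero, max_eq_left (le_of_lt hρ)]
          · refine tendsto_const_nhds.congr' ?_
            filter_upwards [Ioo_mem_nhdsGT h5] with ρ hρ
            rw [max_eq_right (by linarith [hρ.2]), bdry_zero h2 hz (hU i), zero_div]
      simp only [mul_zero, Finset.sum_const_zero, sub_zero] at h3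
      refine h3.congr' ?_
      filter_upwards [self_mem_nhdsWithin] with ρ hρ
      have hρ : 0 < ρ := hρ
      simp only [hΨ, sub_zero, zero_add, max_eq_left hρ.le, sub_div, Finset.sum_div,
        mul_div_assoc]
    · -- the sum of the word is positive
      have hls' : wsum z l ≠ s.re := by
        intro h3
        rw [← hsr, hs, wsum_cons] at h3
        exact hz b (by linear_combination -h3)
      rw [connCoeff, if_pos ⟨him, h0⟩, ← hs]
      have hb1 := bval_connection h2 hz hlt ih h0 hls'
      set g : ℕ → ℂ := fun i => if r i < s.re then bval E μ₀ (-1) z (l.take i) (s.re - r i) else 0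
        with hg
      have hJ := tendsto_bdry_jump h1 hz hA h0 (by rw [← hs]; exact hsr)
      -- Only the terms with `r i < s` jump at `s`. For `r i = s` the shifted function starts at `s`
      -- with slope zero, and for `r i > s` it vanishes near `s`.
      have hJi : ∀ i ∈ Finset.range (l.length + 1), Filter.Tendsto (fun ρ : ℝ => σ i *
          ((bdry E μ₀ (-1) z (b :: l.take i) (max (s.re + ρ - r i) 0) +
            bdry E μ₀ (-1) z (b :: l.take i) (max (s.re - ρ - r i) 0) -
            2 * bdry E μ₀ (-1) z (l.take i) (max (s.re - r i) 0)) / ρ)) (𝓝[>] 0)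
          (𝓝 (σ i * (-1 * Complex.I * Real.pi * g i))) := by
        intro i _
        by_cases h4 : σ i = 0
        · simp [h4]
        refine Filter.Tendsto.const_mul _ ?_
        obtain ⟨h5, h6⟩ := hσr i h4
        have hsu : wsum z (b :: l.take i) = ((s.re - r i : ℝ) : ℂ) := by
          have := hsum i
          rw [h5] at this
          push_cast
          rw [← hsr]
          linear_combination -this
        rcases lt_trichotomy (r i) s.re with h7 | h7 | h7
        · have h8 := tendsto_bdry_jump h2 hz (hU i) (sub_pos.2 h7) hsu
          simp only [hg, if_pos h7]
          have h8' := h8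
          simp only [Complex.ofReal_neg, Complex.ofReal_one] at h8'
          refine h8'.congr' ?_
          filter_upwards [Ioo_mem_nhdsGT (sub_pos.2 h7)] with ρ hρ
          rw [max_eq_left (by linarith [hρ.1]), max_eq_left (by linarith [hρ.2]),
            max_eq_left (by linarith), show s.re + ρ - r i = s.re - r i + ρ by ring,
            show s.re - ρ - r i = s.re - r i - ρ by ring]
        · simp only [hg, if_neg h7.not_lt, mul_zero]
          refine (tendsto_bdry_div h2 hz (hU i) (by simp)).congr' ?_
          filter_upwards [self_mem_nhdsWithin] with ρ hρ
          have hρ : 0 < ρ := hρ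
          rw [max_eq_left (by linarith), max_eq_right (by linarith), max_eq_right (by linarith),
            bdry_zero h2 hz (hU i), bdry_zero h2 hz (hU i).2, show s.re + ρ - r i = ρ by linarith]
          simp
        · simp only [hg, if_neg h7.not_gt, mul_zero]
          refine tendsto_const_nhds.congr' ?_
          filter_upwards [Ioo_mem_nhdsGT (sub_pos.2 h7)] with ρ hρ
          rw [max_eq_right (by linarith [hρ.2]), max_eq_right (by linarith [hρ.1]),
            max_eq_right (by linarith), bdry_zero h2 hz (hU i), bdry_zero h2 hz (hU i).2]
          simp
      have hT := hJ.sub (tendsto_finsetSum _ hJi)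
      -- The two sides of the axis contribute one half each: by `bval_connection` the sum over `i`
      -- is again the boundary value from above.
      have e1 : ((1 : ℝ) : ℂ) * Complex.I * Real.pi * bval E μ₀ 1 z l s.re -
          ∑ i ∈ Finset.range (l.length + 1), σ i * (-1 * Complex.I * Real.pi * g i) =
          2 * Real.pi * Complex.I * bval E μ₀ 1 z l s.re := by
        have e2 : ∑ i ∈ Finset.range (l.length + 1), σ i * (-1 * Complex.I * Real.pi * g i) =
            -1 * Complex.I * Real.pi * ∑ i ∈ Finset.range (l.length + 1), σ i * g i := by
          rw [Finset.mul_sum]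
          exact Finset.sum_congr rfl fun i _ => by ring
        rw [e2, ← hb1]
        push_cast
        ring
      rw [e1] at hT
      refine hT.congr' ?_
      filter_upwards [Ioo_mem_nhdsGT h0] with ρ hρ
      have e3 : Ψ (s.re - ρ) = 0 := hbelow _ (by linarith [hρ.2]) (by linarith [hρ.1])
      have e4 := ih l List.suffix_rfl s.re h0.le
      rw [connSum] at e4
      -- Adding the vanishing value `Ψ (s - ρ)` produces the symmetric differences of the jump
      -- formula.
      rw [← add_zero (Ψ (s.re + ρ)), ← e3]
      simp only [hΨ, sub_zero]
      rw [max_eq_left (by linarith [hρ.1]), max_eq_left (by linarith [hρ.2]), e4]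
      simp only [div_eq_mul_inv, Finset.mul_sum, Finset.sum_mul, sub_mul, add_mul, mul_add, mul_sub,
        Finset.sum_add_distrib, Finset.sum_sub_distrib]
      have e5 : ∀ i, 2 * (σ i * bdry E μ₀ (-1) z (l.take i) (max (s.re - r i) 0)) * (ρ : ℂ)⁻¹ =
        σ i * (2 * bdry E μ₀ (-1) z (l.take i) (max (s.re - r i) 0) * (ρ : ℂ)⁻¹) := fun i => by ring
      have e6 : ∀ i (w : ℂ), σ i * w * (ρ : ℂ)⁻¹ = σ i * (w * (ρ : ℂ)⁻¹) := fun i w => by ring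
      simp only [hσ, hr] at e5 e6 ⊢
      simp only [e5, e6]
      ring

theorem PolyGrowth.shift {g : ℝ → ℂ} (hg : PolyGrowth g) {c : ℝ} (hc : 0 ≤ c) :
    PolyGrowth fun x => g (max (x - c) 0) := by
  obtain ⟨h1, C, κ, hC, hCκ⟩ := hg
  refine ⟨h1.comp (by fun_prop) fun x _ => Set.mem_Ici.2 (le_max_right _ _), C, κ, hC,
    fun x hx => (hCκ _ (le_max_right _ _)).trans ?_⟩
  gcongr
  exact max_le (by linarith) hx

theorem lap_shift {g : ℝ → ℂ} (h0 : g 0 = 0) {c : ℝ} (hc : 0 ≤ c) (τ : ℂ) :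
    lap (fun x => g (max (x - c) 0)) τ = Complex.exp (-(c * τ)) * lap g τ := by
  have h1 : ∫ x in Set.Ioi (0 : ℝ), Complex.exp (-(x * τ)) * g (max (x - c) 0) =
      ∫ x in Set.Ioi c, Complex.exp (-(x * τ)) * g (max (x - c) 0) := by
    refine (MeasureTheory.setIntegral_eq_of_subset_of_forall_sdiff_eq_zero measurableSet_Ioi
      (Set.Ioi_subset_Ioi hc) fun x hx => ?_)
    rw [max_eq_right (by have := hx.2; simp at this; linarith), h0, mul_zero]
  have h2 := (MeasureTheory.measurePreserving_add_right MeasureTheory.volume c).setIntegral_preimage_emb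
    (measurableEmbedding_addRight c)
    (fun x : ℝ => Complex.exp (-(x * τ)) * g (max (x - c) 0)) (Set.Ioi c)
  rw [lap, h1, ← h2, lap, ← MeasureTheory.integral_const_mul]
  simp only [Set.preimage_add_const_Ioi, sub_self]
  refine MeasureTheory.setIntegral_congr_fun measurableSet_Ioi fun x hx => ?_
  have hx : 0 < x := hx
  simp only [add_sub_cancel_right, max_eq_left hx.le]
  rw [← mul_assoc, ← Complex.exp_add]
  push_cast
  ring_nf

theorem lap_sum {ι : Type*} (s : Finset ι) {g : ι → ℝ → ℂ} (hg : ∀ i ∈ s, PolyGrowth (g i)) {τ : ℂ}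
    (hτ : 0 < τ.re) : lap (fun x => ∑ i ∈ s, g i x) τ = ∑ i ∈ s, lap (g i) τ := by
  simp only [lap, Finset.mul_sum]
  exact MeasureTheory.integral_finsetSum s fun i hi => (hg i hi).integrableOn hτ

/-- The connection formula for the flat sections. -/
theorem qser_connection (h1 : IsSector E μ₀ 1) (h2 : IsSector E μ₀ (-1)) (hz : ∀ b, z b ≠ 0)
    {l : List Φ} (hl : AdmInf E z l) {μ : ℝ} (hμ : 0 < μ) (hμ' : μ < μ₀) {τ : ℂ} (hτ : 0 < τ.re)
    (hτ1 : 0 < (slope 1 μ * τ).re) (hτ2 : 0 < (slope (-1) μ * τ).re) :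
    qser E μ₀ 1 z μ l τ = ((⟨fun u => qser E μ₀ (-1) z μ u τ⟩ : NCS Φ ℂ) *
      ⟨fun v => connCoeff E μ₀ z v * Complex.exp (-(wsum z v * τ))⟩) l := by
  rw [NCS.mul_eq_sum, qser_eq_lap_bdry h1 hz hμ hμ' (hl.adm List.infix_rfl) hτ1 hτ,
    lap_congr (fun x hx => bdry_connection h1 h2 hz hl hx.le)]
  have hU : ∀ i, Adm E z (l.take i) := fun i => hl.adm (List.take_prefix i l).isInfix
  have hP : ∀ i ∈ Finset.range (l.length + 1), PolyGrowth fun x => connCoeff E μ₀ z (l.drop i) *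
      bdry E μ₀ (-1) z (l.take i) (max (x - (wsum z (l.drop i)).re) 0) := by
    intro i _
    by_cases h0 : connCoeff E μ₀ z (l.drop i) = 0
    · simpa [h0] using PolyGrowth.const 0
    · exact ((polyGrowth_bdry h2 hz (hU i)).shift (connCoeff_ne_zero h0).2).const_mul _
  simp only [connSum]
  rw [lap_sum _ hP hτ, Finset.mul_sum]
  refine Finset.sum_congr rfl fun i _ => ?_
  by_cases h0 : connCoeff E μ₀ z (l.drop i) = 0
  · simp [h0, lap]
  · obtain ⟨h3, h4⟩ := connCoeff_ne_zero h0
    rw [lap_const_mul, lap_shift (bdry_zero h2 hz (hU i)) h4,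
      qser_eq_lap_bdry h2 hz hμ hμ' (hU i) hτ2 hτ, ← h3]
    ring

end Connection

/-! ### Independence of the set of singular points -/

section Restriction

variable {E E' : Finset ℂ} {μ₀ e : ℝ} {Φ : Type*} {z : Φ → ℂ}

theorem dom_anti (hE : E' ⊆ E) : dom E μ₀ e ⊆ dom E' μ₀ e := fun _ hp s hs => hp s (hE hs)

theorem IsSector.mono (h : IsSector E μ₀ e) (hE : E' ⊆ E) : IsSector E' μ₀ e :=
  ⟨h.pos, h.sign, fun s hs => h.out s (hE hs)⟩

theorem Adm.mono {l : List Φ} (hl : Adm E' z l) (hE : E' ⊆ E) : Adm E z l := by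
  rw [adm_iff] at *
  exact fun l' h1 h2 => hE (hl l' h1 h2)

/-- A larger set of singular points shrinks the domain but not the functions. Off the sum of the
word the derivatives agree by the equation, at that point by continuity. -/
theorem mlog_mono (h : IsSector E μ₀ e) (hE : E' ⊆ E) (hz : ∀ b, z b ≠ 0) {l : List Φ}
    (hl : Adm E' z l) {p : ℂ} (hp : p ∈ dom E μ₀ e) :
    mlog E μ₀ e z l p = mlog E' μ₀ e z l p := by
  induction l generalizing p with
  | nil => rfl
  | cons b l ih =>
    have h' := h.mono hE
    have hlE := hl.mono hE
    obtain ⟨h0, hd⟩ := (mlog_spec h hz hlE).2 b l rfl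
    obtain ⟨h0', hd'⟩ := (mlog_spec h' hz hl).2 b l rfl
    set g : ℂ → ℂ := fun p => mlog E μ₀ e z (b :: l) p - mlog E' μ₀ e z (b :: l) p with hg
    have hgd : DifferentiableOn ℂ g (dom E μ₀ e) :=
      (mlog_spec h hz hlE).1.sub ((mlog_spec h' hz hl).1.mono (dom_anti hE))
    have hne : ∀ q ∈ dom E μ₀ e, q ≠ wsum z (b :: l) → deriv g q = 0 := by
      intro q hq hqs
      obtain ⟨d, h1, h2⟩ := hd q hq
      obtain ⟨d', h1', h2'⟩ := hd' q (dom_anti hE hq)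
      rw [show deriv g q = d - d' from (h1.sub h1').deriv]
      rw [ih hl.2 hq, ← h2'] at h2
      exact sub_eq_zero.2 (mul_left_cancel₀ (sub_ne_zero.2 (Ne.symm hqs)) h2)
    have hall : ∀ q ∈ dom E μ₀ e, deriv g q = 0 := by
      intro q hq
      by_cases hqs : q = wsum z (b :: l)
      · have hc : ContinuousAt (deriv g) q :=
          ((hgd.deriv isOpen_dom).continuousOn).continuousAt (isOpen_dom.mem_nhds hq)
        refine tendsto_nhds_unique (hc.tendsto.mono_left (nhdsWithin_le_nhds (s := {q}ᶜ)))
          (tendsto_const_nhds.congr' ?_)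
        filter_upwards [self_mem_nhdsWithin, mem_nhdsWithin_of_mem_nhds (isOpen_dom.mem_nhds hq)]
          with r hr hr2
        exact (hne r hr2 (by rw [← hqs]; exact hr)).symm
      · exact hne q hq hqs
    have := isOpen_dom.is_const_of_deriv_eq_zero (isPreconnected_dom h) hgd hall hp h.zero_mem
    simp only [hg, h0, h0', sub_zero] at this
    exact sub_eq_zero.1 this

theorem mlogInt_mono (h : IsSector E μ₀ e) (hE : E' ⊆ E) (hz : ∀ b, z b ≠ 0) {l : List Φ}
    (hl : Adm E' z l) {p : ℂ} (hp : p ∈ dom E μ₀ e) :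
    mlogInt E μ₀ e z l p = mlogInt E' μ₀ e z l p := by
  have h1 := mlogInt_spec h hz (hl.mono hE)
  have h2 := mlogInt_spec (h.mono hE) hz hl
  have hd : ∀ q ∈ dom E μ₀ e,
      HasDerivAt (fun q => mlogInt E μ₀ e z l q - mlogInt E' μ₀ e z l q) 0 q := fun q hq => by
    refine ((h1.2 q hq).sub (h2.2 q (dom_anti hE hq))).congr_deriv ?_
    rw [mlog_mono h hE hz hl hq, sub_self]
  have := isOpen_dom.is_const_of_deriv_eq_zero (isPreconnected_dom h)
    (fun q hq => (hd q hq).differentiableAt.differentiableWithinAt)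
    (fun q hq => (hd q hq).deriv) hp h.zero_mem
  simp only [h1.1, h2.1, sub_zero] at this
  exact sub_eq_zero.1 this

theorem bdry_mono (h : IsSector E μ₀ e) (hE : E' ⊆ E) (hz : ∀ b, z b ≠ 0) {l : List Φ}
    (hl : Adm E' z l) {x : ℝ} (hx : 0 ≤ x) : bdry E μ₀ e z l x = bdry E' μ₀ e z l x := by
  refine tendsto_nhds_unique (tendsto_bdry h hz (hl.mono hE) hx)
    ((tendsto_bdry (h.mono hE) hz hl hx).congr' ?_)
  filter_upwards [Ioo_mem_nhdsGT h.pos] with μ hμ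
  exact (mlogInt_mono h hE hz hl (h.mul_slope_mem hx hμ.1.le hμ.2 (Or.inr (Or.inl hμ.1)))).symm

theorem bval_mono (h : IsSector E μ₀ e) (hE : E' ⊆ E) (hz : ∀ b, z b ≠ 0) {l : List Φ}
    (hl : Adm E' z l) {x : ℝ} (hx : 0 ≤ x) : bval E μ₀ e z l x = bval E' μ₀ e z l x := by
  rcases l with _ | ⟨b, l⟩
  · rfl
  · rw [bval, bval, bdry_mono h hE hz hl hx, bdry_mono h hE hz hl.2 hx]

end Restriction

/-! ### The indented segment -/

section Path

/-- The height of the indented segment. -/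
def bump (P : Finset ℝ) (δ x : ℝ) : ℝ := ∑ p ∈ P, √(δ ^ 2 - (x - p) ^ 2)

/-- The indented segment from `0` to the positive real number `ρ`. -/
def ipath (P : Finset ℝ) (ρ δ x : ℝ) : ℂ := ρ * (x + Complex.I * (bump P δ x : ℂ))

variable {P : Finset ℝ} {ρ δ : ℝ}

theorem bump_nonneg (P : Finset ℝ) (δ x : ℝ) : 0 ≤ bump P δ x :=
  Finset.sum_nonneg fun _ _ => Real.sqrt_nonneg _

theorem bump_le (hδ : 0 ≤ δ) (x : ℝ) : bump P δ x ≤ P.card * δ := by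
  rw [bump, ← nsmul_eq_mul]
  refine Finset.sum_le_card_nsmul _ _ _ fun p _ => ?_
  rw [Real.sqrt_le_left hδ]
  nlinarith [sq_nonneg (x - p)]

theorem bump_eq_zero {x : ℝ} (hδ : 0 ≤ δ) (h : ∀ p ∈ P, δ ≤ |x - p|) : bump P δ x = 0 := by
  refine Finset.sum_eq_zero fun p hp => Real.sqrt_eq_zero_of_nonpos ?_
  have := pow_le_pow_left₀ hδ (h p hp) 2
  rw [sq_abs] at this
  linarith

theorem continuous_ipath : Continuous (ipath P ρ δ) := by
  unfold ipath bump
  fun_prop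

theorem hasDerivAt_ipath {x : ℝ} (hx : ∀ p ∈ P, δ ^ 2 - (x - p) ^ 2 ≠ 0) :
    HasDerivAt (ipath P ρ δ) (deriv (ipath P ρ δ) x) x := by
  rw [hasDerivAt_deriv_iff]
  have h1 : DifferentiableAt ℝ (bump P δ) x := by
    unfold bump
    refine DifferentiableAt.fun_sum fun p hp => ?_
    exact DifferentiableAt.sqrt (by fun_prop) (hx p hp)
  have h2 : DifferentiableAt ℝ (fun x => (bump P δ x : ℂ)) x :=
    Complex.ofRealCLM.differentiableAt.comp x h1
  have h3 : DifferentiableAt ℝ (fun x : ℝ => (x : ℂ)) x := Complex.ofRealCLM.differentiableAt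
  unfold ipath
  fun_prop

theorem finite_sqrt_zeros (P : Finset ℝ) (δ : ℝ) :
    {x : ℝ | ¬ ∀ p ∈ P, δ ^ 2 - (x - p) ^ 2 ≠ 0}.Finite := by
  refine Set.Finite.subset (s := ⋃ p ∈ P, {p + δ, p - δ})
    (Set.Finite.biUnion P.finite_toSet fun p _ => by simp) ?_
  intro x hx
  simp only [Set.mem_ofPred_eq, not_forall, not_not, ne_eq] at hx
  obtain ⟨p, hp, h⟩ := hx
  simp only [Set.mem_iUnion]
  refine ⟨p, hp, ?_⟩
  have : (δ - (x - p)) * (δ + (x - p)) = 0 := by linear_combination h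
  rcases mul_eq_zero.1 this with h | h
  · left; linarith
  · right; simp; linarith

/-- The derivative is unbounded at the ends of the half circle, but the function is monotone on
either side of `p`, and derivatives of monotone functions are integrable. -/
theorem intervalIntegrable_deriv_sqrt (p δ a b : ℝ) :
    IntervalIntegrable (deriv fun x : ℝ => √(δ ^ 2 - (x - p) ^ 2)) MeasureTheory.volume a b := by
  have h1 : ∀ c, IntervalIntegrable (deriv fun x : ℝ => √(δ ^ 2 - (x - p) ^ 2))
      MeasureTheory.volume c p := by
    intro c
    rcases le_total c p with hc | hc
    · refine MonotoneOn.intervalIntegrable_deriv fun x hx y hy hxy => ?_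
      rw [Set.uIcc_of_le hc] at hx hy
      refine Real.sqrt_le_sqrt ?_
      nlinarith [hx.2, hy.2]
    · have : IntervalIntegrable (deriv fun x : ℝ => -√(δ ^ 2 - (x - p) ^ 2))
          MeasureTheory.volume c p := by
        refine MonotoneOn.intervalIntegrable_deriv fun x hx y hy hxy => ?_
        rw [Set.uIcc_of_ge hc] at hx hy
        refine neg_le_neg (Real.sqrt_le_sqrt ?_)
        nlinarith [hx.1, hy.1]
      have h2 : (deriv fun x : ℝ => -√(δ ^ 2 - (x - p) ^ 2)) =
          fun x => -(deriv (fun x : ℝ => √(δ ^ 2 - (x - p) ^ 2)) x) := by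
        funext x
        exact deriv.fun_neg
      rw [h2] at this
      have h3 := this.neg
      rwa [show (-fun x => -deriv (fun x : ℝ => √(δ ^ 2 - (x - p) ^ 2)) x) =
        deriv fun x : ℝ => √(δ ^ 2 - (x - p) ^ 2) from funext fun x => neg_neg _] at h3
  exact (h1 a).trans (h1 b).symm

theorem intervalIntegrable_deriv_ipath (P : Finset ℝ) (ρ δ a b : ℝ) :
    IntervalIntegrable (deriv (ipath P ρ δ)) MeasureTheory.volume a b := by
  have h1 : IntervalIntegrable (fun x : ℝ => (ρ : ℂ) * (1 + Complex.I *
      ((∑ p ∈ P, deriv (fun x : ℝ => √(δ ^ 2 - (x - p) ^ 2)) x : ℝ) : ℂ)))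
      MeasureTheory.volume a b := by
    refine IntervalIntegrable.const_mul (intervalIntegrable_const.add
      (IntervalIntegrable.const_mul ?_ _)) _
    have := IntervalIntegrable.sum (s := P) (μ := MeasureTheory.volume) (a := a) (b := b)
      (f := fun p => deriv fun x : ℝ => √(δ ^ 2 - (x - p) ^ 2))
      (fun p _ => intervalIntegrable_deriv_sqrt p δ a b)
    have h2 : ∀ {f : ℝ → ℝ}, IntervalIntegrable f MeasureTheory.volume a b →
        IntervalIntegrable (fun x => (f x : ℂ)) MeasureTheory.volume a b :=
      fun hf => ⟨hf.1.ofReal, hf.2.ofReal⟩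
    have h3 := h2 this
    simpa using h3
  refine h1.congr_ae ?_
  have h3 : ∀ᵐ x ∂MeasureTheory.volume, x ∉ {x : ℝ | ¬ ∀ p ∈ P, δ ^ 2 - (x - p) ^ 2 ≠ 0} :=
    (finite_sqrt_zeros P δ).countable.ae_notMem _
  filter_upwards [MeasureTheory.ae_restrict_of_ae h3] with x hx
  simp only [not_not] at hx
  symm
  have h4 : HasDerivAt (bump P δ) (∑ p ∈ P, deriv (fun x : ℝ => √(δ ^ 2 - (x - p) ^ 2)) x) x := by
    refine HasDerivAt.fun_sum fun p hp => DifferentiableAt.hasDerivAt ?_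
    exact DifferentiableAt.sqrt (by fun_prop) (hx p hp)
  have h5 := (((Complex.ofRealCLM.hasDerivAt (x := x)).add
    (h4.ofReal_comp.const_mul Complex.I)).const_mul (ρ : ℂ)).deriv
  rw [show deriv (ipath P ρ δ) x = _ from h5]
  simp

end Path

/-! ### Iterated integrals along the indented segment -/

section PathIntegrals

open MeasureTheory

variable {E : Finset ℂ} {μ₀ : ℝ} {Φ : Type*} {z : Φ → ℂ}

/-- The radius `δ` is small in terms of the indentations. -/
structure IsSmall (P : Finset ℝ) (μ₀ δ : ℝ) : Prop where
  pos : 0 < δ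
  left : ∀ p ∈ P, δ < p / 2
  right : ∀ p ∈ P, δ < (1 - p) / 2
  height : ∀ p ∈ P, P.card * δ < μ₀ * (p / 2)

theorem eventually_isSmall {P : Finset ℝ} (hP : ∀ p ∈ P, 0 < p ∧ p < 1) (hμ₀ : 0 < μ₀) :
    ∀ᶠ δ in 𝓝[>] (0 : ℝ), IsSmall P μ₀ δ := by
  have h1 : ∀ᶠ δ in 𝓝[>] (0 : ℝ), ∀ p ∈ P, δ < p / 2 ∧ δ < (1 - p) / 2 ∧
      P.card * δ < μ₀ * (p / 2) := by
    rw [Finset.eventually_all]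
    intro p hp
    obtain ⟨h0, h1⟩ := hP p hp
    have hlim : Filter.Tendsto (fun δ : ℝ => P.card * δ) (𝓝[>] 0) (𝓝 0) := by
      have : Continuous fun δ : ℝ => P.card * δ := by fun_prop
      simpa using (this.tendsto 0).mono_left nhdsWithin_le_nhds
    filter_upwards [Ioo_mem_nhdsGT (half_pos h0), Ioo_mem_nhdsGT (half_pos (sub_pos.2 h1)),
      hlim.eventually (gt_mem_nhds (show 0 < μ₀ * (p / 2) by positivity))] with δ h2 h3 h4
    exact ⟨h2.2, h3.2, h4⟩
  filter_upwards [h1, self_mem_nhdsWithin] with δ h2 h3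
  exact ⟨h3, fun p hp => (h2 p hp).1, fun p hp => (h2 p hp).2.1, fun p hp => (h2 p hp).2.2⟩

variable {P : Finset ℝ} {ρ δ : ℝ}

theorem ipath_re (P : Finset ℝ) (ρ δ x : ℝ) : (ipath P ρ δ x).re = ρ * x := by
  simp [ipath]

theorem ipath_im (P : Finset ℝ) (ρ δ x : ℝ) : (ipath P ρ δ x).im = ρ * bump P δ x := by
  simp [ipath]

/-- Where the path leaves the axis, its height is at most `P.card * δ` and its abscissa at least
half an indentation point, up to the scale `ρ`, so its slope stays below `μ₀`. Elsewhere it is a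
real point that is not in `E`. -/
theorem ipath_mem (h : IsSector E μ₀ 1) (hρ : 0 < ρ)
    (hPE : ∀ x : ℝ, 0 < x → x < 1 → ((ρ * x : ℝ) : ℂ) ∈ E → x ∈ P)
    (hP : ∀ p ∈ P, 0 < p ∧ p < 1) (hδ : IsSmall P μ₀ δ) {x : ℝ} (hx : 0 ≤ x) (hx1 : x < 1) :
    ipath P ρ δ x ∈ dom E μ₀ 1 := by
  rcases (bump_nonneg P δ x).eq_or_lt with h0 | h0
  · have e1 : ipath P ρ δ x = ((ρ * x : ℝ) : ℂ) := by simp [ipath, ← h0]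
    rw [e1]
    rcases hx.eq_or_lt with rfl | hx0
    · simpa using h.zero_mem
    · refine h.ofReal_mem (by positivity) fun hE => ?_
      have hxP := hPE x hx0 hx1 hE
      have h2 : √(δ ^ 2 - (x - x) ^ 2) ≤ bump P δ x :=
        Finset.single_le_sum (f := fun p => √(δ ^ 2 - (x - p) ^ 2))
          (fun _ _ => Real.sqrt_nonneg _) hxP
      rw [← h0, sub_self, zero_pow two_ne_zero, sub_zero, Real.sqrt_sq hδ.pos.le] at h2
      linarith [hδ.pos]
  · have hex : ∃ p ∈ P, |x - p| < δ := by
      by_contra hcon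
      push Not at hcon
      exact h0.ne' (bump_eq_zero hδ.pos.le hcon)
    obtain ⟨p, hp, hxp⟩ := hex
    have hp0 := (hP p hp).1
    have hxlow : p / 2 < x := by
      have h1 := (abs_lt.1 hxp).1
      have h2 := hδ.left p hp
      linarith
    have hx0 : 0 < x := by linarith
    have hslope : bump P δ x / x < μ₀ := by
      rw [div_lt_iff₀ hx0]
      calc bump P δ x ≤ P.card * δ := bump_le hδ.pos.le x
        _ < μ₀ * (p / 2) := hδ.height p hp
        _ ≤ μ₀ * x := mul_le_mul_of_nonneg_left hxlow.le h.pos.le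
    have e1 : ipath P ρ δ x = ((ρ * x : ℝ) : ℂ) * slope 1 (bump P δ x / x) := by
      apply Complex.ext
      · simp [ipath_re]
      · simp only [ipath_im, Complex.mul_im, Complex.ofReal_re, slope_im, Complex.ofReal_im, slope_re]
        field_simp
        ring
    rw [e1]
    exact h.mul_slope_mem (by positivity) (by positivity) hslope (Or.inr (Or.inl (by positivity)))

theorem exists_bump_eq_zero (hδ : IsSmall P μ₀ δ) (hP : ∀ p ∈ P, 0 < p ∧ p < 1) :
    ∃ η, 0 < η ∧ η < 1 ∧ ∀ x, 1 - η < x → bump P δ x = 0 := by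
  have h1 : ∀ᶠ η in 𝓝[>] (0 : ℝ), ∀ p ∈ P, η < (1 - p) / 2 := by
    rw [Finset.eventually_all]
    intro p hp
    filter_upwards [Ioo_mem_nhdsGT (half_pos (sub_pos.2 (hP p hp).2))] with η hη using hη.2
  obtain ⟨η, hη, hη0⟩ := (h1.and (Ioo_mem_nhdsGT one_pos)).exists
  refine ⟨η, hη0.1, hη0.2, fun x hx => bump_eq_zero hδ.pos.le fun p hp => ?_⟩
  have h2 := hη p hp
  have h3 := hδ.right p hp
  exact le_trans (by linarith) (le_abs_self (x - p))

theorem ipath_ne (h : IsSector E μ₀ 1) (hρ : 0 < ρ)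
    (hPE : ∀ x : ℝ, 0 < x → x < 1 → ((ρ * x : ℝ) : ℂ) ∈ E → x ∈ P)
    (hP : ∀ p ∈ P, 0 < p ∧ p < 1) (hδ : IsSmall P μ₀ δ) {x : ℝ} (hx : 0 < x) (hx1 : x < 1)
    {s : ℂ} (hs : s ∈ E) : s - ipath P ρ δ x ≠ 0 := by
  intro h0
  rw [sub_eq_zero] at h0
  by_cases hs0 : s = 0
  · have := ipath_re P ρ δ x
    rw [← h0, hs0, Complex.zero_re] at this
    have : 0 < ρ * x := by positivity
    linarith
  · exact notMem_dom (μ₀ := μ₀) (e := 1) hs hs0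
      (h0 ▸ ipath_mem h hρ hPE hP hδ hx.le hx1)

theorem hasDerivAt_mlog_ipath (h : IsSector E μ₀ 1) (hz : ∀ b, z b ≠ 0) (hρ : 0 < ρ)
    (hPE : ∀ x : ℝ, 0 < x → x < 1 → ((ρ * x : ℝ) : ℂ) ∈ E → x ∈ P)
    (hP : ∀ p ∈ P, 0 < p ∧ p < 1) (hδ : IsSmall P μ₀ δ) {b : Φ} {l : List Φ}
    (hl : Adm E z (b :: l)) {x : ℝ} (hx : 0 < x) (hx1 : x < 1)
    (hxP : ∀ p ∈ P, δ ^ 2 - (x - p) ^ 2 ≠ 0) :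
    HasDerivAt (fun x => mlog E μ₀ 1 z (b :: l) (ipath P ρ δ x))
      (mlog E μ₀ 1 z l (ipath P ρ δ x) *
        (deriv (ipath P ρ δ) x / (wsum z (b :: l) - ipath P ρ δ x))) x := by
  obtain ⟨d, hd, hd2⟩ := ((mlog_spec h hz hl).2 b l rfl).2 _ (ipath_mem h hρ hPE hP hδ hx.le hx1)
  have h1 : HasDerivAt (fun x => mlog E μ₀ 1 z (b :: l) (ipath P ρ δ x))
      (d * deriv (ipath P ρ δ) x) x := HasDerivAt.comp_of_eq x hd (hasDerivAt_ipath hxP) rfl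
  refine h1.congr_deriv ?_
  have hne := ipath_ne h hρ hPE hP hδ hx hx1 hl.1
  rw [← hd2]
  field_simp

theorem intervalIntegrable_mlog_ipath (h : IsSector E μ₀ 1) (hz : ∀ b, z b ≠ 0) (hρ : 0 < ρ)
    (hPE : ∀ x : ℝ, 0 < x → x < 1 → ((ρ * x : ℝ) : ℂ) ∈ E → x ∈ P)
    (hP : ∀ p ∈ P, 0 < p ∧ p < 1) (hδ : IsSmall P μ₀ δ) {b : Φ} {l : List Φ}
    (hl : Adm E z (b :: l)) {x : ℝ} (hx : 0 ≤ x) (hx1 : x < 1) :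
    IntervalIntegrable (fun u => mlog E μ₀ 1 z l (ipath P ρ δ u) *
        (deriv (ipath P ρ δ) u / (wsum z (b :: l) - ipath P ρ δ u))) volume 0 x := by
  have h1 : ContinuousOn (fun u => deriv (mlog E μ₀ 1 z (b :: l)) (ipath P ρ δ u))
      (Set.uIcc 0 x) := by
    refine (((mlog_spec h hz hl).1.deriv isOpen_dom).continuousOn).comp
      continuous_ipath.continuousOn fun u hu => ?_
    rw [Set.uIcc_of_le hx] at hu
    exact ipath_mem h hρ hPE hP hδ hu.1 (hu.2.trans_lt hx1)
  have h2 := (intervalIntegrable_deriv_ipath P ρ δ 0 x).continuousOn_mul h1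
  refine h2.congr fun u hu => ?_
  rw [Set.uIoc_of_le hx] at hu
  have hu1 : u < 1 := hu.2.trans_lt hx1
  obtain ⟨d, hd, hd2⟩ := ((mlog_spec h hz hl).2 b l rfl).2 _
    (ipath_mem h hρ hPE hP hδ hu.1.le hu1)
  have hne := ipath_ne h hρ hPE hP hδ hu.1 hu1 hl.1
  rw [hd.deriv, ← hd2]
  field_simp

theorem integral_mlog_ipath (h : IsSector E μ₀ 1) (hz : ∀ b, z b ≠ 0) (hρ : 0 < ρ)
    (hPE : ∀ x : ℝ, 0 < x → x < 1 → ((ρ * x : ℝ) : ℂ) ∈ E → x ∈ P)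
    (hP : ∀ p ∈ P, 0 < p ∧ p < 1) (hδ : IsSmall P μ₀ δ) {b : Φ} {l : List Φ}
    (hl : Adm E z (b :: l)) {x : ℝ} (hx : 0 ≤ x) (hx1 : x < 1) :
    ∫ u in (0 : ℝ)..x, mlog E μ₀ 1 z l (ipath P ρ δ u) *
        (deriv (ipath P ρ δ) u / (wsum z (b :: l) - ipath P ρ δ u)) =
      mlog E μ₀ 1 z (b :: l) (ipath P ρ δ x) := by
  have h0 : ipath P ρ δ 0 = 0 := by
    have : bump P δ 0 = 0 := bump_eq_zero hδ.pos.le fun p hp => by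
      have h1 := (hP p hp).1
      have h2 := hδ.left p hp
      rw [zero_sub, abs_neg, abs_of_pos h1]
      linarith
    simp [ipath, this]
  rw [integral_eq_of_hasDerivAt_off_countable_of_le
    (fun x => mlog E μ₀ 1 z (b :: l) (ipath P ρ δ x)) _ hx (finite_sqrt_zeros P δ).countable
    ?_ ?_ (intervalIntegrable_mlog_ipath h hz hρ hPE hP hδ hl hx hx1)]
  · rw [h0, ((mlog_spec h hz hl).2 b l rfl).1, sub_zero]
  · exact (mlog_spec h hz hl).1.continuousOn.comp continuous_ipath.continuousOn fun u hu =>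
      ipath_mem h hρ hPE hP hδ hu.1 (hu.2.trans_lt hx1)
  · rintro u ⟨hu, hu2⟩
    simp only [Set.mem_ofPred_eq, not_not] at hu2
    exact hasDerivAt_mlog_ipath h hz hρ hPE hP hδ hl hu.1 (hu.2.trans hx1) hu2

/-- The end point `ρ` may itself be the sum of a final part of the word, and then the integrands
have logarithmic singularities there. As before, the integrable bound `1 / √μ` in the distance `μ`
reproduces itself. -/
theorem exists_mlog_bound_endpoint (h : IsSector E μ₀ 1) (hz : ∀ b, z b ≠ 0) (hρ : 0 < ρ) :
    ∃ m, 0 < m ∧ m < ρ ∧ (∀ μ, 0 < μ → μ ≤ m → ((ρ - μ : ℝ) : ℂ) ∈ dom E μ₀ 1) ∧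
      ∀ l, Adm E z l → ∃ C, 0 ≤ C ∧ ∀ μ, 0 < μ → μ ≤ m →
        ‖mlog E μ₀ 1 z l ((ρ - μ : ℝ) : ℂ)‖ ≤ C / √μ := by
  have h1 : ∀ᶠ m in 𝓝[>] (0 : ℝ), ∀ s ∈ E, s ≠ (ρ : ℂ) → 2 * m < ‖s - ρ‖ := by
    rw [Finset.eventually_all]
    intro s _
    by_cases hs : s = ρ
    · simp [hs]
    · have : 0 < ‖s - ρ‖ := norm_pos_iff.2 (sub_ne_zero.2 hs)
      filter_upwards [Ioo_mem_nhdsGT (half_pos this)] with m hm _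
      linarith [hm.2]
  obtain ⟨m, hm, hm0⟩ := (h1.and (Ioo_mem_nhdsGT hρ)).exists
  have hdom : ∀ μ, 0 < μ → μ ≤ m → ((ρ - μ : ℝ) : ℂ) ∈ dom E μ₀ 1 := by
    intro μ hμ hμm
    refine h.ofReal_mem (by linarith [hm0.2]) fun hE => ?_
    have h2 := hm _ hE (by
      intro h3
      have : ρ - μ = ρ := by exact_mod_cast h3
      linarith)
    have e1 : ((ρ - μ : ℝ) : ℂ) - ρ = ((-μ : ℝ) : ℂ) := by push_cast; ring
    rw [e1, Complex.norm_real, Real.norm_eq_abs, abs_neg, abs_of_pos hμ] at h2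
    linarith
  have hlow : ∀ s ∈ E, ∀ μ, 0 < μ → μ ≤ m → μ ≤ ‖s - ((ρ - μ : ℝ) : ℂ)‖ := by
    intro s hs μ hμ hμm
    by_cases hsρ : s = ρ
    · rw [hsρ, show (ρ : ℂ) - ((ρ - μ : ℝ) : ℂ) = (μ : ℂ) by push_cast; ring, Complex.norm_real,
        Real.norm_of_nonneg hμ.le]
    · have h2 := hm s hs hsρ
      have h3 : ‖s - ρ‖ ≤ ‖s - ((ρ - μ : ℝ) : ℂ)‖ + μ := by
        have := norm_sub_le (s - ((ρ - μ : ℝ) : ℂ)) (μ : ℂ)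
        rw [Complex.norm_real, Real.norm_of_nonneg hμ.le] at this
        refine le_trans (le_of_eq ?_) this
        push_cast
        ring_nf
      linarith
  refine ⟨m, hm0.1, hm0.2, hdom, fun l hl => ?_⟩
  induction l with
  | nil =>
    refine ⟨√m, Real.sqrt_nonneg _, fun μ hμ hμm => ?_⟩
    simp only [mlog, norm_one]
    rw [one_le_div (Real.sqrt_pos.2 hμ)]
    exact Real.sqrt_le_sqrt hμm
  | cons b l ih =>
    obtain ⟨C, hC, hCb⟩ := ih hl.2
    have hex : ∀ μ, 0 < μ ∧ μ ≤ m → ∃ d, HasDerivAt (mlog E μ₀ 1 z (b :: l)) d ((ρ - μ : ℝ) : ℂ) ∧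
        (wsum z (b :: l) - ((ρ - μ : ℝ) : ℂ)) * d = mlog E μ₀ 1 z l ((ρ - μ : ℝ) : ℂ) :=
      fun μ hμ => ((mlog_spec h hz hl).2 b l rfl).2 _ (hdom μ hμ.1 hμ.2)
    choose! d hd1 hd2 using hex
    refine ⟨‖mlog E μ₀ 1 z (b :: l) ((ρ - m : ℝ) : ℂ)‖ * √m + 2 * C, by positivity,
      fun μ hμ hμm => ?_⟩
    have h2 := norm_le_of_deriv_rpow (f := fun μ : ℝ => mlog E μ₀ 1 z (b :: l) ((ρ - μ : ℝ) : ℂ))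
      (f' := fun μ => d μ * -1) hm0.1 hC
      (fun μ hμ hμm => by
        have h3 : HasDerivAt (fun μ : ℝ => ((ρ - μ : ℝ) : ℂ)) (-1) μ := by
          simpa using (Complex.ofRealCLM.hasDerivAt (x := μ)).const_sub (ρ : ℂ)
        exact HasDerivAt.comp_of_eq μ (hd1 μ ⟨hμ, hμm⟩) h3 rfl)
      (fun μ hμ hμm => by
        rw [mul_neg_one, norm_neg, mul_comm, ← div_div, le_div_iff₀ hμ]
        refine le_trans ?_ (hCb μ hμ hμm)
        rw [← hd2 μ ⟨hμ, hμm⟩, norm_mul, mul_comm]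
        gcongr
        exact hlow _ hl.1 μ hμ hμm) hμ hμm
    refine h2.trans ?_
    rw [add_div]
    gcongr
    rw [mul_div_assoc]
    refine le_mul_of_one_le_right (norm_nonneg _) ?_
    rw [one_le_div (Real.sqrt_pos.2 hμ)]
    exact Real.sqrt_le_sqrt hμm

theorem intervalIntegrable_inv_sqrt_one_sub {a : ℝ} (ha : a ≤ 1) :
    IntervalIntegrable (fun u : ℝ => 1 / √(1 - u)) volume a 1 := by
  have h1 : IntervalIntegrable (fun x : ℝ => x ^ (-(1 / 2) : ℝ)) volume (1 - a) (1 - 1) :=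
    intervalIntegral.intervalIntegrable_rpow' (by norm_num)
  have h2 := h1.comp_sub_left 1
  simp only [sub_sub_cancel] at h2
  refine h2.congr fun u hu => ?_
  rw [Set.uIoc_of_le ha] at hu
  simp only [Real.sqrt_eq_rpow, Real.rpow_neg (sub_nonneg.2 hu.2), one_div]

theorem intervalIntegrable_mlog_ipath_one (h : IsSector E μ₀ 1) (hz : ∀ b, z b ≠ 0) (hρ : 0 < ρ)
    (hPE : ∀ x : ℝ, 0 < x → x < 1 → ((ρ * x : ℝ) : ℂ) ∈ E → x ∈ P)
    (hP : ∀ p ∈ P, 0 < p ∧ p < 1) (hδ : IsSmall P μ₀ δ) {b : Φ} {l : List Φ}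
    (hl : Adm E z (b :: l)) (hlρ : wsum z (b :: l) ≠ ρ) :
    IntervalIntegrable (fun u => mlog E μ₀ 1 z l (ipath P ρ δ u) *
        (deriv (ipath P ρ δ) u / (wsum z (b :: l) - ipath P ρ δ u))) volume 0 1 := by
  obtain ⟨η, hη0, hη1, hη⟩ := exists_bump_eq_zero hδ hP
  obtain ⟨m, hm0, hmρ, hdom, hbd⟩ := exists_mlog_bound_endpoint (E := E) (z := z) h hz hρ
  obtain ⟨C, hC, hCb⟩ := hbd l hl.2
  set t := min η (m / ρ) with ht
  have ht0 : 0 < t := by positivity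
  have htη : t ≤ η := min_le_left _ _
  have htm : ρ * t ≤ m := by
    have : t ≤ m / ρ := min_le_right _ _
    rwa [le_div_iff₀ hρ, mul_comm] at this
  set a := 1 - t / 2 with ha
  have ha0 : 0 ≤ a := by linarith
  have ha1 : a < 1 := by linarith
  refine (intervalIntegrable_mlog_ipath h hz hρ hPE hP hδ hl ha0 ha1).trans ?_
  have hpath : ∀ u, 1 - η < u → ipath P ρ δ u = ((ρ - ρ * (1 - u) : ℝ) : ℂ) := by
    intro u hu
    simp only [ipath, hη u hu]
    push_cast
    ring
  have hderiv : ∀ u, 1 - η < u → deriv (ipath P ρ δ) u = ρ := by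
    intro u hu
    have h1 : HasDerivAt (fun u : ℝ => (ρ : ℂ) * u) ρ u := by
      simpa using (Complex.ofRealCLM.hasDerivAt (x := u)).const_mul (ρ : ℂ)
    refine (h1.congr_of_eventuallyEq ?_).deriv
    filter_upwards [lt_mem_nhds hu] with v hv
    rw [hpath v hv]
    push_cast
    ring
  have hμ : ∀ u ∈ Set.Ioo a 1, 0 < ρ * (1 - u) ∧ ρ * (1 - u) ≤ m := by
    intro u hu
    refine ⟨mul_pos hρ (by linarith [hu.2]), le_trans ?_ htm⟩
    gcongr
    linarith [hu.1]
  have hae : volume.restrict (Set.uIoc a 1) = volume.restrict (Set.Ioo a 1) := by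
    rw [Set.uIoc_of_le ha1.le]
    exact Measure.restrict_congr_set Ioo_ae_eq_Ioc.symm
  have hF : IntervalIntegrable (fun u : ℝ => mlog E μ₀ 1 z l ((ρ - ρ * (1 - u) : ℝ) : ℂ))
      volume a 1 := by
    refine IntervalIntegrable.mono_fun'
      ((intervalIntegrable_inv_sqrt_one_sub ha1.le).const_mul (C / √ρ)) ?_ ?_
    · rw [hae]
      refine ContinuousOn.aestronglyMeasurable ?_ measurableSet_Ioo
      refine (mlog_spec h hz hl.2).1.continuousOn.comp (by fun_prop) fun u hu => ?_
      exact hdom _ (hμ u hu).1 (hμ u hu).2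
    · rw [hae]
      filter_upwards [ae_restrict_mem measurableSet_Ioo] with u hu
      refine (hCb _ (hμ u hu).1 (hμ u hu).2).trans (le_of_eq ?_)
      rw [Real.sqrt_mul hρ.le, div_mul_div_comm, mul_one]
  have hcont : ContinuousOn (fun u : ℝ => (ρ : ℂ) / (wsum z (b :: l) - ((ρ - ρ * (1 - u) : ℝ) : ℂ)))
      (Set.uIcc a 1) := by
    refine ContinuousOn.div (by fun_prop) (by fun_prop) fun u hu => ?_
    rw [Set.uIcc_of_le ha1.le] at hu
    rcases hu.2.eq_or_lt with rfl | hu1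
    · simpa [sub_eq_zero] using hlρ
    · rw [← hpath u (by linarith [hu.1])]
      exact ipath_ne h hρ hPE hP hδ (by linarith [hu.1]) hu1 hl.1
  refine (hF.mul_continuousOn hcont).congr fun u hu => ?_
  rw [Set.uIoc_of_le ha1.le] at hu
  have : 1 - η < u := by linarith [hu.1]
  simp only [hderiv u this, hpath u this]

/-- The path reaches `ρ` from the side `e = 1`, where the multilogarithm has the limit `bval` as
long as the sum of the whole word differs from `ρ`. -/
theorem integral_mlog_ipath_one (h : IsSector E μ₀ 1) (hz : ∀ b, z b ≠ 0) (hρ : 0 < ρ)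
    (hPE : ∀ x : ℝ, 0 < x → x < 1 → ((ρ * x : ℝ) : ℂ) ∈ E → x ∈ P)
    (hP : ∀ p ∈ P, 0 < p ∧ p < 1) (hδ : IsSmall P μ₀ δ) {b : Φ} {l : List Φ}
    (hl : Adm E z (b :: l)) (hlρ : wsum z (b :: l) ≠ ρ) :
    ∫ u in (0 : ℝ)..1, mlog E μ₀ 1 z l (ipath P ρ δ u) *
        (deriv (ipath P ρ δ) u / (wsum z (b :: l) - ipath P ρ δ u)) =
      bval E μ₀ 1 z (b :: l) ρ := by
  classical
  have h0 : ipath P ρ δ 0 = 0 := by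
    have : bump P δ 0 = 0 := bump_eq_zero hδ.pos.le fun p hp => by
      have h1 := (hP p hp).1
      have h2 := hδ.left p hp
      rw [zero_sub, abs_neg, abs_of_pos h1]
      linarith
    simp [ipath, this]
  obtain ⟨η, hη0, hη1, hη⟩ := exists_bump_eq_zero hδ hP
  have h1 : ipath P ρ δ 1 = ρ := by simp [ipath, hη 1 (by linarith)]
  -- The end point may lie outside the domain, so the limit is put in there by hand.
  set f : ℝ → ℂ := fun x => if x < 1 then mlog E μ₀ 1 z (b :: l) (ipath P ρ δ x)
    else bval E μ₀ 1 z (b :: l) ρ with hf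
  have hfe : ∀ x, x < 1 → f =ᶠ[𝓝 x] fun x => mlog E μ₀ 1 z (b :: l) (ipath P ρ δ x) := by
    intro x hx
    filter_upwards [gt_mem_nhds hx] with y hy
    simp only [hf, if_pos hy]
  have key := integral_eq_of_hasDerivAt_off_countable_of_le f
    (fun u => mlog E μ₀ 1 z l (ipath P ρ δ u) *
        (deriv (ipath P ρ δ) u / (wsum z (b :: l) - ipath P ρ δ u))) zero_le_one
    (finite_sqrt_zeros P δ).countable ?_ ?_
    (intervalIntegrable_mlog_ipath_one h hz hρ hPE hP hδ hl hlρ)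
  · rw [key]
    simp only [hf, lt_self_iff_false, if_false, zero_lt_one, if_true, h0,
      ((mlog_spec h hz hl).2 b l rfl).1, sub_zero]
  · intro x hx
    rcases hx.2.eq_or_lt with rfl | hx1
    · have h2 : Filter.Tendsto f (𝓝[<] 1) (𝓝 (f 1)) := by
        have h3 : Filter.Tendsto (ipath P ρ δ) (𝓝[<] 1) (𝓝[halfDom E μ₀ 1] (ρ : ℂ)) := by
          refine tendsto_nhdsWithin_iff.2 ⟨?_, ?_⟩
          · have := (continuous_ipath (P := P) (ρ := ρ) (δ := δ)).tendsto 1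
            rw [h1] at this
            exact this.mono_left nhdsWithin_le_nhds
          · filter_upwards [Ioo_mem_nhdsLT zero_lt_one] with y hy
            refine ⟨ipath_mem h hρ hPE hP hδ hy.1.le hy.2, ?_⟩
            rw [ipath_im, one_mul]
            exact mul_nonneg hρ.le (bump_nonneg _ _ _)
        have h4 := (tendsto_mlog_bval h hz hl hρ hlρ).comp h3
        have e1 : f 1 = bval E μ₀ 1 z (b :: l) ρ := by simp [hf]
        rw [e1]
        refine h4.congr' ?_
        filter_upwards [self_mem_nhdsWithin] with y hy
        have hy : y < 1 := hy
        simp only [hf, if_pos hy, Function.comp_apply]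
      have h5 : ContinuousWithinAt f (Set.Iic 1) 1 := by
        rw [← continuousWithinAt_Iio_iff_Iic]
        exact h2
      exact h5.mono fun y hy => hy.2
    · refine ContinuousAt.continuousWithinAt ?_
      refine ContinuousAt.congr ?_ (hfe x hx1).symm
      refine ContinuousAt.comp (g := mlog E μ₀ 1 z (b :: l)) ?_ continuous_ipath.continuousAt
      exact (mlog_spec h hz hl).1.continuousOn.continuousAt
        (isOpen_dom.mem_nhds (ipath_mem h hρ hPE hP hδ hx.1 hx1))
  · rintro u ⟨hu, hu2⟩
    simp only [Set.mem_ofPred_eq, not_not] at hu2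
    exact (hasDerivAt_mlog_ipath h hz hρ hPE hP hδ hl hu.1 hu.2 hu2).congr_of_eventuallyEq
      (hfe u hu.2)

/-- The outermost form of an iterated integral corresponds to the first letter of the word. Hence
the final parts `W k` of a word, in the order of their lengths, match the partial iterated
integrals. -/
theorem iteratedIntegral_eq_mlog (h : IsSector E μ₀ 1) (hz : ∀ b, z b ≠ 0) (hρ : 0 < ρ)
    (hPE : ∀ x : ℝ, 0 < x → x < 1 → ((ρ * x : ℝ) : ℂ) ∈ E → x ∈ P)
    (hP : ∀ p ∈ P, 0 < p ∧ p < 1) (hδ : IsSmall P μ₀ δ) {W : ℕ → List Φ} (hW0 : W 0 = []) {n : ℕ}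
    (hW : ∀ k < n, ∃ b, W (k + 1) = b :: W k) (hWn : Adm E z (W n)) {ω : ℕ → ℝ → ℂ}
    (hω : ∀ k < n, ∀ u, ω k u = deriv (ipath P ρ δ) u / (wsum z (W (k + 1)) - ipath P ρ δ u)) :
    ∀ k ≤ n, Adm E z (W k) ∧ ∀ x, 0 ≤ x → x < 1 →
      iteratedIntegral ω k x = mlog E μ₀ 1 z (W k) (ipath P ρ δ x) := by
  have hadm : ∀ k ≤ n, Adm E z (W k) := by
    intro k hk
    induction n, hk using Nat.le_induction with
    | base => exact hWn
    | succ m hm ih =>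
      obtain ⟨b, hb⟩ := hW m (by omega)
      rw [hb] at hWn
      exact ih (fun k hk => hW k (by omega)) hWn.2 (fun k hk => hω k (by omega))
  intro k hk
  refine ⟨hadm k hk, ?_⟩
  induction k with
  | zero => intro x _ _; simp [iteratedIntegral, hW0, mlog]
  | succ k ih =>
    intro x hx hx1
    obtain ⟨b, hb⟩ := hW k (by omega)
    have hA := hadm (k + 1) hk
    rw [hb] at hA
    rw [iteratedIntegral, hb, ← integral_mlog_ipath h hz hρ hPE hP hδ hA hx hx1]
    refine intervalIntegral.integral_congr fun u hu => ?_
    rw [Set.uIcc_of_le hx] at hu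
    simp only [ih (by omega) u hu.1 (hu.2.trans_lt hx1), hω k (by omega), hb]

theorem iteratedIntegral_one_eq_bval (h : IsSector E μ₀ 1) (hz : ∀ b, z b ≠ 0) (hρ : 0 < ρ)
    (hPE : ∀ x : ℝ, 0 < x → x < 1 → ((ρ * x : ℝ) : ℂ) ∈ E → x ∈ P)
    (hP : ∀ p ∈ P, 0 < p ∧ p < 1) (hδ : IsSmall P μ₀ δ) {W : ℕ → List Φ} (hW0 : W 0 = []) {n : ℕ}
    (hW : ∀ k < n, ∃ b, W (k + 1) = b :: W k) (hWn : Adm E z (W n)) {ω : ℕ → ℝ → ℂ}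
    (hω : ∀ k < n, ∀ u, ω k u = deriv (ipath P ρ δ) u / (wsum z (W (k + 1)) - ipath P ρ δ u))
    (hWρ : wsum z (W n) ≠ ρ) :
    iteratedIntegral ω n 1 = bval E μ₀ 1 z (W n) ρ := by
  have hmain := iteratedIntegral_eq_mlog h hz hρ hPE hP hδ hW0 hW hWn hω
  rcases n with _ | n
  · simp [iteratedIntegral, hW0, bval]
  · obtain ⟨b, hb⟩ := hW n (by omega)
    rw [hb] at hWn hWρ
    rw [iteratedIntegral, hb, ← integral_mlog_ipath_one h hz hρ hPE hP hδ hWn hWρ]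
    refine intervalIntegral.integral_congr_ae ?_
    have h3 : ∀ᵐ x ∂(volume : Measure ℝ), x ≠ 1 := by simp [ae_iff, measure_singleton]
    filter_upwards [h3] with u hu1 hu
    rw [Set.uIoc_of_le zero_le_one] at hu
    simp only [(hmain n (by omega)).2 u hu.1.le (lt_of_le_of_ne hu.2 hu1), hω n (by omega), hb]

end PathIntegrals

/-! ### The connection coefficients are the values of `M` -/

section Identification

variable {E : Finset ℂ} {μ₀ : ℝ} {Φ : Type*} {z : Φ → ℂ}

theorem partialSum_get (L : List ℂ) (k : ℕ) : partialSum L.get k = (L.take k).sum := by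
  rw [partialSum]
  induction L generalizing k with
  | nil => simp
  | cons a L ih =>
    rcases k with _ | k
    · simp
    · have := ih k
      simp only [List.length_cons, Fin.sum_univ_succ, Fin.val_zero, Nat.zero_lt_succ, if_true,
        List.get_cons_zero, Fin.val_succ, Nat.succ_lt_succ_iff, List.take_succ_cons, List.sum_cons]
      rw [← this]
      rfl

/-- Multilogarithms read a word from its end and `M` from its beginning, which is why words are
reversed throughout. -/
theorem partialSum_reverse (z : Φ → ℂ) (ζ : ℂ) (l : List Φ) (k : ℕ) :
    partialSum (l.reverse.map fun b => z b * ζ).get k = wsum z (l.drop (l.length - k)) * ζ := by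
  rw [partialSum_get, ← List.map_take, List.take_reverse, List.map_reverse, List.sum_reverse, wsum,
    List.sum_map_mul_right]

/-- Division by `ζ` turns the segment into the real segment from `0` to `ρ`, and the clockwise half
circles lie above it, on the side `e = 1`. The `n - 1` forms in `M` correspond to the letters of
`l`; the letter `b` only fixes the end point. -/
theorem Mw_reverse (h : IsSector E μ₀ 1) (hz : ∀ b, z b ≠ 0) {ζ : ℂ} (hζ : ζ ≠ 0) {b : Φ}
    {l : List Φ} (hl : Adm E z (b :: l)) {ρ : ℝ} (hρ : 0 < ρ) (hs : wsum z (b :: l) = ρ) :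
    Mw ((b :: l).reverse.map fun b => z b * ζ) =
      2 * Real.pi * Complex.I * bval E μ₀ 1 z l ρ := by
  classical
  set n := (b :: l).length with hn
  have hnl : n = l.length + 1 := by simp [hn]
  set L := (b :: l).reverse.map fun b => z b * ζ with hL
  have hLn : L.length = n := by simp [hL, hn]
  set W : ℕ → List Φ := fun k => (b :: l).drop (n - k) with hW
  have hps : ∀ k, partialSum L.get k = wsum z (W k) * ζ := fun k =>
    partialSum_reverse z ζ (b :: l) k
  set E' : Finset ℂ := (Finset.range n).image fun k => wsum z (W (k + 1)) with hE'
  have hEE : E' ⊆ E := by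
    intro s hs
    rw [hE', Finset.mem_image] at hs
    obtain ⟨k, hk, rfl⟩ := hs
    refine adm_iff.1 hl _ (List.drop_suffix _ _) fun h0 => ?_
    have := congrArg List.length h0
    rw [Finset.mem_range] at hk
    simp only [hW, List.length_drop, List.length_nil] at this
    omega
  have hlE : Adm E' z (b :: l) := by
    rw [adm_iff]
    intro l' hl' hne
    rw [hE', Finset.mem_image]
    have h1 := List.suffix_iff_eq_drop.1 hl'
    have h2 := hl'.length_le
    have h3 : 0 < l'.length := List.length_pos_iff.2 hne
    refine ⟨l'.length - 1, Finset.mem_range.2 (by omega), ?_⟩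
    simp only [hW]
    rw [show n - (l'.length - 1 + 1) = (b :: l).length - l'.length by omega, ← h1]
  have h' := h.mono hEE
  have hWn : W n = b :: l := by simp [hW]
  have hpn : partialSum L.get L.length = ρ * ζ := by
    rw [hps, show W L.length = b :: l by rw [hLn, hWn], hs]
  have hρC : (ρ : ℂ) ≠ 0 := by exact_mod_cast hρ.ne'
  set P := indentParams L.get with hP
  have hPmem : ∀ p, p ∈ P ↔ ∃ k, (0 < k ∧ k < n) ∧ wsum z (W k) / ρ = p ∧ 0 < p ∧ p < 1 := by
    intro p
    rw [hP, indentParams, Finset.mem_image]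
    have hquot : ∀ k, partialSum L.get k / partialSum L.get L.length = wsum z (W k) / ρ := by
      intro k
      rw [hpn, hps, mul_div_mul_right _ _ hζ]
    constructor
    · rintro ⟨w, hw, rfl⟩
      rw [Finset.mem_filter, Finset.mem_image] at hw
      obtain ⟨⟨k, hk, rfl⟩, h1, h2, h3⟩ := hw
      rw [Finset.mem_Ioo, hLn] at hk
      refine ⟨k, hk, ?_, h2, h3⟩
      rw [← hquot]
      exact Complex.ext (by simp) (by simpa using h1)
    · rintro ⟨k, hk, h1, h2, h3⟩
      refine ⟨(p : ℂ), ?_, by simp⟩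
      rw [Finset.mem_filter, Finset.mem_image]
      refine ⟨⟨k, by rw [Finset.mem_Ioo, hLn]; exact hk, by rw [hquot, h1]⟩, by simp, by simpa, by simpa⟩
  have hP01 : ∀ p ∈ P, 0 < p ∧ p < 1 := by
    intro p hp
    obtain ⟨k, _, _, h2⟩ := (hPmem p).1 hp
    exact h2
  have hPE : ∀ x : ℝ, 0 < x → x < 1 → ((ρ * x : ℝ) : ℂ) ∈ E' → x ∈ P := by
    intro x hx0 hx1 hx
    rw [hE', Finset.mem_image] at hx
    obtain ⟨k, hk, hkx⟩ := hx
    rw [Finset.mem_range] at hk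
    refine (hPmem x).2 ⟨k + 1, ⟨by omega, ?_⟩, ?_, hx0, hx1⟩
    · by_contra hcon
      have : k + 1 = n := by omega
      rw [this, hWn, hs] at hkx
      have h1 : ρ = ρ * x := by exact_mod_cast hkx
      nlinarith
    · rw [hkx]
      push_cast
      field_simp
  have hls' : wsum z l ≠ ρ := by
    intro h1
    rw [wsum_cons, h1] at hs
    exact hz b (by simpa using hs)
  have hpath : ∀ δ, indentedPath L.get δ = fun x => ζ * ipath P ρ δ x := by
    intro δ
    funext x
    rw [indentedPath, hpn, ipath, bump]
    ring
  have hWl : W l.length = l := by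
    simp only [hW]
    rw [hnl, Nat.add_sub_cancel_left]
    simp
  have key : ∀ δ, IsSmall P μ₀ δ → iteratedIntegral
      (fun k u => deriv (indentedPath L.get δ) u / (partialSum L.get (k + 1) - indentedPath L.get δ u))
      (L.length - 1) 1 = bval E' μ₀ 1 z l ρ := by
    intro δ hδ
    rw [show L.length - 1 = l.length by omega]
    have h1 := iteratedIntegral_one_eq_bval h' hz hρ hPE hP01 hδ (W := W) (n := l.length)
      (ω := fun k u => deriv (indentedPath L.get δ) u /
        (partialSum L.get (k + 1) - indentedPath L.get δ u)) ?_ ?_ ?_ ?_ ?_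
    · rw [h1, hWl]
    · simp [hW, hn]
    · intro k hk
      simp only [hW]
      have hlt : n - (k + 1) < (b :: l).length := by omega
      refine ⟨(b :: l)[n - (k + 1)], ?_⟩
      rw [List.drop_eq_getElem_cons hlt, show n - (k + 1) + 1 = n - k by omega]
    · rw [hWl]; exact hlE.2
    · intro k hk u
      simp only [hpath, hps]
      rw [deriv_const_mul_field', mul_comm (wsum z (W (k + 1))), ← mul_sub, mul_div_mul_left _ _ hζ]
    · rw [hWl]; exact hls'
  rw [Mw, M]
  congr 1
  rw [bval_mono h hEE hz hlE.2 hρ.le]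
  refine Filter.Tendsto.limUnder_eq (tendsto_const_nhds.congr' ?_)
  filter_upwards [eventually_isSmall hP01 h.pos] with δ hδ
  exact (key δ hδ).symm

theorem connCoeff_eq (h : IsSector E μ₀ 1) (hz : ∀ b, z b ≠ 0) {ζ : ℂ} (hζ : ζ ≠ 0)
    {l : List Φ} (hl : Adm E z l) :
    connCoeff E μ₀ z l = stokesSeriesRev (fun b => z b * ζ) ζ l := by
  classical
  rcases l with _ | ⟨b, l⟩
  · rw [stokesSeriesRev_nil]; rfl
  · have hsum : ((b :: l).reverse.map fun b => z b * ζ).sum = wsum z (b :: l) * ζ := by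
      rw [List.map_reverse, List.sum_reverse, wsum, List.sum_map_mul_right]
    have hiff : (∃ ρ : ℝ, 0 < ρ ∧ ((b :: l).reverse.map fun b => z b * ζ).sum = ρ * ζ) ↔
        (wsum z (b :: l)).im = 0 ∧ 0 < (wsum z (b :: l)).re := by
      rw [hsum]
      constructor
      · rintro ⟨ρ, hρ, h1⟩
        rw [mul_right_cancel₀ hζ h1]
        simpa using hρ
      · rintro ⟨h1, h2⟩
        refine ⟨_, h2, ?_⟩
        congr 1
        exact Complex.ext (by simp) (by simpa using h1)
    have hne : (b :: l).reverse ≠ [] := by simp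
    show _ = stokesSeries _ _ (b :: l).reverse
    simp only [connCoeff, stokesSeries, hne, if_false, hiff]
    split_ifs with h1
    · rw [Mw_reverse h hz hζ hl h1.2 (Complex.ext (by simp) (by simpa using h1.1))]
    · rfl

end Identification

/-! ### Shuffle relations for `M` and Lie polynomials with the coefficients `L` -/

section Primitive

variable {Φ : Type*}

theorem exists_isSector (E : Finset ℂ) :
    ∃ μ₀ : ℝ, 0 < μ₀ ∧ ∀ e : ℝ, e = 1 ∨ e = -1 → IsSector E μ₀ e := by
  have key : ∃ μ₀ : ℝ, 0 < μ₀ ∧ ∀ s ∈ E, s ≠ 0 → s.im = 0 ∧ 0 < s.re ∨ μ₀ * s.re < |s.im| := by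
    induction E using Finset.induction_on with
    | empty => exact ⟨1, one_pos, by simp⟩
    | insert w E _ ih =>
      obtain ⟨μ, hμ, h⟩ := ih
      have hmono : ∀ ν : ℝ, 0 < ν → ν ≤ μ → ∀ s ∈ E, s ≠ 0 →
          s.im = 0 ∧ 0 < s.re ∨ ν * s.re < |s.im| := by
        intro ν hν hνμ s hs hs0
        rcases h s hs hs0 with h1 | h1
        · exact .inl h1
        · rcases le_or_gt s.re 0 with h2 | h2
          · by_cases h3 : s.im = 0
            · have h4 : s.re ≠ 0 := fun h4 => hs0 (Complex.ext h4 h3)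
              exact .inr (by rw [h3, abs_zero]; exact mul_neg_of_pos_of_neg hν (lt_of_le_of_ne h2 h4))
            · exact .inr ((mul_nonpos_of_nonneg_of_nonpos hν.le h2).trans_lt (abs_pos.2 h3))
          · exact .inr ((mul_le_mul_of_nonneg_right hνμ h2.le).trans_lt h1)
      by_cases hw : w.im = 0
      · refine ⟨μ, hμ, fun s hs hs0 => ?_⟩
        rcases Finset.mem_insert.1 hs with rfl | hs
        · rcases lt_trichotomy s.re 0 with h2 | h2 | h2
          · exact .inr (by rw [hw, abs_zero]; exact mul_neg_of_pos_of_neg hμ h2)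
          · exact absurd (Complex.ext h2 hw) hs0
          · exact .inl ⟨hw, h2⟩
        · exact h s hs hs0
      · have hp : 0 < |w.re| + 1 := by positivity
        have hq : 0 < |w.im| / (|w.re| + 1) := div_pos (abs_pos.2 hw) hp
        refine ⟨min μ (|w.im| / (|w.re| + 1)), lt_min hμ hq, fun s hs hs0 => ?_⟩
        rcases Finset.mem_insert.1 hs with rfl | hs
        · refine .inr ?_
          have h1 := min_le_right μ (|s.im| / (|s.re| + 1))
          calc _ ≤ min μ (|s.im| / (|s.re| + 1)) * |s.re| :=
                mul_le_mul_of_nonneg_left (le_abs_self _) (lt_min hμ hq).le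
            _ < min μ (|s.im| / (|s.re| + 1)) * (|s.re| + 1) :=
                mul_lt_mul_of_pos_left (by linarith) (lt_min hμ hq)
            _ ≤ |s.im| := by rwa [le_div_iff₀ hp] at h1
        · exact hmono _ (lt_min hμ hq) (min_le_left _ _) s hs hs0
  obtain ⟨μ₀, hμ₀, h⟩ := key
  exact ⟨μ₀, hμ₀, fun e he => ⟨hμ₀, he, h⟩⟩

/-- The sums of the words of length at most `m`. -/
def wordSums [Fintype Φ] (z : Φ → ℂ) (m : ℕ) : Finset ℂ :=
  ((List.finite_length_le Φ m).image (wsum z)).toFinset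

theorem wsum_mem_wordSums [Fintype Φ] (z : Φ → ℂ) {m : ℕ} {l : List Φ} (hl : l.length ≤ m) :
    wsum z l ∈ wordSums z m := by
  rw [wordSums, Set.Finite.mem_toFinset]
  exact ⟨l, hl, rfl⟩

theorem slope_mul_one_re (e μ : ℝ) : (slope e μ * 1).re = 1 := by simp [slope]

/-- The Stokes series is a character of the shuffle algebra. -/
theorem isChar_stokesSeriesRev [Fintype Φ] {z : Φ → ℂ} (hz : ∀ b, z b ≠ 0) {ζ : ℂ} (hζ : ζ ≠ 0)
    (m : ℕ) : IsChar m (stokesSeriesRev z ζ) := by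
  set y : Φ → ℂ := fun b => z b / ζ with hy
  have hy0 : ∀ b, y b ≠ 0 := fun b => div_ne_zero (hz b) hζ
  have hyz : (fun b => y b * ζ) = z := by funext b; simp [hy, hζ]
  set E := wordSums y m with hE
  obtain ⟨μ₀, hμ₀, hsec⟩ := exists_isSector E
  have h1 := hsec 1 (.inl rfl)
  have h2 := hsec (-1) (.inr rfl)
  have hpair : ∀ u v : List Φ, u.length + v.length ≤ m → AdmPair E y u v := by
    intro u v huv u' v' hu hv
    rw [← wsum_append]
    refine wsum_mem_wordSums y ?_
    have := hu.length_le
    have := hv.length_le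
    rw [List.length_append]
    omega
  have hre : ∀ e : ℝ, 0 < (slope e (μ₀ / 2) * 1).re := fun e => by
    rw [slope_mul_one_re]; exact one_pos
  have hq : ∀ e : ℝ, e = 1 ∨ e = -1 →
      IsChar m (⟨fun u => qser E μ₀ e y (μ₀ / 2) u 1⟩ : NCS Φ ℂ) := fun e he u v huv =>
    sh_qser (hsec e he) hy0 (half_pos hμ₀) (half_lt_self hμ₀) (hpair u v huv) (hre e)
  -- At `τ = 1` the connection formula exhibits the coefficients, up to exponential factors, as a
  -- quotient of two characters.
  have hb := (hq (-1) (.inr rfl)).of_mul (hq 1 (.inl rfl)) (qser_nil (hre _)) (fun l hl =>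
    qser_connection h1 h2 hy0 (fun l' hl' _ => wsum_mem_wordSums y (hl'.length_le.trans hl))
      (half_pos hμ₀) (half_lt_self hμ₀) (τ := 1) (by simp) (hre _) (hre _))
  intro u v huv
  have hu : ∀ l : List Φ, l.length ≤ m → connCoeff E μ₀ y l = stokesSeriesRev z ζ l := by
    intro l hl
    rw [connCoeff_eq h1 hy0 hζ (adm_iff.2 fun l' hl' _ =>
      wsum_mem_wordSums y (hl'.length_le.trans hl)), hyz]
  have h3 := hb u v huv
  -- The exponential factor depends only on the sum of the letters, which is the same for all
  -- shuffles of `u` and `v`, and it is multiplicative. So it cancels.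
  have h4 : sh (⟨fun v => connCoeff E μ₀ y v * Complex.exp (-(wsum y v * 1))⟩ : NCS Φ ℂ).coeff u v =
      Complex.exp (-(wsum y u + wsum y v)) * sh (stokesSeriesRev z ζ).coeff u v := by
    rw [← sh_const_mul]
    have h5 : sh (⟨fun v => connCoeff E μ₀ y v * Complex.exp (-(wsum y v * 1))⟩ : NCS Φ ℂ).coeff u v =
        sh (fun v => stokesSeriesRev z ζ v * Complex.exp (-(wsum y v * 1))) u v := by
      refine sh_congr fun l hl => ?_
      show connCoeff E μ₀ y l * _ = _
      rw [hu l (by rw [hl.length_eq, List.length_append]; exact huv)]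
    rw [h5]
    refine sh_congr_shuf fun w hw => ?_
    rw [hw.wsum_eq y, mul_one, mul_comm]
  rw [h4] at h3
  have h5 : ∀ l, (⟨fun v => connCoeff E μ₀ y v * Complex.exp (-(wsum y v * 1))⟩ : NCS Φ ℂ) l =
    connCoeff E μ₀ y l * Complex.exp (-(wsum y l * 1)) := fun _ => rfl
  rw [h5, h5, hu u (by omega), hu v (by omega), mul_one, mul_one, neg_add, Complex.exp_add] at h3
  have h6 := Complex.exp_ne_zero (-wsum y u)
  have h7 := Complex.exp_ne_zero (-wsum y v)
  refine mul_left_cancel₀ (mul_ne_zero h6 h7) (h3.trans ?_)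
  ring

/-- For `s_n = 0` the path is constant, and the forms pull back to zero. -/
theorem M_eq_zero {n : ℕ} (z : Fin n → ℂ) (hn : 2 ≤ n) (hs : ∑ i, z i = 0) : M n z = 0 := by
  have h0 : partialSum z n = 0 := by simp [partialSum, hs]
  obtain ⟨k, hk⟩ : ∃ k, n - 1 = k + 1 := ⟨n - 2, by omega⟩
  have h1 : ∀ δ, indentedPath z δ = fun _ => 0 := fun δ => funext fun x => by
    rw [indentedPath, h0, zero_mul]
  have h2 : ∀ δ : ℝ, iteratedIntegral
        (fun k u => deriv (indentedPath z δ) u / (partialSum z (k + 1) - indentedPath z δ u))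
        (n - 1) 1 = 0 := by
    intro δ
    rw [hk, iteratedIntegral]
    simp [h1]
  rw [M]
  simp only [h2]
  rw [tendsto_const_nhds.limUnder_eq, mul_zero]

/-- If the total sum is zero, the admissible blocks have sum zero. Such a block has at least two
letters, and its value of `M` vanishes. -/
theorem L_eq_zero {n : ℕ} (hn : 0 < n) (z : Fin n → ℂ) (hz : ∀ i, z i ≠ 0) (hs : ∑ i, z i = 0) :
    L n z = 0 := by
  classical
  rw [L]
  refine Finset.sum_eq_zero fun c _ => ?_
  split_ifs with h
  · have hl : 0 < c.length := c.length_pos_of_pos hn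
    refine mul_eq_zero_of_right _ (Finset.prod_eq_zero (Finset.mem_univ ⟨0, hl⟩) ?_)
    obtain ⟨ρ, _, h1⟩ := h ⟨0, hl⟩
    rw [hs, mul_zero] at h1
    refine M_eq_zero _ ?_ h1
    by_contra h2
    have h3 := c.one_le_blocksFun ⟨0, hl⟩
    have h4 : c.blocksFun ⟨0, hl⟩ = 1 := by omega
    have : Subsingleton (Fin (c.blocksFun ⟨0, hl⟩)) := by rw [h4]; infer_instance
    rw [Fintype.sum_eq_single ⟨0, by omega⟩ fun i hi => absurd (Subsingleton.elim _ _) hi] at h1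
    exact hz _ h1
  · rfl

theorem rprod_reverse {A : Type*} [Monoid A] (x : Φ → A) (l : List Φ) :
    rprod x l.reverse = (l.map x).prod := by
  have h : ∀ l : List Φ, rprod x l = (l.reverse.map x).prod := by
    intro l
    induction l with
    | nil => rfl
    | cons b l ih => simp [rprod, ih]
  rw [h, List.reverse_reverse]

theorem lsum_eq_sum_ofFn_reverse [Fintype Φ] {A : Type*} [AddCommMonoid A] (n : ℕ)
    (F : List Φ → A) : lsum n F = ∑ a : Fin n → Φ, F (List.ofFn a).reverse := by
  rw [lsum_eq_sum_ofFn]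
  refine Fintype.sum_equiv (Equiv.arrowCongr Fin.revPerm (Equiv.refl Φ)) _ _ fun a => ?_
  congr 1
  apply List.ext_getElem
  · simp
  · intro i h1 h2
    simp only [List.length_ofFn] at h1
    simp only [List.getElem_ofFn, List.getElem_reverse, List.length_ofFn, Equiv.arrowCongr_apply,
      Equiv.coe_refl, Function.comp, id, Fin.revPerm_symm, Fin.revPerm_apply]
    congr 1
    ext
    simp only [Fin.val_rev]
    omega

theorem map_brk {𝔏 𝔏' : Type*} [LieRing 𝔏] [LieAlgebra ℂ 𝔏] [LieRing 𝔏'] [LieAlgebra ℂ 𝔏']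
    (φ : 𝔏 →ₗ⁅ℂ⁆ 𝔏') (x : Φ → 𝔏) (l : List Φ) : φ (brk x l) = brk (fun b => φ (x b)) l := by
  induction l with
  | nil => exact map_zero φ
  | cons b l ih =>
    rcases l with _ | ⟨c, l⟩
    · rfl
    · rw [brk_cons x b (List.cons_ne_nil c l), brk_cons (fun b => φ (x b)) b (List.cons_ne_nil c l),
        LieHom.map_lie, ih]

theorem L_eq_log_reverse {n : ℕ} (z : Φ → ℂ) (a : Fin n → Φ) {ζ : ℂ} (hs : ∑ i, z (a i) = ζ) :
    L n (fun i => z (a i)) = NCS.log (stokesSeriesRev z ζ) (List.ofFn a).reverse := by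
  rw [log_stokesSeriesRev, List.reverse_reverse]
  exact L_eq_log z a one_pos (by simpa using hs)

variable [Fintype Φ]

/-- The sum of the brackets of the words of length `n` with the coefficients `c / n`. -/
def lieSum {𝔏 : Type*} [LieRing 𝔏] [LieAlgebra ℂ 𝔏] (x : Φ → 𝔏) (c : List Φ → ℂ) (n : ℕ) : 𝔏 :=
  (n : ℂ)⁻¹ • lsum n fun l => c l • brk x l

theorem map_lieSum {𝔏 𝔏' : Type*} [LieRing 𝔏] [LieAlgebra ℂ 𝔏] [LieRing 𝔏'] [LieAlgebra ℂ 𝔏']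
    (φ : 𝔏 →ₗ⁅ℂ⁆ 𝔏') (x : Φ → 𝔏) (c : List Φ → ℂ) (n : ℕ) :
    φ (lieSum x c n) = lieSum (fun b => φ (x b)) c n := by
  simp only [lieSum, lsum_eq_sum_ofFn, ← map_brk, map_smul, map_sum]

theorem lieSum_mem {𝔏 : Type*} [LieRing 𝔏] [LieAlgebra ℂ 𝔏] (x : Φ → 𝔏) (c : List Φ → ℂ) (n : ℕ)
    (K : LieSubalgebra ℂ 𝔏) (hx : ∀ b, x b ∈ K) : lieSum x c n ∈ K := by
  have h : ∀ l, brk x l ∈ K := by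
    intro l
    induction l with
    | nil => exact K.zero_mem
    | cons b l ih =>
      rcases l with _ | ⟨c, l⟩
      · exact hx b
      · rw [brk_cons _ _ (by simp)]
        exact K.lie_mem ih (hx b)
  rw [lieSum, lsum_eq_sum_ofFn]
  exact K.smul_mem _ (sum_mem fun a _ => K.smul_mem _ (h _))

theorem lieSum_eq {A : Type*} [Ring A] [Algebra ℂ A] (x : Φ → A) {c : List Φ → ℂ} {n : ℕ}
    (hn : n ≠ 0)
    (hc : ∀ u v : List Φ, u ≠ [] → v ≠ [] → u.length + v.length = n → sh c u v = 0) :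
    lieSum x c n = ∑ a : Fin n → Φ, c (List.ofFn a).reverse • (List.ofFn fun i => x (a i)).prod := by
  rw [lieSum, ← natCast_mul_lsum_rprod x n c hc, inv_smul_smul₀ (by exact_mod_cast hn),
    lsum_eq_sum_ofFn_reverse]
  refine Finset.sum_congr rfl fun a _ => ?_
  rw [rprod_reverse, List.map_ofFn]
  rfl

/-- The coefficients of the logarithm of the Stokes series, at the words that satisfy `p`. -/
def logStokes (z : Φ → ℂ) (ζ : ℂ) (p : List Φ → Prop) [DecidablePred p] (l : List Φ) : ℂ :=
  if p l then NCS.log (stokesSeriesRev z ζ) l else 0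

/-- All shuffles of two words are permutations of each other, so a selection of words that is stable
under permutations keeps the vanishing on shuffles. -/
theorem sh_logStokes {z : Φ → ℂ} (hz : ∀ b, z b ≠ 0) {ζ : ℂ} (hζ : ζ ≠ 0) {p : List Φ → Prop}
    [DecidablePred p] (hp : ∀ l l', l.Perm l' → (p l ↔ p l')) {u v : List Φ} (hu : u ≠ [])
    (hv : v ≠ []) : sh (logStokes z ζ p) u v = 0 := by
  have h := (isChar_stokesSeriesRev hz hζ (u.length + v.length)).sh_log (stokesSeriesRev_nil z ζ)
    hu hv le_rfl
  by_cases hpuv : p (u ++ v)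
  · rw [← h]
    exact sh_congr fun l hl => if_pos ((hp _ _ hl).2 hpuv)
  · rw [← sh_zero u v]
    exact sh_congr fun l hl => if_neg (mt (hp _ _ hl).1 hpuv)

/-- A sum of words with the coefficients `L` is a sum of brackets. -/
theorem sum_L_smul_prod {A : Type*} [Ring A] [Algebra ℂ A] (x : Φ → A) {z : Φ → ℂ}
    (hz : ∀ b, z b ≠ 0) {ζ : ℂ} (hζ : ζ ≠ 0) {p : List Φ → Prop} [DecidablePred p]
    (hp : ∀ l l', l.Perm l' → (p l ↔ p l')) {n : ℕ} (hn : n ≠ 0)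
    (hs : ∀ a : Fin n → Φ, p (List.ofFn a) → ∑ i, z (a i) = ζ) :
    ∑ a : Fin n → Φ with p (List.ofFn a),
      L n (fun i => z (a i)) • (List.ofFn fun i => x (a i)).prod = lieSum x (logStokes z ζ p) n := by
  rw [lieSum_eq x hn fun u v hu hv _ => sh_logStokes hz hζ hp hu hv, Finset.sum_filter]
  refine Finset.sum_congr rfl fun a _ => ?_
  have h : p (List.ofFn a).reverse ↔ p (List.ofFn a) := hp _ _ (List.reverse_perm _)
  rw [logStokes]
  simp only [h]
  split_ifs with h1
  · rw [L_eq_log_reverse z a (hs a h1)]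
  · rw [zero_smul]

end Primitive

/-- The words of length `m` in `m` letters without repetition are the permutations, and they all
have the same sum. So the sum is the multilinear part of a logarithm, a sum of brackets; if the
total sum is zero, all values of `L` vanish. -/
theorem exists_freeLie (m : ℕ) (hm : 1 ≤ m) (z : Fin m → ℂ) (hz : ∀ i, z i ≠ 0) :
    ∃ P : FreeLieAlgebra ℂ (Fin m),
      ∀ (𝔏 : Type*) [LieRing 𝔏] [LieAlgebra ℂ 𝔏] (x : Fin m → 𝔏),
        ∑ σ : Equiv.Perm (Fin m),
            L m (fun i => z (σ i)) •
              (List.ofFn fun i => UniversalEnvelopingAlgebra.ι ℂ (x (σ i))).prod =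
          UniversalEnvelopingAlgebra.ι ℂ (FreeLieAlgebra.lift ℂ x P) := by
  classical
  by_cases hs : ∑ i, z i = 0
  · refine ⟨0, fun 𝔏 _ _ x => ?_⟩
    rw [map_zero, map_zero]
    refine Finset.sum_eq_zero fun σ _ => ?_
    rw [L_eq_zero hm _ (fun i => hz _) (by rw [Equiv.sum_comp σ z, hs]), zero_smul]
  · refine ⟨lieSum (FreeLieAlgebra.of ℂ) (logStokes z (∑ i, z i) List.Nodup) m, fun 𝔏 _ _ x => ?_⟩
    rw [map_lieSum, map_lieSum]
    simp only [FreeLieAlgebra.lift_of_apply]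
    rw [← sum_L_smul_prod _ hz hs (fun l l' h => h.nodup_iff) (by omega) fun a ha => ?_]
    · refine Finset.sum_bij (fun σ _ => ⇑σ) (fun σ _ => ?_) (fun σ _ τ _ h => DFunLike.coe_injective h)
        (fun a ha => ?_) fun σ _ => rfl
      · rw [Finset.mem_filter]
        exact ⟨Finset.mem_univ _, List.nodup_ofFn.2 σ.injective⟩
      · have h1 := List.nodup_ofFn.1 (Finset.mem_filter.1 ha).2
        exact ⟨Equiv.ofBijective a (Finite.injective_iff_bijective.1 h1), Finset.mem_univ _, rfl⟩
    · exact Equiv.sum_comp (Equiv.ofBijective a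
        (Finite.injective_iff_bijective.1 (List.nodup_ofFn.1 ha))) z

/-! ### Words in eigenvectors of `ad W` -/

section Weights

variable {Φ A : Type*} [Ring A] [Algebra ℂ A] {x : Φ → A} {W : A} {z : Φ → ℂ} {E₀ : Finset ℂ}

/-- The `x b` are eigenvectors of `ad W` with eigenvalues `z b ≠ 0`, and `E₀` contains `0` and the
eigenvalues of `ad W`. -/
structure IsWeighted (x : Φ → A) (W : A) (z : Φ → ℂ) (E₀ : Finset ℂ) : Prop where
  ne_zero : ∀ b, z b ≠ 0
  lie : ∀ b, W * x b - x b * W = z b • x b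
  mem : ∀ (s : ℂ) (y : A), y ≠ 0 → W * y - y * W = s • y → s ∈ E₀
  zero_mem : 0 ∈ E₀

theorem rprod_append (x : Φ → A) (u v : List Φ) : rprod x (u ++ v) = rprod x v * rprod x u := by
  induction u with
  | nil => simp [rprod]
  | cons b u ih => rw [List.cons_append, rprod, rprod, ih, mul_assoc]

theorem IsWeighted.lie_rprod (hx : IsWeighted x W z E₀) (l : List Φ) :
    W * rprod x l - rprod x l * W = wsum z l • rprod x l := by
  induction l with
  | nil => simp [rprod]
  | cons b l ih =>
    have h1 : W * rprod x (b :: l) - rprod x (b :: l) * W =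
        (W * rprod x l - rprod x l * W) * x b + rprod x l * (W * x b - x b * W) := by
      rw [rprod]; noncomm_ring
    rw [h1, ih, hx.lie, rprod, wsum_cons, add_smul, smul_mul_assoc, mul_smul_comm, add_comm]

theorem lie_brk_of_lie (hx : ∀ b, W * x b - x b * W = z b • x b) (l : List Φ) :
    W * brk x l - brk x l * W = wsum z l • brk x l := by
  induction l with
  | nil => simp [brk]
  | cons b l ih =>
    rcases l with _ | ⟨c, l⟩
    · simpa [brk] using hx b
    · have h1 : ∀ y : A, W * (y * x b - x b * y) - (y * x b - x b * y) * W =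
          (W * y - y * W) * x b + y * (W * x b - x b * W) -
            ((W * x b - x b * W) * y + x b * (W * y - y * W)) := by
        intro y; noncomm_ring
      rw [brk_cons x b (List.cons_ne_nil c l), Ring.lie_def, h1, ih, hx, wsum_cons z b, add_smul]
      simp only [smul_mul_assoc, mul_smul_comm, smul_sub]
      abel

/-- A factor of a nonzero product is nonzero, hence an eigenvector of `ad W`. This bounds the set of
singular points independently of the length of the words; words with zero product play no role. -/
theorem IsWeighted.wsum_mem_of_infix (hx : IsWeighted x W z E₀) {l l' : List Φ}
    (hl : rprod x l ≠ 0) (h : l' <:+: l) : wsum z l' ∈ E₀ := by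
  obtain ⟨u, v, rfl⟩ := h
  refine hx.mem _ _ (fun h0 => hl ?_) (hx.lie_rprod l')
  rw [rprod_append, rprod_append, h0, zero_mul, mul_zero]

theorem brk_ne_zero_of_suffix {l l' : List Φ} (hl : brk x l ≠ 0) (h : l' <:+ l) (hne : l' ≠ []) :
    brk x l' ≠ 0 := by
  obtain ⟨u, rfl⟩ := h
  induction u with
  | nil => exact hl
  | cons b u ih =>
    refine ih fun h0 => hl ?_
    rw [List.cons_append, brk_cons x b (by simp [hne]), h0, zero_lie]

open Classical in
/-- The sums of two elements of `E₀`. -/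
def sumset (E₀ : Finset ℂ) : Finset ℂ := Finset.image₂ (· + ·) E₀ E₀

theorem add_mem_sumset {s t : ℂ} (hs : s ∈ E₀) (ht : t ∈ E₀) : s + t ∈ sumset E₀ :=
  Finset.mem_image₂_of_mem hs ht

theorem IsWeighted.mem_sumset (hx : IsWeighted x W z E₀) {s : ℂ} (hs : s ∈ E₀) :
    s ∈ sumset E₀ := by
  simpa using add_mem_sumset hs hx.zero_mem

theorem IsWeighted.admInf (hx : IsWeighted x W z E₀) {l : List Φ} (hl : rprod x l ≠ 0) :
    AdmInf (sumset E₀) z l :=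
  fun _ h _ => hx.mem_sumset (hx.wsum_mem_of_infix hl h)

theorem IsWeighted.adm (hx : IsWeighted x W z E₀) {l : List Φ} (hl : rprod x l ≠ 0) :
    Adm (sumset E₀) z l := (hx.admInf hl).adm (List.infix_refl l)

theorem wsum_reverse (z : Φ → ℂ) (l : List Φ) : wsum z l.reverse = wsum z l := by
  rw [wsum, List.map_reverse, List.sum_reverse, wsum]

theorem IsWeighted.adm_reverse (hx : IsWeighted x W z E₀) {l : List Φ}
    (hl : rprod x l.reverse ≠ 0) : Adm (sumset E₀) z l := by
  refine adm_iff.2 fun l' h _ => hx.mem_sumset ?_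
  rw [← wsum_reverse]
  exact hx.wsum_mem_of_infix hl (List.reverse_infix.2 h.isInfix)

theorem IsWeighted.wsum_mem_of_brk (hx : IsWeighted x W z E₀) {l l' : List Φ} (hl : brk x l ≠ 0)
    (h : l' <:+ l) : wsum z l' ∈ E₀ := by
  by_cases hne : l' = []
  · rw [hne, wsum_nil]; exact hx.zero_mem
  · exact hx.mem _ _ (brk_ne_zero_of_suffix hl h hne) (lie_brk_of_lie hx.lie l')

theorem IsWeighted.adm_brk (hx : IsWeighted x W z E₀) {l : List Φ} (hl : brk x l ≠ 0) :
    Adm (sumset E₀) z l :=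
  adm_iff.2 fun _ h _ => hx.mem_sumset (hx.wsum_mem_of_brk hl h)

/-- The shuffles of `u` and `v` may have zero product and sums that are not eigenvalues, but the sum
of each of their final parts is a sum of two eigenvalues. This is why `sumset E₀` is the set of
singular points. -/
theorem IsWeighted.admPair (hx : IsWeighted x W z E₀) {u v : List Φ}
    (h : rprod x v * brk x u ≠ 0) : AdmPair (sumset E₀) z u v := by
  intro u' v' hu hv
  exact add_mem_sumset (hx.wsum_mem_of_brk (right_ne_zero_of_mul h) hu)
    (hx.wsum_mem_of_infix (left_ne_zero_of_mul h) hv.isInfix)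

theorem IsWeighted.admPair_reverse (hx : IsWeighted x W z E₀) {u v : List Φ}
    (h : rprod x (u ++ v) ≠ 0) : AdmPair (sumset E₀) z u.reverse v := by
  intro u' v' hu hv
  refine add_mem_sumset ?_ (hx.wsum_mem_of_infix h
    (hv.isInfix.trans (List.suffix_append u v).isInfix))
  rw [← wsum_reverse]
  refine hx.wsum_mem_of_infix h (List.IsInfix.trans ?_ (List.prefix_append u v).isInfix)
  simpa using List.reverse_infix.2 hu.isInfix

end Weights

/-! ### Norm bounds for sums over words -/

section Bounds

variable {Φ A : Type*} [Fintype Φ] [NormedRing A] [NormedAlgebra ℂ A] {x : Φ → A} {W : A}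
  {z : Φ → ℂ} {E₀ E : Finset ℂ} {μ₀ e μ : ℝ}

theorem norm_lsum_le {F : List Φ → A} {n : ℕ} {C : ℝ} (h : ∀ l, l.length = n → ‖F l‖ ≤ C) :
    ‖lsum n F‖ ≤ (Fintype.card Φ : ℝ) ^ n * C := by
  rw [lsum_eq_sum_ofFn]
  refine (norm_sum_le_of_le _ fun a _ => h _ (List.length_ofFn)).trans ?_
  rw [Finset.sum_const, nsmul_eq_mul]
  simp

/-- There are `card Φ ^ n` words of length `n`, with values of the order `D ^ n`. The free base `b`
of the bound on the coefficients is chosen so small that it beats these factors and `R ^ n`, leaving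
`(1 / 2) ^ n`. -/
theorem exists_lsum_bound (h : IsSector E μ₀ e) (hz : ∀ b, z b ≠ 0) (hμ : 0 < μ) (hμ' : μ < μ₀)
    {y : List Φ → A} {D₀ D : ℝ} (hD₀ : 0 ≤ D₀) (hD : 0 ≤ D) (hy : ∀ l, ‖y l‖ ≤ D₀ * D ^ l.length)
    (hadm : ∀ l, y l ≠ 0 → Adm E z l) {R r : ℝ} (hR : 0 ≤ R) (hr : 0 < r) :
    ∃ C : ℝ, 0 ≤ C ∧ ∀ n : ℕ, n ≠ 0 → ∀ τ : ℂ, r ≤ (slope e μ * τ).re →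
      R ^ n * ‖lsum n fun l => qser E μ₀ e z μ l τ • y l‖ ≤
        (1 / 2) ^ n * (C * ‖slope e μ * τ‖ / (slope e μ * τ).re ^ 2) := by
  set m : ℝ := R * D * Fintype.card Φ with hm
  have hm0 : 0 ≤ m := by positivity
  set b : ℝ := 1 / 2 / (m + 1) with hb
  have hb0 : 0 < b := by positivity
  have hbm : m * b ≤ 1 / 2 := by
    rw [hb, mul_div_assoc', div_le_iff₀ (by positivity)]
    nlinarith
  have hb1 : b ≤ 1 := by
    rw [hb, div_le_one (by positivity)]
    linarith
  obtain ⟨K, hK, hbound⟩ := exists_qser_bound h hz hμ hμ' hb0 hb1 hr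
  refine ⟨K * D₀, by positivity, fun n hn τ hτ => ?_⟩
  set X := ‖slope e μ * τ‖ / (slope e μ * τ).re ^ 2 with hX
  have hX0 : 0 ≤ X := by positivity
  have h1 : ‖lsum n fun l => qser E μ₀ e z μ l τ • y l‖ ≤
      (Fintype.card Φ : ℝ) ^ n * (b ^ n * (K * X) * (D₀ * D ^ n)) := by
    refine norm_lsum_le fun l hl => ?_
    by_cases hyl : y l = 0
    · rw [hyl, smul_zero, norm_zero]
      positivity
    · rw [norm_smul]
      have h2 := hbound l (hadm l hyl) (by rintro rfl; exact hn hl.symm) τ hτ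
      have h3 := hy l
      rw [hl] at h2 h3
      refine mul_le_mul ?_ h3 (norm_nonneg _) (by positivity)
      rwa [hX, ← mul_div_assoc]
  calc _ ≤ R ^ n * ((Fintype.card Φ : ℝ) ^ n * (b ^ n * (K * X) * (D₀ * D ^ n))) := by gcongr
    _ = (m * b) ^ n * (K * D₀ * X) := by rw [hm]; ring
    _ ≤ (1 / 2) ^ n * (K * D₀ * X) := by gcongr
    _ = _ := by rw [hX, ← mul_div_assoc]

theorem exists_norm_rprod_le (x : Φ → A) :
    ∃ D : ℝ, 0 ≤ D ∧ ∀ l, ‖rprod x l‖ ≤ ‖(1 : A)‖ * D ^ l.length := by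
  refine ⟨∑ b, ‖x b‖, by positivity, fun l => ?_⟩
  induction l with
  | nil => simp [rprod]
  | cons b l ih =>
    rw [rprod, List.length_cons, pow_succ, ← mul_assoc]
    refine (norm_mul_le _ _).trans (mul_le_mul ih ?_ (norm_nonneg _) (by positivity))
    exact Finset.single_le_sum (fun b _ => norm_nonneg (x b)) (Finset.mem_univ b)

theorem exists_norm_brk_le (x : Φ → A) :
    ∃ D : ℝ, 0 ≤ D ∧ ∀ l, ‖brk x l‖ ≤ 1 * D ^ l.length := by
  have hle : ∀ b, ‖x b‖ ≤ ∑ b, ‖x b‖ := fun b =>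
    Finset.single_le_sum (fun b _ => norm_nonneg (x b)) (Finset.mem_univ b)
  have h0 : (0 : ℝ) ≤ ∑ b, ‖x b‖ := by positivity
  refine ⟨2 * ∑ b, ‖x b‖, by positivity, fun l => ?_⟩
  rw [one_mul]
  induction l with
  | nil => simp [brk]
  | cons b l ih =>
    rcases l with _ | ⟨c, l⟩
    · simp only [brk, List.length_cons, List.length_nil, zero_add, pow_one]
      linarith [hle b]
    · rw [brk_cons x b (List.cons_ne_nil c l), Ring.lie_def, List.length_cons, pow_succ]
      have h1 := norm_mul_le (brk x (c :: l)) (x b)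
      have h2 := norm_mul_le (x b) (brk x (c :: l))
      have h3 := norm_sub_le (brk x (c :: l) * x b) (x b * brk x (c :: l))
      have h4 := mul_le_mul ih (hle b) (norm_nonneg _) (by positivity)
      nlinarith

end Bounds

/-! ### Sums of words with coefficients in a series -/

section WordSeries

variable {Φ A : Type*} [Fintype Φ] [NormedRing A] [NormedAlgebra ℂ A] {x : Φ → A}

/-- The part of degree `n` of the sum of words with the coefficients `c`. -/
def wpart (x : Φ → A) (c : NCS Φ ℂ) (n : ℕ) : A := lsum n fun l => c l • rprod x l

/-- The sum of words with the coefficients `c`. -/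
def wser (x : Φ → A) (c : NCS Φ ℂ) : A := ∑' n, wpart x c n

theorem wpart_congr {c d : NCS Φ ℂ} {n : ℕ}
    (h : ∀ l, l.length = n → rprod x l ≠ 0 → c l = d l) : wpart x c n = wpart x d n := by
  refine lsum_congr fun l hl => ?_
  by_cases h0 : rprod x l = 0
  · rw [h0, smul_zero, smul_zero]
  · rw [h l hl h0]

theorem wpart_one (n : ℕ) : wpart x 1 n = if n = 0 then 1 else 0 := by
  rcases n with _ | n
  · simp [wpart, lsum, NCS.one_nil, rprod]
  · rw [wpart, lsum]
    simp [NCS.one_cons, lsum_zero]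

theorem wpart_mul (a b : NCS Φ ℂ) (n : ℕ) : wpart x (a * b) n =
    ∑ ij ∈ Finset.HasAntidiagonal.antidiagonal n, wpart x b ij.1 * wpart x a ij.2 := by
  rw [wpart, lsum_mul_rprod, ← Finset.Nat.sum_antidiagonal_swap]
  rfl

theorem wpart_reverse (c : NCS Φ ℂ) (n : ℕ) :
    wpart x c n = lsum n fun l => c l.reverse • rprod x l.reverse := by
  rw [wpart, lsum_eq_sum_ofFn_reverse, lsum_eq_sum_ofFn]

theorem summable_wpart_one : Summable fun n => ‖wpart x 1 n‖ := by
  refine summable_of_ne_finset_zero (s := {0}) fun n hn => ?_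
  rw [wpart_one, if_neg (by simpa using hn), norm_zero]

theorem wser_one : wser x 1 = 1 := by
  rw [wser, tsum_eq_single 0 fun n hn => by rw [wpart_one, if_neg hn], wpart_one, if_pos rfl]

variable [CompleteSpace A]

theorem summable_wpart_mul {a b : NCS Φ ℂ} (ha : Summable fun n => ‖wpart x a n‖)
    (hb : Summable fun n => ‖wpart x b n‖) : Summable fun n => ‖wpart x (a * b) n‖ := by
  simp only [wpart_mul]
  exact summable_norm_sum_mul_antidiagonal_of_summable_norm hb ha

/-- The factors change places because `rprod` multiplies the letters in reversed order. -/
theorem wser_mul {a b : NCS Φ ℂ} (ha : Summable fun n => ‖wpart x a n‖)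
    (hb : Summable fun n => ‖wpart x b n‖) : wser x (a * b) = wser x b * wser x a := by
  rw [wser, wser, wser, tsum_mul_tsum_eq_tsum_sum_antidiagonal_of_summable_norm hb ha]
  exact tsum_congr fun n => wpart_mul a b n

theorem summable_wpart_pow {a : NCS Φ ℂ} (ha : Summable fun n => ‖wpart x a n‖) (k : ℕ) :
    Summable fun n => ‖wpart x (a ^ k) n‖ := by
  induction k with
  | zero => simpa using summable_wpart_one
  | succ k ih => rw [pow_succ]; exact summable_wpart_mul ih ha

theorem wser_pow {a : NCS Φ ℂ} (ha : Summable fun n => ‖wpart x a n‖) (k : ℕ) :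
    wser x (a ^ k) = wser x a ^ k := by
  induction k with
  | zero => simpa using wser_one
  | succ k ih => rw [pow_succ, wser_mul (summable_wpart_pow ha k) ha, ih, pow_succ']

end WordSeries

/-! ### The normalised fundamental solution and its asymptotics -/

section Solution

variable {Φ A : Type*} [Fintype Φ] [NormedRing A] [NormedAlgebra ℂ A] {x : Φ → A} {W : A}
  {z : Φ → ℂ} {E₀ E : Finset ℂ} {μ₀ e μ : ℝ}

/-- The series of the `q_l(τ)`. -/
def qncs (E : Finset ℂ) (μ₀ e : ℝ) (z : Φ → ℂ) (μ : ℝ) (τ : ℂ) : NCS Φ ℂ :=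
  ⟨fun l => qser E μ₀ e z μ l τ⟩

theorem wpart_antipode (c : NCS Φ ℂ) (n : ℕ) :
    wpart x (antipode c) n = (-1 : ℂ) ^ n • lsum n fun l => c l • rprod x l.reverse := by
  rw [wpart_reverse, lsum_eq_sum_ofFn, lsum_eq_sum_ofFn, Finset.smul_sum]
  refine Finset.sum_congr rfl fun a _ => ?_
  rw [smul_smul]
  show ((-1) ^ (List.ofFn a).reverse.length * c (List.ofFn a).reverse.reverse) • _ = _
  rw [List.reverse_reverse, List.length_reverse, List.length_ofFn]

theorem exists_wpart_bound (hx : IsWeighted x W z E₀) (h : IsSector (sumset E₀) μ₀ e) (hμ : 0 < μ)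
    (hμ' : μ < μ₀) {R r : ℝ} (hR : 0 ≤ R) (hr : 0 < r) :
    ∃ C : ℝ, 0 ≤ C ∧ ∀ n : ℕ, n ≠ 0 → ∀ τ : ℂ, r ≤ (slope e μ * τ).re →
      R ^ n * ‖wpart x (qncs (sumset E₀) μ₀ e z μ τ) n‖ ≤
        (1 / 2) ^ n * (C * ‖slope e μ * τ‖ / (slope e μ * τ).re ^ 2) := by
  obtain ⟨D, hD, hb⟩ := exists_norm_rprod_le x
  exact exists_lsum_bound h hx.ne_zero hμ hμ' (norm_nonneg _) hD hb (fun l hl => hx.adm hl) hR hr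

theorem exists_wpart_antipode_bound (hx : IsWeighted x W z E₀) (h : IsSector (sumset E₀) μ₀ e)
    (hμ : 0 < μ) (hμ' : μ < μ₀) {r : ℝ} (hr : 0 < r) :
    ∃ C : ℝ, 0 ≤ C ∧ ∀ n : ℕ, n ≠ 0 → ∀ τ : ℂ, r ≤ (slope e μ * τ).re →
      ‖wpart x (antipode (qncs (sumset E₀) μ₀ e z μ τ)) n‖ ≤
        (1 / 2) ^ n * (C * ‖slope e μ * τ‖ / (slope e μ * τ).re ^ 2) := by
  obtain ⟨D, hD, hb⟩ := exists_norm_rprod_le x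
  obtain ⟨C, hC, h1⟩ := exists_lsum_bound h hx.ne_zero hμ hμ' (y := fun l => rprod x l.reverse)
    (norm_nonneg _) hD (fun l => by simpa using hb l.reverse) (fun l hl => hx.adm_reverse hl)
    zero_le_one hr
  refine ⟨C, hC, fun n hn τ hτ => ?_⟩
  have h2 := h1 n hn τ hτ
  rw [one_pow, one_mul] at h2
  rw [wpart_antipode, norm_smul, norm_pow, norm_neg, norm_one, one_pow, one_mul]
  exact h2

theorem summable_of_forall_ne_zero {a : ℕ → ℝ} {C : ℝ} (h0 : ∀ n, 0 ≤ a n)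
    (h : ∀ n, n ≠ 0 → a n ≤ (1 / 2) ^ n * C) : Summable a := by
  rw [← summable_nat_add_iff 1]
  refine Summable.of_nonneg_of_le (fun n => h0 _) (fun n => h (n + 1) (by omega)) ?_
  exact ((summable_nat_add_iff 1).2 summable_geometric_two).mul_right C

theorem summable_wpart_qncs (hx : IsWeighted x W z E₀) (h : IsSector (sumset E₀) μ₀ e) (hμ : 0 < μ)
    (hμ' : μ < μ₀) {τ : ℂ} (hτ : 0 < (slope e μ * τ).re) {R : ℝ} (hR : 0 ≤ R) :
    Summable fun n => R ^ n * ‖wpart x (qncs (sumset E₀) μ₀ e z μ τ) n‖ := by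
  obtain ⟨C, _, h1⟩ := exists_wpart_bound hx h hμ hμ' hR hτ
  exact summable_of_forall_ne_zero (fun n => by positivity) fun n hn => h1 n hn τ le_rfl

theorem summable_wpart_antipode (hx : IsWeighted x W z E₀) (h : IsSector (sumset E₀) μ₀ e)
    (hμ : 0 < μ) (hμ' : μ < μ₀) {τ : ℂ} (hτ : 0 < (slope e μ * τ).re) :
    Summable fun n => ‖wpart x (antipode (qncs (sumset E₀) μ₀ e z μ τ)) n‖ := by
  obtain ⟨C, _, h1⟩ := exists_wpart_antipode_bound hx h hμ hμ' hτ
  exact summable_of_forall_ne_zero (fun n => by positivity) fun n hn => h1 n hn τ le_rfl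

/-- The normalised fundamental solution. -/
def sol (x : Φ → A) (E : Finset ℂ) (μ₀ e : ℝ) (z : Φ → ℂ) (μ : ℝ) (τ : ℂ) : A :=
  wser x (antipode (qncs E μ₀ e z μ τ))

/-- The inverse of the normalised fundamental solution. -/
def solInv (x : Φ → A) (E : Finset ℂ) (μ₀ e : ℝ) (z : Φ → ℂ) (μ : ℝ) (τ : ℂ) : A :=
  wser x (qncs E μ₀ e z μ τ)

theorem wpart_antipode_mul (hx : IsWeighted x W z E₀) (h : IsSector (sumset E₀) μ₀ e)
    (hμ : 0 < μ) (hμ' : μ < μ₀) {τ : ℂ} (hτ : 0 < (slope e μ * τ).re) {l : List Φ}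
    (hl : rprod x l ≠ 0) :
    (antipode (qncs (sumset E₀) μ₀ e z μ τ) * qncs (sumset E₀) μ₀ e z μ τ) l = (1 : NCS Φ ℂ) l := by
  refine antipode_mul (qser_nil hτ) fun u v huv => ?_
  exact sh_qser h hx.ne_zero hμ hμ' (hx.admPair_reverse (by rwa [huv])) hτ

theorem solInv_mul_sol [CompleteSpace A] (hx : IsWeighted x W z E₀) (h : IsSector (sumset E₀) μ₀ e)
    (hμ : 0 < μ) (hμ' : μ < μ₀) {τ : ℂ} (hτ : 0 < (slope e μ * τ).re) :
    solInv x (sumset E₀) μ₀ e z μ τ * sol x (sumset E₀) μ₀ e z μ τ = 1 := by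
  rw [solInv, sol, ← wser_mul (summable_wpart_antipode hx h hμ hμ' hτ)
    (by simpa using summable_wpart_qncs hx h hμ hμ' hτ zero_le_one), ← wser_one (x := x), wser, wser]
  exact tsum_congr fun n => wpart_congr fun l _ hl => wpart_antipode_mul hx h hμ hμ' hτ hl

theorem hasDerivAt_lsum {F : List Φ → ℂ → A} {G : List Φ → A} {n : ℕ} {τ : ℂ}
    (h : ∀ l, l.length = n → HasDerivAt (F l) (G l) τ) :
    HasDerivAt (fun τ => lsum n fun l => F l τ) (lsum n G) τ := by
  simp only [lsum_eq_sum_ofFn]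
  exact HasDerivAt.fun_sum fun a _ => h _ (by simp)

/-- The antipode reverses words, so the removal of the first letter `b` in the equation of `q`
becomes a left multiplication by `x b`. The term `-s q` becomes a commutator with `W`, as `s` is the
eigenvalue of the word under `ad W`. -/
theorem hasDerivAt_wpart_antipode (hx : IsWeighted x W z E₀) (h : IsSector (sumset E₀) μ₀ e)
    (hμ : 0 < μ) (hμ' : μ < μ₀) {τ : ℂ} (hτ : 0 < (slope e μ * τ).re) (n : ℕ) :
    HasDerivAt (fun τ => wpart x (antipode (qncs (sumset E₀) μ₀ e z μ τ)) (n + 1))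
      (wpart x (antipode (qncs (sumset E₀) μ₀ e z μ τ)) (n + 1) * W -
        W * wpart x (antipode (qncs (sumset E₀) μ₀ e z μ τ)) (n + 1) -
        τ⁻¹ • ((∑ b, x b) * wpart x (antipode (qncs (sumset E₀) μ₀ e z μ τ)) n)) τ := by
  simp only [wpart_antipode]
  have h1 : ∀ (l : List Φ) (b : Φ), HasDerivAt (fun τ => qser (sumset E₀) μ₀ e z μ (b :: l) τ •
      rprod x (b :: l).reverse) ((-wsum z (b :: l) * qser (sumset E₀) μ₀ e z μ (b :: l) τ +
        qser (sumset E₀) μ₀ e z μ l τ / τ) • rprod x (b :: l).reverse) τ := by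
    intro l b
    by_cases h0 : rprod x (b :: l).reverse = 0
    · simp only [h0, smul_zero]
      exact hasDerivAt_const _ _
    · exact (hasDerivAt_qser h hx.ne_zero hμ hμ' (hx.adm_reverse h0) hτ).smul_const _
  have h2 : HasDerivAt (fun τ => lsum (n + 1) fun l => qser (sumset E₀) μ₀ e z μ l τ •
      rprod x l.reverse) (∑ b, lsum n fun l =>
        ((-wsum z (b :: l) * qser (sumset E₀) μ₀ e z μ (b :: l) τ +
        qser (sumset E₀) μ₀ e z μ l τ / τ) • rprod x (b :: l).reverse)) τ := by
    simp only [lsum]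
    exact HasDerivAt.fun_sum fun b _ => hasDerivAt_lsum fun l _ => h1 l b
  refine (h2.const_smul ((-1 : ℂ) ^ (n + 1))).congr_deriv ?_
  rw [smul_mul_assoc, mul_smul_comm, mul_smul_comm, ← smul_sub, pow_succ, mul_neg_one,
    smul_comm τ⁻¹, sub_eq_add_neg, ← smul_neg, neg_smul, neg_smul, ← smul_neg, ← smul_neg,
    ← smul_add]
  congr 1
  rw [lsum, Finset.sum_mul, Finset.mul_sum, ← Finset.sum_sub_distrib, Finset.sum_mul,
    Finset.smul_sum, ← Finset.sum_neg_distrib, ← Finset.sum_neg_distrib, ← Finset.sum_neg_distrib,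
    ← Finset.sum_add_distrib]
  refine Finset.sum_congr rfl fun b _ => ?_
  simp only [lsum_eq_sum_ofFn, Finset.sum_mul, Finset.mul_sum, Finset.smul_sum,
    ← Finset.sum_neg_distrib, ← Finset.sum_add_distrib, ← Finset.sum_sub_distrib]
  refine Finset.sum_congr rfl fun a _ => ?_
  have h3 := hx.lie_rprod (b :: List.ofFn a).reverse
  rw [wsum_reverse] at h3
  have h4 : x b * rprod x (List.ofFn a).reverse = rprod x (b :: List.ofFn a).reverse := by
    rw [List.reverse_cons, rprod_append]
    simp [rprod]
  have h5 : ∀ (l : List Φ), (qncs (sumset E₀) μ₀ e z μ τ).coeff l = qser (sumset E₀) μ₀ e z μ l τ :=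
    fun _ => rfl
  rw [h5, h5, smul_mul_assoc, mul_smul_comm, mul_smul_comm, h4, ← smul_sub, ← neg_sub (W * _), h3]
  module

variable [CompleteSpace A]

theorem hasDerivAt_sol (hx : IsWeighted x W z E₀) (h : IsSector (sumset E₀) μ₀ e)
    (hμ : 0 < μ) (hμ' : μ < μ₀) {τ : ℂ} (hτ : 0 < (slope e μ * τ).re) :
    HasDerivAt (sol x (sumset E₀) μ₀ e z μ)
      (sol x (sumset E₀) μ₀ e z μ τ * W - W * sol x (sumset E₀) μ₀ e z μ τ -
        τ⁻¹ • ((∑ b, x b) * sol x (sumset E₀) μ₀ e z μ τ)) τ := by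
  set F : ℕ → ℂ → A := fun n τ => wpart x (antipode (qncs (sumset E₀) μ₀ e z μ τ)) n with hF
  set r := (slope e μ * τ).re / 2 with hr
  have hr0 : 0 < r := half_pos hτ
  set B := ‖slope e μ * τ‖ + 1 with hB
  set U : Set ℂ := {σ | r < (slope e μ * σ).re} ∩ {σ | ‖slope e μ * σ‖ < B} with hU
  have hUo : IsOpen U := (isOpen_lt (by fun_prop) (by fun_prop)).inter
    (isOpen_lt (by fun_prop) (by fun_prop))
  have hτU : τ ∈ U := ⟨half_lt_self hτ, show ‖slope e μ * τ‖ < B from lt_add_one _⟩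
  have hF0 : ∀ σ ∈ U, F 0 σ = 1 := by
    intro σ hσ
    have : qser (sumset E₀) μ₀ e z μ [] σ = 1 := qser_nil (hr0.trans hσ.1)
    simp only [hF, wpart, lsum, rprod]
    show ((-1) ^ 0 * qser (sumset E₀) μ₀ e z μ [] σ) • (1 : A) = 1
    simp [this]
  have hd : ∀ n, ∀ σ ∈ U, HasDerivAt (F (n + 1)) (F (n + 1) σ * W - W * F (n + 1) σ -
      σ⁻¹ • ((∑ b, x b) * F n σ)) σ := fun n σ hσ =>
    hasDerivAt_wpart_antipode hx h hμ hμ' (hr0.trans hσ.1) n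
  have hd0 : ∀ σ ∈ U, HasDerivAt (F 0) 0 σ := by
    intro σ hσ
    refine (hasDerivAt_const σ (1 : A)).congr_of_eventuallyEq ?_
    filter_upwards [hUo.mem_nhds hσ] with σ' hσ' using hF0 σ' hσ'
  have hdiff : ∀ n, DifferentiableOn ℂ (F n) U := by
    rintro (_ | n) σ hσ
    · exact (hd0 σ hσ).differentiableAt.differentiableWithinAt
    · exact (hd n σ hσ).differentiableAt.differentiableWithinAt
  obtain ⟨C, hC, hbound⟩ := exists_wpart_antipode_bound hx h hμ hμ' hr0
  have hle : ∀ n, ∀ σ ∈ U, ‖F n σ‖ ≤ (1 / 2 : ℝ) ^ n * (C * B / r ^ 2 + ‖(1 : A)‖) := by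
    rintro n σ hσ
    rcases eq_or_ne n 0 with rfl | hn
    · rw [hF0 σ hσ, pow_zero, one_mul]
      exact le_add_of_nonneg_left (by positivity)
    · refine (hbound n hn σ (le_of_lt hσ.1)).trans ?_
      have h1 : C * ‖slope e μ * σ‖ / (slope e μ * σ).re ^ 2 ≤ C * B / r ^ 2 := by
        have h2 : r < (slope e μ * σ).re := hσ.1
        have h3 : ‖slope e μ * σ‖ < B := hσ.2
        gcongr
      have h2 := norm_nonneg (1 : A)
      gcongr
      linarith
  have hsum : Summable fun n => (1 / 2 : ℝ) ^ n * (C * B / r ^ 2 + ‖(1 : A)‖) :=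
    summable_geometric_two.mul_right _
  have h1 := Complex.hasSum_deriv_of_summable_norm hsum hdiff hUo hle hτU
  have h2 := (Complex.differentiableOn_tsum_of_summable_norm hsum hdiff hUo hle).differentiableAt
    (hUo.mem_nhds hτU)
  have hFs : HasSum (fun n => F n τ) (sol x (sumset E₀) μ₀ e z μ τ) :=
    (summable_wpart_antipode hx h hμ hμ' hτ).of_norm.hasSum
  have h3 : HasSum (fun n => deriv (F n) τ)
      (sol x (sumset E₀) μ₀ e z μ τ * W - W * sol x (sumset E₀) μ₀ e z μ τ -
        τ⁻¹ • ((∑ b, x b) * sol x (sumset E₀) μ₀ e z μ τ)) := by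
    rw [← hasSum_nat_add_iff' 1]
    have h4 := ((((hasSum_nat_add_iff' 1).2 hFs).mul_right W).sub
      (((hasSum_nat_add_iff' 1).2 hFs).mul_left W)).sub
      ((hFs.mul_left (∑ b, x b)).const_smul τ⁻¹)
    simp only [Finset.range_one, Finset.sum_singleton, hF0 τ hτU, (hd0 τ hτU).deriv] at h4 ⊢
    convert! h4 using 1
    · funext n
      exact (hd n τ hτU).deriv
    · noncomm_ring
  have h4 := h2.hasDerivAt
  rw [h1.unique h3] at h4
  exact h4

/-- Near the boundary of the half plane of `μ` the real part is not comparable to `‖τ‖`. Tilting the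
ray of integration slightly to one side, according to the sign of `e * τ.im`, makes it comparable,
and the solution does not change. -/
theorem exists_slope_alternative (hμ : 0 < μ) (hμ' : μ < μ₀) (he : e = 1 ∨ e = -1) :
    ∃ μ₁ μ₂ c : ℝ, 0 < μ₁ ∧ μ₁ < μ₀ ∧ 0 < μ₂ ∧ μ₂ < μ₀ ∧ 0 < c ∧ ∀ τ : ℂ,
      0 < (slope e μ * τ).re → c * ‖τ‖ ≤ (slope e μ₁ * τ).re ∨ c * ‖τ‖ ≤ (slope e μ₂ * τ).re := by
  have hre : ∀ (ν : ℝ) (τ : ℂ), (slope e ν * τ).re = τ.re - ν * (e * τ.im) := by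
    intro ν τ
    simp [slope]
    ring
  set d := min (μ / 2) ((μ₀ - μ) / 2) with hd
  have hd0 : 0 < d := lt_min (by linarith) (by linarith)
  have hd1 : d ≤ μ / 2 := min_le_left _ _
  have hd2 : d ≤ (μ₀ - μ) / 2 := min_le_right _ _
  have hdiv : d / (μ + 1) ≤ 1 := by rw [div_le_one (by linarith)]; linarith
  have hdiv' : d / (μ + 1) * (μ + 1) = d := by field_simp
  refine ⟨μ - d, μ + d, d / (μ + 1), by linarith, by linarith, by linarith, by linarith,
    by positivity, fun τ hτ => ?_⟩
  set c := d / (μ + 1) with hc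
  have hc0 : 0 < c := by positivity
  have hnorm : ‖τ‖ ≤ |τ.re| + |e * τ.im| := by
    have h1 := Complex.norm_le_abs_re_add_abs_im τ
    have h2 : |e * τ.im| = |τ.im| := by rcases he with rfl | rfl <;> simp
    rwa [h2]
  rw [hre] at hτ
  rw [hre, hre]
  set b := e * τ.im with hb
  have habs : |τ.re| ≤ (τ.re - μ * b) + μ * |b| := by
    have h1 := le_abs_self b
    have h2 := neg_abs_le b
    rw [abs_le]
    constructor <;> nlinarith
  have h1 : c * ‖τ‖ ≤ (τ.re - μ * b) + d * |b| := by
    have h2 : c * ‖τ‖ ≤ c * ((τ.re - μ * b) + (μ + 1) * |b|) :=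
      mul_le_mul_of_nonneg_left (by linarith) hc0.le
    have h3 : c * (τ.re - μ * b) ≤ 1 * (τ.re - μ * b) := mul_le_mul_of_nonneg_right hdiv hτ.le
    have h4 : c * ((μ + 1) * |b|) = d * |b| := by rw [← mul_assoc, hdiv']
    linarith
  rcases le_total 0 b with h0 | h0
  · left
    rw [abs_of_nonneg h0] at h1
    linarith
  · right
    rw [abs_of_nonpos h0] at h1
    linarith

theorem sol_indep (hx : IsWeighted x W z E₀) (h : IsSector (sumset E₀) μ₀ e)
    (hμ : 0 < μ) (hμ' : μ < μ₀) {ν : ℝ} (hν : 0 < ν) (hν' : ν < μ₀) {τ : ℂ}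
    (hτ : 0 < (slope e μ * τ).re) (hτ' : 0 < (slope e ν * τ).re) :
    sol x (sumset E₀) μ₀ e z μ τ = sol x (sumset E₀) μ₀ e z ν τ := by
  refine tsum_congr fun n => wpart_congr fun l _ hl => ?_
  show (-1) ^ l.length * qser _ _ _ _ _ _ _ = (-1) ^ l.length * qser _ _ _ _ _ _ _
  rw [qser_indep h hx.ne_zero hμ hμ' hν hν' (hx.adm_reverse (by rwa [List.reverse_reverse])) hτ hτ']

theorem norm_sol_sub_one_le (hx : IsWeighted x W z E₀) (h : IsSector (sumset E₀) μ₀ e)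
    (hμ : 0 < μ) (hμ' : μ < μ₀) {r : ℝ} (hr : 0 < r) :
    ∃ C : ℝ, 0 ≤ C ∧ ∀ τ : ℂ, r ≤ (slope e μ * τ).re → ‖sol x (sumset E₀) μ₀ e z μ τ - 1‖ ≤
      C * ‖slope e μ * τ‖ / (slope e μ * τ).re ^ 2 := by
  obtain ⟨C, hC, hbound⟩ := exists_wpart_antipode_bound hx h hμ hμ' hr
  refine ⟨C, hC, fun τ hτ => ?_⟩
  have hτ0 : 0 < (slope e μ * τ).re := hr.trans_le hτ
  have h0 : wpart x (antipode (qncs (sumset E₀) μ₀ e z μ τ)) 0 = 1 := by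
    have : qser (sumset E₀) μ₀ e z μ [] τ = 1 := qser_nil hτ0
    simp only [wpart, lsum, rprod]
    show ((-1) ^ 0 * qser (sumset E₀) μ₀ e z μ [] τ) • (1 : A) = 1
    simp [this]
  have h1 := summable_wpart_antipode hx h hμ hμ' hτ0
  have h2 : sol x (sumset E₀) μ₀ e z μ τ - 1 =
      ∑' n, wpart x (antipode (qncs (sumset E₀) μ₀ e z μ τ)) (n + 1) := by
    rw [sol, wser, h1.of_norm.tsum_eq_zero_add, h0, add_sub_cancel_left]
  rw [h2]
  have h3 : HasSum (fun n : ℕ => (1 / 2 : ℝ) ^ (n + 1) *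
      (C * ‖slope e μ * τ‖ / (slope e μ * τ).re ^ 2))
      (1 * (C * ‖slope e μ * τ‖ / (slope e μ * τ).re ^ 2)) := by
    refine HasSum.mul_right _ ?_
    have h4 := hasSum_geometric_two.mul_left (1 / 2 : ℝ)
    simp only [← pow_succ'] at h4
    norm_num at h4 ⊢
    exact h4
  rw [← one_mul (C * ‖slope e μ * τ‖ / (slope e μ * τ).re ^ 2)]
  exact tsum_of_norm_bounded h3 fun n => hbound (n + 1) (by omega) τ hτ

/-- The normalised solution tends to `1` at infinity, uniformly in the half plane. -/
theorem exists_sol_bound (hx : IsWeighted x W z E₀) (h : IsSector (sumset E₀) μ₀ e)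
    (hμ : 0 < μ) (hμ' : μ < μ₀) : ∃ C : ℝ, 0 ≤ C ∧ ∀ τ : ℂ, 0 < (slope e μ * τ).re → 1 ≤ ‖τ‖ →
      ‖sol x (sumset E₀) μ₀ e z μ τ - 1‖ ≤ C / ‖τ‖ := by
  obtain ⟨μ₁, μ₂, c, h1, h1', h2, h2', hc, halt⟩ := exists_slope_alternative hμ hμ' h.sign
  have key : ∀ ν, 0 < ν → ν < μ₀ → ∃ C : ℝ, 0 ≤ C ∧ ∀ τ : ℂ, 0 < (slope e μ * τ).re → 1 ≤ ‖τ‖ →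
      c * ‖τ‖ ≤ (slope e ν * τ).re → ‖sol x (sumset E₀) μ₀ e z μ τ - 1‖ ≤ C / ‖τ‖ := by
    intro ν hν hν'
    obtain ⟨C, hC, hb⟩ := norm_sol_sub_one_le hx h hν hν' hc
    refine ⟨C * ‖slope e ν‖ / c ^ 2, by positivity, fun τ hτ hτ1 hτc => ?_⟩
    have h3 : c ≤ (slope e ν * τ).re := by nlinarith
    rw [sol_indep hx h hμ hμ' hν hν' hτ (hc.trans_le h3)]
    refine (hb τ h3).trans ?_
    have h4 : 0 < ‖τ‖ := by linarith
    calc _ ≤ C * ‖slope e ν * τ‖ / (c * ‖τ‖) ^ 2 := by gcongr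
      _ = _ := by rw [norm_mul]; field_simp
  obtain ⟨C₁, hC₁, hb₁⟩ := key μ₁ h1 h1'
  obtain ⟨C₂, hC₂, hb₂⟩ := key μ₂ h2 h2'
  refine ⟨C₁ + C₂, by positivity, fun τ hτ hτ1 => ?_⟩
  have h4 : 0 < ‖τ‖ := by linarith
  rcases halt τ hτ with h5 | h5
  · refine (hb₁ τ hτ hτ1 h5).trans ?_
    gcongr
    linarith
  · refine (hb₂ τ hτ hτ1 h5).trans ?_
    gcongr
    linarith

end Solution

/-! ### Exponentials and logarithms of unipotent elements -/

section Exponential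

variable {A : Type*} [NormedRing A] [NormedAlgebra ℂ A]

/-- The composites of the curve with the linear functionals are polynomials. -/
def IsPolyCurve (F : ℂ → A) : Prop :=
  ∀ φ : A →ₗ[ℂ] ℂ, ∃ p : Polynomial ℂ, ∀ s, φ (F s) = p.eval s

theorem IsPolyCurve.mul_const {F : ℂ → A} (hF : IsPolyCurve F) (a : A) :
    IsPolyCurve fun s => F s * a := fun φ => hF (φ ∘ₗ LinearMap.mulRight ℂ a)

theorem IsPolyCurve.const_mul {F : ℂ → A} (hF : IsPolyCurve F) (a : A) :
    IsPolyCurve fun s => a * F s := fun φ => hF (φ ∘ₗ LinearMap.mulLeft ℂ a)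

theorem IsPolyCurve.comp_add {F : ℂ → A} (hF : IsPolyCurve F) (t : ℂ) :
    IsPolyCurve fun s => F (s + t) := by
  intro φ
  obtain ⟨p, hp⟩ := hF φ
  exact ⟨p.comp (Polynomial.X + Polynomial.C t), fun s => by rw [hp]; simp⟩

/-- After application of a linear functional these are polynomials that agree at all natural
numbers. -/
theorem IsPolyCurve.ext {F G : ℂ → A} (hF : IsPolyCurve F) (hG : IsPolyCurve G)
    (h : ∀ k : ℕ, F k = G k) : F = G := by
  funext s
  rw [← sub_eq_zero, ← Module.forall_dual_apply_eq_zero_iff ℂ]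
  intro φ
  obtain ⟨p, hp⟩ := hF φ
  obtain ⟨q, hq⟩ := hG φ
  have hpq : p = q := by
    refine Polynomial.eq_of_infinite_eval_eq p q ((Set.infinite_range_of_injective
      (Nat.cast_injective (R := ℂ))).mono ?_)
    rintro _ ⟨k, rfl⟩
    show p.eval _ = q.eval _
    rw [← hp, ← hq, h]
  rw [map_sub, hp, hq, hpq, sub_self]

theorem isPolyCurve_sum (J : ℕ) (p : ℕ → Polynomial ℂ) (a : ℕ → A) :
    IsPolyCurve fun s => ∑ j ∈ Finset.range J, (p j).eval s • a j := by
  refine fun φ => ⟨∑ j ∈ Finset.range J, p j * Polynomial.C (φ (a j)), fun s => ?_⟩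
  simp [Polynomial.eval_finsetSum]

/-- The powers of `1 + y` for a nilpotent `y`, with complex exponents. -/
def cpowNil (y : A) (J : ℕ) (s : ℂ) : A := ∑ j ∈ Finset.range J, (binomPoly j).eval s • y ^ j

theorem cpowNil_natCast {y : A} {J : ℕ} (hy : y ^ J = 0) (k : ℕ) :
    cpowNil y J k = (1 + y) ^ k := by
  have h1 : (1 + y) ^ k = ∑ j ∈ Finset.range (k + 1), (k.choose j : ℂ) • y ^ j := by
    rw [add_comm, (Commute.one_right y).add_pow]
    refine Finset.sum_congr rfl fun j _ => ?_
    rw [one_pow, mul_one, Nat.cast_smul_eq_nsmul, nsmul_eq_mul, Nat.cast_comm]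
  rw [h1, cpowNil]
  simp only [binomPoly_eval]
  rcases le_total J (k + 1) with h | h
  · refine Finset.sum_subset (Finset.range_mono h) fun j _ hj => ?_
    rw [pow_eq_zero_of_le (by simpa using hj) hy, smul_zero]
  · refine (Finset.sum_subset (Finset.range_mono h) fun j _ hj => ?_).symm
    rw [Nat.choose_eq_zero_of_lt (by simpa using hj), Nat.cast_zero, zero_smul]

/-- The law holds for natural exponents; polynomiality extends it first in `s`, then in `t`. -/
theorem cpowNil_add {y : A} {J : ℕ} (hy : y ^ J = 0) (s t : ℂ) :
    cpowNil y J (s + t) = cpowNil y J s * cpowNil y J t := by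
  have hpc : IsPolyCurve (cpowNil y J) := isPolyCurve_sum J _ _
  have h1 : ∀ (k : ℕ) (s : ℂ), cpowNil y J (s + k) = cpowNil y J s * (1 + y) ^ k := fun k =>
    congrFun ((hpc.comp_add k).ext (hpc.mul_const ((1 + y) ^ k)) fun m => by
      rw [← Nat.cast_add, cpowNil_natCast hy, cpowNil_natCast hy, pow_add])
  have h2 := (hpc.comp_add s).ext (hpc.const_mul (cpowNil y J s)) fun k => by
    rw [add_comm, h1, cpowNil_natCast hy]
  have := congrFun h2 t
  rwa [add_comm] at this

variable [CompleteSpace A]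

/-- The exponential of the logarithm of a unipotent element. -/
theorem exp_sum_logCoeff {y : A} {J : ℕ} (hy : y ^ J = 0) :
    NormedSpace.exp (∑ j ∈ Finset.range J, logCoeff j • y ^ j) = 1 + y := by
  set X := ∑ j ∈ Finset.range J, logCoeff j • y ^ j with hX
  have hd0 : HasDerivAt (cpowNil y J) X 0 := by
    have : HasDerivAt (cpowNil y J)
        (∑ j ∈ Finset.range J, (Polynomial.derivative (binomPoly j)).eval 0 • y ^ j) 0 :=
      HasDerivAt.fun_sum fun j _ => ((binomPoly j).hasDerivAt 0).smul_const _
    refine this.congr_deriv (Finset.sum_congr rfl fun j _ => ?_)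
    rw [← Polynomial.coeff_zero_eq_eval_zero, Polynomial.coeff_derivative, ← binomPoly_coeff_one]
    simp
  have hd : ∀ s, HasDerivAt (cpowNil y J) (cpowNil y J s * X) s := by
    intro s
    have h1 : HasDerivAt (fun t => cpowNil y J s * cpowNil y J (t - s)) (cpowNil y J s * X) s := by
      refine HasDerivAt.const_mul _ ?_
      have : HasDerivAt (cpowNil y J) X (s - s) := by rwa [sub_self]
      exact this.comp_sub_const s s
    refine h1.congr_of_eventuallyEq (Filter.Eventually.of_forall fun t => ?_)
    show _ = cpowNil y J s * cpowNil y J (t - s)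
    rw [← cpowNil_add hy, add_sub_cancel]
  have hconst : ∀ s, HasDerivAt (fun s => cpowNil y J s * NormedSpace.exp (s • -X)) 0 s := by
    intro s
    refine ((hd s).mul (hasDerivAt_exp_smul_const' (-X) s)).congr_deriv ?_
    rw [neg_mul, mul_neg, mul_assoc, add_neg_cancel]
  have h1 := is_const_of_deriv_eq_zero (fun s => (hconst s).differentiableAt)
    (fun s => (hconst s).deriv) 1 0
  have h2 := cpowNil_natCast hy 0
  have h3 := cpowNil_natCast hy 1
  simp only [Nat.cast_zero, Nat.cast_one, pow_zero, pow_one] at h2 h3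
  rw [h2, h3, zero_smul, NormedSpace.exp_zero, one_mul, one_smul] at h1
  let _ : NormedAlgebra ℚ A := NormedAlgebra.restrictScalars ℚ ℂ A
  have h4 : NormedSpace.exp (-X) * NormedSpace.exp X = 1 := by
    rw [← NormedSpace.exp_add_of_commute (Commute.neg_left (Commute.refl X)), neg_add_cancel,
      NormedSpace.exp_zero]
  calc NormedSpace.exp X = (1 + y) * NormedSpace.exp (-X) * NormedSpace.exp X := by rw [h1, one_mul]
    _ = 1 + y := by rw [mul_assoc, h4, mul_one]

/-- For nilpotent `X` the curve `exp (s • X)` is polynomial in `s`, so it is determined by its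
values `exp X ^ k` at the natural numbers. Its derivative at `0` is `X`. -/
theorem exp_injective_of_isNilpotent {X Y : A} (hX : IsNilpotent X) (hY : IsNilpotent Y)
    (h : NormedSpace.exp X = NormedSpace.exp Y) : X = Y := by
  have hpc : ∀ X : A, IsNilpotent X → IsPolyCurve fun s : ℂ => NormedSpace.exp (s • X) := by
    rintro X ⟨J, hJ⟩
    have : (fun s : ℂ => NormedSpace.exp (s • X)) = fun s : ℂ => ∑ j ∈ Finset.range J,
        (Polynomial.C ((j.factorial : ℂ)⁻¹) * Polynomial.X ^ j).eval s • X ^ j := by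
      funext s
      rw [NormedSpace.exp_eq_tsum ℂ]
      simp only
      rw [tsum_eq_sum (s := Finset.range J) fun j hj => by
        rw [smul_pow, pow_eq_zero_of_le (by simpa using hj) hJ, smul_zero, smul_zero]]
      refine Finset.sum_congr rfl fun j _ => ?_
      rw [smul_pow, smul_smul]
      simp
    rw [this]
    exact isPolyCurve_sum J _ _
  let _ : NormedAlgebra ℚ A := NormedAlgebra.restrictScalars ℚ ℂ A
  have h1 := (hpc X hX).ext (hpc Y hY) fun k => by
    rw [Nat.cast_smul_eq_nsmul, Nat.cast_smul_eq_nsmul, NormedSpace.exp_nsmul,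
      NormedSpace.exp_nsmul, h]
  have h2 := hasDerivAt_exp_smul_const (𝕂 := ℂ) X (0 : ℂ)
  have h3 := hasDerivAt_exp_smul_const (𝕂 := ℂ) Y (0 : ℂ)
  rw [h1] at h2
  have h4 := h2.unique h3
  simpa using h4

/-- The hypothesis says `y * (W + s) = W * y`, and this relation passes to exponentials. -/
theorem exp_neg_mul_mul_exp {W y : A} {s : ℂ} (h : W * y - y * W = s • y) (τ : ℂ) :
    NormedSpace.exp (-(τ • W)) * y * NormedSpace.exp (τ • W) = Complex.exp (-(s * τ)) • y := by
  let _ : NormedAlgebra ℚ A := NormedAlgebra.restrictScalars ℚ ℂ A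
  have h1 : SemiconjBy y (τ • W + algebraMap ℂ A (s * τ)) (τ • W) := by
    rw [SemiconjBy, mul_add, smul_mul_assoc, mul_smul_comm, ← Algebra.commutes, ← Algebra.smul_def,
      mul_comm s, mul_smul, ← h, ← smul_add]
    congr 1
    abel
  have h2 := h1.exp_neg_mul_mul_exp_eq_self
  rw [NormedSpace.exp_add_of_commute (Algebra.commutes (s * τ) (τ • W)).symm,
    ← NormedSpace.algebraMap_exp_comm, ← Complex.exp_eq_exp_ℂ, ← Algebra.commutes,
    ← Algebra.smul_def, mul_smul_comm] at h2
  have h3 : Complex.exp (-(s * τ)) * Complex.exp (s * τ) = 1 := by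
    rw [← Complex.exp_add, neg_add_cancel, Complex.exp_zero]
  conv_rhs => rw [← h2]
  rw [smul_smul, h3, one_smul]

end Exponential

/-! ### Logarithms of series whose words have positive weights -/

section Log

variable {Φ A : Type*} [Fintype Φ] [NormedRing A] [NormedAlgebra ℂ A] {x : Φ → A} {W : A}
  {z : Φ → ℂ} {E₀ : Finset ℂ}

theorem exists_pos_le_re (E₀ : Finset ℂ) :
    ∃ δ : ℝ, 0 < δ ∧ ∀ s ∈ E₀, 0 < s.re → δ ≤ s.re := by
  induction E₀ using Finset.induction_on with
  | empty => exact ⟨1, one_pos, by simp⟩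
  | insert w E _ ih =>
    obtain ⟨δ, hδ, h⟩ := ih
    rcases le_or_gt w.re 0 with hw | hw
    · refine ⟨δ, hδ, fun s hs h0 => ?_⟩
      rcases Finset.mem_insert.1 hs with rfl | hs
      · linarith
      · exact h s hs h0
    · refine ⟨min δ w.re, lt_min hδ hw, fun s hs h0 => ?_⟩
      rcases Finset.mem_insert.1 hs with rfl | hs
      · exact min_le_right _ _
      · exact (min_le_left _ _).trans (h s hs h0)

theorem exists_re_le_nat_mul (E₀ : Finset ℂ) {δ : ℝ} (hδ : 0 < δ) :
    ∃ J : ℕ, ∀ s ∈ E₀, s.re < J * δ := by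
  obtain ⟨J, hJ⟩ := exists_nat_gt ((∑ s ∈ E₀, |s.re|) / δ)
  refine ⟨J, fun s hs => ?_⟩
  rw [div_lt_iff₀ hδ] at hJ
  exact ((le_abs_self _).trans (Finset.single_le_sum (f := fun s : ℂ => |s.re|)
    (fun s _ => abs_nonneg s.re) hs)).trans_lt hJ

theorem NCS.exists_of_mul_ne_zero {a b : NCS Φ ℂ} {l : List Φ} (h : (a * b) l ≠ 0) :
    ∃ u v, u ++ v = l ∧ a u ≠ 0 ∧ b v ≠ 0 := by
  by_contra hc
  push Not at hc
  refine h ?_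
  rw [NCS.mul_congr (a' := 0) (b' := b) fun u v huv => ?_, zero_mul, NCS.zero_apply]
  rw [NCS.zero_apply, zero_mul]
  by_cases hu : a u = 0
  · rw [hu, zero_mul]
  · rw [hc u v huv hu, mul_zero]

/-- The powers of a series without constant term whose words have weights with positive real parts
vanish on the nonzero words, from some power on. -/
theorem IsWeighted.exists_pow_eq_zero (hx : IsWeighted x W z E₀) {c : NCS Φ ℂ}
    (hpos : ∀ l, c l ≠ 0 → 0 < (wsum z l).re) :
    ∃ J : ℕ, ∀ j, J ≤ j → ∀ l, rprod x l ≠ 0 → (c ^ j) l = 0 := by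
  obtain ⟨δ, hδ, hδE⟩ := exists_pos_le_re E₀
  obtain ⟨J, hJ⟩ := exists_re_le_nat_mul E₀ hδ
  have key : ∀ (j : ℕ) (l : List Φ), rprod x l ≠ 0 → (c ^ j) l ≠ 0 → j * δ ≤ (wsum z l).re := by
    intro j
    induction j with
    | zero =>
      intro l hl h
      rcases l with _ | ⟨b, l⟩
      · simp
      · rw [pow_zero, NCS.one_cons] at h
        exact absurd rfl h
    | succ j ih =>
      intro l hl h
      rw [pow_succ] at h
      obtain ⟨u, v, rfl, hu, hv⟩ := NCS.exists_of_mul_ne_zero h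
      have hl' := hl
      rw [rprod_append] at hl'
      have h1 := ih u (right_ne_zero_of_mul hl') hu
      have h2 := hδE _ (hx.wsum_mem_of_infix hl (List.suffix_append u v).isInfix) (hpos v hv)
      rw [wsum_append, Complex.add_re]
      push_cast
      linarith
  refine ⟨J, fun j hj l hl => ?_⟩
  by_contra h
  have h1 := key j l hl h
  have h2 := hJ _ (hx.wsum_mem_of_infix hl (List.infix_refl l))
  have h3 : (J : ℝ) * δ ≤ j * δ := by gcongr
  linarith

theorem wpart_sum_smul (s : Finset ℕ) (r : ℕ → ℂ) (c : ℕ → NCS Φ ℂ) {d : NCS Φ ℂ} {n : ℕ}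
    (h : ∀ l, l.length = n → rprod x l ≠ 0 → d l = ∑ j ∈ s, r j * c j l) :
    wpart x d n = ∑ j ∈ s, r j • wpart x (c j) n := by
  have h1 : wpart x d n = lsum n fun l => ∑ j ∈ s, (r j * c j l) • rprod x l := by
    refine lsum_congr fun l hl => ?_
    rw [← Finset.sum_smul]
    by_cases h0 : rprod x l = 0
    · rw [h0, smul_zero, smul_zero]
    · rw [h l hl h0]
  rw [h1, lsum_sum]
  refine Finset.sum_congr rfl fun j _ => ?_
  rw [wpart, lsum_eq_sum_ofFn, lsum_eq_sum_ofFn, Finset.smul_sum]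
  exact Finset.sum_congr rfl fun a _ => mul_smul _ _ _

/-- The real parts of the weights add up, so in a sufficiently long product they exceed those of all
eigenvalues of `ad W`, and the product is zero. -/
theorem isNilpotent_sum (hx : IsWeighted x W z E₀) (hpos : ∀ b, 0 < (z b).re) :
    IsNilpotent (∑ b, x b) := by
  obtain ⟨δ, hδ, hδE⟩ := exists_pos_le_re E₀
  obtain ⟨J, hJ⟩ := exists_re_le_nat_mul E₀ hδ
  have h1 : ∀ k, (∑ b, x b) ^ k = lsum k (rprod x) := by
    intro k
    induction k with
    | zero => rw [pow_zero]; rfl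
    | succ k ih =>
      rw [pow_succ, Finset.mul_sum, lsum]
      refine Finset.sum_congr rfl fun b _ => ?_
      rw [ih, ← lsum_mul]
      rfl
  refine ⟨J, ?_⟩
  rw [h1, ← lsum_zero (Φ := Φ) J]
  refine lsum_congr fun l hl => ?_
  by_contra h
  have h2 : ∀ l : List Φ, rprod x l ≠ 0 → l.length * δ ≤ (wsum z l).re := by
    intro l
    induction l with
    | nil => simp
    | cons b l ih =>
      intro h
      have h3 := ih (left_ne_zero_of_mul h)
      have h4 := hδE _ (hx.mem _ _ (right_ne_zero_of_mul h) (hx.lie b)) (hpos b)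
      rw [wsum_cons, Complex.add_re, List.length_cons]
      push_cast
      linarith
  have h3 := h2 l h
  have h4 := hJ _ (hx.wsum_mem_of_infix h (List.infix_refl l))
  rw [hl] at h3
  linarith

theorem wpart_sub (c d : NCS Φ ℂ) (n : ℕ) : wpart x (c - d) n = wpart x c n - wpart x d n := by
  simp only [wpart, lsum_eq_sum_ofFn, NCS.sub_apply, sub_smul, Finset.sum_sub_distrib]

theorem summable_wpart_sub_one {c : NCS Φ ℂ} (hc : Summable fun n => ‖wpart x c n‖) :
    Summable fun n => ‖wpart x (c - 1) n‖ := by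
  have h1 : Summable fun n => ‖wpart x (1 : NCS Φ ℂ) n‖ := summable_wpart_one
  refine Summable.of_nonneg_of_le (fun _ => norm_nonneg _) (fun n => ?_) (hc.add h1)
  rw [wpart_sub]
  exact norm_sub_le _ _

theorem hasSum_wser [CompleteSpace A] {c : NCS Φ ℂ} (hc : Summable fun n => ‖wpart x c n‖) :
    HasSum (wpart x c) (wser x c) := hc.of_norm.hasSum

theorem wser_sub_one [CompleteSpace A] {c : NCS Φ ℂ} (hc : Summable fun n => ‖wpart x c n‖) :
    wser x (c - 1) = wser x c - 1 := by
  have h1 : HasSum (wpart x (1 : NCS Φ ℂ)) (wser x (1 : NCS Φ ℂ)) := hasSum_wser summable_wpart_one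
  have h2 := (hasSum_wser hc).sub h1
  rw [wser_one] at h2
  rw [← h2.tsum_eq]
  exact tsum_congr fun n => wpart_sub c 1 n

variable [CompleteSpace A]

/-- The logarithm of a series of words is an exponential logarithm of its sum. -/
theorem exists_hasSum_wpart_log (hx : IsWeighted x W z E₀) {c : NCS Φ ℂ} (h1 : c [] = 1)
    (hc : Summable fun n => ‖wpart x c n‖) (hpos : ∀ l, l ≠ [] → c l ≠ 0 → 0 < (wsum z l).re) :
    ∃ X : A, HasSum (fun n => wpart x (NCS.log c) n) X ∧ NormedSpace.exp X = wser x c := by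
  have hpos' : ∀ l, (c - 1) l ≠ 0 → 0 < (wsum z l).re := by
    intro l hl
    rcases l with _ | ⟨b, l⟩
    · exact absurd (sub_one_nil h1) hl
    · refine hpos _ (List.cons_ne_nil b l) ?_
      rwa [NCS.sub_apply, NCS.one_cons, sub_zero] at hl
  obtain ⟨J, hJ⟩ := hx.exists_pow_eq_zero hpos'
  have hc1 := summable_wpart_sub_one hc
  have hser := wser_sub_one hc
  -- Weights with positive real part make `wser x c` unipotent, so the logarithm is a finite sum and
  -- may be taken before or after summing over the words.
  have hpow : wser x (c - 1) ^ J = 0 := by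
    rw [← wser_pow hc1, wser, ← tsum_zero (β := ℕ)]
    refine tsum_congr fun n => ?_
    have : wpart x ((c - 1) ^ J) n = wpart x 0 n :=
      wpart_congr fun l _ hl => by rw [hJ J le_rfl l hl, NCS.zero_apply]
    rw [this, wpart]
    simp only [NCS.zero_apply, zero_smul, lsum_zero]
  refine ⟨∑ j ∈ Finset.range J, logCoeff j • wser x (c - 1) ^ j, ?_, ?_⟩
  · have h2 : ∀ n, wpart x (NCS.log c) n =
        ∑ j ∈ Finset.range J, logCoeff j • wpart x ((c - 1) ^ j) n := by
      intro n
      refine wpart_sum_smul _ _ _ fun l hl h0 => ?_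
      rw [NCS.log_eq h1 (n := max l.length J) (le_max_left _ _)]
      refine (Finset.sum_subset (Finset.range_mono ((le_max_right l.length J).trans
        (Nat.le_succ _))) fun j _ hj => ?_).symm
      rw [hJ j (by simpa using hj) l h0, mul_zero]
    simp only [h2]
    refine hasSum_sum fun j _ => ?_
    rw [← wser_pow hc1]
    exact (summable_wpart_pow hc1 j).of_norm.hasSum.const_smul _
  · rw [exp_sum_logCoeff hpow, hser, add_sub_cancel]

end Log

/-! ### The connection formula for the fundamental solutions -/

section Connection

variable {Φ A : Type*} [Fintype Φ] [NormedRing A] [NormedAlgebra ℂ A] [CompleteSpace A] {x : Φ → A}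
  {W : A} {z : Φ → ℂ} {E₀ : Finset ℂ} {μ₀ μ : ℝ}

theorem slope_mul_re_add (μ : ℝ) (τ : ℂ) :
    (slope 1 μ * τ).re + (slope (-1) μ * τ).re = 2 * τ.re := by
  simp [slope]
  ring

/-- The series of the connection coefficients. -/
def connSeries (E : Finset ℂ) (μ₀ : ℝ) (z : Φ → ℂ) : NCS Φ ℂ := ⟨connCoeff E μ₀ z⟩

theorem wpart_connSeries (hx : IsWeighted x W z E₀) (τ : ℂ) (n : ℕ) :
    wpart x ⟨fun v => connCoeff (sumset E₀) μ₀ z v * Complex.exp (-(wsum z v * τ))⟩ n =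
      NormedSpace.exp (-(τ • W)) * wpart x (connSeries (sumset E₀) μ₀ z) n *
        NormedSpace.exp (τ • W) := by
  simp only [wpart, lsum_eq_sum_ofFn, Finset.mul_sum, Finset.sum_mul]
  refine Finset.sum_congr rfl fun a _ => ?_
  rw [mul_smul_comm, smul_mul_assoc, exp_neg_mul_mul_exp (hx.lie_rprod _), smul_smul]
  rfl

theorem exp_neg_mul_exp (X : A) : NormedSpace.exp (-X) * NormedSpace.exp X = 1 := by
  let _ : NormedAlgebra ℚ A := NormedAlgebra.restrictScalars ℚ ℂ A
  rw [← NormedSpace.exp_add_of_commute (Commute.neg_left (Commute.refl X)), neg_add_cancel,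
    NormedSpace.exp_zero]

theorem exp_mul_exp_neg (X : A) : NormedSpace.exp X * NormedSpace.exp (-X) = 1 := by
  simpa using exp_neg_mul_exp (-X)

/-- Multiplying `qser_connection` by the antipode isolates the connection coefficients with their
exponential factors, and these factors are a conjugation by `exp (τ • W)`. The identities are needed
only at words with nonzero product. -/
theorem hasSum_connection (hx : IsWeighted x W z E₀) (h1 : IsSector (sumset E₀) μ₀ 1)
    (h2 : IsSector (sumset E₀) μ₀ (-1)) (hμ : 0 < μ) (hμ' : μ < μ₀) {τ : ℂ}
    (hτ1 : 0 < (slope 1 μ * τ).re) (hτ2 : 0 < (slope (-1) μ * τ).re) :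
    (Summable fun n => ‖NormedSpace.exp (-(τ • W)) * wpart x (connSeries (sumset E₀) μ₀ z) n *
        NormedSpace.exp (τ • W)‖) ∧
    ∑' n, NormedSpace.exp (-(τ • W)) * wpart x (connSeries (sumset E₀) μ₀ z) n *
        NormedSpace.exp (τ • W) =
      solInv x (sumset E₀) μ₀ 1 z μ τ * sol x (sumset E₀) μ₀ (-1) z μ τ := by
  have hτ : 0 < τ.re := by linarith [slope_mul_re_add μ τ]
  set c : NCS Φ ℂ := ⟨fun v => connCoeff (sumset E₀) μ₀ z v * Complex.exp (-(wsum z v * τ))⟩ with hc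
  set q1 := qncs (sumset E₀) μ₀ 1 z μ τ with hq1
  set q2 := qncs (sumset E₀) μ₀ (-1) z μ τ with hq2
  have hs1 : Summable fun n => ‖wpart x q1 n‖ := by
    simpa using summable_wpart_qncs hx h1 hμ hμ' hτ1 zero_le_one
  have hs2 : Summable fun n => ‖wpart x (antipode q2) n‖ := summable_wpart_antipode hx h2 hμ hμ' hτ2
  have key : ∀ n, wpart x (antipode q2 * q1) n = NormedSpace.exp (-(τ • W)) *
      wpart x (connSeries (sumset E₀) μ₀ z) n * NormedSpace.exp (τ • W) := by
    intro n
    rw [← wpart_connSeries hx τ n]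
    refine wpart_congr fun l _ hl => ?_
    have e1 : (antipode q2 * q1) l = (antipode q2 * (q2 * c)) l := by
      refine NCS.mul_congr fun u v huv => ?_
      congr 1
      refine qser_connection h1 h2 hx.ne_zero ((hx.admInf hl).mono ?_) hμ hμ' hτ hτ1 hτ2
      exact huv ▸ (List.suffix_append u v).isInfix
    rw [e1, ← mul_assoc]
    show _ = c l
    conv_rhs => rw [← one_mul c]
    refine NCS.mul_congr fun u v huv => ?_
    congr 1
    refine wpart_antipode_mul hx h2 hμ hμ' hτ2 fun h0 => hl ?_
    rw [← huv, rprod_append, h0, mul_zero]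
  simp only [← key]
  exact ⟨summable_wpart_mul hs2 hs1, wser_mul hs2 hs1⟩

/-- No estimate of the coefficients themselves is needed: conjugated by the exponential at `τ = 1`,
the series is a Cauchy product of two absolutely convergent ones. -/
theorem summable_wpart_connSeries (hx : IsWeighted x W z E₀) (h1 : IsSector (sumset E₀) μ₀ 1)
    (h2 : IsSector (sumset E₀) μ₀ (-1)) :
    Summable fun n => ‖wpart x (connSeries (sumset E₀) μ₀ z) n‖ := by
  have hμ₀ := h1.pos
  have h3 := (hasSum_connection hx h1 h2 (half_pos hμ₀) (half_lt_self hμ₀) (τ := 1)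
    (by rw [slope_mul_one_re]; exact one_pos) (by rw [slope_mul_one_re]; exact one_pos)).1
  refine Summable.of_nonneg_of_le (fun _ => norm_nonneg _) (fun n => ?_)
    ((h3.mul_left ‖NormedSpace.exp ((1 : ℂ) • W)‖).mul_right ‖NormedSpace.exp (-((1 : ℂ) • W))‖)
  set y := wpart x (connSeries (sumset E₀) μ₀ z) n
  have e : y = NormedSpace.exp ((1 : ℂ) • W) * (NormedSpace.exp (-((1 : ℂ) • W)) * y *
      NormedSpace.exp ((1 : ℂ) • W)) * NormedSpace.exp (-((1 : ℂ) • W)) := by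
    rw [mul_assoc, mul_assoc, exp_mul_exp_neg, mul_one, ← mul_assoc, exp_mul_exp_neg, one_mul]
  conv_lhs => rw [e]
  exact (norm_mul_le _ _).trans (mul_le_mul_of_nonneg_right (norm_mul_le _ _) (norm_nonneg _))

/-- The fundamental solutions on the two sides of the ray differ by the sum of the series of the
connection coefficients. -/
theorem sol_connection [IsDedekindFiniteMonoid A] (hx : IsWeighted x W z E₀)
    (h1 : IsSector (sumset E₀) μ₀ 1)
    (h2 : IsSector (sumset E₀) μ₀ (-1)) (hμ : 0 < μ) (hμ' : μ < μ₀) {τ : ℂ}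
    (hτ1 : 0 < (slope 1 μ * τ).re) (hτ2 : 0 < (slope (-1) μ * τ).re) :
    sol x (sumset E₀) μ₀ (-1) z μ τ * NormedSpace.exp (-(τ • W)) =
      sol x (sumset E₀) μ₀ 1 z μ τ * NormedSpace.exp (-(τ • W)) *
        wser x (connSeries (sumset E₀) μ₀ z) := by
  have hs := (summable_wpart_connSeries hx h1 h2).of_norm
  have h3 := (hasSum_connection hx h1 h2 hμ hμ' hτ1 hτ2).2
  rw [(hs.mul_left _).tsum_mul_right, hs.tsum_mul_left] at h3
  have h4 : sol x (sumset E₀) μ₀ 1 z μ τ * solInv x (sumset E₀) μ₀ 1 z μ τ = 1 :=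
    mul_eq_one_symm (solInv_mul_sol hx h1 hμ hμ' hτ1)
  have h5 : sol x (sumset E₀) μ₀ (-1) z μ τ = sol x (sumset E₀) μ₀ 1 z μ τ *
      (NormedSpace.exp (-(τ • W)) * wser x (connSeries (sumset E₀) μ₀ z) *
        NormedSpace.exp (τ • W)) := by
    rw [wser, h3, ← mul_assoc, h4, one_mul]
  rw [h5, mul_assoc, mul_assoc _ _ (NormedSpace.exp (-(τ • W))), exp_mul_exp_neg, mul_one, mul_assoc]

end Connection

/-! ### Curves in linear algebraic groups and their Lie algebras -/

section Groups

attribute [local instance] Matrix.linftyOpNormedRing Matrix.linftyOpNormedAlgebra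

variable {N : ℕ}

/-- The value of a polynomial in the matrix entries at a matrix. -/
def evalM (m : Matrix (Fin N) (Fin N) ℂ) (p : MvPolynomial (Fin N × Fin N) ℂ) : ℂ :=
  MvPolynomial.eval (fun ij => m ij.1 ij.2) p

/-- The polynomial vanishes on `G`. -/
def VanishesOn (G : Subgroup (GL (Fin N) ℂ)) (p : MvPolynomial (Fin N × Fin N) ℂ) : Prop :=
  ∀ g ∈ G, evalAt g p = 0

theorem hasDerivAt_entry {g : ℂ → Matrix (Fin N) (Fin N) ℂ} {g' : Matrix (Fin N) (Fin N) ℂ} {s : ℂ}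
    (h : HasDerivAt g g' s) (i j : Fin N) : HasDerivAt (fun s => g s i j) (g' i j) s :=
  hasDerivAt_pi.1 (hasDerivAt_pi.1 h i) j

/-- This links the algebraic definition of `lieAlg` to differential equations `g' = g X`. -/
theorem hasDerivAt_evalM {g : ℂ → Matrix (Fin N) (Fin N) ℂ} {X : Matrix (Fin N) (Fin N) ℂ} {s : ℂ}
    (h : HasDerivAt g (g s * X) s) (p : MvPolynomial (Fin N × Fin N) ℂ) :
    HasDerivAt (fun s => evalM (g s) p) (evalM (g s) (leftInvDer X p)) s := by
  induction p using MvPolynomial.induction_on with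
  | C a =>
    rw [MvPolynomial.derivation_C]
    simpa [evalM] using hasDerivAt_const s a
  | add p q hp hq =>
    simp only [evalM, map_add] at hp hq ⊢
    exact hp.add hq
  | mul_X p ij hp =>
    obtain ⟨i, j⟩ := ij
    have h2 : evalM (g s) (leftInvDer X (MvPolynomial.X (i, j))) = (g s * X) i j := by
      rw [leftInvDer_X, evalM, map_sum, Matrix.mul_apply]
      refine Finset.sum_congr rfl fun k _ => ?_
      simp [mul_comm]
    have h1 := hp.mul (hasDerivAt_entry h i j)
    rw [← h2] at h1
    simp only [evalM, Derivation.leibniz, map_add, map_mul, smul_eq_mul, MvPolynomial.eval_X]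
      at h1 ⊢
    refine h1.congr_deriv ?_
    ring

/-- `leftInvDer` as a linear map. -/
def leftInvDerₗ : Matrix (Fin N) (Fin N) ℂ →ₗ[ℂ]
    Derivation ℂ (MvPolynomial (Fin N × Fin N) ℂ) (MvPolynomial (Fin N × Fin N) ℂ) where
  toFun := leftInvDer
  map_add' := leftInvDer_add
  map_smul' := leftInvDer_smul

theorem exists_coords (G : Subgroup (GL (Fin N) ℂ)) :
    ∃ (r : ℕ) (b : Fin r → Matrix (Fin N) (Fin N) ℂ) (a : Fin r → Matrix (Fin N) (Fin N) ℂ →ₗ[ℂ] ℂ),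
      (∀ k, b k ∈ lieAlg G) ∧ ∀ X ∈ lieAlg G, X = ∑ k, a k X • b k := by
  set K := (lieAlg G).toSubmodule with hK
  obtain ⟨π, hπ⟩ := LinearMap.exists_leftInverse_of_injective K.subtype
    (LinearMap.ker_eq_bot.2 K.injective_subtype)
  let β := Module.finBasis ℂ K
  refine ⟨_, fun k => (β k : Matrix (Fin N) (Fin N) ℂ), fun k => β.coord k ∘ₗ π, fun k => (β k).2,
    fun X hX => ?_⟩
  have h1 : π X = (⟨X, hX⟩ : K) := LinearMap.congr_fun hπ (⟨X, hX⟩ : K)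
  have h2 := congrArg K.subtype (β.sum_repr ⟨X, hX⟩)
  rw [map_sum] at h2
  simp only [LinearMap.comp_apply, h1, Module.Basis.coord_apply]
  simp only [map_smul] at h2
  exact h2.symm

theorem isBigO_of_hasDerivAt {φ φ' : ℂ → ℂ} {n : ℕ} (hd : ∀ s, HasDerivAt φ (φ' s) s) (h0 : φ 0 = 0)
    (h : φ' =O[𝓝 0] fun s => s ^ n) : φ =O[𝓝 0] fun s => s ^ (n + 1) := by
  obtain ⟨C, hC, hb⟩ := h.exists_pos
  rw [Asymptotics.IsBigOWith, Metric.eventually_nhds_iff] at hb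
  obtain ⟨r, hr, hb⟩ := hb
  refine Asymptotics.IsBigO.of_bound C (Metric.eventually_nhds_iff.2 ⟨r, hr, fun s hs => ?_⟩)
  have h1 := (convex_closedBall (0 : ℂ) ‖s‖).norm_image_sub_le_of_norm_hasDerivWithin_le
    (f := φ) (f' := φ') (C := C * ‖s‖ ^ n) (fun w _ => (hd w).hasDerivWithinAt) (fun w hw => ?_)
    (Metric.mem_closedBall_self (norm_nonneg s)) (mem_closedBall_zero_iff.2 (le_refl ‖s‖))
  · rw [h0, sub_zero, sub_zero] at h1
    rw [norm_pow, pow_succ, ← mul_assoc]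
    exact h1
  · rw [mem_closedBall_zero_iff] at hw
    rw [dist_zero_right] at hs
    refine (hb (by rw [dist_zero_right]; exact hw.trans_lt hs)).trans ?_
    rw [norm_pow]
    gcongr

/-- An entire function that vanishes to infinite order at a point is zero. -/
theorem eq_zero_of_forall_isBigO {φ : ℂ → ℂ} (hd : Differentiable ℂ φ)
    (h : ∀ n : ℕ, φ =O[𝓝 0] fun s => s ^ n) : φ = 0 := by
  have han : AnalyticAt ℂ φ 0 := hd.analyticAt 0
  have hev : ∀ᶠ s in 𝓝 (0 : ℂ), φ s = 0 := by
    by_contra hc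
    obtain ⟨n, g, hg, hg0, hgφ⟩ := han.exists_eventuallyEq_pow_smul_nonzero_iff.2 hc
    refine hg0 ?_
    obtain ⟨C, hC, hb⟩ := (h (n + 1)).exists_pos
    have h1 : ∀ᶠ s in 𝓝[≠] (0 : ℂ), ‖g s‖ ≤ C * ‖s‖ := by
      filter_upwards [hb.bound.filter_mono nhdsWithin_le_nhds, hgφ.filter_mono nhdsWithin_le_nhds,
        self_mem_nhdsWithin] with s h1 h2 h3
      have hs : 0 < ‖s‖ ^ n := pow_pos (norm_pos_iff.2 h3) n
      rw [h2, sub_zero, norm_smul, norm_pow, norm_pow, pow_succ] at h1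
      refine le_of_mul_le_mul_left ?_ hs
      linarith
    have h2 : Filter.Tendsto (fun s : ℂ => C * ‖s‖) (𝓝[≠] 0) (𝓝 0) := by
      have : Filter.Tendsto (fun s : ℂ => C * ‖s‖) (𝓝 0) (𝓝 (C * ‖(0 : ℂ)‖)) :=
        (continuous_const.mul continuous_norm).tendsto 0
      rw [norm_zero, mul_zero] at this
      exact this.mono_left nhdsWithin_le_nhds
    exact tendsto_nhds_unique (hg.continuousAt.tendsto.mono_left nhdsWithin_le_nhds)
      (squeeze_zero_norm' h1 h2)
  have h1 : AnalyticOnNhd ℂ φ Set.univ := fun s _ => hd.analyticAt s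
  funext s
  exact h1.eqOn_zero_of_preconnected_of_eventuallyEq_zero isPreconnected_univ (Set.mem_univ 0) hev
    (Set.mem_univ s)

/-- A curve through `1` whose logarithmic derivative lies in the Lie algebra of `G` satisfies the
equations of `G`. -/
theorem evalM_eq_zero_of_ode {G : Subgroup (GL (Fin N) ℂ)} {g X : ℂ → Matrix (Fin N) (Fin N) ℂ}
    (hg : ∀ s, HasDerivAt g (g s * X s) s) (hX : ∀ s, X s ∈ lieAlg G) (hXc : ContinuousAt X 0)
    (h0 : g 0 = 1) {p : MvPolynomial (Fin N × Fin N) ℂ} (hp : VanishesOn G p) (s : ℂ) :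
    evalM (g s) p = 0 := by
  obtain ⟨r, b, a, hb, hab⟩ := exists_coords G
  have hd : ∀ p s, HasDerivAt (fun s => evalM (g s) p) (evalM (g s) (leftInvDer (X s) p)) s :=
    fun p s => hasDerivAt_evalM (hg s) p
  have hsum : ∀ p s, evalM (g s) (leftInvDer (X s) p) =
      ∑ k, a k (X s) * evalM (g s) (leftInvDer (b k) p) := by
    intro p s
    have h1 : leftInvDer (X s) = ∑ k, a k (X s) • leftInvDer (b k) := by
      have := congrArg leftInvDerₗ (hab (X s) (hX s))
      rw [map_sum] at this
      simp only [map_smul] at this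
      exact this
    have h2 : leftInvDer (X s) p = ∑ k, a k (X s) • leftInvDer (b k) p := by
      rw [h1, ← Derivation.coeFnAddMonoidHom_apply, map_sum, Finset.sum_apply]
      rfl
    rw [h2, evalM, map_sum]
    refine Finset.sum_congr rfl fun k _ => ?_
    rw [MvPolynomial.smul_eval]
    rfl
  have hv : ∀ k p, VanishesOn G p → VanishesOn G (leftInvDer (b k) p) := fun k p hp => hb k p hp
  -- The derivative along the curve is a combination of values of polynomials that again vanish on
  -- `G`, with bounded coefficients, so the order of vanishing at `0` can be raised indefinitely.
  have hbig : ∀ (n : ℕ) p, VanishesOn G p → (fun s => evalM (g s) p) =O[𝓝 0] fun s => s ^ n := by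
    intro n
    induction n with
    | zero =>
      intro p _
      simp only [pow_zero]
      exact (hd p 0).continuousAt.tendsto.isBigO_one ℂ
    | succ n ih =>
      intro p hp
      refine isBigO_of_hasDerivAt (hd p) ?_ ?_
      · rw [h0]
        exact hp 1 G.one_mem
      · simp only [hsum]
        refine Asymptotics.IsBigO.fun_sum fun k _ => ?_
        have h1 : (fun s => a k (X s)) =O[𝓝 0] fun _ => (1 : ℂ) :=
          Filter.Tendsto.isBigO_one ℂ
            (((a k).continuous_of_finiteDimensional.continuousAt (x := X 0)).comp hXc).tendsto
        simpa using h1.mul (ih _ (hv k p hp))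
  exact congrFun (eq_zero_of_forall_isBigO (fun s => (hd p s).differentiableAt)
    fun n => hbig n p hp) s

theorem IsZariskiClosed.mem {G : Subgroup (GL (Fin N) ℂ)} (hG : IsZariskiClosed G)
    {g : GL (Fin N) ℂ} (h : ∀ p, VanishesOn G p → evalM (g : Matrix (Fin N) (Fin N) ℂ) p = 0) :
    g ∈ G := by
  obtain ⟨S, hS⟩ := hG
  exact (hS g).2 fun p hp => h p fun g' hg' => (hS g').1 hg' p hp

/-- The exponential of a matrix, as an invertible matrix. -/
def expGL (X : Matrix (Fin N) (Fin N) ℂ) : GL (Fin N) ℂ :=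
  ⟨NormedSpace.exp X, NormedSpace.exp (-X), exp_mul_exp_neg X, exp_neg_mul_exp X⟩

theorem coe_expGL (X : Matrix (Fin N) (Fin N) ℂ) :
    (expGL X : Matrix (Fin N) (Fin N) ℂ) = NormedSpace.exp X := rfl

theorem expGL_mem {G : Subgroup (GL (Fin N) ℂ)} (hG : IsZariskiClosed G)
    {X : Matrix (Fin N) (Fin N) ℂ} (hX : X ∈ lieAlg G) : expGL X ∈ G := by
  refine hG.mem fun p hp => ?_
  have h1 := evalM_eq_zero_of_ode (g := fun s : ℂ => NormedSpace.exp (s • X)) (X := fun _ => X)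
    (fun s => hasDerivAt_exp_smul_const X s) (fun _ => hX) continuousAt_const
    (by simp only [zero_smul, NormedSpace.exp_zero]) hp 1
  simp only [one_smul] at h1
  exact h1

theorem evalM_leftInvDer_of_curve {G : Subgroup (GL (Fin N) ℂ)} {γ : ℂ → GL (Fin N) ℂ}
    (hγ : ∀ s, γ s ∈ G) {Y : Matrix (Fin N) (Fin N) ℂ}
    (hd : HasDerivAt (fun s => (γ s : Matrix (Fin N) (Fin N) ℂ)) (γ 0 * Y) 0)
    {p : MvPolynomial (Fin N × Fin N) ℂ} (hp : VanishesOn G p) :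
    evalAt (γ 0) (leftInvDer Y p) = 0 := by
  have h1 := hasDerivAt_evalM hd p
  have h2 : (fun s => evalM (γ s : Matrix (Fin N) (Fin N) ℂ) p) = fun _ => 0 :=
    funext fun s => hp _ (hγ s)
  rw [h2] at h1
  exact h1.unique (hasDerivAt_const 0 0)

/-- The conjugate is the velocity of the curve `g c⁻¹ exp(sX) c` in `G` at the point `g`. -/
theorem conj_mem_lieAlg {G H : Subgroup (GL (Fin N) ℂ)} (hH : IsZariskiClosed H) (hHG : H ≤ G)
    {X : Matrix (Fin N) (Fin N) ℂ} (hX : X ∈ lieAlg H) {c : GL (Fin N) ℂ} (hc : c ∈ G) :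
    ((c⁻¹ : GL (Fin N) ℂ) : Matrix (Fin N) (Fin N) ℂ) * X * c ∈ lieAlg G := by
  intro p hp g hg
  set γ : ℂ → GL (Fin N) ℂ := fun s => g * c⁻¹ * expGL (s • X) * c with hγ
  have hγ0 : γ 0 = g := by
    have : expGL ((0 : ℂ) • X) = 1 := by
      refine Units.ext ?_
      rw [coe_expGL, zero_smul, NormedSpace.exp_zero]
      rfl
    simp only [hγ, this]
    group
  have h1 := evalM_leftInvDer_of_curve (G := G) (γ := γ) (Y := (c⁻¹ : GL (Fin N) ℂ) * X * c)
    (fun s => G.mul_mem (G.mul_mem (G.mul_mem hg (G.inv_mem hc))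
      (hHG (expGL_mem hH ((lieAlg H).smul_mem s hX)))) hc) ?_ hp
  · rwa [hγ0] at h1
  · have h2 := ((hasDerivAt_exp_smul_const X (0 : ℂ)).const_mul
      ((g * c⁻¹ : GL (Fin N) ℂ) : Matrix (Fin N) (Fin N) ℂ)).mul_const (c : Matrix (Fin N) (Fin N) ℂ)
    refine h2.congr_deriv ?_
    rw [hγ0, zero_smul, NormedSpace.exp_zero, one_mul, Units.val_mul]
    simp only [mul_assoc]

theorem lieAlg_mono {G H : Subgroup (GL (Fin N) ℂ)} (hH : IsZariskiClosed H) (hHG : H ≤ G)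
    {X : Matrix (Fin N) (Fin N) ℂ} (hX : X ∈ lieAlg H) : X ∈ lieAlg G := by
  simpa using conj_mem_lieAlg hH hHG hX G.one_mem

/-- The off-diagonal entries of `P m P⁻¹` are linear polynomials in `m` that vanish on `H`; their
derivatives at `1` vanish on the Lie algebra. -/
theorem isDiag_of_mem_lieAlg {H : Subgroup (GL (Fin N) ℂ)} {P : GL (Fin N) ℂ}
    (hP : ∀ h ∈ H, ((P * h * P⁻¹ : GL (Fin N) ℂ) : Matrix (Fin N) (Fin N) ℂ).IsDiag)
    {X : Matrix (Fin N) (Fin N) ℂ} (hX : X ∈ lieAlg H) :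
    ((P : Matrix (Fin N) (Fin N) ℂ) * X * (P⁻¹ : GL (Fin N) ℂ)).IsDiag := by
  intro i j hij
  set p : MvPolynomial (Fin N × Fin N) ℂ := ∑ k, ∑ l,
    MvPolynomial.C ((P : Matrix (Fin N) (Fin N) ℂ) i k *
      ((P⁻¹ : GL (Fin N) ℂ) : Matrix (Fin N) (Fin N) ℂ) l j) * MvPolynomial.X (k, l) with hp
  have hev : ∀ m : Matrix (Fin N) (Fin N) ℂ, evalM m p =
      ((P : Matrix (Fin N) (Fin N) ℂ) * m * (P⁻¹ : GL (Fin N) ℂ)) i j := by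
    intro m
    simp only [evalM, hp, map_sum, map_mul, MvPolynomial.eval_C, MvPolynomial.eval_X,
      Matrix.mul_apply, Finset.sum_mul]
    rw [Finset.sum_comm]
    exact Finset.sum_congr rfl fun _ _ => Finset.sum_congr rfl fun _ _ => by ring
  have hv : VanishesOn H p := fun h hh => (hev h).trans (hP h hh hij)
  have hd : HasDerivAt (fun s : ℂ => NormedSpace.exp (s • X)) (NormedSpace.exp ((0 : ℂ) • X) * X) 0 :=
    hasDerivAt_exp_smul_const X 0
  have h1 := hasDerivAt_evalM hd p
  simp only [hev] at h1
  have h2 := hasDerivAt_entry ((hd.const_mul (P : Matrix (Fin N) (Fin N) ℂ)).mul_const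
    ((P⁻¹ : GL (Fin N) ℂ) : Matrix (Fin N) (Fin N) ℂ)) i j
  have h3 := h2.unique h1
  rw [zero_smul, NormedSpace.exp_zero, one_mul] at h3
  rw [h3]
  exact hX p hv 1 H.one_mem

/-- `ad Z`. -/
def adL (Z : Matrix (Fin N) (Fin N) ℂ) : Module.End ℂ (Matrix (Fin N) (Fin N) ℂ) :=
  LinearMap.mulLeft ℂ Z - LinearMap.mulRight ℂ Z

theorem adL_apply (Z y : Matrix (Fin N) (Fin N) ℂ) : adL Z y = Z * y - y * Z := rfl

theorem iSup_eigenspace_adL {Z : Matrix (Fin N) (Fin N) ℂ} {P : GL (Fin N) ℂ}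
    (hP : ((P : Matrix (Fin N) (Fin N) ℂ) * Z * (P⁻¹ : GL (Fin N) ℂ)).IsDiag) :
    ⨆ w, (adL Z).eigenspace w = ⊤ := by
  set Q : Matrix (Fin N) (Fin N) ℂ := ((P⁻¹ : GL (Fin N) ℂ) : Matrix (Fin N) (Fin N) ℂ) with hQ
  have hPQ : (P : Matrix (Fin N) (Fin N) ℂ) * Q = 1 := by rw [hQ, ← Units.val_mul]; simp
  have hQP : Q * (P : Matrix (Fin N) (Fin N) ℂ) = 1 := by rw [hQ, ← Units.val_mul]; simp
  obtain ⟨d, hd⟩ : ∃ d : Fin N → ℂ, (P : Matrix (Fin N) (Fin N) ℂ) * Z * Q = Matrix.diagonal d :=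
    ⟨_, (hP.diagonal_diag).symm⟩
  have hZ1 : Z * Q = Q * Matrix.diagonal d := by
    rw [← hd, ← mul_assoc, ← mul_assoc, hQP, one_mul]
  have hZ2 : (P : Matrix (Fin N) (Fin N) ℂ) * Z = Matrix.diagonal d * P := by
    rw [← hd, mul_assoc, hQP, mul_one]
  rw [eq_top_iff]
  intro y _
  have hy : y = ∑ i, ∑ j, Q * Matrix.single i j (((P : Matrix (Fin N) (Fin N) ℂ) * y * Q) i j) * P := by
    have h1 := Matrix.matrix_eq_sum_single ((P : Matrix (Fin N) (Fin N) ℂ) * y * Q)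
    have h2 : y = Q * ((P : Matrix (Fin N) (Fin N) ℂ) * y * Q) * P := by
      rw [mul_assoc, mul_assoc, mul_assoc, hQP, mul_one, ← mul_assoc, hQP, one_mul]
    conv_lhs => rw [h2, h1]
    simp only [Finset.mul_sum, Finset.sum_mul]
  rw [hy]
  refine Submodule.sum_mem _ fun i _ => Submodule.sum_mem _ fun j _ => ?_
  refine Submodule.mem_iSup_of_mem (d i - d j) (Module.End.mem_eigenspace_iff.2 ?_)
  set m := Matrix.single i j (((P : Matrix (Fin N) (Fin N) ℂ) * y * Q) i j) with hm
  have h1 : Matrix.diagonal d * m - m * Matrix.diagonal d = (d i - d j) • m := by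
    ext k l
    rw [Matrix.sub_apply, Matrix.diagonal_mul, Matrix.mul_diagonal, Matrix.smul_apply, hm,
      Matrix.single_apply, smul_eq_mul]
    split_ifs with h
    · rw [← h.1, ← h.2]
      ring
    · ring
  have h2 : Z * (Q * m * P) - Q * m * P * Z =
      Q * (Matrix.diagonal d * m - m * Matrix.diagonal d) * P := by
    rw [mul_assoc _ (P : Matrix (Fin N) (Fin N) ℂ) Z, hZ2, ← mul_assoc, ← mul_assoc, hZ1]
    simp only [mul_assoc, mul_sub, sub_mul]
  rw [adL_apply, h2, h1, mul_smul_comm, smul_mul_assoc]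

end Groups

/-! ### Recursions for power series as differential equations -/

section PowerSeries

variable {A : Type*} [NormedRing A] [NormedAlgebra ℂ A] [CompleteSpace A]

theorem hasDerivAt_tsum_pow_smul {Q : ℕ → A} (hQ : ∀ R : ℝ, 0 ≤ R → Summable fun n => R ^ n * ‖Q n‖)
    (s : ℂ) : ∃ D, HasDerivAt (fun s : ℂ => ∑' n, s ^ n • Q n) D s ∧
      HasSum (fun n : ℕ => ((n + 1 : ℕ) : ℂ) • s ^ n • Q (n + 1)) D := by
  have hd : ∀ (n : ℕ) (w : ℂ), HasDerivAt (fun s : ℂ => s ^ n • Q n) ((n * w ^ (n - 1)) • Q n) w :=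
    fun n w => (hasDerivAt_pow n w).smul_const _
  have hball : ∀ (n : ℕ) (w : ℂ), w ∈ Metric.ball (0 : ℂ) (‖s‖ + 1) →
      ‖w ^ n • Q n‖ ≤ (‖s‖ + 1) ^ n * ‖Q n‖ := by
    intro n w hw
    rw [mem_ball_zero_iff] at hw
    rw [norm_smul, norm_pow]
    gcongr
  have hs : s ∈ Metric.ball (0 : ℂ) (‖s‖ + 1) := by
    rw [mem_ball_zero_iff]
    linarith
  have hdiff : ∀ n : ℕ, DifferentiableOn ℂ (fun w : ℂ => w ^ n • Q n) (Metric.ball 0 (‖s‖ + 1)) :=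
    fun n w _ => (hd n w).differentiableAt.differentiableWithinAt
  have hsum := hQ (‖s‖ + 1) (by positivity)
  have h1 := Complex.hasSum_deriv_of_summable_norm hsum hdiff Metric.isOpen_ball hball hs
  have h2 := (Complex.differentiableOn_tsum_of_summable_norm hsum hdiff Metric.isOpen_ball
    hball).differentiableAt (Metric.isOpen_ball.mem_nhds hs)
  refine ⟨_, h2.hasDerivAt, ?_⟩
  rw [← hasSum_nat_add_iff' 1] at h1
  simp only [Finset.range_one, Finset.sum_singleton, (hd _ s).deriv, Nat.cast_zero, zero_mul,
    zero_smul, sub_zero, Nat.add_sub_cancel] at h1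
  simpa only [mul_smul] using h1

theorem summable_pow_mul_shift {B : ℕ → A}
    (hB : ∀ R : ℝ, 0 ≤ R → Summable fun n => R ^ n * ‖B n‖) (R : ℝ) (hR : 0 ≤ R) :
    Summable fun n => R ^ n * ‖B (n + 1)‖ := by
  refine Summable.of_nonneg_of_le (fun n => by positivity) (fun n => ?_)
    ((summable_nat_add_iff 1).2 (hB (R + 1) (by positivity)))
  refine mul_le_mul_of_nonneg_right ?_ (norm_nonneg _)
  calc R ^ n ≤ (R + 1) ^ n := by gcongr; linarith
    _ ≤ (R + 1) ^ (n + 1) := pow_le_pow_right₀ (by linarith) (Nat.le_succ n)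

/-- A recursion for the coefficients of a power series, as a differential equation. -/
theorem hasDerivAt_of_recursion {Q B : ℕ → A}
    (hQ : ∀ R : ℝ, 0 ≤ R → Summable fun n => R ^ n * ‖Q n‖)
    (hB : ∀ R : ℝ, 0 ≤ R → Summable fun n => R ^ n * ‖B n‖) (hB0 : B 0 = 0)
    (hrec : ∀ n : ℕ, (n : ℂ) • Q n =
      ∑ ij ∈ Finset.HasAntidiagonal.antidiagonal n, Q ij.2 * B ij.1) (s : ℂ) :
    HasDerivAt (fun s : ℂ => ∑' n, s ^ n • Q n)
      ((∑' n, s ^ n • Q n) * ∑' n, s ^ n • B (n + 1)) s := by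
  obtain ⟨D, hD, hDs⟩ := hasDerivAt_tsum_pow_smul hQ s
  refine hD.congr_deriv ?_
  have h1 : Summable fun n => ‖s ^ n • Q n‖ := by
    simpa only [norm_smul, norm_pow] using hQ ‖s‖ (norm_nonneg s)
  have h2 : Summable fun n => ‖s ^ n • B (n + 1)‖ := by
    simpa only [norm_smul, norm_pow] using summable_pow_mul_shift hB ‖s‖ (norm_nonneg s)
  rw [tsum_mul_tsum_eq_tsum_sum_antidiagonal_of_summable_norm h1 h2, ← hDs.tsum_eq]
  refine tsum_congr fun n => ?_
  rw [smul_comm, hrec (n + 1), Finset.Nat.sum_antidiagonal_succ, hB0, mul_zero, zero_add,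
    ← Finset.Nat.sum_antidiagonal_swap, Finset.smul_sum]
  refine Finset.sum_congr rfl fun ij hij => ?_
  rw [Finset.HasAntidiagonal.mem_antidiagonal] at hij
  rw [smul_mul_smul_comm, ← pow_add, hij]
  rfl

end PowerSeries

/-! ### The normalised solution lies in the group -/

section Membership

attribute [local instance] Matrix.linftyOpNormedRing Matrix.linftyOpNormedAlgebra

variable {N : ℕ} {Φ : Type*} [Fintype Φ] {x : Φ → Matrix (Fin N) (Fin N) ℂ}
  {W : Matrix (Fin N) (Fin N) ℂ} {z : Φ → ℂ} {E₀ : Finset ℂ} {μ₀ e μ : ℝ}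

theorem hasSum_mem_lieAlg {G : Subgroup (GL (Fin N) ℂ)} {F : ℕ → Matrix (Fin N) (Fin N) ℂ}
    {X : Matrix (Fin N) (Fin N) ℂ} (h : HasSum F X) (hF : ∀ n, F n ∈ lieAlg G) : X ∈ lieAlg G := by
  have h1 : IsClosed ((lieAlg G).toSubmodule : Set (Matrix (Fin N) (Fin N) ℂ)) :=
    Submodule.closed_of_finiteDimensional _
  exact h1.mem_of_tendsto h (Filter.Eventually.of_forall fun s =>
    (lieAlg G).toSubmodule.sum_mem fun n _ => hF n)

theorem brk_mem_lieAlg {G : Subgroup (GL (Fin N) ℂ)} (hxG : ∀ b, x b ∈ lieAlg G) (l : List Φ) :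
    brk x l ∈ lieAlg G := by
  induction l with
  | nil => exact (lieAlg G).zero_mem
  | cons b l ih =>
    rcases l with _ | ⟨c, l⟩
    · exact hxG b
    · rw [brk_cons x b (List.cons_ne_nil c l)]
      exact (lieAlg G).lie_mem ih (hxG b)

/-- Scaling the words of length `n` by `s ^ n` gives an entire curve from `1` at `s = 0` to the
inverse solution at `s = 1`. By the shuffle relations and Dynkin's identity its logarithmic
derivative is a series of brackets, so it lies in the Lie algebra. -/
theorem evalM_solInv {G : Subgroup (GL (Fin N) ℂ)} (hxG : ∀ b, x b ∈ lieAlg G)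
    (hx : IsWeighted x W z E₀) (h : IsSector (sumset E₀) μ₀ e) (hμ : 0 < μ) (hμ' : μ < μ₀) {τ : ℂ}
    (hτ : 0 < (slope e μ * τ).re) {p : MvPolynomial (Fin N × Fin N) ℂ} (hp : VanishesOn G p) :
    evalM (solInv x (sumset E₀) μ₀ e z μ τ) p = 0 := by
  set Q : ℕ → Matrix (Fin N) (Fin N) ℂ := wpart x (qncs (sumset E₀) μ₀ e z μ τ) with hQdef
  set B : ℕ → Matrix (Fin N) (Fin N) ℂ := fun n =>
    lsum n fun l => qser (sumset E₀) μ₀ e z μ l τ • brk x l with hBdef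
  have hQ : ∀ R : ℝ, 0 ≤ R → Summable fun n => R ^ n * ‖Q n‖ := fun R hR =>
    summable_wpart_qncs hx h hμ hμ' hτ hR
  have hB : ∀ R : ℝ, 0 ≤ R → Summable fun n => R ^ n * ‖B n‖ := by
    intro R hR
    obtain ⟨D, hD, hb⟩ := exists_norm_brk_le x
    obtain ⟨C, _, h1⟩ := exists_lsum_bound h hx.ne_zero hμ hμ' zero_le_one hD hb
      (fun l hl => hx.adm_brk hl) hR hτ
    exact summable_of_forall_ne_zero (fun n => by positivity) fun n hn => h1 n hn τ le_rfl
  have hB0 : B 0 = 0 := by simp [hBdef, lsum, brk]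
  have hrec : ∀ n : ℕ, (n : ℂ) • Q n =
      ∑ ij ∈ Finset.HasAntidiagonal.antidiagonal n, Q ij.2 * B ij.1 := fun n =>
    natCast_mul_lsum_rprod_of_char x n (fun l => qser (sumset E₀) μ₀ e z μ l τ) fun u v => by
      by_cases h0 : rprod x v * brk x u = 0
      · exact .inl h0
      · exact .inr (sh_qser h hx.ne_zero hμ hμ' (hx.admPair h0) hτ)
  have hBG : ∀ n, B n ∈ lieAlg G := by
    intro n
    simp only [hBdef, lsum_eq_sum_ofFn]
    exact sum_mem fun a _ => (lieAlg G).smul_mem _ (brk_mem_lieAlg hxG _)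
  have hBs := summable_pow_mul_shift hB
  have h1 := evalM_eq_zero_of_ode (G := G) (g := fun s : ℂ => ∑' n, s ^ n • Q n)
    (X := fun s : ℂ => ∑' n, s ^ n • B (n + 1)) (hasDerivAt_of_recursion hQ hB hB0 hrec)
    (fun s => ?_) ?_ ?_ hp 1
  · simp only [one_pow, one_smul] at h1
    exact h1
  · have hs : Summable fun n => s ^ n • B (n + 1) := by
      refine Summable.of_norm ?_
      simpa only [norm_smul, norm_pow] using hBs ‖s‖ (norm_nonneg s)
    exact hasSum_mem_lieAlg hs.hasSum fun n => (lieAlg G).smul_mem _ (hBG _)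
  · obtain ⟨D, hD, _⟩ := hasDerivAt_tsum_pow_smul (Q := fun n => B (n + 1)) hBs 0
    exact hD.continuousAt
  · rw [tsum_eq_single 0 fun n hn => by rw [zero_pow hn, zero_smul], pow_zero, one_smul]
    show qser (sumset E₀) μ₀ e z μ [] τ • (1 : Matrix (Fin N) (Fin N) ℂ) = 1
    rw [qser_nil hτ, one_smul]

/-- The normalised solution, as an element of the group. -/
theorem exists_sol_mem {G : Subgroup (GL (Fin N) ℂ)} (hG : IsZariskiClosed G)
    (hxG : ∀ b, x b ∈ lieAlg G)
    (hx : IsWeighted x W z E₀) (h : IsSector (sumset E₀) μ₀ e) (hμ : 0 < μ) (hμ' : μ < μ₀) {τ : ℂ}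
    (hτ : 0 < (slope e μ * τ).re) :
    ∃ g ∈ G, (g : Matrix (Fin N) (Fin N) ℂ) = sol x (sumset E₀) μ₀ e z μ τ := by
  have h1 := solInv_mul_sol hx h hμ hμ' hτ
  have h2 := mul_eq_one_symm h1
  set g : GL (Fin N) ℂ := ⟨solInv x (sumset E₀) μ₀ e z μ τ, sol x (sumset E₀) μ₀ e z μ τ, h1, h2⟩
  exact ⟨g⁻¹, G.inv_mem (hG.mem fun p hp => evalM_solInv hxG hx h hμ hμ' hτ hp), rfl⟩

end Membership

/-! ### Half planes in the variables `t` and `τ` -/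

section HalfPlanes

theorem mem_halfPlane {φ : ℝ} {t : ℂ} :
    t ∈ halfPlane φ ↔ 0 < (t * Complex.exp (-(φ * Complex.I))).re := by
  have h1 : Complex.exp (φ * Complex.I) * Complex.exp (-(φ * Complex.I)) = 1 := by
    rw [← Complex.exp_add, add_neg_cancel, Complex.exp_zero]
  constructor
  · rintro ⟨u, ⟨ρ, hρ, rfl⟩, v, hv, rfl⟩
    have : ρ * Complex.exp (φ * Complex.I) * v * Complex.exp (-(φ * Complex.I)) = ρ * v := by
      linear_combination (ρ * v) * h1
    rw [this, Complex.re_ofReal_mul]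
    positivity
  · intro h
    refine ⟨_, ⟨1, one_pos, rfl⟩, _, h, ?_⟩
    push_cast
    linear_combination (-t) * h1

theorem isOpen_halfPlane (φ : ℝ) : IsOpen (halfPlane φ) := by
  have : halfPlane φ = {t | 0 < (t * Complex.exp (-(φ * Complex.I))).re} :=
    Set.ext fun t => mem_halfPlane
  rw [this]
  exact isOpen_lt (by fun_prop) (by fun_prop)

theorem convex_halfPlane (φ : ℝ) : Convex ℝ (halfPlane φ) := by
  have : halfPlane φ = {t | 0 < (Complex.exp (-(φ * Complex.I)) * t).re} :=
    Set.ext fun t => by rw [mem_halfPlane, mul_comm]; rfl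
  rw [this]
  exact convex_re_pos _

theorem ne_zero_of_mem_halfPlane {φ : ℝ} {t : ℂ} (h : t ∈ halfPlane φ) : t ≠ 0 := by
  rintro rfl
  simp [mem_halfPlane] at h

theorem slope_eq_mul_exp {e : ℝ} (he : e = 1 ∨ e = -1) (μ : ℝ) :
    slope e μ = (√(1 + μ ^ 2) : ℝ) * Complex.exp ((e * Real.arctan μ : ℝ) * Complex.I) := by
  have h0 : (√(1 + μ ^ 2) : ℝ) ≠ 0 := by positivity
  have hc : Real.cos (e * Real.arctan μ) = 1 / √(1 + μ ^ 2) := by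
    rcases he with rfl | rfl <;> simp [Real.cos_arctan]
  have hs : Real.sin (e * Real.arctan μ) = e * (μ / √(1 + μ ^ 2)) := by
    rcases he with rfl | rfl <;> simp [Real.sin_arctan]
  rw [Complex.exp_mul_I, ← Complex.ofReal_cos, ← Complex.ofReal_sin, hc, hs, slope]
  have h0' : ((√(1 + μ ^ 2) : ℝ) : ℂ) ≠ 0 := by exact_mod_cast h0
  push_cast
  field_simp

/-- Under `τ = exp(iθ) / t` the half plane of convergence of the Laplace integral becomes the half
plane of the ray turned by `e * arctan μ`. -/
theorem slope_mul_div_re_pos {e : ℝ} (he : e = 1 ∨ e = -1) (μ θ : ℝ) {t : ℂ} :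
    0 < (slope e μ * (Complex.exp (θ * Complex.I) / t)).re ↔
      t ∈ halfPlane (θ + e * Real.arctan μ) := by
  have h0 : (0 : ℝ) < √(1 + μ ^ 2) := by positivity
  have h1 : slope e μ * (Complex.exp (θ * Complex.I) / t) = (√(1 + μ ^ 2) : ℝ) *
      (t * Complex.exp (-((θ + e * Real.arctan μ : ℝ) * Complex.I)))⁻¹ := by
    rw [slope_eq_mul_exp he, mul_inv, ← Complex.exp_neg, neg_neg]
    have : ((θ + e * Real.arctan μ : ℝ) : ℂ) * Complex.I =
        (e * Real.arctan μ : ℝ) * Complex.I + θ * Complex.I := by push_cast; ring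
    rw [this, Complex.exp_add, div_eq_mul_inv]
    ring
  rw [mem_halfPlane, h1, Complex.re_ofReal_mul, mul_pos_iff_of_pos_left h0, Complex.inv_re]
  set w := t * Complex.exp (-((θ + e * Real.arctan μ : ℝ) * Complex.I))
  constructor
  · intro h
    by_contra hc
    exact absurd h (not_lt.2 (div_nonpos_of_nonpos_of_nonneg (not_lt.1 hc) (Complex.normSq_nonneg w)))
  · intro h
    refine div_pos h (Complex.normSq_pos.2 fun h0 => ?_)
    rw [h0] at h
    simp at h

end HalfPlanes

/-! ### Existence of canonical solutions -/

section Canonical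

attribute [local instance] Matrix.linftyOpNormedRing Matrix.linftyOpNormedAlgebra

variable {N : ℕ} {Φ : Type*} [Fintype Φ] {x : Φ → Matrix (Fin N) (Fin N) ℂ}
  {Z : Matrix (Fin N) (Fin N) ℂ} {z : Φ → ℂ} {E₀ : Finset ℂ} {μ₀ e μ : ℝ}

theorem hasDerivAt_exp_inv_smul (Z : Matrix (Fin N) (Fin N) ℂ) {t : ℂ} (ht : t ≠ 0) :
    HasDerivAt (fun t : ℂ => NormedSpace.exp (-(t⁻¹ • Z)))
      ((t ^ 2)⁻¹ • (Z * NormedSpace.exp (-(t⁻¹ • Z)))) t := by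
  have h1 : HasDerivAt (fun t : ℂ => NormedSpace.exp (t⁻¹ • -Z))
      ((-(t ^ 2)⁻¹) • (-Z * NormedSpace.exp (t⁻¹ • -Z))) t :=
    (hasDerivAt_exp_smul_const' (-Z) t⁻¹).scomp t (hasDerivAt_inv ht)
  simp only [smul_neg] at h1
  refine h1.congr_deriv ?_
  rw [neg_mul, smul_neg, neg_smul, neg_neg]

theorem hasDerivAt_fundamental {θ : ℝ}
    (hx : IsWeighted x ((Complex.exp (θ * Complex.I))⁻¹ • Z) z E₀)
    (h : IsSector (sumset E₀) μ₀ e) (hμ : 0 < μ) (hμ' : μ < μ₀) {t : ℂ}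
    (ht : t ∈ halfPlane (θ + e * Real.arctan μ)) :
    HasDerivAt (fun t => sol x (sumset E₀) μ₀ e z μ (Complex.exp (θ * Complex.I) / t) *
        NormedSpace.exp (-(t⁻¹ • Z)))
      (((t ^ 2)⁻¹ • Z + t⁻¹ • ∑ b, x b) *
        (sol x (sumset E₀) μ₀ e z μ (Complex.exp (θ * Complex.I) / t) *
        NormedSpace.exp (-(t⁻¹ • Z)))) t := by
  set ζ := Complex.exp (θ * Complex.I) with hζ
  have hζ0 : ζ ≠ 0 := Complex.exp_ne_zero _
  have ht0 := ne_zero_of_mem_halfPlane ht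
  have hτ := (slope_mul_div_re_pos h.sign μ θ).2 ht
  have hinv : HasDerivAt (fun t : ℂ => ζ / t) (-ζ / t ^ 2) t := by
    have := (hasDerivAt_inv ht0).const_mul ζ
    refine this.congr_deriv ?_
    ring
  have h1 := ((hasDerivAt_sol hx h hμ hμ' hτ).scomp t hinv).mul (hasDerivAt_exp_inv_smul Z ht0)
  set K := sol x (sumset E₀) μ₀ e z μ (ζ / t) with hK
  set D := NormedSpace.exp (-(t⁻¹ • Z)) with hD
  set f := ∑ b, x b with hf
  refine h1.congr_deriv ?_
  have e1 : (-ζ / t ^ 2) • (K * ζ⁻¹ • Z - (ζ⁻¹ • Z) * K - (ζ / t)⁻¹ • (f * K)) =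
      (t ^ 2)⁻¹ • (Z * K) - (t ^ 2)⁻¹ • (K * Z) + t⁻¹ • (f * K) := by
    rw [mul_smul_comm, smul_mul_assoc, smul_sub, smul_sub, smul_smul, smul_smul, smul_smul]
    have a1 : -ζ / t ^ 2 * ζ⁻¹ = -(t ^ 2)⁻¹ := by field_simp
    have a2 : -ζ / t ^ 2 * (ζ / t)⁻¹ = -t⁻¹ := by field_simp
    rw [a1, a2]
    module
  show (-ζ / t ^ 2) • (K * ζ⁻¹ • Z - (ζ⁻¹ • Z) * K - (ζ / t)⁻¹ • (f * K)) * D +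
    K * (t ^ 2)⁻¹ • (Z * D) = _
  rw [e1]
  simp only [add_mul, sub_mul, smul_mul_assoc, mul_smul_comm, mul_assoc]
  abel

/-- The canonical solution on the half plane of a ray that is close to the ray of angle `θ`. -/
theorem exists_isCanonicalSolution {G H : Subgroup (GL (Fin N) ℂ)} (hG : IsZariskiClosed G)
    (hH : IsZariskiClosed H) (hHG : H ≤ G) (hZ : Z ∈ lieAlg H) (hxG : ∀ b, x b ∈ lieAlg G) {θ : ℝ}
    (hx : IsWeighted x ((Complex.exp (θ * Complex.I))⁻¹ • Z) z E₀)
    (h : IsSector (sumset E₀) μ₀ e) (hμ : 0 < μ) (hμ' : μ < μ₀) :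
    ∃ Y : ℂ → GL (Fin N) ℂ, IsCanonicalSolution G Z (∑ b, x b) (θ + e * Real.arctan μ) Y ∧
      ∀ t ∈ halfPlane (θ + e * Real.arctan μ), (Y t : Matrix (Fin N) (Fin N) ℂ) =
        sol x (sumset E₀) μ₀ e z μ (Complex.exp (θ * Complex.I) / t) *
          NormedSpace.exp (-(t⁻¹ • Z)) := by
  have hex : ∀ t, ∃ g : GL (Fin N) ℂ, t ∈ halfPlane (θ + e * Real.arctan μ) → g ∈ G ∧
      (g : Matrix (Fin N) (Fin N) ℂ) =
        sol x (sumset E₀) μ₀ e z μ (Complex.exp (θ * Complex.I) / t) *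
          NormedSpace.exp (-(t⁻¹ • Z)) := by
    intro t
    by_cases ht : t ∈ halfPlane (θ + e * Real.arctan μ)
    · obtain ⟨g, hg, hgs⟩ := exists_sol_mem hG hxG hx h hμ hμ'
        ((slope_mul_div_re_pos h.sign μ θ).2 ht)
      refine ⟨g * expGL (-(t⁻¹ • Z)), fun _ => ⟨G.mul_mem hg (hHG (expGL_mem hH ?_)), ?_⟩⟩
      · exact (lieAlg H).neg_mem ((lieAlg H).smul_mem _ hZ)
      · rw [Units.val_mul, hgs, coe_expGL]
    · exact ⟨1, fun h => absurd h ht⟩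
  choose Y hY using hex
  refine ⟨Y, ⟨fun t ht => (hY t ht).1, fun t ht => ?_, ?_⟩, fun t ht => (hY t ht).2⟩
  · rw [(hY t ht).2]
    refine (hasDerivAt_fundamental hx h hμ hμ' ht).congr_of_eventuallyEq ?_
    filter_upwards [(isOpen_halfPlane _).mem_nhds ht] with s hs using (hY s hs).2
  · obtain ⟨C, hC, hb⟩ := exists_sol_bound hx h hμ hμ'
    refine tendsto_iff_norm_sub_tendsto_zero.2 ?_
    have h1 : Filter.Tendsto (fun t : ℂ => C * ‖t‖) (𝓝[halfPlane (θ + e * Real.arctan μ)] 0) (𝓝 0) := by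
      have : Filter.Tendsto (fun s : ℂ => C * ‖s‖) (𝓝 0) (𝓝 (C * ‖(0 : ℂ)‖)) :=
        (continuous_const.mul continuous_norm).tendsto 0
      rw [norm_zero, mul_zero] at this
      exact this.mono_left nhdsWithin_le_nhds
    refine squeeze_zero' (Filter.Eventually.of_forall fun _ => norm_nonneg _) ?_ h1
    have hball : ∀ᶠ t : ℂ in 𝓝[halfPlane (θ + e * Real.arctan μ)] 0, ‖t‖ < 1 :=
      nhdsWithin_le_nhds (by
        filter_upwards [Metric.ball_mem_nhds (0 : ℂ) one_pos] with t ht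
        exact mem_ball_zero_iff.1 ht)
    filter_upwards [hball, self_mem_nhdsWithin] with t ht1 ht
    have ht0 := ne_zero_of_mem_halfPlane ht
    have htp : 0 < ‖t‖ := norm_pos_iff.2 ht0
    have hYe : (Y t : Matrix (Fin N) (Fin N) ℂ) * NormedSpace.exp (t⁻¹ • Z) =
        sol x (sumset E₀) μ₀ e z μ (Complex.exp (θ * Complex.I) / t) := by
      have hee : NormedSpace.exp (-(t⁻¹ • Z)) * NormedSpace.exp (t⁻¹ • Z) = 1 := exp_neg_mul_exp _
      rw [(hY t ht).2, mul_assoc, hee, mul_one]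
    refine (congrArg (fun m => ‖m - 1‖) hYe).trans_le ?_
    have hn : ‖Complex.exp (θ * Complex.I) / t‖ = ‖t‖⁻¹ := by
      rw [norm_div, Complex.norm_exp_ofReal_mul_I, one_div]
    have h2 := hb (Complex.exp (θ * Complex.I) / t) ((slope_mul_div_re_pos h.sign μ θ).2 ht) (by
      rw [hn]
      exact (one_le_inv₀ htp).2 ht1.le)
    rwa [hn, div_inv_eq_mul] at h2

end Canonical

/-- A linear map that extracts one component of a sum of eigenvectors. -/
theorem exists_eigenprojection {V ι : Type*} [AddCommGroup V] [Module ℂ V] (f : Module.End ℂ V)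
    {S : Finset ι} {w : ι → ℂ} (hw : Set.InjOn w S) {i : ι} (hi : i ∈ S) :
    ∃ π : V →ₗ[ℂ] V, ∀ y : ι → V, (∀ j ∈ S, f (y j) = w j • y j) → π (∑ j ∈ S, y j) = y i := by
  classical
  refine ⟨Polynomial.aeval f (Lagrange.basis S w i), fun y hy => ?_⟩
  have key : ∀ j ∈ S, Polynomial.aeval f (Lagrange.basis S w i) (y j) =
      (Lagrange.basis S w i).eval (w j) • y j := by
    intro j hj
    by_cases h0 : y j = 0
    · rw [h0, map_zero, smul_zero]
    · exact Module.End.aeval_apply_of_hasEigenvector ⟨Module.End.mem_eigenspace_iff.2 (hy j hj), h0⟩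
  rw [map_sum, Finset.sum_eq_single_of_mem i hi, key i hi, Lagrange.eval_basis_self hw hi, one_smul]
  intro j hj hji
  rw [key j hj, Lagrange.eval_basis_of_ne hji.symm hj, zero_smul]

/-! ### Comparison of two solutions of the same equation -/

section Units

variable {A : Type*} [NormedRing A] [CompleteSpace A]

theorem inv_mul_eq_of_ode [NormedAlgebra ℂ A] {Y₁ Y₂ : ℂ → Aˣ} {a : ℂ → A} {U : Set ℂ} (hU : IsOpen U)
    (hUc : Convex ℝ U) (h₁ : ∀ t ∈ U, HasDerivAt (fun t => (Y₁ t : A)) (a t * Y₁ t) t)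
    (h₂ : ∀ t ∈ U, HasDerivAt (fun t => (Y₂ t : A)) (a t * Y₂ t) t) {s t : ℂ} (hs : s ∈ U)
    (ht : t ∈ U) : (Y₁ s)⁻¹ * Y₂ s = (Y₁ t)⁻¹ * Y₂ t := by
  have hd : ∀ t ∈ U, HasDerivAt (fun t => (((Y₁ t)⁻¹ * Y₂ t : Aˣ) : A)) 0 t := by
    intro t ht
    have h3 := (hasFDerivAt_ringInverse (𝕜 := ℂ) (Y₁ t)).comp_hasDerivAt t (h₁ t ht)
    have h4 := h3.mul (h₂ t ht)
    simp only [Function.comp_def, Ring.inverse_unit] at h4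
    refine h4.congr_deriv ?_
    simp [mul_assoc]
  refine Units.ext (hU.is_const_of_deriv_eq_zero hUc.isPreconnected
    (f := fun t => (((Y₁ t)⁻¹ * Y₂ t : Aˣ) : A))
    (fun t ht => (hd t ht).differentiableAt.differentiableWithinAt)
    (fun t ht => (hd t ht).deriv) hs ht)

theorem tendsto_conj {ι : Type*} {l : Filter ι} {Y₁ Y₂ E : ι → Aˣ} {C : Aˣ}
    (h₁ : Filter.Tendsto (fun i => (Y₁ i * E i : A)) l (𝓝 1))
    (h₂ : Filter.Tendsto (fun i => (Y₂ i * E i : A)) l (𝓝 1))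
    (hC : ∀ᶠ i in l, Y₂ i = Y₁ i * C) :
    Filter.Tendsto (fun i => (((E i)⁻¹ * C * E i : Aˣ) : A)) l (𝓝 1) := by
  have h3 : Filter.Tendsto (fun i => Ring.inverse (Y₁ i * E i : A)) l (𝓝 (Ring.inverse 1)) :=
    (NormedRing.inverse_continuousAt (1 : Aˣ)).tendsto.comp h₁
  have h4 := h3.mul h₂
  rw [Ring.inverse_one, one_mul] at h4
  refine h4.congr' ?_
  filter_upwards [hC] with i hi
  rw [← Units.val_mul, Ring.inverse_unit, hi, ← Units.val_mul, ← Units.val_mul]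
  congr 1
  group

/-- This passes from the group element `C` to `Z - C⁻¹ Z C`, which for `C` in `G` lies in the Lie
algebra and can be decomposed there into eigenvectors of `ad Z`. -/
theorem tendsto_conj_sub {ι : Type*} {l : Filter ι} {E : ι → Aˣ} {C : Aˣ} {Z : A}
    (h : Filter.Tendsto (fun i => (((E i)⁻¹ * C * E i : Aˣ) : A)) l (𝓝 1))
    (hE : ∀ i, Commute Z (E i : A)) :
    Filter.Tendsto (fun i => ((E i)⁻¹ : Aˣ) * (Z - (C⁻¹ : Aˣ) * Z * C) * (E i : A)) l (𝓝 0) := by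
  have h3 : Filter.Tendsto (fun i => Ring.inverse (((E i)⁻¹ * C * E i : Aˣ) : A)) l
      (𝓝 (Ring.inverse 1)) := (NormedRing.inverse_continuousAt (1 : Aˣ)).tendsto.comp h
  have h4 := (tendsto_const_nhds (x := Z)).sub ((h3.mul_const Z).mul h)
  rw [Ring.inverse_one, one_mul, mul_one, sub_self] at h4
  refine h4.congr fun i => ?_
  have h5 : ((E i)⁻¹ : Aˣ) * Z = Z * ((E i)⁻¹ : Aˣ) := ((hE i).units_inv_right).eq.symm
  have h6 : ((E i)⁻¹ : Aˣ) * Z * (E i : A) = Z := by rw [h5, mul_assoc, Units.inv_mul, mul_one]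
  rw [Ring.inverse_unit, mul_sub, sub_mul, h6]
  simp only [mul_inv_rev, inv_inv, Units.val_mul, mul_assoc]
  rw [← mul_assoc (E i : A) Z, ← (hE i).eq, mul_assoc Z, Units.mul_inv_cancel_left]

end Units

/-- Duality of cones in the plane: the directions `φ` form the open dual of the sector between `φ₁`
and `φ₂`, so `w` lies in the closed sector. -/
theorem exists_mem_ray {φ₁ φ₂ : ℝ} (h : φ₁ ≤ φ₂) (hπ : φ₂ - φ₁ < Real.pi) {w : ℂ} (hw : w ≠ 0)
    (hpos : ∀ φ : ℝ, φ₂ - Real.pi / 2 < φ → φ < φ₁ + Real.pi / 2 →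
      0 < (w * Complex.exp (-(φ * Complex.I))).re) :
    ∃ ψ ∈ Set.Icc φ₁ φ₂, w ∈ ray ψ := by
  set m := (φ₁ + φ₂) / 2 with hm
  set v := w * Complex.exp (-(m * Complex.I)) with hv
  have hv0 : v ≠ 0 := mul_ne_zero hw (Complex.exp_ne_zero _)
  have hwv : w = ‖v‖ * Complex.exp ((m + v.arg : ℝ) * Complex.I) := by
    push_cast
    rw [add_mul, Complex.exp_add, mul_left_comm, Complex.norm_mul_exp_arg_mul_I, hv, mul_left_comm,
      ← Complex.exp_add, add_neg_cancel, Complex.exp_zero, mul_one]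
  have hcos : ∀ η : ℝ, |η| < Real.pi / 2 - (φ₂ - φ₁) / 2 → 0 < Real.cos (v.arg - η) := by
    intro η hη
    obtain ⟨h1, h2⟩ := abs_lt.1 hη
    have h3 := hpos (m + η) (by rw [hm]; linarith) (by rw [hm]; linarith)
    rw [hwv, mul_assoc, ← Complex.exp_add, ← neg_mul, ← add_mul, Complex.re_ofReal_mul] at h3
    have h4 : ((m + v.arg : ℝ) : ℂ) + -((m + η : ℝ) : ℂ) = ((v.arg - η : ℝ) : ℂ) := by
      push_cast; ring
    rw [h4, Complex.exp_ofReal_mul_I_re] at h3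
    exact pos_of_mul_pos_right h3 (norm_nonneg _)
  have hb1 := Complex.neg_pi_lt_arg v
  have hb2 := Complex.arg_le_pi v
  refine ⟨m + v.arg, ?_, ‖v‖, norm_pos_iff.2 hv0, hwv⟩
  suffices h : |v.arg| ≤ (φ₂ - φ₁) / 2 by
    obtain ⟨h1, h2⟩ := abs_le.1 h
    constructor <;> rw [hm] <;> linarith
  by_contra! hc
  rcases le_or_gt (Real.pi / 2) |v.arg| with h2 | h2
  · have := hcos 0 (by rw [abs_zero]; linarith)
    rw [sub_zero, ← Real.cos_abs] at this
    exact absurd this (not_lt.2 (Real.cos_nonpos_of_pi_div_two_le_of_le h2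
      (by linarith [abs_le.2 ⟨hb1.le, hb2⟩, Real.pi_pos])))
  · rcases lt_abs.1 hc with h3 | h3
    · have h4 := lt_of_abs_lt h2
      have := hcos (v.arg - Real.pi / 2) (by rw [abs_lt]; constructor <;> linarith)
      rw [sub_sub_cancel, Real.cos_pi_div_two] at this
      exact lt_irrefl _ this
    · have h4 := neg_lt_of_abs_lt h2
      have := hcos (v.arg + Real.pi / 2) (by rw [abs_lt]; constructor <;> linarith)
      rw [sub_add_cancel_left, Real.cos_neg, Real.cos_pi_div_two] at this
      exact lt_irrefl _ this

theorem exp_div_mem_halfPlane {φ ψ x : ℝ} (h1 : ψ - Real.pi / 2 < φ) (h2 : φ < ψ + Real.pi / 2)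
    (hx : 0 < x) : Complex.exp (φ * Complex.I) / x ∈ halfPlane ψ := by
  have h3 : Complex.exp (φ * Complex.I) / x * Complex.exp (-(ψ * Complex.I)) =
      (x⁻¹ : ℝ) * Complex.exp ((φ - ψ : ℝ) * Complex.I) := by
    push_cast
    rw [sub_mul, sub_eq_add_neg, Complex.exp_add]
    ring
  rw [mem_halfPlane, h3, Complex.re_ofReal_mul, Complex.exp_ofReal_mul_I_re]
  have := Real.cos_pos_of_mem_Ioo (x := φ - ψ) ⟨by linarith, by linarith⟩
  positivity

/-! ### Uniqueness of canonical solutions across sectors without Stokes rays -/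

section Uniqueness

attribute [local instance] Matrix.linftyOpNormedRing Matrix.linftyOpNormedAlgebra

variable {N : ℕ} {G H : Subgroup (GL (Fin N) ℂ)} {Z f : Matrix (Fin N) (Fin N) ℂ}

/-- `ad Z` is diagonalisable on all matrices because `Z` is, and it preserves the Lie algebra of
`G`; so the eigencomponents stay in that Lie algebra. -/
theorem exists_sum_eigen (hH : IsTorus H) (hHG : H ≤ G) (hZ : Z ∈ lieAlg H)
    {V : Matrix (Fin N) (Fin N) ℂ} (hV : V ∈ lieAlg G) :
    ∃ (S : Finset ℂ) (y : ℂ → Matrix (Fin N) (Fin N) ℂ), (∀ w, y w ∈ lieAlg G) ∧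
      (∀ w, Z * y w - y w * Z = w • y w) ∧ ∑ w ∈ S, y w = V := by
  obtain ⟨hHc, ⟨P, hP⟩, -⟩ := hH
  have h1 := iSup_eigenspace_adL (isDiag_of_mem_lieAlg hP hZ)
  have h2 := Submodule.eq_iSup_inf_genEigenspace (p := (lieAlg G).toSubmodule) (f := adL Z) 1
    (fun y hy => (lieAlg G).lie_mem (lieAlg_mono hHc hHG hZ) hy) h1
  have h3 : V ∈ (lieAlg G).toSubmodule := hV
  rw [h2, Submodule.mem_iSup_iff_exists_finsupp] at h3
  obtain ⟨y, hy, hs⟩ := h3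
  exact ⟨y.support, y, fun w => (hy w).1, fun w => Module.End.mem_eigenspace_iff.1 (hy w).2, hs⟩

theorem exp_inv_tendsto_atTop (φ : ℝ) :
    Filter.Tendsto (fun x : ℝ => Complex.exp (φ * Complex.I) / x) Filter.atTop (𝓝 0) := by
  have := (Complex.continuous_ofReal.tendsto 0).comp tendsto_inv_atTop_zero
  have h2 := this.const_mul (Complex.exp (φ * Complex.I))
  simpa [div_eq_mul_inv, Function.comp_def] using h2

/-- Canonical solutions agree across sectors without Stokes rays. -/
theorem IsCanonicalSolution.eq_of_forall_not_isStokesRay (hH : IsTorus H) (hHG : H ≤ G)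
    (hZ : Z ∈ lieAlg H) {φ₁ φ₂ : ℝ} {Y₁ Y₂ : ℂ → GL (Fin N) ℂ}
    (h₁ : IsCanonicalSolution G Z f φ₁ Y₁) (h₂ : IsCanonicalSolution G Z f φ₂ Y₂)
    (h : φ₁ ≤ φ₂) (hπ : φ₂ - φ₁ < Real.pi)
    (hns : ∀ ψ ∈ Set.Icc φ₁ φ₂, ¬ IsStokesRay G Z ψ) {t : ℂ}
    (ht : t ∈ halfPlane φ₁ ∩ halfPlane φ₂) : Y₁ t = Y₂ t := by
  set U := halfPlane φ₁ ∩ halfPlane φ₂ with hU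
  set C := (Y₁ t)⁻¹ * Y₂ t with hC
  have hCs : ∀ s ∈ U, Y₂ s = Y₁ s * C := by
    intro s hs
    have := inv_mul_eq_of_ode (A := Matrix (Fin N) (Fin N) ℂ)
      ((isOpen_halfPlane φ₁).inter (isOpen_halfPlane φ₂))
      ((convex_halfPlane φ₁).inter (convex_halfPlane φ₂))
      (fun t ht => h₁.hasDerivAt t ht.1) (fun t ht => h₂.hasDerivAt t ht.2) hs ht
    rw [hC, ← this, mul_inv_cancel_left]
  have hCG : C ∈ G := G.mul_mem (G.inv_mem (h₁.mem t ht.1)) (h₂.mem t ht.2)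
  set E : ℂ → GL (Fin N) ℂ := fun t => expGL (t⁻¹ • Z) with hE
  have hlim : Filter.Tendsto (fun i => (((E i)⁻¹ * C * E i : GL (Fin N) ℂ) : Matrix (Fin N) (Fin N) ℂ))
      (𝓝[U] 0) (𝓝 1) := by
    refine tendsto_conj (A := Matrix (Fin N) (Fin N) ℂ) (Y₁ := Y₁) (Y₂ := Y₂) ?_ ?_ ?_
    · exact h₁.tendsto.mono_left (nhdsWithin_mono _ Set.inter_subset_left)
    · exact h₂.tendsto.mono_left (nhdsWithin_mono _ Set.inter_subset_right)
    · filter_upwards [self_mem_nhdsWithin] with s hs using hCs s hs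
  have hcomm : ∀ i, Commute Z (E i : Matrix (Fin N) (Fin N) ℂ) := fun i =>
    ((Commute.refl Z).smul_right _).exp_right
  have hlim2 := tendsto_conj_sub (A := Matrix (Fin N) (Fin N) ℂ) (Z := Z) hlim hcomm
  set V := Z - ((C⁻¹ : GL (Fin N) ℂ) : Matrix (Fin N) (Fin N) ℂ) * Z * C with hV
  have hVG : V ∈ lieAlg G :=
    (lieAlg G).sub_mem (lieAlg_mono hH.1 hHG hZ) (conj_mem_lieAlg hH.1 hHG hZ hCG)
  have hray : ∀ φ : ℝ, φ₂ - Real.pi / 2 < φ → φ < φ₁ + Real.pi / 2 →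
      Filter.Tendsto (fun x : ℝ => Complex.exp (φ * Complex.I) / x) Filter.atTop (𝓝[U] 0) := by
    intro φ hφ2 hφ1
    refine tendsto_nhdsWithin_iff.2 ⟨exp_inv_tendsto_atTop φ, ?_⟩
    filter_upwards [Filter.eventually_gt_atTop 0] with x hx
    exact ⟨exp_div_mem_halfPlane (by linarith) hφ1 hx, exp_div_mem_halfPlane hφ2 (by linarith) hx⟩
  obtain ⟨S, y, hyG, hyw, hyV⟩ := exists_sum_eigen hH hHG hZ hVG
  -- A nonzero component `y w` forces `exp(-w/t)` to decay as `t → 0` in every direction common to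
  -- the two half planes. Then `w` lies on a ray of the sector, which would be a Stokes ray.
  have hy0 : ∀ w ∈ S, y w = 0 := by
    intro w hw
    by_contra hne
    obtain ⟨π, hπ'⟩ := exists_eigenprojection (adL Z) (w := id) Function.injective_id.injOn hw
    have hcont : Continuous π := π.continuous_of_finiteDimensional
    have hdecay : Filter.Tendsto (fun t : ℂ => Complex.exp (-(w * t⁻¹)) • y w) (𝓝[U] 0) (𝓝 0) := by
      have h3 := (hcont.tendsto 0).comp hlim2
      rw [map_zero] at h3
      refine h3.congr fun t => ?_
      have h4 : ((E t)⁻¹ : GL (Fin N) ℂ) * V * (E t : Matrix (Fin N) (Fin N) ℂ) =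
          ∑ v ∈ S, Complex.exp (-(v * t⁻¹)) • y v := by
        rw [← hyV, Finset.mul_sum, Finset.sum_mul]
        exact Finset.sum_congr rfl fun v _ => exp_neg_mul_mul_exp (hyw v) t⁻¹
      rw [Function.comp_apply, h4, hπ' (fun v => Complex.exp (-(v * t⁻¹)) • y v)]
      intro v _
      rw [map_smul, adL_apply, hyw, smul_comm]
      rfl
    have hpos : ∀ φ : ℝ, φ₂ - Real.pi / 2 < φ → φ < φ₁ + Real.pi / 2 →
        0 < (w * Complex.exp (-(φ * Complex.I))).re := by
      intro φ hφ2 hφ1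
      by_contra! hre
      have h3 := (hdecay.comp (hray φ hφ2 hφ1)).norm
      rw [norm_zero] at h3
      refine absurd (ge_of_tendsto h3 (b := ‖y w‖) ?_) (not_le.2 (norm_pos_iff.2 hne))
      filter_upwards [Filter.eventually_gt_atTop 0] with x hx
      rw [Function.comp_apply, norm_smul, Complex.norm_exp]
      refine le_mul_of_one_le_left (norm_nonneg _) (Real.one_le_exp ?_)
      have h4 : -(w * (Complex.exp (φ * Complex.I) / x)⁻¹) =
          (x : ℝ) * -(w * Complex.exp (-(φ * Complex.I))) := by
        rw [inv_div, Complex.exp_neg]; ring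
      rw [h4, Complex.re_ofReal_mul, Complex.neg_re]
      exact mul_nonneg hx.le (by linarith)
    have hw0 : w ≠ 0 := by
      rintro rfl
      have := hpos ((φ₁ + φ₂) / 2) (by linarith) (by linarith)
      simp at this
    obtain ⟨ψ, hψ, hwψ⟩ := exists_mem_ray h hπ hw0 hpos
    exact hns ψ hψ ⟨w, hwψ, y w, hyG w, hne, hyw w⟩
  have hV0 : V = 0 := by rw [← hyV, Finset.sum_eq_zero hy0]
  have hCZ : Commute Z (C : Matrix (Fin N) (Fin N) ℂ) := by
    have h3 : Z = ((C⁻¹ : GL (Fin N) ℂ) : Matrix (Fin N) (Fin N) ℂ) * Z * C := sub_eq_zero.1 hV0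
    have h4 := congrArg (fun m => (C : Matrix (Fin N) (Fin N) ℂ) * m) h3
    simp only [mul_assoc, Units.mul_inv_cancel_left] at h4
    exact h4.symm
  -- Now `C` commutes with the exponentials, so the conjugates that tend to `1` are all equal to
  -- `C`.
  have hC1 : (C : Matrix (Fin N) (Fin N) ℂ) = 1 := by
    have h3 := hlim.comp (hray ((φ₁ + φ₂) / 2) (by linarith) (by linarith))
    refine tendsto_nhds_unique (tendsto_const_nhds.congr fun x => ?_) h3
    have h4 : Commute (C : Matrix (Fin N) (Fin N) ℂ)
        (E (Complex.exp (((φ₁ + φ₂) / 2 : ℝ) * Complex.I) / x) : Matrix (Fin N) (Fin N) ℂ) :=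
      (hCZ.symm.smul_right _).exp_right
    rw [Function.comp_apply, mul_assoc, show C * E _ = E _ * C from Units.ext h4.eq,
      inv_mul_cancel_left]
  have hC1' : C = 1 := Units.ext hC1
  have := hCs t ht
  rw [hC1', mul_one] at this
  exact this.symm

end Uniqueness

/-! ### Existence of the Stokes factor and its logarithm -/

section StokesFactor

attribute [local instance] Matrix.linftyOpNormedRing Matrix.linftyOpNormedAlgebra

variable {N : ℕ} {Φ : Type*} {G H : Subgroup (GL (Fin N) ℂ)} {x : Φ → Matrix (Fin N) (Fin N) ℂ}
  {Z : Matrix (Fin N) (Fin N) ℂ} {z w : Φ → ℂ} {E₀ : Finset ℂ} {μ₀ μ θ : ℝ}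

theorem exists_isWeighted (hw : ∀ b, w b ≠ 0) (hxw : ∀ b, Z * x b - x b * Z = w b • x b) {ζ : ℂ}
    (hζ : ζ ≠ 0) : ∃ E₀, IsWeighted x (ζ⁻¹ • Z) (fun b => ζ⁻¹ * w b) E₀ := by
  refine ⟨insert 0 (adL (ζ⁻¹ • Z)).finite_hasEigenvalue.toFinset,
    fun b => mul_ne_zero (inv_ne_zero hζ) (hw b), fun b => ?_, fun s y hy hs => ?_,
    Finset.mem_insert_self _ _⟩
  · rw [smul_mul_assoc, mul_smul_comm, ← smul_sub, hxw, smul_smul]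
  · refine Finset.mem_insert_of_mem ((Set.Finite.mem_toFinset _).2 ?_)
    exact Module.End.hasEigenvalue_of_hasEigenvector (x := y) ⟨Module.End.mem_eigenspace_iff.2 hs, hy⟩

/-- Rotated by `-θ`, the eigenvalue is an element of the singular set within the sector of slope `μ
< μ₀`, where such points are real. -/
theorem eq_of_isStokesRay (hx : IsWeighted x ((Complex.exp (θ * Complex.I))⁻¹ • Z) z E₀) {e : ℝ}
    (h : IsSector (sumset E₀) μ₀ e) (hμ' : μ < μ₀) {φ : ℝ}
    (hφ : |φ - θ| ≤ Real.arctan μ) (hS : IsStokesRay G Z φ) : φ = θ := by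
  obtain ⟨_, ⟨ρ, hρ, rfl⟩, y, -, hy0, hlie⟩ := hS
  set s := (ρ : ℂ) * Complex.exp ((φ - θ : ℝ) * Complex.I) with hs
  have hs' : s = (Complex.exp (θ * Complex.I))⁻¹ * (ρ * Complex.exp (φ * Complex.I)) := by
    rw [hs, ← Complex.exp_neg, mul_left_comm, ← Complex.exp_add]
    push_cast
    ring_nf
  have hsE : s ∈ sumset E₀ := by
    refine hx.mem_sumset (hx.mem s y hy0 ?_)
    rw [smul_mul_assoc, mul_smul_comm, ← smul_sub, ← Ring.lie_def, hlie, smul_smul, hs']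
  have hs0 : s ≠ 0 := mul_ne_zero (by exact_mod_cast hρ.ne') (Complex.exp_ne_zero _)
  have hre : s.re = ρ * Real.cos (φ - θ) := by
    rw [hs, Complex.re_ofReal_mul, Complex.exp_ofReal_mul_I_re]
  have him : s.im = ρ * Real.sin (φ - θ) := by
    rw [hs, Complex.im_ofReal_mul, Complex.exp_ofReal_mul_I_im]
  have hlt : |φ - θ| < Real.pi / 2 := hφ.trans_lt (Real.arctan_lt_pi_div_two μ)
  have hπ := Real.pi_pos
  obtain ⟨h1, h2⟩ := abs_lt.1 hlt
  have hcos : 0 < Real.cos (φ - θ) := Real.cos_pos_of_mem_Ioo ⟨h1, h2⟩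
  rcases h.out s hsE hs0 with ⟨h3, -⟩ | h3
  · rw [him, mul_eq_zero, or_iff_right hρ.ne',
      Real.sin_eq_zero_iff_of_lt_of_lt (by linarith) (by linarith)] at h3
    linarith
  · exfalso
    rw [hre, him, abs_mul, abs_of_pos hρ, Real.abs_sin_eq_sin_abs_of_abs_le_pi (by linarith),
      ← Real.cos_abs, ← Real.tan_mul_cos (by rw [Real.cos_abs]; exact hcos.ne')] at h3
    have h4 : Real.tan |φ - θ| ≤ μ := by
      rw [← Real.tan_arctan μ]
      exact Real.strictMonoOn_tan.monotoneOn ⟨by linarith [abs_nonneg (φ - θ)], hlt⟩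
        (Real.arctan_mem_Ioo μ) hφ
    have h5 : 0 < ρ * Real.cos |φ - θ| := mul_pos hρ (by rwa [Real.cos_abs])
    nlinarith

theorem exists_pos_of_stokesSeriesRev_ne_zero {ζ : ℂ} {l : List Φ} (hl : l ≠ [])
    (h : stokesSeriesRev w ζ l ≠ 0) : ∃ ρ : ℝ, 0 < ρ ∧ wsum w l = ρ * ζ := by
  by_contra hc
  refine h ?_
  show stokesSeries w ζ l.reverse = 0
  rw [wsum, ← List.sum_reverse, ← List.map_reverse] at hc
  simp only [stokesSeries]
  rw [if_neg (mt List.reverse_eq_nil_iff.1 hl), if_neg hc]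

variable [Fintype Φ]

/-- The Stokes factor of a ray and its logarithm, given by canonical solutions for rays that are
arbitrarily close. -/
theorem exists_stokesFactor (hG : IsZariskiClosed G) (hH : IsTorus H) (hHG : H ≤ G)
    (hZ : Z ∈ lieAlg H) (hxG : ∀ b, x b ∈ lieAlg G) (hw : ∀ b, w b ≠ 0)
    (hxw : ∀ b, Z * x b - x b * Z = w b • x b) (θ : ℝ) :
    ∃ (S : GL (Fin N) ℂ) (X : Matrix (Fin N) (Fin N) ℂ), S ∈ G ∧
      HasSum (wpart x (NCS.log (stokesSeriesRev w (Complex.exp (θ * Complex.I))))) X ∧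
      NormedSpace.exp X = (S : Matrix (Fin N) (Fin N) ℂ) ∧
      ∀ η > 0, ∃ (θp θm : ℝ) (Yp Ym : ℂ → GL (Fin N) ℂ),
        θ - η < θp ∧ θp < θ ∧ θ < θm ∧ θm < θ + η ∧
        (∀ φ ∈ Set.Icc θp θm, IsStokesRay G Z φ → φ = θ) ∧
        IsCanonicalSolution G Z (∑ b, x b) θp Yp ∧ IsCanonicalSolution G Z (∑ b, x b) θm Ym ∧
        ∀ t ∈ halfPlane θp ∩ halfPlane θm, Yp t = Ym t * S := by
  set ζ := Complex.exp (θ * Complex.I) with hζ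
  have hζ0 : ζ ≠ 0 := Complex.exp_ne_zero _
  obtain ⟨E₀, hx⟩ := exists_isWeighted hw hxw hζ0
  obtain ⟨μ₀, hμ₀, hsec⟩ := exists_isSector (sumset E₀)
  have h1 := hsec 1 (.inl rfl)
  have h2 := hsec (-1) (.inr rfl)
  set z : Φ → ℂ := fun b => ζ⁻¹ * w b with hz
  have hzw : (fun b => z b * ζ) = w := funext fun b => by
    rw [hz]; field_simp
  have hwz : ∀ l, wsum z l = ζ⁻¹ * wsum w l := fun l => List.sum_map_mul_left _ _ _
  have hser : ∀ n, wpart x (connSeries (sumset E₀) μ₀ z) n = wpart x (stokesSeriesRev w ζ) n := by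
    intro n
    refine wpart_congr fun l _ hl => ?_
    have := connCoeff_eq h1 hx.ne_zero hζ0 (hx.adm hl)
    rwa [hzw] at this
  have hsum := summable_wpart_connSeries hx h1 h2
  simp only [hser] at hsum
  obtain ⟨X, hX, hXe⟩ := exists_hasSum_wpart_log hx (stokesSeriesRev_nil w ζ) hsum (by
    intro l hl h0
    obtain ⟨ρ, hρ, h3⟩ := exists_pos_of_stokesSeriesRev_ne_zero hl h0
    rw [hwz, h3, mul_comm, mul_assoc, mul_inv_cancel₀ hζ0, mul_one, Complex.ofReal_re]
    exact hρ)
  have hXe' : NormedSpace.exp X = wser x (connSeries (sumset E₀) μ₀ z) := by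
    refine hXe.trans ?_
    rw [wser, wser]
    exact tsum_congr fun n => (hser n).symm
  -- The sign `-1` gives the clockwise perturbation and `1` the anticlockwise one. The comparison
  -- matrix `exp X` does not depend on `μ`, so the perturbation can be as small as desired.
  have key : ∀ μ, 0 < μ → μ < μ₀ → ∃ Yp Ym : ℂ → GL (Fin N) ℂ,
      IsCanonicalSolution G Z (∑ b, x b) (θ + (-1) * Real.arctan μ) Yp ∧
      IsCanonicalSolution G Z (∑ b, x b) (θ + 1 * Real.arctan μ) Ym ∧
      ∀ t ∈ halfPlane (θ + (-1) * Real.arctan μ) ∩ halfPlane (θ + 1 * Real.arctan μ),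
        (Yp t : Matrix (Fin N) (Fin N) ℂ) = Ym t * NormedSpace.exp X := by
    intro μ hμ hμ'
    obtain ⟨Yp, hYp, hYp'⟩ := exists_isCanonicalSolution hG hH.1 hHG hZ hxG hx h2 hμ hμ'
    obtain ⟨Ym, hYm, hYm'⟩ := exists_isCanonicalSolution hG hH.1 hHG hZ hxG hx h1 hμ hμ'
    refine ⟨Yp, Ym, hYp, hYm, fun t ht => ?_⟩
    have h3 := sol_connection hx h1 h2 hμ hμ' (τ := ζ / t)
      ((slope_mul_div_re_pos h1.sign μ θ).2 ht.2) ((slope_mul_div_re_pos h2.sign μ θ).2 ht.1)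
    have h4 : (ζ / t) • ζ⁻¹ • Z = t⁻¹ • Z := by
      rw [smul_smul]
      congr 1
      field_simp
    rw [h4, ← hXe'] at h3
    rw [hYp' t ht.1, hYm' t ht.2]
    exact h3
  have hmem : ∀ μ, Complex.exp (θ * Complex.I) / (1 : ℝ) ∈
      halfPlane (θ + (-1) * Real.arctan μ) ∩ halfPlane (θ + 1 * Real.arctan μ) := by
    intro μ
    have a1 := Real.arctan_lt_pi_div_two μ
    have a2 := Real.neg_pi_div_two_lt_arctan μ
    constructor <;> exact exp_div_mem_halfPlane (by linarith) (by linarith) one_pos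
  obtain ⟨Yp, Ym, hYp, hYm, hY⟩ := key (μ₀ / 2) (half_pos hμ₀) (half_lt_self hμ₀)
  have ht := hmem (μ₀ / 2)
  set t := Complex.exp (θ * Complex.I) / (1 : ℝ)
  -- `exp X` is recognised as an element of `G` by evaluating both solutions at one point of the
  -- common half plane.
  have hS : NormedSpace.exp X = (((Ym t)⁻¹ * Yp t : GL (Fin N) ℂ) : Matrix (Fin N) (Fin N) ℂ) := by
    rw [Units.val_mul, hY t ht, Units.inv_mul_cancel_left]
  refine ⟨(Ym t)⁻¹ * Yp t, X, G.mul_mem (G.inv_mem (hYm.mem t ht.2)) (hYp.mem t ht.1), hX, hS,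
    fun η hη => ?_⟩
  have hev : ∀ᶠ μ in 𝓝[>] (0 : ℝ), Real.arctan μ < η ∧ μ < μ₀ := by
    refine nhdsWithin_le_nhds (Filter.Eventually.and ?_ (gt_mem_nhds hμ₀))
    have := Real.continuous_arctan.tendsto 0
    rw [Real.arctan_zero] at this
    exact this.eventually (gt_mem_nhds hη)
  obtain ⟨μ, ⟨hμη, hμ'⟩, hμ⟩ := (hev.and self_mem_nhdsWithin).exists
  obtain ⟨Yp', Ym', hYp', hYm', hY'⟩ := key μ hμ hμ'
  have hat : 0 < Real.arctan μ := Real.arctan_pos.2 hμ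
  refine ⟨_, _, Yp', Ym', by linarith, by linarith, by linarith, by linarith, fun φ hφ hφS => ?_,
    hYp', hYm', fun t ht => ?_⟩
  · refine eq_of_isStokesRay hx h1 hμ' (abs_le.2 ⟨?_, ?_⟩) hφS <;> linarith [hφ.1, hφ.2]
  · refine Units.ext ?_
    rw [hY' t ht, Units.val_mul, ← hS]

end StokesFactor

/-! ### The words that occur in the logarithm of the Stokes series -/

section LogSupport

variable {Φ : Type*} {w : Φ → ℂ} {ζ : ℂ}

theorem stokesSeriesRev_mul {ρ : ℝ} (hρ : 0 < ρ) (w : Φ → ℂ) (ζ : ℂ) :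
    stokesSeriesRev w (ρ * ζ) = stokesSeriesRev w ζ := by
  have h : ∀ s : ℂ, (∃ σ : ℝ, 0 < σ ∧ s = σ * (ρ * ζ)) ↔ ∃ σ : ℝ, 0 < σ ∧ s = σ * ζ := by
    refine fun s => ⟨?_, ?_⟩
    · rintro ⟨σ, hσ, rfl⟩
      exact ⟨σ * ρ, mul_pos hσ hρ, by push_cast; ring⟩
    · rintro ⟨σ, hσ, rfl⟩
      have : (ρ : ℂ) ≠ 0 := by exact_mod_cast hρ.ne'
      exact ⟨σ / ρ, div_pos hσ hρ, by push_cast; field_simp⟩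
  classical
  exact NCS.ext' fun l => if_congr Iff.rfl rfl (if_congr (h _) rfl rfl)

theorem log_stokesSeriesRev_nil (w : Φ → ℂ) (ζ : ℂ) : NCS.log (stokesSeriesRev w ζ) [] = 0 := by
  simp [NCS.log, logCoeff]

theorem exists_pos_of_log_ne_zero [Fintype Φ] {l : List Φ} (h : NCS.log (stokesSeriesRev w ζ) l ≠ 0) :
    ∃ ρ : ℝ, 0 < ρ ∧ wsum w l = ρ * ζ := by
  have key : ∀ (j : ℕ) (l : List Φ), ((stokesSeriesRev w ζ - 1) ^ (j + 1)) l ≠ 0 →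
      ∃ ρ : ℝ, 0 < ρ ∧ wsum w l = ρ * ζ := by
    have h1 : ∀ l : List Φ, (stokesSeriesRev w ζ - 1) l ≠ 0 →
        ∃ ρ : ℝ, 0 < ρ ∧ wsum w l = ρ * ζ := by
      rintro (_ | ⟨b, l⟩) h
      · exact absurd (sub_one_nil (stokesSeriesRev_nil w ζ)) h
      · rw [NCS.sub_apply, NCS.one_cons, sub_zero] at h
        exact exists_pos_of_stokesSeriesRev_ne_zero (List.cons_ne_nil b l) h
    intro j
    induction j with
    | zero => simpa using h1
    | succ j ih =>
      intro l h
      rw [pow_succ] at h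
      obtain ⟨u, v, rfl, hu, hv⟩ := NCS.exists_of_mul_ne_zero h
      obtain ⟨ρ, hρ, h2⟩ := ih u hu
      obtain ⟨σ, hσ, h3⟩ := h1 v hv
      exact ⟨ρ + σ, add_pos hρ hσ, by rw [wsum_append, h2, h3]; push_cast; ring⟩
  obtain ⟨j, -, hj⟩ := Finset.exists_ne_zero_of_sum_ne_zero (s := Finset.range (l.length + 1))
    (f := fun j => logCoeff j * ((stokesSeriesRev w ζ - 1) ^ j) l) h
  rcases j with _ | j
  · simp [logCoeff] at hj
  · exact key j l (right_ne_zero_of_mul hj)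

end LogSupport

/-! ### Decomposition of the logarithm by roots -/

section Terms

attribute [local instance] Matrix.linftyOpNormedRing Matrix.linftyOpNormedAlgebra

variable {N : ℕ} {G H : Subgroup (GL (Fin N) ℂ)} {Z : lieAlg H}

/-- The values `Z(α)`. -/
def rootVal (Z : lieAlg H) (b : rootsZ G H Z) : ℂ := b.1 Z

theorem rootVal_ne_zero (b : rootsZ G H Z) : rootVal Z b ≠ 0 := b.2.2.2

/-- The components of `f`, as matrices. -/
def OffDiag.mat (f : OffDiag G H Z) (b : rootsZ G H Z) : Matrix (Fin N) (Fin N) ℂ :=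
  (f.component b : Matrix (Fin N) (Fin N) ℂ)

theorem OffDiag.lie_mat (f : OffDiag G H Z) (b : rootsZ G H Z) (h : lieAlg H) :
    (h : Matrix (Fin N) (Fin N) ℂ) * f.mat b - f.mat b * h = b.1 h • f.mat b :=
  (f b).2 h

open Classical in
/-- The Lie polynomial of degree `n` in the components of `f`, of weight `α`. -/
def lieTerm (f : OffDiag G H Z) (α : rootsZ G H Z) (n : ℕ) : lieAlg G :=
  lieSum f.component (logStokes (rootVal Z) (rootVal Z α)
    fun l => (l.map fun b => b.1).sum = α.1) n

theorem lieTerm_mem (f : OffDiag G H Z) (α : rootsZ G H Z) (n : ℕ) :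
    lieTerm f α n ∈ LieSubalgebra.lieSpan ℂ (lieAlg G) (Set.range f.component) :=
  lieSum_mem _ _ _ _ fun b => LieSubalgebra.subset_lieSpan ⟨b, rfl⟩

theorem seriesTerm_eq {A : Type*} [Ring A] [Algebra ℂ A] (φ : lieAlg G →ₗ⁅ℂ⁆ A)
    (f : OffDiag G H Z) (α : rootsZ G H Z) {n : ℕ} (hn : n ≠ 0) :
    seriesTerm φ.toLinearMap f α n = φ (lieTerm f α n) := by
  classical
  rw [lieTerm, map_lieSum, ← sum_L_smul_prod _ rootVal_ne_zero (rootVal_ne_zero α)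
    (fun l l' h => by rw [(h.map _).sum_eq]) hn, seriesTerm]
  · refine Finset.sum_congr (Finset.filter_congr fun a _ => ?_) fun a _ => rfl
    rw [List.map_ofFn, List.sum_ofFn]
    rfl
  · intro a ha
    rw [List.map_ofFn, List.sum_ofFn] at ha
    rw [rootVal, ← ha, LinearMap.sum_apply]
    rfl

open Classical in
theorem coe_lieTerm (f : OffDiag G H Z) (α : rootsZ G H Z) (n : ℕ) :
    (lieTerm f α n : Matrix (Fin N) (Fin N) ℂ) =
      lieSum f.mat (logStokes (rootVal Z) (rootVal Z α)
        fun l => (l.map fun b => b.1).sum = α.1) n :=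
  map_lieSum (lieAlg G).incl f.component _ n

theorem wsum_eq_sum_apply (l : List (rootsZ G H Z)) (h : lieAlg H) :
    wsum (fun b => b.1 h) l = (l.map fun b => b.1).sum h := by
  induction l with
  | nil => simp
  | cons b l ih => rw [wsum_cons, ih, List.map_cons, List.sum_cons, LinearMap.add_apply]

theorem lie_lieTerm (f : OffDiag G H Z) (α : rootsZ G H Z) (n : ℕ) (h : lieAlg H) :
    adL (h : Matrix (Fin N) (Fin N) ℂ) (lieTerm f α n) =
      α.1 h • (lieTerm f α n : Matrix (Fin N) (Fin N) ℂ) := by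
  classical
  rw [coe_lieTerm, lieSum, lsum_eq_sum_ofFn, map_smul, map_sum, smul_comm (α.1 h)]
  congr 1
  rw [Finset.smul_sum]
  refine Finset.sum_congr rfl fun a _ => ?_
  rw [map_smul, adL_apply, lie_brk_of_lie (x := f.mat) (fun b => f.lie_mat b h) _,
    wsum_eq_sum_apply, logStokes]
  split_ifs with h1
  · rw [h1, smul_comm]
  · rw [zero_smul, zero_smul, smul_zero]

-- The word series on the left of the ray's exponential is first rewritten by brackets. A bracket of
-- letters has as weight the sum of their roots, so if it is nonzero and its coefficient does not
-- vanish, that weight is a root with value on the ray, and the bracket occurs in the term of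
-- exactly this root.
open Classical in
theorem sum_lieTerm (f : OffDiag G H Z) (θ : ℝ) (n : ℕ) :
    ∑ α : rootsZ G H Z with α.1 Z ∈ ray θ, (lieTerm f α n : Matrix (Fin N) (Fin N) ℂ) =
      wpart f.mat (NCS.log (stokesSeriesRev (rootVal Z) (Complex.exp (θ * Complex.I)))) n := by
  set ζ := Complex.exp (θ * Complex.I) with hζ
  have hζ0 : ζ ≠ 0 := Complex.exp_ne_zero _
  rcases eq_or_ne n 0 with rfl | hn
  · have h0 : ∀ α : rootsZ G H Z, (lieTerm f α 0 : Matrix (Fin N) (Fin N) ℂ) = 0 := fun α => by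
      rw [coe_lieTerm, lieSum, Nat.cast_zero, inv_zero, zero_smul]
    rw [Finset.sum_eq_zero fun α _ => h0 α, wpart, lsum, log_stokesSeriesRev_nil, zero_smul]
  have h1 := natCast_mul_lsum_rprod f.mat n (NCS.log (stokesSeriesRev (rootVal Z) ζ)).coeff
    fun u v hu hv huv => (isChar_stokesSeriesRev rootVal_ne_zero hζ0 n).sh_log
      (stokesSeriesRev_nil _ _) hu hv huv.le
  have hn' : (n : ℂ) ≠ 0 := by exact_mod_cast hn
  rw [wpart, ← inv_smul_smul₀ hn' (lsum n _), h1, lsum_eq_sum_ofFn, Finset.smul_sum]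
  simp only [coe_lieTerm, lieSum, lsum_eq_sum_ofFn, Finset.smul_sum]
  rw [Finset.sum_comm]
  refine Finset.sum_congr rfl fun a _ => ?_
  set l := List.ofFn a
  rw [← Finset.smul_sum, ← Finset.sum_smul]
  congr 1
  by_cases hb : brk f.mat l = 0
  · rw [hb, smul_zero, smul_zero]
  congr 1
  have hlog : ∀ α : rootsZ G H Z, α.1 Z ∈ ray θ →
      stokesSeriesRev (rootVal (G := G) Z) (rootVal Z α) = stokesSeriesRev (rootVal Z) ζ := by
    rintro α ⟨ρ, hρ, hα⟩
    rw [rootVal, hα, stokesSeriesRev_mul hρ]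
  by_cases hl : NCS.log (stokesSeriesRev (rootVal Z) ζ) l = 0
  · rw [hl]
    refine Finset.sum_eq_zero fun α hα => ?_
    rw [logStokes, hlog α (Finset.mem_filter.1 hα).2, hl, ite_self]
  obtain ⟨ρ, hρ, hw⟩ := exists_pos_of_log_ne_zero hl
  rw [show rootVal (G := G) Z = fun b => b.1 Z from rfl, wsum_eq_sum_apply] at hw
  have hZ0 : (l.map fun b => b.1).sum Z ≠ 0 := by
    rw [hw]
    exact mul_ne_zero (by exact_mod_cast hρ.ne') hζ0
  have hroot : (l.map fun b => b.1).sum ∈ rootsZ G H Z := by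
    refine ⟨fun h0 => hZ0 (by rw [h0, LinearMap.zero_apply]), fun h0 => hb ?_, hZ0⟩
    have h2 : (⟨brk f.mat l, brk_mem_lieAlg (fun b => (f.component b).2) l⟩ : lieAlg G) ∈
        rootSpace G H (l.map fun b => b.1).sum := fun h => by
      rw [← wsum_eq_sum_apply]
      exact lie_brk_of_lie (fun b => f.lie_mat b h) l
    rw [h0, Submodule.mem_bot] at h2
    exact congrArg Subtype.val h2
  rw [Finset.sum_eq_single_of_mem ⟨_, hroot⟩ (Finset.mem_filter.2 ⟨Finset.mem_univ _, ρ, hρ, hw⟩)]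
  · rw [logStokes, hlog _ ⟨ρ, hρ, hw⟩, if_pos rfl]
  · intro α _ hα
    exact if_neg fun h2 => hα (Subtype.ext h2.symm)

/-- Some `h` separates the finitely many roots; the projection is a polynomial in `ad h`. An
auxiliary `h` is needed because `Z` may take the same value on different roots. -/
theorem exists_weight_projection (S : Finset (rootsZ G H Z)) {α : rootsZ G H Z} (hα : α ∈ S) :
    ∃ π : Matrix (Fin N) (Fin N) ℂ →ₗ[ℂ] Matrix (Fin N) (Fin N) ℂ,
      ∀ y : rootsZ G H Z → Matrix (Fin N) (Fin N) ℂ,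
        (∀ β (h : lieAlg H), adL (h : Matrix (Fin N) (Fin N) ℂ) (y β) = β.1 h • y β) →
        π (∑ β ∈ S, y β) = y α := by
  obtain ⟨h, hh⟩ := Module.Dual.exists_forall_ne_zero_of_forall_exists
    (fun q : {q : rootsZ G H Z × rootsZ G H Z // q.1 ≠ q.2} => q.1.1.1 - q.1.2.1)
    (fun q => by
      by_contra hc
      push Not at hc
      exact q.2 (Subtype.ext (sub_eq_zero.1 (LinearMap.ext fun v => hc v))))
  obtain ⟨π, hπ⟩ := exists_eigenprojection (adL (h : Matrix (Fin N) (Fin N) ℂ))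
    (S := S) (w := fun β : rootsZ G H Z => β.1 h) (fun β _ γ _ hβγ => by
      by_contra hne
      exact hh ⟨(β, γ), hne⟩ (by simpa [sub_eq_zero] using hβγ)) hα
  exact ⟨π, fun y hy => hπ y fun β _ => hy β h⟩

theorem mem_ray_arg {u : ℂ} (hu : u ≠ 0) : u ∈ ray u.arg :=
  ⟨‖u‖, norm_pos_iff.2 hu, (Complex.norm_mul_exp_arg_mul_I u).symm⟩

theorem isStokesRay_arg (α : rootsZ G H Z) :
    IsStokesRay G (Z : Matrix (Fin N) (Fin N) ℂ) (α.1 Z).arg := by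
  obtain ⟨x, hx, hx0⟩ := Submodule.exists_mem_ne_zero_of_ne_bot α.2.2.1
  exact ⟨α.1 Z, mem_ray_arg α.2.2.2, x, x.2, by simpa using hx0, hx Z⟩

theorem hasSum_map_linear {N M : ℕ} (π : Matrix (Fin N) (Fin N) ℂ →ₗ[ℂ] Matrix (Fin M) (Fin M) ℂ)
    {F : ℕ → Matrix (Fin N) (Fin N) ℂ} {X : Matrix (Fin N) (Fin N) ℂ} (h : HasSum F X) :
    HasSum (fun n => π (F n)) (π X) :=
  h.map π π.continuous_of_finiteDimensional

/-- The logarithm of the Stokes factor of the ray through `Z(α)` converges as a whole; the linear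
projection to weight `α` carries the convergence over to the single root. -/
theorem exists_hasSum_lieTerm (hG : IsZariskiClosed G) (hH : IsTorus H) (hHG : H ≤ G)
    (f : OffDiag G H Z) :
    ∃ ε : OffDiag G H Z, ∀ α, HasSum (fun n => (lieTerm f α n : Matrix (Fin N) (Fin N) ℂ)) (ε.mat α) := by
  classical
  suffices h : ∀ α : rootsZ G H Z, ∃ e : rootSpace G H α.1,
      HasSum (fun n => (lieTerm f α n : Matrix (Fin N) (Fin N) ℂ)) (e : lieAlg G) by
    choose ε hε using h
    exact ⟨ε, hε⟩
  intro α
  obtain ⟨-, X, -, hX, -⟩ := exists_stokesFactor (x := f.mat) hG hH hHG Z.2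
    (fun b => (f.component b).2)
    rootVal_ne_zero (fun b => f.lie_mat b Z) (α.1 Z).arg
  obtain ⟨π, hπ⟩ := exists_weight_projection
    (Finset.univ.filter fun β : rootsZ G H Z => β.1 Z ∈ ray (α.1 Z).arg)
    (Finset.mem_filter.2 ⟨Finset.mem_univ α, mem_ray_arg α.2.2.2⟩)
  have h1 : HasSum (fun n => (lieTerm f α n : Matrix (Fin N) (Fin N) ℂ)) (π X) := by
    have h2 := hasSum_map_linear π hX
    simp only [← sum_lieTerm] at h2
    simpa only [hπ _ fun β h => lie_lieTerm f β _ h] using h2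
  refine ⟨⟨⟨π X, hasSum_mem_lieAlg h1 fun n => (lieTerm f α n).2⟩, fun h => ?_⟩, h1⟩
  have h2 := hasSum_map_linear (adL (h : Matrix (Fin N) (Fin N) ℂ)) h1
  simp only [lie_lieTerm] at h2
  exact h2.unique (h1.const_smul (α.1 h))

end Terms

/-! ### Existence and uniqueness of the value of the Stokes map -/

section StokesMap

attribute [local instance] Matrix.linftyOpNormedRing Matrix.linftyOpNormedAlgebra

variable {N : ℕ} {G H : Subgroup (GL (Fin N) ℂ)}

/-- Stokes factors are unique, given a Stokes factor for which the perturbed rays can be chosen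
arbitrarily close. -/
theorem IsStokesFactor.eq_of_forall_exists {Z f : Matrix (Fin N) (Fin N) ℂ} (hH : IsTorus H)
    (hHG : H ≤ G) (hZ : Z ∈ lieAlg H) {θ : ℝ} {S S' : GL (Fin N) ℂ}
    (h' : IsStokesFactor G Z f θ S')
    (h : ∀ η > 0, ∃ (θp θm : ℝ) (Yp Ym : ℂ → GL (Fin N) ℂ),
        θ - η < θp ∧ θp < θ ∧ θ < θm ∧ θm < θ + η ∧
        (∀ φ ∈ Set.Icc θp θm, IsStokesRay G Z φ → φ = θ) ∧
        IsCanonicalSolution G Z f θp Yp ∧ IsCanonicalSolution G Z f θm Ym ∧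
        ∀ t ∈ halfPlane θp ∩ halfPlane θm, Yp t = Ym t * S) : S' = S := by
  obtain ⟨-, θp', θm', Yp', Ym', hp', hm', hπ, hns, hYp', hYm', hS'⟩ := h'
  obtain ⟨θp, θm, Yp, Ym, h1, h2, h3, h4, -, hYp, hYm, hS⟩ :=
    h (min (θ - θp') (θm' - θ)) (lt_min (by linarith) (by linarith))
  have h5 := min_le_left (θ - θp') (θm' - θ)
  have h6 := min_le_right (θ - θp') (θm' - θ)
  have hmem : ∀ ψ, θp' ≤ ψ → ψ ≤ θm' →
      Complex.exp (((θp' + θm') / 2 : ℝ) * Complex.I) / (1 : ℝ) ∈ halfPlane ψ :=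
    fun ψ hψ1 hψ2 => exp_div_mem_halfPlane (by linarith) (by linarith) one_pos
  set t := Complex.exp (((θp' + θm') / 2 : ℝ) * Complex.I) / (1 : ℝ)
  have e1 : Yp' t = Yp t := hYp'.eq_of_forall_not_isStokesRay hH hHG hZ hYp (by linarith)
    (by linarith) (fun ψ hψ hSt => by
      linarith [hψ.2, hns ψ ⟨hψ.1, by linarith [hψ.2]⟩ hSt])
    ⟨hmem _ (by linarith) (by linarith), hmem _ (by linarith) (by linarith)⟩
  have e2 : Ym t = Ym' t := hYm.eq_of_forall_not_isStokesRay hH hHG hZ hYm' (by linarith)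
    (by linarith) (fun ψ hψ hSt => by
      linarith [hψ.1, hns ψ ⟨by linarith [hψ.1], hψ.2⟩ hSt])
    ⟨hmem _ (by linarith) (by linarith), hmem _ (by linarith) (by linarith)⟩
  have e3 := hS' t ⟨hmem _ (by linarith) (by linarith), hmem _ (by linarith) (by linarith)⟩
  have e4 := hS t ⟨hmem _ (by linarith) (by linarith), hmem _ (by linarith) (by linarith)⟩
  rw [e1, e4, e2] at e3
  exact (mul_left_cancel e3).symm

variable {Z : lieAlg H}

-- The eigenvalues `Z(α)` lie on one ray, so after division by its direction they are all positive.
open Classical in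
theorem isNilpotent_sum_ray (ε : OffDiag G H Z) (θ : ℝ) :
    IsNilpotent (∑ α : rootsZ G H Z with α.1 Z ∈ ray θ, ε.mat α) := by
  rw [Finset.sum_subtype (p := fun α : rootsZ G H Z => α.1 Z ∈ ray θ) _ (by simp)]
  obtain ⟨E₀, hx⟩ := exists_isWeighted (Z := (Z : Matrix (Fin N) (Fin N) ℂ))
    (x := fun α : {α : rootsZ G H Z // α.1 Z ∈ ray θ} => ε.mat α.1)
    (w := fun α => rootVal Z α.1) (fun α => rootVal_ne_zero α.1) (fun α => ε.lie_mat α.1 Z)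
    (Complex.exp_ne_zero (θ * Complex.I))
  refine isNilpotent_sum hx fun α => ?_
  obtain ⟨ρ, hρ, h⟩ := α.2
  rw [rootVal, h, mul_comm, mul_assoc, mul_inv_cancel₀ (Complex.exp_ne_zero _), mul_one,
    Complex.ofReal_re]
  exact hρ

open Classical in
theorem sum_ray_eq {f ε : OffDiag G H Z}
    (hε : ∀ α, HasSum (fun n => (lieTerm f α n : Matrix (Fin N) (Fin N) ℂ)) (ε.mat α)) {θ : ℝ}
    {X : Matrix (Fin N) (Fin N) ℂ} (hX : HasSum
      (wpart f.mat (NCS.log (stokesSeriesRev (rootVal Z) (Complex.exp (θ * Complex.I))))) X) :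
    ∑ α : rootsZ G H Z with α.1 Z ∈ ray θ, ε.mat α = X := by
  have h1 := hasSum_sum (s := Finset.univ.filter fun α : rootsZ G H Z => α.1 Z ∈ ray θ)
    fun α _ => hε α
  simp only [sum_lieTerm] at h1
  exact h1.unique hX

theorem isStokesMapValue_of_hasSum (hG : IsZariskiClosed G) (hH : IsTorus H) (hHG : H ≤ G)
    {f ε : OffDiag G H Z}
    (hε : ∀ α, HasSum (fun n => (lieTerm f α n : Matrix (Fin N) (Fin N) ℂ)) (ε.mat α)) :
    IsStokesMapValue f ε := by
  intro θ _
  obtain ⟨S, X, hSG, hX, hXS, h⟩ := exists_stokesFactor (x := f.mat) hG hH hHG Z.2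
    (fun b => (f.component b).2) rootVal_ne_zero (fun b => f.lie_mat b Z) θ
  obtain ⟨θp, θm, Yp, Ym, h1, h2, h3, h4, h5, h6⟩ := h (Real.pi / 2) Real.pi_div_two_pos
  refine ⟨S, ⟨hSG, θp, θm, Yp, Ym, h2, h3, by linarith, h5, h6⟩, ?_⟩
  rw [← hXS, ← sum_ray_eq hε hX]
  rfl

/-- On the ray through `Z(α)` both families have the same Stokes factor as exponential of a
nilpotent matrix. So the sums over the ray agree, and weight projections extract the components. -/
theorem IsStokesMapValue.eq_of_hasSum (hG : IsZariskiClosed G) (hH : IsTorus H) (hHG : H ≤ G)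
    {f ε ε' : OffDiag G H Z}
    (hε : ∀ α, HasSum (fun n => (lieTerm f α n : Matrix (Fin N) (Fin N) ℂ)) (ε.mat α))
    (h' : IsStokesMapValue f ε') : ε' = ε := by
  classical
  refine funext fun α => Subtype.ext (Subtype.ext ?_)
  show ε'.mat α = ε.mat α
  set θ := (α.1 Z).arg
  obtain ⟨S, X, -, hX, hXS, h⟩ := exists_stokesFactor (x := f.mat) hG hH hHG Z.2
    (fun b => (f.component b).2) rootVal_ne_zero (fun b => f.lie_mat b Z) θ
  obtain ⟨S', hS', hexp⟩ := h' θ (isStokesRay_arg α)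
  have hSS := hS'.eq_of_forall_exists hH hHG Z.2 h
  have hexp' : NormedSpace.exp (∑ α : rootsZ G H Z with α.1 Z ∈ ray θ, ε'.mat α) =
      NormedSpace.exp (∑ α : rootsZ G H Z with α.1 Z ∈ ray θ, ε.mat α) := by
    rw [sum_ray_eq hε hX, hXS, ← hSS]
    exact hexp.symm
  have hsum := exp_injective_of_isNilpotent (isNilpotent_sum_ray ε' θ) (isNilpotent_sum_ray ε θ) hexp'
  obtain ⟨π, hπ⟩ := exists_weight_projection
    (Finset.univ.filter fun β : rootsZ G H Z => β.1 Z ∈ ray θ)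
    (Finset.mem_filter.2 ⟨Finset.mem_univ α, mem_ray_arg α.2.2.2⟩)
  rw [← hπ ε'.mat fun β h => ε'.lie_mat β h, ← hπ ε.mat fun β h => ε.lie_mat β h, hsum]

theorem summable_norm_entry {M : ℕ} {F : ℕ → Matrix (Fin M) (Fin M) ℂ}
    {X : Matrix (Fin M) (Fin M) ℂ} (h : HasSum F X) (i j : Fin M) : Summable fun n => ‖F n i j‖ :=
  (Pi.hasSum.1 (Pi.hasSum.1 h i) j).summable.norm

/-- The term of degree `0` is zero because `lieSum` divides by the degree and `0⁻¹ = 0`. -/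
theorem hasSum_succ_lieTerm {f ε : OffDiag G H Z} {α : rootsZ G H Z}
    (hε : HasSum (fun n => (lieTerm f α n : Matrix (Fin N) (Fin N) ℂ)) (ε.mat α)) :
    HasSum (fun n => (lieTerm f α (n + 1) : Matrix (Fin N) (Fin N) ℂ)) (ε.mat α) := by
  classical
  refine (hasSum_nat_add_iff (f := fun n => (lieTerm f α n : Matrix (Fin N) (Fin N) ℂ)) 1).2 ?_
  rw [Finset.sum_range_one, coe_lieTerm, lieSum, Nat.cast_zero, inv_zero, zero_smul, add_zero]
  exact hε

/-- The representation extends to a linear map on all matrices, which is continuous in finite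
dimension. -/
theorem hasSum_rep {M : ℕ} (ρ : lieAlg G →ₗ⁅ℂ⁆ Matrix (Fin M) (Fin M) ℂ) {F : ℕ → lieAlg G}
    {X : lieAlg G} (h : HasSum (fun n => (F n : Matrix (Fin N) (Fin N) ℂ)) X) :
    HasSum (fun n => ρ (F n)) (ρ X) := by
  obtain ⟨π, hπ⟩ := LinearMap.exists_extend (p := (lieAlg G).toSubmodule) ρ.toLinearMap
  have h1 : ∀ y : lieAlg G, π y = ρ y := fun y => LinearMap.congr_fun hπ y
  have h2 := hasSum_map_linear π h
  simpa only [h1] using h2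

end StokesMap

end Stokes

end

theorem theorem4p2 :
    (∀ (m : ℕ), 1 ≤ m → ∀ z : Fin m → ℂ, (∀ i, z i ≠ 0) →
      ∃ P : FreeLieAlgebra ℂ (Fin m),
        ∀ (𝔏 : Type*) [LieRing 𝔏] [LieAlgebra ℂ 𝔏] (x : Fin m → 𝔏),
          ∑ σ : Equiv.Perm (Fin m),
              Stokes.L m (fun i => z (σ i)) •
                (List.ofFn fun i => UniversalEnvelopingAlgebra.ι ℂ (x (σ i))).prod =
            UniversalEnvelopingAlgebra.ι ℂ (FreeLieAlgebra.lift ℂ x P)) ∧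
    (∀ (N : ℕ) (G H : Subgroup (GL (Fin N) ℂ)), Stokes.IsZariskiClosed G → Stokes.IsTorus H →
      H ≤ G → ∀ (Z : Stokes.lieAlg H) (f : Stokes.OffDiag G H Z),
      ∃ ε : Stokes.OffDiag G H Z,
        Stokes.IsStokesMapValue f ε ∧
        (∀ ε' : Stokes.OffDiag G H Z, Stokes.IsStokesMapValue f ε' → ε' = ε) ∧
        ∀ α : Stokes.rootsZ G H Z,
          (∃ T : ℕ → Stokes.lieAlg G,
            (∀ n, T n ∈ LieSubalgebra.lieSpan ℂ (Stokes.lieAlg G) (Set.range f.component)) ∧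
            (∀ n, UniversalEnvelopingAlgebra.ι ℂ (T n) =
              Stokes.seriesTerm
                (UniversalEnvelopingAlgebra.ι ℂ :
                  Stokes.lieAlg G →ₗ⁅ℂ⁆ UniversalEnvelopingAlgebra ℂ (Stokes.lieAlg G)).toLinearMap
                f α (n + 1)) ∧
            (∀ i j, Summable fun n => ‖(T n : Matrix (Fin N) (Fin N) ℂ) i j‖) ∧
            HasSum (fun n => (T n : Matrix (Fin N) (Fin N) ℂ))
              (ε.component α : Matrix (Fin N) (Fin N) ℂ)) ∧
          ∀ (d : ℕ) (ρ : Stokes.lieAlg G →ₗ⁅ℂ⁆ Matrix (Fin d) (Fin d) ℂ),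
            (∀ i j, Summable fun n => ‖Stokes.seriesTerm ρ.toLinearMap f α (n + 1) i j‖) ∧
            HasSum (fun n => Stokes.seriesTerm ρ.toLinearMap f α (n + 1)) (ρ (ε.component α))) := by
  refine ⟨Stokes.exists_freeLie, fun N G H hG hH hHG Z f => ?_⟩
  obtain ⟨ε, hε⟩ := Stokes.exists_hasSum_lieTerm hG hH hHG f
  refine ⟨ε, Stokes.isStokesMapValue_of_hasSum hG hH hHG hε,
    fun ε' h' => h'.eq_of_hasSum hG hH hHG hε, fun α => ⟨⟨fun n => Stokes.lieTerm f α (n + 1),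
      fun n => Stokes.lieTerm_mem f α (n + 1),
      fun n => (Stokes.seriesTerm_eq _ f α n.succ_ne_zero).symm,
      Stokes.summable_norm_entry (Stokes.hasSum_succ_lieTerm (hε α)),
      Stokes.hasSum_succ_lieTerm (hε α)⟩, fun d ρ => ?_⟩⟩
  have h := Stokes.hasSum_rep ρ (Stokes.hasSum_succ_lieTerm (hε α))
  simp only [Stokes.seriesTerm_eq ρ f α (Nat.succ_ne_zero _)]
  exact ⟨Stokes.summable_norm_entry h, h⟩
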